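/- Let $M$ be a smooth manifold (Hausdorff, $\sigma$-compact, without boundary) and let $E\to M$ be a Courant algebroid, with bracket $[\cdot,\cdot]$, pairing $\langle\cdot,\cdot\rangle$ (used to identify $E\cong E^*$ and to raise and lower indices) and anchor $\rho$; put $\mathcal D f=\rho^T df$. A generalized pseudometric is a smooth symmetric endomorphism $\mathcal G$ of $E$ with $\mathcal G^2=\mathrm{Id}$ whose $\pm1$-eigenbundles $V_\pm$ do not have rank $1$. For a positive half-density $\sigma$ on $M$ let $\operatorname{div}_\sigma u=\sigma^{-2}L_{\rho(u)}\sigma^2$ and $\Delta_{\mathcal G,\sigma}f=\operatorname{div}_\sigma(\mathcal G\mathcal Df)$. Let $D$ be a Courant algebroid connection that is torsion-free, satisfies $D\mathcal G=0$ and has divergence $\operatorname{Tr}(Du)=\operatorname{div}_\sigma u$ for all $u\in\Gamma(E)$. Its Riemann tensor is $$\mathcal{R}m(w,z,x,y)=\tfrac12 w^\delta y^\beta\bigl(x^\alpha[D_\alpha,D_\beta]z_\delta+z^\alpha[D_\alpha,D_\delta]x_\beta-(D_\alpha x_\beta)(D^\alpha z_\delta)\bigr),$$ its full Ricci tensor $\mathcal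 F$ is given by $\langle v,\mathcal F(u)\rangle=\mathcal{R}m(e^\alpha,v,e_\alpha,u)$, and the generalized Ricci and scalar curvatures are $$\mathcal{R}c(\mathcal G,\sigma)=\mathcal F-\mathcal G\mathcal F\mathcal G,\qquad \mathcal R(\mathcal G,\sigma)=\operatorname{Tr}(\mathcal G\mathcal F);$$ they do not depend on the choice of $D$. Write $|\cdot|^2_{\mathcal G}$ for the (possibly indefinite) square norm on $E\otimes E$ induced by $\langle\mathcal G\cdot,\cdot\rangle$. Let $J\subset\mathbb R$ be an interval with non-empty interior and let $(\mathcal G_t,\sigma_t)_{t\in J}$ be a smooth solution of generalized Ricci flow, $$\partial_t\mathcal G=-2\,\mathcal{R}c(\mathcal G,\sigma),\qquad \partial_t\sigma=-\tfrac12\mathcal R(\mathcal G,\sigma)\,\sigma .$$ Define $\square^*_\sigma=-\partial_t-\Delta_{\mathcal G,\sigma}+\mathcal R(\mathcal G,\sigma)$ (time derivatives at an endpoint of $J$ being one-sided). Let $f$ be a smooth function on $J\times M$ such that $u=e^{-f}$ satisfies $\square^*_\sigma u=0$, and set $\sigma^f=e^{-f/2}\sigma$. Then $\mathcal R(\mathcal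 G,\sigma^f)u$ is smooth on $M$ for each $t\in J$ and differentiable in $t$, and on $J\times M$ $$\square^*_\sigma\bigl(\mathcal R(\mathcal G,\sigma^f)\,u\bigr)=-\,|\mathcal{R}c(\mathcal G,\sigma^f)|^2_{\mathcal G}\,u .$$ -/

import Mathlib

open scoped Manifold ContDiff Bundle
open Set

noncomputable section

namespace GenGeom

section Sections

variable (EB : Type*) [NormedAddCommGroup EB] [NormedSpace ℝ EB]
  {M : Type*} [TopologicalSpace M] [ChartedSpace EB M]
  (F : Type*) [NormedAddCommGroup F] [NormedSpace ℝ F]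
  (E : M → Type*) [TopologicalSpace (Bundle.TotalSpace F E)]
  [∀ x, TopologicalSpace (E x)] [FiberBundle F E]

/-- `Γ(E)`: smooth global sections of the vector bundle `E → M`. The base `M` is a manifold without
boundary modelled on the vector space `EB`. -/
abbrev Sec : Type _ := ContMDiffSection 𝓘(ℝ, EB) F ∞ E

end Sections

section Scalars

variable {EB : Type*} [NormedAddCommGroup EB] [NormedSpace ℝ EB]
  {M : Type*} [TopologicalSpace M] [ChartedSpace EB M]

/-- The derivative `X f` of a function `f` in the direction of a tangent vector `X` at `x`. -/
def dirDeriv (f : M → ℝ) (x : M) : TangentSpace 𝓘(ℝ, EB) x →ₗ[ℝ] ℝ :=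
  (mfderiv 𝓘(ℝ, EB) 𝓘(ℝ, ℝ) f x : TangentSpace 𝓘(ℝ, EB) x →L[ℝ] ℝ).toLinearMap

/-- The frame of `T_x M` given by the coordinate vector fields of the preferred chart around `x₀`
(meaningful for `x` in the domain of that chart). Frames at `x` are linear maps `EB → T_x M`. -/
def coordFrame [IsManifold 𝓘(ℝ, EB) ∞ M] (x₀ x : M) : EB →L[ℝ] TangentSpace 𝓘(ℝ, EB) x :=
  (trivializationAt EB (TangentSpace 𝓘(ℝ, EB) : M → Type _) x₀).symmL ℝ x

variable (EB M) in
/-- Everywhere positive smooth half-densities. A half-density at `x` is a function of the frames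
`φ` of `T_x M` with `s (φ ∘ A) = |det A|^{1/2} s φ`; it is extended by this same rule to all
linear maps `φ : EB → T_x M` (so it vanishes on the non-invertible ones). -/
structure PosHalfDensity [IsManifold 𝓘(ℝ, EB) ∞ M] where
  toFun : ∀ x : M, (EB →L[ℝ] TangentSpace 𝓘(ℝ, EB) x) → ℝ
  equivariant : ∀ (x : M) (φ : EB →L[ℝ] TangentSpace 𝓘(ℝ, EB) x) (A : EB →L[ℝ] EB),
    toFun x (φ.comp A) = Real.sqrt |A.det| * toFun x φ
  pos : ∀ (x : M) (φ : EB ≃L[ℝ] TangentSpace 𝓘(ℝ, EB) x),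
    0 < toFun x (φ : EB →L[ℝ] TangentSpace 𝓘(ℝ, EB) x)
  smooth : ∀ x₀ : M, ContMDiffOn 𝓘(ℝ, EB) 𝓘(ℝ, ℝ) ∞
    (fun x => toFun x (coordFrame x₀ x))
    (trivializationAt EB (TangentSpace 𝓘(ℝ, EB) : M → Type _) x₀).baseSet

variable [IsManifold 𝓘(ℝ, EB) ∞ M]

/-- The function `s` representing `σ = s |dx|^{1/2}` in the preferred chart around `x₀`. -/
def PosHalfDensity.rep (σ : PosHalfDensity EB M) (x₀ x : M) : ℝ := σ.toFun x (coordFrame x₀ x)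

/-- The coordinate divergence `∂_i X^i` at `x` of a vector field `X`, in the preferred chart
around `x`. -/
def coordDiv (X : ∀ x : M, TangentSpace 𝓘(ℝ, EB) x) (x : M) : ℝ :=
  let DX : TangentSpace 𝓘(ℝ, EB) x →L[ℝ] EB :=
    mfderiv 𝓘(ℝ, EB) 𝓘(ℝ, EB)
      (fun y => (trivializationAt EB (TangentSpace 𝓘(ℝ, EB) : M → Type _) x ⟨y, X y⟩).2) x
  LinearMap.trace ℝ EB (DX.comp (coordFrame x x)).toLinearMap

/-- The Lie derivative `L_X σ` of a half-density at `x`, evaluated on the coordinate frame of the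
preferred chart around `x`: if `σ = s |dx|^{1/2}` then
`L_X σ = (X s + (1/2) (∂_i X^i) s) |dx|^{1/2}`. -/
def PosHalfDensity.lieDeriv (σ : PosHalfDensity EB M)
    (X : ∀ x : M, TangentSpace 𝓘(ℝ, EB) x) (x : M) : ℝ :=
  dirDeriv (σ.rep x) x (X x) + (1 / 2) * coordDiv X x * σ.rep x x

/-- `e^{-f/2} σ`. -/
def PosHalfDensity.weight (σ : PosHalfDensity EB M) (f : C^∞⟮𝓘(ℝ, EB), M; ℝ⟯) :
    PosHalfDensity EB M where
  toFun x φ := Real.exp (-(f x) / 2) * σ.toFun x φ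
  equivariant x φ A := by rw [σ.equivariant]; ring
  pos x φ := mul_pos (Real.exp_pos _) (σ.pos x φ)
  smooth x₀ := by
    have hf : ContMDiff 𝓘(ℝ, EB) 𝓘(ℝ, ℝ) ∞ (fun x : M => Real.exp (-(f x) / 2)) := by
      have h1 : ContDiff ℝ ∞ (fun r : ℝ => Real.exp (-r / 2)) := by fun_prop
      exact h1.contMDiff.comp f.contMDiff
    exact hf.contMDiffOn.mul (σ.smooth x₀)

end Scalars

section Courant

variable {EB : Type*} [NormedAddCommGroup EB] [NormedSpace ℝ EB]
  {M : Type*} [TopologicalSpace M] [ChartedSpace EB M]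
  {F : Type*} [NormedAddCommGroup F] [NormedSpace ℝ F]
  {E : M → Type*} [TopologicalSpace (Bundle.TotalSpace F E)]
  [∀ x, AddCommGroup (E x)] [∀ x, Module ℝ (E x)]
  [∀ x, TopologicalSpace (E x)] [FiberBundle F E] [VectorBundle ℝ F E]

/-- The product `f v` of a smooth function and a smooth section. -/
def fsmul (f : C^∞⟮𝓘(ℝ, EB), M; ℝ⟯) (v : Sec EB F E) : Sec EB F E :=
  ⟨fun x => f x • v x, ContMDiff.smul_section f.contMDiff v.contMDiff⟩

/-- Every vector of a smooth vector bundle is the value of a smooth global section. -/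
theorem exists_section_through [FiniteDimensional ℝ EB] [IsManifold 𝓘(ℝ, EB) ∞ M]
    [T2Space M] [SigmaCompactSpace M] [ContMDiffVectorBundle ∞ F E 𝓘(ℝ, EB)]
    {p : M} (e : E p) : ∃ s : Sec EB F E, s p = e := by
  classical
  obtain ⟨s, hs⟩ := exists_contMDiffSection_forall_mem_convex_of_local (I := 𝓘(ℝ, EB))
    (n := ⊤) (F_fiber := F) E (fun x => {v | ∀ h : p = x, v = h ▸ e})
    (fun x => by
      by_cases h : p = x
      · subst h
        simp
      · simp [h, convex_univ])
    (fun x₀ => by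
      by_cases h : p = x₀
      · subst h
        obtain ⟨u, hu, hsm⟩ := FiberBundle.exists_contMDiffOn_extend 𝓘(ℝ, EB) F (k := ∞) e
        refine ⟨u, hu, FiberBundle.extend F e, hsm, ?_⟩
        intro y _ hy
        subst hy
        simp
      · refine ⟨{p}ᶜ, isOpen_compl_singleton.mem_nhds (fun h' => h h'.symm), fun _ => 0,
          (Bundle.contMDiff_zeroSection ℝ E).contMDiffOn, ?_⟩
        intro y hy hpy
        exact absurd hpy.symm hy)
  exact ⟨s, hs p rfl⟩

variable (EB F E) in
/-- A Courant algebroid structure on the vector bundle `E → M`. The last field is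
`[u,v] + [v,u] = 𝒟⟨u,v⟩`, paired with an arbitrary section `w`, where
`⟨𝒟 f, w⟩ = ρ(w) f`. -/
structure CourantAlgebroid [IsManifold 𝓘(ℝ, EB) ∞ M] where
  bracket : Sec EB F E →ₗ[ℝ] Sec EB F E →ₗ[ℝ] Sec EB F E
  pairing : ∀ x : M, LinearMap.BilinForm ℝ (E x)
  anchor : ∀ x : M, E x →ₗ[ℝ] TangentSpace 𝓘(ℝ, EB) x
  pairing_smooth : ∀ u v : Sec EB F E,
    ContMDiff 𝓘(ℝ, EB) 𝓘(ℝ, ℝ) ∞ (fun x => pairing x (u x) (v x))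
  pairing_symm : ∀ (x : M) (a b : E x), pairing x a b = pairing x b a
  pairing_nondegenerate : ∀ x : M, (pairing x).Nondegenerate
  anchor_smooth : ∀ u : Sec EB F E,
    ContMDiff 𝓘(ℝ, EB) 𝓘(ℝ, EB).tangent ∞
      (fun x => (⟨x, anchor x (u x)⟩ : TangentBundle 𝓘(ℝ, EB) M))
  jacobi : ∀ u v w : Sec EB F E,
    bracket u (bracket v w) = bracket (bracket u v) w + bracket v (bracket u w)
  leibniz : ∀ (u v : Sec EB F E) (f : C^∞⟮𝓘(ℝ, EB), M; ℝ⟯) (x : M),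
    bracket u (fsmul f v) x = f x • bracket u v x + dirDeriv f x (anchor x (u x)) • v x
  invariant : ∀ (u v w : Sec EB F E) (x : M),
    dirDeriv (fun y => pairing y (v y) (w y)) x (anchor x (u x)) =
      pairing x (bracket u v x) (w x) + pairing x (v x) (bracket u w x)
  symmetric_part : ∀ (u v w : Sec EB F E) (x : M),
    pairing x (bracket u v x + bracket v u x) (w x) =
      dirDeriv (fun y => pairing y (u y) (v y)) x (anchor x (w x))

variable [IsManifold 𝓘(ℝ, EB) ∞ M]

/-- Generalized pseudometrics: symmetric endomorphisms of `E` with square the identity, whose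
eigenbundles `V₊`, `V₋` do not have rank one. -/
structure GenPseudometric (C : CourantAlgebroid EB F E) where
  toFun : ∀ x : M, Module.End ℝ (E x)
  smooth : ∀ u v : Sec EB F E,
    ContMDiff 𝓘(ℝ, EB) 𝓘(ℝ, ℝ) ∞ (fun x => C.pairing x (toFun x (u x)) (v x))
  symm : ∀ (x : M) (a b : E x), C.pairing x (toFun x a) b = C.pairing x a (toFun x b)
  sq : ∀ (x : M) (a : E x), toFun x (toFun x a) = a
  rank_pos_ne_one : ∀ x : M, Module.finrank ℝ (Module.End.eigenspace (toFun x) 1) ≠ 1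
  rank_neg_ne_one : ∀ x : M, Module.finrank ℝ (Module.End.eigenspace (toFun x) (-1)) ≠ 1

/-- Courant algebroid connections, as maps `Γ(E) → Γ(E^* ⊗ E)`: for a section `v` and `e ∈ E_x`,
`D v x e` is the value of `D_e v` at `x`. -/
structure Connection (C : CourantAlgebroid EB F E) where
  toFun : Sec EB F E → ∀ x : M, Module.End ℝ (E x)
  smooth : ∀ u v : Sec EB F E,
    ContMDiff 𝓘(ℝ, EB) (𝓘(ℝ, EB).prod 𝓘(ℝ, F)) ∞
      (fun x => Bundle.TotalSpace.mk' F x (toFun v x (u x)))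
  add : ∀ (v w : Sec EB F E) (x : M), toFun (v + w) x = toFun v x + toFun w x
  leibniz : ∀ (f : C^∞⟮𝓘(ℝ, EB), M; ℝ⟯) (v : Sec EB F E) (x : M) (e : E x),
    toFun (fsmul f v) x e = f x • toFun v x e + dirDeriv f x (C.anchor x e) • v x
  metric : ∀ (v w : Sec EB F E) (x : M) (e : E x),
    dirDeriv (fun y => C.pairing y (v y) (w y)) x (C.anchor x e) =
      C.pairing x (toFun v x e) (w x) + C.pairing x (v x) (toFun w x e)

variable {C : CourantAlgebroid EB F E}

/-- The section `D_u v`. -/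
def Connection.app (D : Connection C) (u v : Sec EB F E) : Sec EB F E :=
  ⟨fun x => D.toFun v x (u x), D.smooth u v⟩

/-- `D` is compatible with `G`, i.e. `D G = 0`: for every section `v`, writing `Gv` for the section
`G v`, one has `D_e (G v) = G (D_e v)`. -/
def Connection.IsCompatible (D : Connection C) (G : GenPseudometric C) : Prop :=
  ∀ v Gv : Sec EB F E, (∀ x, Gv x = G.toFun x (v x)) →
    ∀ (x : M) (e : E x), D.toFun Gv x e = G.toFun x (D.toFun v x e)

/-- Vanishing of the torsion `T(u,v) = D_u v - D_v u - [u,v] + ⟨Du,v⟩`, paired with `w`. -/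
def Connection.IsTorsionFree (D : Connection C) : Prop :=
  ∀ (u v w : Sec EB F E) (x : M),
    C.pairing x (D.app u v x - D.app v u x - C.bracket u v x) (w x) +
      C.pairing x (D.app w u x) (v x) = 0

/-- The divergence operator `div_σ u = σ⁻² L_{ρ(u)} σ² = 2 σ⁻¹ L_{ρ(u)} σ` of a positive
half-density. -/
def divHD (C : CourantAlgebroid EB F E) (σ : PosHalfDensity EB M) (u : ∀ x : M, E x) (x : M) : ℝ :=
  2 * σ.lieDeriv (fun y => C.anchor y (u y)) x / σ.rep x x

/-- `D ∈ LC(G, div_σ)`: `D` is torsion-free, compatible with `G`, and its divergence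
`Tr (D u)` is `div_σ u`. -/
structure Connection.IsLC (D : Connection C) (G : GenPseudometric C) (σ : PosHalfDensity EB M) :
    Prop where
  compatible : D.IsCompatible G
  torsionFree : D.IsTorsionFree
  divergence : ∀ (u : Sec EB F E) (x : M), LinearMap.trace ℝ (E x) (D.toFun u x) = divHD C σ u x

section Frames

variable [FiniteDimensional ℝ F]

variable (F) in
/-- A basis `e_α` of the fibre `E_x`, used to write contractions. -/
def frame (x : M) : Module.Basis (Fin (Module.finrank ℝ (E x))) ℝ (E x) :=
  haveI : FiniteDimensional ℝ (E x) := VectorBundle.finiteDimensional ℝ F E x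
  Module.finBasis ℝ (E x)

variable (C) in
/-- The dual basis `e^α`, with `⟨e^α, e_β⟩ = δ^α_β`. -/
def coframe (x : M) : Module.Basis (Fin (Module.finrank ℝ (E x))) ℝ (E x) :=
  LinearMap.BilinForm.dualBasis (C.pairing x) (C.pairing_nondegenerate x) (frame F x)

variable (C) in
/-- `𝒟 f = ρ^T d f`, where `E^*` is identified with `E` by the pairing. -/
def calD (f : M → ℝ) (x : M) : E x :=
  haveI : FiniteDimensional ℝ (E x) := VectorBundle.finiteDimensional ℝ F E x
  ((C.pairing x).toDual (C.pairing_nondegenerate x)).symm ((dirDeriv f x).comp (C.anchor x))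

/-- The Laplace operator `Δ_{G,σ} f = div_σ (G 𝒟 f)` on functions. -/
def laplacian (G : GenPseudometric C) (σ : PosHalfDensity EB M) (f : M → ℝ) (x : M) : ℝ :=
  divHD C σ (fun y => G.toFun y (calD C f y)) x

/-- The Riemann tensor
`Rm(w,z,x,y) = 1/2 w^δ y^β (x^α [D_α,D_β] z_δ + z^α [D_α,D_δ] x_β - (D_α x_β)(D^α z_δ))`
on sections, where `x^α y^β D_α D_β z = D_x D_y z - D_{D_x y} z`. -/
def Connection.riem (D : Connection C) (w z x y : Sec EB F E) (p : M) : ℝ :=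
  (1 / 2) *
    (C.pairing p (w p)
        ((D.app x (D.app y z) - D.app (D.app x y) z -
          (D.app y (D.app x z) - D.app (D.app y x) z)) p)
      + C.pairing p (y p)
        ((D.app z (D.app w x) - D.app (D.app z w) x -
          (D.app w (D.app z x) - D.app (D.app w z) x)) p)
      - ∑ α, C.pairing p (D.toFun x p (frame F p α)) (y p) *
          C.pairing p (D.toFun z p (coframe C p α)) (w p))

end Frames

section Curvature

variable [FiniteDimensional ℝ EB] [T2Space M] [SigmaCompactSpace M]
  [ContMDiffVectorBundle ∞ F E 𝓘(ℝ, EB)]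

variable (EB F) in
/-- A smooth global section with value `e` at `p`. -/
def extSec {p : M} (e : E p) : Sec EB F E := (exists_section_through (EB := EB) (F := F) e).choose

theorem extSec_apply {p : M} (e : E p) : extSec EB F e p = e :=
  (exists_section_through (EB := EB) (F := F) e).choose_spec

variable [FiniteDimensional ℝ F]

/-- The value of the Riemann tensor on vectors of `E_p`. -/
def Connection.riemAt (D : Connection C) (p : M) (w z x y : E p) : ℝ :=
  D.riem (extSec EB F w) (extSec EB F z) (extSec EB F x) (extSec EB F y) p

/-- The full Ricci tensor `⟨v, fRc(u)⟩ = Rm(e^α, v, e_α, u)` of a torsion-free connection. -/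
def Connection.fullRicci (D : Connection C) (p : M) (v u : E p) : ℝ :=
  ∑ α, D.riemAt p (coframe C p α) v (frame F p α) u

open Classical in
/-- The full Ricci tensor of some connection in `LC(G, div_σ)`. (Such connections always exist;
the tensors defined from it below do not depend on the choice.) -/
def fullRicci (G : GenPseudometric C) (σ : PosHalfDensity EB M) (p : M) (v u : E p) : ℝ :=
  if h : ∃ D : Connection C, D.IsLC G σ then h.choose.fullRicci p v u else 0

/-- The generalized Ricci tensor `Rc(G,σ) = fRc - G fRc G`, with its index lowered:
`⟨v, Rc(u)⟩ = ⟨v, fRc(u)⟩ - ⟨G v, fRc(G u)⟩`. -/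
def ricci (G : GenPseudometric C) (σ : PosHalfDensity EB M) (p : M) (v u : E p) : ℝ :=
  fullRicci G σ p v u - fullRicci G σ p (G.toFun p v) (G.toFun p u)

/-- The generalized scalar curvature `R(G,σ) = Tr (G fRc) = ∑ ⟨G e^α, fRc(e_α)⟩`. -/
def scalar (G : GenPseudometric C) (σ : PosHalfDensity EB M) (p : M) : ℝ :=
  ∑ α, fullRicci G σ p (G.toFun p (coframe C p α)) (frame F p α)

/-- `|Rc(G,σ)|²_G`, the square norm on `E ⊗ E` induced by `⟨G ·, ·⟩`: with
`Rc = Rc_{αβ} e^α ⊗ e^β` this is `Rc_{αβ} Rc_{γδ} ⟨G e^α, e^γ⟩ ⟨G e^β, e^δ⟩`. -/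
def ricciNormSq (G : GenPseudometric C) (σ : PosHalfDensity EB M) (p : M) : ℝ :=
  ∑ α, ∑ β, ∑ γ, ∑ δ,
    ricci G σ p (frame F p α) (frame F p β) * ricci G σ p (frame F p γ) (frame F p δ) *
      (C.pairing p (G.toFun p (coframe C p α)) (coframe C p γ) *
        C.pairing p (G.toFun p (coframe C p β)) (coframe C p δ))

/-- Smooth solutions of generalized Ricci flow on a time interval `J`:
`∂_t G = -2 Rc(G,σ)`, `∂_t σ = -(1/2) R(G,σ) σ`, with `G` and `σ` smooth in space-time. -/
structure IsGenRicciFlow (J : Set ℝ) (G : ℝ → GenPseudometric C)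
    (σ : ℝ → PosHalfDensity EB M) : Prop where
  smooth_metric : ∀ u v : Sec EB F E,
    ContMDiffOn (𝓘(ℝ, ℝ).prod 𝓘(ℝ, EB)) 𝓘(ℝ, ℝ) ∞
      (fun q : ℝ × M => C.pairing q.2 (u q.2) ((G q.1).toFun q.2 (v q.2))) (J ×ˢ univ)
  smooth_density : ∀ x₀ : M,
    ContMDiffOn (𝓘(ℝ, ℝ).prod 𝓘(ℝ, EB)) 𝓘(ℝ, ℝ) ∞
      (fun q : ℝ × M => (σ q.1).rep x₀ q.2)
      (J ×ˢ (trivializationAt EB (TangentSpace 𝓘(ℝ, EB) : M → Type _) x₀).baseSet)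
  metric_eq : ∀ t ∈ J, ∀ (x : M) (v u : E x),
    HasDerivWithinAt (fun s => C.pairing x v ((G s).toFun x u))
      (-2 * ricci (G t) (σ t) x v u) J t
  density_eq : ∀ t ∈ J, ∀ (x : M) (φ : EB →L[ℝ] TangentSpace 𝓘(ℝ, EB) x),
    HasDerivWithinAt (fun s => (σ s).toFun x φ)
      (-(1 / 2) * scalar (G t) (σ t) x * (σ t).toFun x φ) J t

/-- The conjugate heat operator `□*_σ ψ = - ∂_t ψ - Δ_{G,σ} ψ + R(G,σ) ψ` along a family `(G,σ)`
over the time interval `J`. -/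
def conjHeat (J : Set ℝ) (G : ℝ → GenPseudometric C) (σ : ℝ → PosHalfDensity EB M)
    (ψ : ℝ → M → ℝ) (t : ℝ) (x : M) : ℝ :=
  -derivWithin (fun s => ψ s x) J t - laplacian (G t) (σ t) (ψ t) x +
    scalar (G t) (σ t) x * ψ t x

end Curvature

end Courant

end GenGeom

end

/-! Put `τ = e^{-f/2} σ`. The conjugate heat equation for `u = e^{-f}` amounts to `∂_t f = -Δ_τ f -
R(G,σ)`, because `Δ_σ e^{-f} = -e^{-f} Δ_τ f`. Together with the flow of `σ` this makes the
curvature cancel from the motion of `τ`: `∂_t log τ = Δ_τ f / 2`. In the same way `Rc(G,σ)` is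
`Rc(G,τ)` minus twice the mixed Hessian of `f`. The theorem thus reduces to the evolution `∂_t R =
|Rc|² - Δ_τ R + ⟨G 𝒟f, 𝒟R⟩` of `R = R(G,τ)`, with `Rc` also taken for `τ`; the product rule for `Δ_σ
(R u)` does the rest.

The evolution is computed in a local orthonormal frame `e_A` of eigenvectors of `G` at a fixed time.
Let `c` be the structure functions of the bracket, `d` the divergences of the frame and `Γ` the
coefficients of a connection. Connections in `LC(G, div_σ)` are not unique, but the scalar curvature
(`IsLC.scalar_eq`) and the mixed Ricci components (`IsCourant.ric2_eq`) are expressions in `c` and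
`d` alone. The axioms of a Courant algebroid become the structure equations `IsCourant`, one of
which is `div ∘ 𝒟 = 0`. Four facts carry the computation.

(1) First variation, `IsVariation.scalar`. At other times the frame is no longer adapted and the
connection is an arbitrary choice without regularity in `t`. A fixed torsion-free connection is
compared with it: the difference `χ` enters the scalar curvature quadratically (`ctr2_ric2_eq`), and
that quadratic expression depends only on the commutator of `χ` with `G_t` (`quad_eq`). The
commutator is the covariant derivative of `G_t` for the fixed connection; it is smooth in `t` and
zero at the initial time, so its square does not contribute.

(2) Contracted Bianchi identity, `IsCourant.bianchi`. The scalar curvature is invariant under the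
symmetry generated by `e_k`; this is verified directly from the structure equations in `der_scalar`.
The identity follows by evaluating the first variation on the Lie derivative of `G`, using that the
two eigenbundles contribute equally to a double divergence (`dv_sg_mdiv`).

(3) Commutation of the divergence with the mixed Hessian, `IsCourant.mdiv_hess`, again from `div ∘ 𝒟
= 0`.

(4) Inserting the flow in (1) and using (2) and (3), the terms `Δ²f` and `⟨Ric, Hess f⟩` cancel:
`IsCourant.scalarVar_eq`.

On the geometric side one needs that `div_σ` does not depend on the chart and is compatible with the
bracket (`represents_divMap`), that adapted frames exist (`exists_adapted`), that connections in
`LC(G, div_σ)` exist (`exists_isLC`; this uses that the eigenbundles do not have rank one), and that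
time derivatives commute with space derivatives, also at the endpoints of `J`. The frame identities
are stated over an abstract commutative ring with derivations, applied to the germs of smooth
functions at a point. -/

set_option linter.unusedSectionVars false
namespace GenGeom

/-! ### Contraction of indices in an orthonormal frame -/

section Flux

variable {K ι : Type*} [CommRing K] [Fintype ι]

/-- The contraction of an index with the signs `ε` of an orthonormal frame. -/
def ctr (ε : ι → K) (f : ι → K) : K := ∑ A, ε A * f A

section ctr

variable (ε : ι → K)

theorem ctr_congr {f g : ι → K} (h : ∀ A, f A = g A) : ctr ε f = ctr ε g := by
  rw [funext h]

theorem ctr_add (f g : ι → K) : ctr ε (fun A => f A + g A) = ctr ε f + ctr ε g := by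
  simp [ctr, mul_add, Finset.sum_add_distrib]

theorem ctr_sub (f g : ι → K) : ctr ε (fun A => f A - g A) = ctr ε f - ctr ε g := by
  simp [ctr, mul_sub, Finset.sum_sub_distrib]

theorem ctr_neg (f : ι → K) : ctr ε (fun A => -f A) = -ctr ε f := by
  simp [ctr, Finset.sum_neg_distrib]

theorem ctr_zero : ctr ε (fun _ => 0) = 0 := by simp [ctr]

theorem ctr_mul_left (a : K) (f : ι → K) : ctr ε (fun A => a * f A) = a * ctr ε f := by
  simp only [ctr, Finset.mul_sum]
  exact Finset.sum_congr rfl fun A _ => by ring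

theorem ctr_mul_right (a : K) (f : ι → K) : ctr ε (fun A => f A * a) = ctr ε f * a := by
  simp only [ctr, Finset.sum_mul]
  exact Finset.sum_congr rfl fun A _ => by ring

theorem ctr_comm (f : ι → ι → K) :
    ctr ε (fun A => ctr ε fun B => f A B) = ctr ε fun B => ctr ε fun A => f A B := by
  simp only [ctr, Finset.mul_sum]
  rw [Finset.sum_comm]
  exact Finset.sum_congr rfl fun A _ => Finset.sum_congr rfl fun B _ => by ring

/-- Contraction of two indices. -/
def ctr2 (f : ι → ι → K) : K := ctr ε fun A => ctr ε fun B => f A B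

/-- Contraction of three indices. -/
def ctr3 (f : ι → ι → ι → K) : K := ctr ε fun A => ctr2 ε fun B C => f A B C

/-- Contraction of four indices. -/
def ctr4 (f : ι → ι → ι → ι → K) : K := ctr ε fun A => ctr3 ε fun B C D => f A B C D

theorem ctr3_eq (f : ι → ι → ι → K) :
    ctr3 ε f = ctr2 ε fun A B => ctr ε fun C => f A B C := rfl

theorem ctr2_add (f g : ι → ι → K) :
    ctr2 ε (fun A B => f A B + g A B) = ctr2 ε f + ctr2 ε g := by
  simp only [ctr2, ctr_add]

theorem ctr2_sub (f g : ι → ι → K) :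
    ctr2 ε (fun A B => f A B - g A B) = ctr2 ε f - ctr2 ε g := by
  simp only [ctr2, ctr_sub]

theorem ctr2_neg (f : ι → ι → K) : ctr2 ε (fun A B => -f A B) = -ctr2 ε f := by
  simp only [ctr2, ctr_neg]

theorem ctr2_mul_left (a : K) (f : ι → ι → K) :
    ctr2 ε (fun A B => a * f A B) = a * ctr2 ε f := by
  simp only [ctr2, ctr_mul_left]

theorem ctr2_swap (f : ι → ι → K) : ctr2 ε f = ctr2 ε fun A B => f B A := ctr_comm ε f

theorem ctr3_add (f g : ι → ι → ι → K) :
    ctr3 ε (fun A B C => f A B C + g A B C) = ctr3 ε f + ctr3 ε g := by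
  simp only [ctr3, ctr2_add, ctr_add]

theorem ctr3_sub (f g : ι → ι → ι → K) :
    ctr3 ε (fun A B C => f A B C - g A B C) = ctr3 ε f - ctr3 ε g := by
  simp only [ctr3, ctr2_sub, ctr_sub]

theorem ctr3_neg (f : ι → ι → ι → K) : ctr3 ε (fun A B C => -f A B C) = -ctr3 ε f := by
  simp only [ctr3, ctr2_neg, ctr_neg]

theorem ctr3_mul_left (a : K) (f : ι → ι → ι → K) :
    ctr3 ε (fun A B C => a * f A B C) = a * ctr3 ε f := by
  simp only [ctr3, ctr2_mul_left, ctr_mul_left]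

theorem ctr3_swap12 (f : ι → ι → ι → K) : ctr3 ε f = ctr3 ε fun A B C => f B A C :=
  ctr_comm ε fun A B => ctr ε fun C => f A B C

theorem ctr3_swap23 (f : ι → ι → ι → K) : ctr3 ε f = ctr3 ε fun A B C => f A C B :=
  ctr_congr ε fun A => ctr2_swap ε (f A)

theorem ctr3_swap13 (f : ι → ι → ι → K) : ctr3 ε f = ctr3 ε fun A B C => f C B A := by
  rw [ctr3_swap12, ctr3_swap23, ctr3_swap12]

theorem ctr3_rot (f : ι → ι → ι → K) : ctr3 ε f = ctr3 ε fun A B C => f B C A := by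
  rw [ctr3_swap12, ctr3_swap13]

theorem ctr3_rot' (f : ι → ι → ι → K) : ctr3 ε f = ctr3 ε fun A B C => f C A B := by
  rw [ctr3_rot, ctr3_rot]

theorem ctr4_add (f g : ι → ι → ι → ι → K) :
    ctr4 ε (fun A B C D => f A B C D + g A B C D) = ctr4 ε f + ctr4 ε g := by
  simp only [ctr4, ctr3_add, ctr_add]

theorem ctr4_sub (f g : ι → ι → ι → ι → K) :
    ctr4 ε (fun A B C D => f A B C D - g A B C D) = ctr4 ε f - ctr4 ε g := by
  simp only [ctr4, ctr3_sub, ctr_sub]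

theorem ctr4_mul_left (a : K) (f : ι → ι → ι → ι → K) :
    ctr4 ε (fun A B C D => a * f A B C D) = a * ctr4 ε f := by
  simp only [ctr4, ctr3_mul_left, ctr_mul_left]

theorem ctr4_swap12 (f : ι → ι → ι → ι → K) : ctr4 ε f = ctr4 ε fun A B C D => f B A C D :=
  ctr_comm ε fun A B => ctr2 ε fun C D => f A B C D

theorem ctr4_swap23 (f : ι → ι → ι → ι → K) : ctr4 ε f = ctr4 ε fun A B C D => f A C B D :=
  ctr_congr ε fun A => ctr3_swap12 ε (f A)

theorem ctr4_swap34 (f : ι → ι → ι → ι → K) : ctr4 ε f = ctr4 ε fun A B C D => f A B D C :=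
  ctr_congr ε fun A => ctr3_swap23 ε (f A)

theorem ctr2_congr {f g : ι → ι → K} (h : ∀ A B, f A B = g A B) : ctr2 ε f = ctr2 ε g :=
  ctr_congr ε fun A => ctr_congr ε (h A)

theorem ctr3_congr {f g : ι → ι → ι → K} (h : ∀ A B C, f A B C = g A B C) :
    ctr3 ε f = ctr3 ε g :=
  ctr_congr ε fun A => ctr2_congr ε (h A)

theorem ctr4_congr {f g : ι → ι → ι → ι → K} (h : ∀ A B C D, f A B C D = g A B C D) :
    ctr4 ε f = ctr4 ε g :=
  ctr_congr ε fun A => ctr3_congr ε (h A)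

theorem ctr2_zero : ctr2 ε (fun _ _ => 0) = 0 := by simp [ctr2, ctr_zero]

theorem ctr3_zero : ctr3 ε (fun _ _ _ => 0) = 0 := by simp [ctr3, ctr2_zero, ctr_zero]

theorem ctr4_zero : ctr4 ε (fun _ _ _ _ => 0) = 0 := by simp [ctr4, ctr3_zero, ctr_zero]

end ctr

end Flux
end GenGeom

/-! ### Frame derivations, connection coefficients and the scalar curvature -/

namespace GenGeom

/-- Integers are invertible in an `ℝ`-algebra. Identities can therefore be proved after clearing
denominators or symmetrizing, although the ring of germs is not a domain. -/
theorem natCast_mul_cancel {K : Type*} [CommRing K] [Algebra ℝ K] {n : ℕ} (hn : n ≠ 0) {x y : K}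
    (h : (n : K) * x = n * y) : x = y := by
  have key : ∀ z : K, z = algebraMap ℝ K ((n : ℝ)⁻¹) * (n * z) := fun z => by
    rw [← mul_assoc, ← map_natCast (algebraMap ℝ K) n, ← map_mul,
      inv_mul_cancel₀ (Nat.cast_ne_zero.2 hn), map_one, one_mul]
  rw [key x, key y, h]

section Flux

variable {K ι : Type*} [CommRing K] [Algebra ℝ K] [Fintype ι]

/-- Renaming dummy indices does not change a contraction, so it suffices that the symmetrized
summand vanishes. This reduces identities between contractions to polynomial identities for fixed
indices, where `ring` can decide each pattern of eigenvalues. -/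
theorem ctr3_eq_zero_of_perm (ε : ι → K) (f : ι → ι → ι → K)
    (h : ∀ A B C, f A B C + f B C A + f C A B + f B A C + f A C B + f C B A = 0) :
    ctr3 ε f = 0 := by
  have h1 : ctr3 ε (fun A B C => f A B C + f B C A + f C A B + f B A C + f A C B + f C B A)
      = 0 := (ctr3_congr ε h).trans (ctr3_zero ε)
  simp only [ctr3_add] at h1
  rw [← ctr3_rot ε f, ← ctr3_rot' ε f, ← ctr3_swap12 ε f, ← ctr3_swap23 ε f,
    ← ctr3_swap13 ε f] at h1
  apply natCast_mul_cancel (n := 6) (by norm_num)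
  push_cast
  linear_combination h1

theorem ctr4_rot (ε : ι → K) (f : ι → ι → ι → ι → K) :
    ctr4 ε f = ctr4 ε fun A B C D => f A D B C := by
  rw [ctr4_swap23, ctr4_swap34]

theorem ctr4_swap14 (ε : ι → K) (f : ι → ι → ι → ι → K) :
    ctr4 ε f = ctr4 ε fun A B C D => f D B C A := by
  rw [ctr4_swap34, ctr4_swap23, ctr4_swap12, ctr4_swap23, ctr4_swap34]

/-- The four permutations generated by exchanging the outer and exchanging the inner indices are all
that the terms cubic in `c` require. -/
theorem ctr4_eq_zero_of_perm (ε : ι → K) (f : ι → ι → ι → ι → K)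
    (h : ∀ A B C E, f A B C E + f E B C A + f A C B E + f E C B A = 0) : ctr4 ε f = 0 := by
  have h1 : ctr4 ε (fun A B C E => f A B C E + f E B C A + f A C B E + f E C B A) = 0 :=
    (ctr4_congr ε h).trans (ctr4_zero ε)
  have h2 : ctr4 ε (fun A B C E => f E C B A) = ctr4 ε f := by
    rw [ctr4_swap14, ← ctr4_swap23]
  simp only [ctr4_add] at h1
  rw [← ctr4_swap14 ε f, ← ctr4_swap23 ε f, h2] at h1
  apply natCast_mul_cancel (n := 4) (by norm_num)
  push_cast
  linear_combination h1

variable (K ι) in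
/-- Commuting-coefficient calculus in an orthonormal frame: derivations `der A` along the frame
vectors, signs `ε`, and the splitting of the index set by `pos`. -/
structure FrameCalculus where
  ε : ι → K
  pos : ι → Bool
  der : ι → K → K
  der_add : ∀ A x y, der A (x + y) = der A x + der A y
  der_mul : ∀ A x y, der A (x * y) = x * der A y + y * der A x
  der_ε : ∀ A B, der A (ε B) = 0

namespace FrameCalculus

variable (X : FrameCalculus K ι)

/-- The eigenvalue of `G` on a frame vector. -/
def sg (A : ι) : K := if X.pos A then 1 else -1

theorem der_zero (A : ι) : X.der A 0 = 0 := by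
  have := X.der_add A 0 0
  simpa using this

theorem der_one (A : ι) : X.der A 1 = 0 := by
  have := X.der_mul A 1 1
  simpa using this

theorem der_neg (A : ι) (x : K) : X.der A (-x) = -X.der A x := by
  have := X.der_add A (-x) x
  rw [neg_add_cancel, der_zero] at this
  exact eq_neg_of_add_eq_zero_left this.symm

theorem der_sub (A : ι) (x y : K) : X.der A (x - y) = X.der A x - X.der A y := by
  rw [sub_eq_add_neg, der_add, der_neg, sub_eq_add_neg]

theorem der_sg (A B : ι) : X.der A (X.sg B) = 0 := by
  unfold sg
  split_ifs
  · exact X.der_one A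
  · rw [der_neg, der_one, neg_zero]

theorem der_sg_mul (A B : ι) (x : K) : X.der A (X.sg B * x) = X.sg B * X.der A x := by
  rw [der_mul, der_sg, mul_zero, add_zero]

theorem sg_mul_self (A : ι) : X.sg A * X.sg A = 1 := by
  unfold sg
  split_ifs <;> ring

theorem der_sum {κ : Type*} (A : ι) (s : Finset κ) (f : κ → K) :
    X.der A (∑ i ∈ s, f i) = ∑ i ∈ s, X.der A (f i) := by
  classical
  induction s using Finset.induction_on with
  | empty => simp [der_zero]
  | insert i s hi ih => rw [Finset.sum_insert hi, Finset.sum_insert hi, der_add, ih]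

theorem der_ctr (A : ι) (f : ι → K) : X.der A (ctr X.ε f) = ctr X.ε fun B => X.der A (f B) := by
  simp only [ctr, der_sum, der_mul, der_ε, mul_zero, add_zero]

theorem der_ctr2 (A : ι) (f : ι → ι → K) :
    X.der A (ctr2 X.ε f) = ctr2 X.ε fun B C => X.der A (f B C) := by
  simp only [ctr2, der_ctr]

theorem der_ctr3 (A : ι) (f : ι → ι → ι → K) :
    X.der A (ctr3 X.ε f) = ctr3 X.ε fun B C D => X.der A (f B C D) := by
  simp only [ctr3, der_ctr, der_ctr2]

/-- `∂_A g + d_A g`, the divergence of `g e_A`. -/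
def dv (d : ι → K) (A : ι) (g : K) : K := X.der A g + d A * g

section dv

variable (d : ι → K)

theorem dv_add (A : ι) (x y : K) : X.dv d A (x + y) = X.dv d A x + X.dv d A y := by
  simp only [dv, der_add]; ring

theorem dv_neg (A : ι) (x : K) : X.dv d A (-x) = -X.dv d A x := by
  simp only [dv, der_neg]; ring

theorem dv_sub (A : ι) (x y : K) : X.dv d A (x - y) = X.dv d A x - X.dv d A y := by
  simp only [dv, der_sub]; ring

theorem dv_zero (A : ι) : X.dv d A 0 = 0 := by simp [dv, der_zero]

theorem dv_sg_mul (A B : ι) (x : K) : X.dv d A (X.sg B * x) = X.sg B * X.dv d A x := by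
  simp only [dv, der_sg_mul]; ring

theorem dv_ctr (A : ι) (f : ι → K) :
    X.dv d A (ctr X.ε f) = ctr X.ε fun B => X.dv d A (f B) := by
  simp only [dv, der_ctr, ctr_add, ctr_mul_left]

theorem dv_ctr2 (A : ι) (f : ι → ι → K) :
    X.dv d A (ctr2 X.ε f) = ctr2 X.ε fun B C => X.dv d A (f B C) := by
  simp only [ctr2, dv_ctr]

theorem dv_mul (A : ι) (x y : K) : X.dv d A (x * y) = X.dv d A x * y + x * X.der A y := by
  simp only [dv, der_mul]; ring

end dv

/-- Twice the full Ricci tensor of a torsion-free connection with divergences `d` and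
coefficients `Γ A B C = ⟨D_{e_A} e_B, e_C⟩`. -/
def ric2 (d : ι → K) (Γ : ι → ι → ι → K) (u v : ι) : K :=
  ctr X.ε (fun A => X.dv d A (Γ u v A + Γ v u A)) - X.der u (d v) - X.der v (d u)
    + ctr2 X.ε (fun A B => Γ A u B * Γ A v B) - 2 * ctr2 X.ε fun A B => Γ A u B * Γ B v A

/-- The coefficients of a connection which is compatible with the pairing and with `G`, has
torsion zero for the structure functions `c` and divergences `d`. -/
structure IsLC (c : ι → ι → ι → K) (d : ι → K) (Γ : ι → ι → ι → K) : Prop where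
  anti : ∀ A B C, Γ A B C = -Γ A C B
  cyc : ∀ A B C, Γ A B C + Γ B C A + Γ C A B = c A B C
  tr : ∀ B, ctr X.ε (fun A => Γ A B A) = d B
  mixed : ∀ A B C, X.pos B ≠ X.pos C → Γ A B C = 0

variable {X} in
-- In the derivative terms only the trace `d` of the connection survives. The terms quadratic in `Γ`
-- depend, after symmetrization, only on the cyclic sums `c`, with weights given by the eigenvalues.
-- Hence the undetermined part of the connection drops out, and derivatives of the curvature can be
-- taken with the structure equations.
theorem IsLC.scalar_eq {c Γ : ι → ι → ι → K} {d : ι → K} (h : X.IsLC c d Γ) :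
    6 * ctr X.ε (fun u => X.sg u * X.ric2 d Γ u u) =
      -12 * ctr X.ε (fun A => X.sg A * (2 * X.der A (d A) + d A * d A))
        + 3 * ctr3 X.ε (fun A B C => X.sg A * (c A B C * c A B C))
        - ctr3 X.ε (fun A B C => X.sg A * X.sg B * X.sg C * (c A B C * c A B C)) := by
  have h1 : ctr X.ε (fun u => X.sg u * ctr X.ε fun A => X.dv d A (Γ u u A + Γ u u A))
      = -2 * ctr X.ε (fun A => X.sg A * (X.der A (d A) + d A * d A)) := by
    -- Inside one eigenbundle this is antisymmetry; across the two, both sides vanish. The sign now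
    -- sits on `A`, so the sum over `u` is a trace of `Γ`.
    have e : ∀ u A, X.sg u * Γ u u A = -(X.sg A * Γ u A u) := fun u A => by
      by_cases hh : X.pos u = X.pos A
      · rw [show X.sg u = X.sg A by simp [sg, hh], h.anti]; ring
      · rw [h.mixed u u A hh, h.mixed u A u (Ne.symm hh)]; ring
    calc _ = ctr2 X.ε (fun u A => -2 * (X.sg A * X.dv d A (Γ u A u))) := by
          unfold ctr2
          refine ctr_congr _ fun u => ?_
          rw [← ctr_mul_left]
          refine ctr_congr _ fun A => ?_
          rw [← dv_sg_mul, mul_add, e u A]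
          simp only [dv_add, dv_neg, dv_sg_mul]
          ring
      _ = _ := by
          rw [ctr2_swap, ctr2_mul_left]
          congr 1
          refine ctr_congr _ fun A => ?_
          rw [ctr_mul_left, ← dv_ctr, h.tr]
          rfl
  -- Once `c` is written as a cyclic sum of `Γ`, the symmetrized summand vanishes for each of the
  -- eight distributions of the indices over the eigenbundles.
  have h2 : ctr3 X.ε (fun u A B => 6 * (X.sg u * (Γ A u B * Γ A u B - 2 * (Γ A u B * Γ B u A)))
      - 3 * (X.sg u * (c u A B * c u A B))
      + X.sg u * X.sg A * X.sg B * (c u A B * c u A B)) = 0 := by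
    refine ctr3_eq_zero_of_perm _ _ fun A B C => ?_
    have e1 := h.anti A C B
    have e2 := h.anti B A C
    have e3 := h.anti C B A
    simp only [← h.cyc]
    rw [e1, e2, e3]
    have m1 := h.mixed A B C
    have m2 := h.mixed B C A
    have m3 := h.mixed C A B
    cases hA : X.pos A <;> cases hB : X.pos B <;> cases hC : X.pos C <;>
      simp only [hA, hB, hC, sg, ne_eq, not_true_eq_false, not_false_eq_true, reduceCtorEq,
        forall_const, IsEmpty.forall_iff] at m1 m2 m3 ⊢ <;>
      simp only [m1, m2, m3, if_true, if_false] <;> ring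
  simp only [ctr3_add, ctr3_sub, ctr3_mul_left] at h2
  have h3 : ctr X.ε (fun u => X.sg u * X.ric2 d Γ u u) =
      ctr X.ε (fun u => X.sg u * ctr X.ε fun A => X.dv d A (Γ u u A + Γ u u A))
      - 2 * ctr X.ε (fun u => X.sg u * X.der u (d u))
      + ctr3 X.ε (fun u A B => X.sg u * (Γ A u B * Γ A u B - 2 * (Γ A u B * Γ B u A))) := by
    unfold ctr3
    rw [← ctr_mul_left, ← ctr_sub, ← ctr_add]
    refine ctr_congr _ fun u => ?_
    rw [ctr2_mul_left, ctr2_sub, ctr2_mul_left, ric2]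
    ring
  have h4 : ctr X.ε (fun A => X.sg A * (2 * X.der A (d A) + d A * d A)) =
      ctr X.ε (fun A => X.sg A * (X.der A (d A) + d A * d A))
      + ctr X.ε (fun A => X.sg A * X.der A (d A)) := by
    rw [← ctr_add]
    exact ctr_congr _ fun A => by ring
  rw [h3, h1, h4]
  linear_combination h2

end FrameCalculus

end Flux
end GenGeom

/-! ### Structure equations and the invariance of the scalar curvature -/

namespace GenGeom
namespace FrameCalculus

variable {K ι : Type*} [CommRing K] [Algebra ℝ K] [Fintype ι] (X : FrameCalculus K ι)

/-- The structure equations of a Courant algebroid with a divergence, in an orthonormal frame with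
structure functions `c` and divergences `d`. -/
structure IsCourant (c : ι → ι → ι → K) (d : ι → K) : Prop where
  anti12 : ∀ A B C, c A B C = -c B A C
  anti23 : ∀ A B C, c A B C = -c A C B
  comm : ∀ A B f, X.der A (X.der B f) - X.der B (X.der A f) = ctr X.ε fun C => c A B C * X.der C f
  dcomm : ∀ A B, X.der A (d B) - X.der B (d A) = ctr X.ε fun C => X.dv d C (c A B C)
  lap : ∀ f, ctr X.ε (fun A => X.dv d A (X.der A f)) = 0
  jacobi : ∀ k A B C, X.der k (c A B C) = X.der A (c k B C) + X.der B (c k C A) + X.der C (c k A B)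
    + ctr X.ε fun E => c k A E * c E B C + c k B E * c A E C + c k C E * c A B E

/-- The mixed components of the full Ricci tensor. -/
def mric (c : ι → ι → ι → K) (d : ι → K) (u v : ι) : K :=
  ctr X.ε (fun A => if X.pos A = X.pos v then X.dv d A (c u v A) else 0) - X.der u (d v)
    - ctr2 X.ε fun A B => if X.pos A = X.pos v ∧ X.pos B = X.pos u then c A u B * c B v A else 0

/-- The divergence of a symmetric tensor `h` with mixed components only. -/
def mdiv (c : ι → ι → ι → K) (d : ι → K) (h : ι → ι → K) (B : ι) : K :=
  ctr X.ε (fun A => X.dv d A (h A B))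
    - ctr2 X.ε fun A E => if X.pos A ≠ X.pos B ∧ X.pos E = X.pos B then c A B E * h A E else 0

/-- The first variation of the scalar curvature under `h = ∂_t G` and `b = ∂_t d`. -/
def scalarVar (c : ι → ι → ι → K) (d : ι → K) (h : ι → ι → K) (b : ι → K) : K :=
  ctr2 X.ε (fun u v => h u v * X.mric c d u v) - ctr X.ε (fun B => X.dv d B (X.mdiv c d h B))
    - 2 * ctr X.ε fun A => X.sg A * X.dv d A (b A)

variable {X} {c : ι → ι → ι → K} {d : ι → K}

namespace IsCourant

variable (h : X.IsCourant c d)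
include h

theorem anti13 (A B C : ι) : c A B C = -c C B A := by
  rw [h.anti12, h.anti23, h.anti12, neg_neg]

theorem rot (A B C : ι) : c A B C = c B C A := by
  rw [h.anti12, h.anti23, neg_neg]

/-- Commuting the derivations produces the derivative along the bracket, and commuting the
divergences produces the divergence of the bracket; the product rule joins the two into one total
divergence. -/
theorem dv_comm (A B : ι) (g : K) : X.dv d A (X.dv d B g) - X.dv d B (X.dv d A g) =
    ctr X.ε fun C => X.dv d C (c A B C * g) := by
  have e : ctr X.ε (fun C => X.dv d C (c A B C * g)) =
      ctr X.ε (fun C => X.dv d C (c A B C)) * g + ctr X.ε fun C => c A B C * X.der C g := by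
    rw [← ctr_mul_right, ← ctr_add]
    exact ctr_congr _ fun C => by simp only [dv, der_mul]; ring
  rw [e, ← h.comm, ← h.dcomm]
  simp only [dv, der_mul, der_add]
  ring

/-- The invariance of the scalar curvature under the infinitesimal symmetry generated by a frame
vector. -/
theorem der_scalar {Γ : ι → ι → ι → K} (hΓ : X.IsLC c d Γ) (k : ι) :
    X.der k (ctr X.ε fun u => X.sg u * X.ric2 d Γ u u) =
      2 * X.scalarVar c d (fun A B => (X.sg A - X.sg B) * c k A B) (fun A => X.der A (d k)) := by
  have a12 := h.anti12
  have a23 := h.anti23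
  apply natCast_mul_cancel (n := 6) (by norm_num)
  -- The connection disappears here. What has to be differentiated along `e_k` are `c` and `d`, and
  -- `jacobi`, `dcomm` and `comm` express these derivatives through derivatives in the contracted
  -- directions.
  have hs := congrArg (X.der k) hΓ.scalar_eq
  have e6 : ∀ x, X.der k (6 * x) = 6 * X.der k x := fun x => by
    have : (6 : K) * x = x + x + x + x + x + x := by ring
    rw [this]; simp only [der_add]; ring
  have e12 : ∀ x, X.der k (-12 * x) = -12 * X.der k x := fun x => by
    have : (-12 : K) * x = -(6 * x + 6 * x) := by ring
    rw [this]; simp only [der_add, der_neg, e6]; ring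
  have e3 : ∀ x, X.der k (3 * x) = 3 * X.der k x := fun x => by
    have : (3 : K) * x = x + x + x := by ring
    rw [this]; simp only [der_add]; ring
  rw [e6, der_sub, der_add, e12, e3, der_ctr, der_ctr3, der_ctr3] at hs
  push_cast
  rw [der_ctr, hs, der_ctr]
  -- the terms with `d`
  have p1 : ctr X.ε (fun A => X.der k (X.sg A * (2 * X.der A (d A) + d A * d A))) =
      2 * ctr X.ε (fun A => X.sg A * X.dv d A (X.der A (d k)))
      + 2 * ctr2 X.ε (fun A E => X.sg A * X.dv d A (X.dv d E (c k A E)))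
      + 2 * ctr2 X.ε (fun A E => X.sg A * (c k A E * X.der E (d A))) := by
    unfold ctr2
    rw [← ctr_mul_left, ← ctr_mul_left, ← ctr_mul_left, ← ctr_add, ← ctr_add]
    refine ctr_congr _ fun A => ?_
    simp only [ctr_mul_left]
    have q1 := h.comm k A (d A)
    have q2 := h.dcomm k A
    have q3 : X.der k (d A) = X.der A (d k) + ctr X.ε fun C => X.dv d C (c k A C) := by
      linear_combination q2
    have q4 := congrArg (X.dv d A) q3
    rw [dv_add, dv_ctr] at q4
    rw [← q1, der_sg_mul, der_add]
    have : (2 : K) * X.der A (d A) = X.der A (d A) + X.der A (d A) := by ring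
    rw [this, der_add, der_mul]
    simp only [dv] at q4 ⊢
    linear_combination 2 * X.sg A * q4
  -- The Jacobi identity splits the derivative of a square of `c` into terms with one derivative of
  -- `c k _ _` and terms cubic in `c`, collected in `ctr4`.
  have p2 : ctr3 X.ε (fun A B C => X.der k (X.sg A * (c A B C * c A B C))) =
      ctr3 X.ε (fun A B C => 2 * X.sg A * c A B C *
        (X.der A (c k B C) + X.der B (c k C A) + X.der C (c k A B)))
      + ctr4 X.ε (fun A B C E => 2 * X.sg A * c A B C *
        (c k A E * c E B C + c k B E * c A E C + c k C E * c A B E)) := by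
    have : ctr4 X.ε (fun A B C E => 2 * X.sg A * c A B C *
        (c k A E * c E B C + c k B E * c A E C + c k C E * c A B E)) =
      ctr3 X.ε (fun A B C => 2 * X.sg A * c A B C * ctr X.ε fun E =>
        (c k A E * c E B C + c k B E * c A E C + c k C E * c A B E)) := by
      simp only [← ctr_mul_left]; rfl
    rw [this, ← ctr3_add]
    refine ctr3_congr _ fun A B C => ?_
    rw [der_sg_mul, der_mul, h.jacobi]
    ring
  have p3 : ctr3 X.ε (fun A B C => X.der k (X.sg A * X.sg B * X.sg C * (c A B C * c A B C))) =
      ctr3 X.ε (fun A B C => 2 * (X.sg A * X.sg B * X.sg C) * c A B C *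
        (X.der A (c k B C) + X.der B (c k C A) + X.der C (c k A B)))
      + ctr4 X.ε (fun A B C E => 2 * (X.sg A * X.sg B * X.sg C) * c A B C *
        (c k A E * c E B C + c k B E * c A E C + c k C E * c A B E)) := by
    have : ctr4 X.ε (fun A B C E => 2 * (X.sg A * X.sg B * X.sg C) * c A B C *
        (c k A E * c E B C + c k B E * c A E C + c k C E * c A B E)) =
      ctr3 X.ε (fun A B C => 2 * (X.sg A * X.sg B * X.sg C) * c A B C * ctr X.ε fun E =>
        (c k A E * c E B C + c k B E * c A E C + c k C E * c A B E)) := by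
      simp only [← ctr_mul_left]; rfl
    rw [this, ← ctr3_add]
    refine ctr3_congr _ fun A B C => ?_
    rw [mul_assoc (X.sg A * X.sg B), mul_assoc (X.sg A), der_sg_mul, der_sg_mul, der_sg_mul,
      der_mul, h.jacobi]
    ring
  rw [p1, p2, p3]
  -- the second order terms
  have r1 : ctr X.ε (fun B => ctr X.ε fun A => X.dv d B (X.dv d A ((X.sg A - X.sg B) * c k A B))) =
      2 * ctr2 X.ε (fun A E => X.sg A * X.dv d A (X.dv d E (c k A E)))
      - ctr3 X.ε (fun A B C => X.sg A * X.dv d C (c A B C * c k A B)) := by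
    have t : ctr X.ε (fun B => ctr X.ε fun A => X.dv d B (X.dv d A ((X.sg A - X.sg B) * c k A B)))
        = ctr2 X.ε (fun A B => X.sg A * X.dv d B (X.dv d A (c k A B)))
          - ctr2 X.ε (fun A B => X.sg A * X.dv d A (X.dv d B (c k B A))) := by
      rw [ctr2_swap X.ε (fun A B => X.sg A * X.dv d B (X.dv d A (c k A B))), ← ctr2_sub]
      refine ctr2_congr _ fun A B => ?_
      simp only [sub_mul, dv_sub, dv_sg_mul]
    rw [t, ← ctr2_mul_left, ← ctr2_sub]
    have t' : ctr3 X.ε (fun A B C => X.sg A * X.dv d C (c A B C * c k A B)) =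
        ctr2 X.ε (fun A B => X.sg A * (X.dv d A (X.dv d B (c k A B))
          - X.dv d B (X.dv d A (c k A B)))) := by
      simp only [h.dv_comm, ← ctr_mul_left]; rfl
    rw [t', ← ctr2_sub]
    refine ctr2_congr _ fun A B => ?_
    rw [a23 k B A, dv_neg, dv_neg]
    ring
  have M : ctr2 X.ε (fun u v => (X.sg u - X.sg v) * c k u v * X.mric c d u v) =
      ctr3 X.ε (fun A B C => if X.pos C = X.pos B then
        (X.sg A - X.sg B) * c k A B * X.dv d C (c A B C) else 0)
      - ctr2 X.ε (fun u v => (X.sg u - X.sg v) * c k u v * X.der u (d v))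
      - ctr4 X.ε (fun u v A B => if X.pos A = X.pos v ∧ X.pos B = X.pos u then
        (X.sg u - X.sg v) * c k u v * (c A u B * c B v A) else 0) := by
    have t3 : ∀ f : ι → ι → ι → K, ctr3 X.ε f = ctr2 X.ε fun u v => ctr X.ε (f u v) := fun _ => rfl
    have t4 : ∀ f : ι → ι → ι → ι → K, ctr4 X.ε f = ctr2 X.ε fun u v => ctr2 X.ε (f u v) :=
      fun _ => rfl
    rw [t3, t4, ← ctr2_sub, ← ctr2_sub]
    refine ctr2_congr _ fun u v => ?_
    rw [mric, mul_sub, mul_sub, ← ctr_mul_left, ← ctr2_mul_left]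
    simp only [mul_ite, mul_zero]
  have N : ctr X.ε (fun B => X.dv d B (X.mdiv c d (fun A B => (X.sg A - X.sg B) * c k A B) B)) =
      ctr X.ε (fun B => ctr X.ε fun A => X.dv d B (X.dv d A ((X.sg A - X.sg B) * c k A B)))
      - ctr3 X.ε (fun A B C => X.dv d C (if X.pos A ≠ X.pos C ∧ X.pos B = X.pos C then
        c A C B * ((X.sg A - X.sg B) * c k A B) else 0)) := by
    rw [ctr3_rot X.ε]
    unfold ctr3
    rw [← ctr_sub]
    refine ctr_congr _ fun B => ?_
    simp only [mdiv]
    rw [dv_sub, dv_ctr, dv_ctr2, ctr2_swap]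
  -- The remaining derivatives of `d` occur only in antisymmetrized form, which `dcomm` turns into
  -- divergences of `c`.
  have c1 : -2 * ctr2 X.ε (fun A E => X.sg A * (c k A E * X.der E (d A)))
      + ctr2 X.ε (fun u v => (X.sg u - X.sg v) * c k u v * X.der u (d v))
      = ctr3 X.ε (fun A B C => X.sg A * c k A B * X.dv d C (c A B C)) := by
    have t : ctr3 X.ε (fun A B C => X.sg A * c k A B * X.dv d C (c A B C)) =
        ctr2 X.ε (fun A B => X.sg A * c k A B * X.der A (d B))
        - ctr2 X.ε (fun A B => X.sg A * c k A B * X.der B (d A)) := by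
      rw [← ctr2_sub]
      unfold ctr3 ctr2
      refine ctr_congr _ fun A => ctr_congr _ fun B => ?_
      rw [ctr_mul_left, ← h.dcomm]
      ring
    rw [t, ctr2_swap X.ε (fun A B => X.sg A * c k A B * X.der B (d A)),
      ctr2_swap X.ε (fun A E => X.sg A * (c k A E * X.der E (d A))), ← ctr2_mul_left, ← ctr2_add,
      ← ctr2_sub]
    refine ctr2_congr _ fun A B => ?_
    rw [a23 k B A]
    ring
  -- All terms bilinear in `c` that contain one derivative or one factor `d`; they cancel in each
  -- eigenvalue pattern after symmetrization.
  have c2 : ctr3 X.ε (fun A B C => 12 * (X.sg A * c k A B * X.dv d C (c A B C))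
      + 3 * (2 * X.sg A * c A B C *
        (X.der A (c k B C) + X.der B (c k C A) + X.der C (c k A B)))
      - 2 * (X.sg A * X.sg B * X.sg C) * c A B C *
        (X.der A (c k B C) + X.der B (c k C A) + X.der C (c k A B))
      - 12 * (if X.pos C = X.pos B then
        (X.sg A - X.sg B) * c k A B * X.dv d C (c A B C) else 0)
      - 12 * (X.sg A * X.dv d C (c A B C * c k A B))
      - 12 * X.dv d C (if X.pos A ≠ X.pos C ∧ X.pos B = X.pos C then
        c A C B * ((X.sg A - X.sg B) * c k A B) else 0)) = 0 := by
    refine ctr3_eq_zero_of_perm _ _ fun A B C => ?_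
    simp only [a12 B A C, a23 A C B, h.anti13 C B A, ← h.rot A B C, h.rot C A B, a23 k B A,
      a23 k C B, a23 k A C]
    cases hA : X.pos A <;> cases hB : X.pos B <;> cases hC : X.pos C <;>
      simp only [hA, hB, hC, sg, ne_eq, not_true_eq_false, not_false_eq_true, reduceCtorEq,
        and_true, and_false, if_true, if_false, dv, der_mul, der_neg,
        der_zero, der_sub, der_one] <;> ring
  -- The terms cubic in `c`. Dummy indices are first renamed so that the factor containing `k` is
  -- always `c k A E`; only then are the summands comparable under the four permutations.
  have c3 : ctr4 X.ε (fun A B C E => 3 * (2 * X.sg A * c A B C *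
        (c k A E * c E B C + c k B E * c A E C + c k C E * c A B E))
      - 2 * (X.sg A * X.sg B * X.sg C) * c A B C *
        (c k A E * c E B C + c k B E * c A E C + c k C E * c A B E)) =
      -12 * ctr4 X.ε (fun u v A B => if X.pos A = X.pos v ∧ X.pos B = X.pos u then
        (X.sg u - X.sg v) * c k u v * (c A u B * c B v A) else 0) := by
    rw [ctr4_rot _ (fun u v A B => if X.pos A = X.pos v ∧ X.pos B = X.pos u then
        (X.sg u - X.sg v) * c k u v * (c A u B * c B v A) else 0)]
    have g1 := ctr4_swap12 X.ε fun A B C E =>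
      (6 * X.sg A - 2 * (X.sg A * X.sg B * X.sg C)) * c A B C * (c k B E * c A E C)
    have g2 := (ctr4_swap12 X.ε fun A B C E =>
      (6 * X.sg A - 2 * (X.sg A * X.sg B * X.sg C)) * c A B C * (c k C E * c A B E)).trans
      (ctr4_swap23 X.ε _) |>.trans (ctr4_swap12 X.ε _)
    have g3 : ctr4 X.ε (fun A B C E => 3 * (2 * X.sg A * c A B C *
        (c k A E * c E B C + c k B E * c A E C + c k C E * c A B E))
      - 2 * (X.sg A * X.sg B * X.sg C) * c A B C *
        (c k A E * c E B C + c k B E * c A E C + c k C E * c A B E)) =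
      ctr4 X.ε (fun A B C E => (6 * X.sg A - 2 * (X.sg A * X.sg B * X.sg C)) * c A B C *
        (c k A E * c E B C))
      + ctr4 X.ε (fun A B C E =>
      (6 * X.sg A - 2 * (X.sg A * X.sg B * X.sg C)) * c A B C * (c k B E * c A E C))
      + ctr4 X.ε fun A B C E =>
      (6 * X.sg A - 2 * (X.sg A * X.sg B * X.sg C)) * c A B C * (c k C E * c A B E) := by
      rw [← ctr4_add, ← ctr4_add]
      exact ctr4_congr _ fun A B C E => by ring
    rw [g3, g1, g2, ← ctr4_add, ← ctr4_add, ← sub_eq_zero, ← ctr4_mul_left, ← ctr4_sub]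
    refine ctr4_eq_zero_of_perm _ _ fun A B C E => ?_
    simp only [a12 B A C, a23 A C B, h.anti13 C B A, ← h.rot A B C, h.rot C A B, a23 k E A,
      a12 B E C, a23 E C B, h.anti13 C B E, ← h.rot E B C, h.rot C E B]
    cases hA : X.pos A <;> cases hB : X.pos B <;> cases hC : X.pos C <;> cases hE : X.pos E <;>
      simp only [hA, hB, hC, hE, sg, reduceCtorEq,
        and_true, and_false, if_true, if_false, and_self] <;> ring
  simp only [scalarVar]
  rw [M, N, r1]
  simp only [ctr3_add, ctr3_sub, ctr3_mul_left] at c2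
  simp only [ctr4_sub, ctr4_mul_left] at c3
  linear_combination 12 * c1 + c2 + c3

end IsCourant
end FrameCalculus
end GenGeom

/-! ### Mixed Ricci components and the contracted Bianchi identity -/

namespace GenGeom
namespace FrameCalculus

variable {K ι : Type*} [CommRing K] [Algebra ℝ K] [Fintype ι] {X : FrameCalculus K ι}
  {c Γ : ι → ι → ι → K} {d : ι → K}

theorem sg_eq {A B : ι} (h : X.pos A = X.pos B) : X.sg A = X.sg B := by simp [sg, h]

theorem sg_eq_neg {A B : ι} (h : X.pos A ≠ X.pos B) : X.sg A = -X.sg B := by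
  cases hA : X.pos A <;> cases hB : X.pos B <;> simp_all [sg]

theorem dv_ite (p : Prop) [Decidable p] (A : ι) (x : K) :
    X.dv d A (if p then x else 0) = if p then X.dv d A x else 0 := by
  split_ifs <;> simp [dv_zero]

/-- The indicator of opposite eigenvalues is `(1 - s_A s_B) / 2`. -/
theorem ctr_ite_ne (B : ι) (f : ι → K) :
    2 * ctr X.ε (fun A => if X.pos A ≠ X.pos B then f A else 0) =
      ctr X.ε f - X.sg B * ctr X.ε fun A => X.sg A * f A := by
  rw [← ctr_mul_left, ← ctr_mul_left, ← ctr_sub]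
  refine ctr_congr _ fun A => ?_
  by_cases hh : X.pos A = X.pos B
  · rw [if_neg (not_not.2 hh), sg_eq hh, ← mul_assoc, sg_mul_self]; ring
  · rw [if_pos hh, sg_eq_neg hh]
    linear_combination -f A * X.sg_mul_self B

/-- Two of the three terms in the cyclic sum for `c A B C` pair vectors from different eigenbundles,
so torsion-freeness determines the third. -/
theorem IsLC.eq_of_ne (h : X.IsLC c d Γ) {A B C : ι} (h1 : X.pos A ≠ X.pos B)
    (h2 : X.pos C = X.pos B) : Γ A B C = c A B C := by
  rw [← h.cyc, h.mixed B C A (by rw [h2]; exact h1.symm), h.mixed C A B h1]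
  ring

namespace IsCourant

variable (h : X.IsCourant c d)
include h

/-- An index `A` has the type of exactly one of `u`, `v`, so the difference of the first terms is
the divergence of the bracket; by `dcomm` it compensates the derivatives of `d`. The quadratic terms
agree after renaming. -/
theorem mric_symm {u v : ι} (huv : X.pos u ≠ X.pos v) : X.mric c d u v = X.mric c d v u := by
  have e1 : ctr X.ε (fun A => if X.pos A = X.pos v then X.dv d A (c u v A) else 0)
      - ctr X.ε (fun A => if X.pos A = X.pos u then X.dv d A (c v u A) else 0) =
      ctr X.ε fun A => X.dv d A (c u v A) := by
    rw [← ctr_sub]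
    refine ctr_congr _ fun A => ?_
    rw [h.anti12 v u A, dv_neg]
    cases hA : X.pos A <;> cases hu : X.pos u <;> cases hv : X.pos v <;> simp_all
  have e2 : ctr2 X.ε (fun A B => if X.pos A = X.pos v ∧ X.pos B = X.pos u then
      c A u B * c B v A else 0) = ctr2 X.ε fun A B =>
      if X.pos A = X.pos u ∧ X.pos B = X.pos v then c A v B * c B u A else 0 := by
    rw [ctr2_swap]
    refine ctr2_congr _ fun A B => ?_
    simp only [and_comm, mul_comm]
  have e3 := h.dcomm u v
  simp only [mric]
  linear_combination e1 - e2 - e3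

/-- For `u`, `v` of different type the only coefficients that enter are those fixed by
`IsLC.eq_of_ne`, whence the independence of the connection. The factor two comes from the symmetry
`mric_symm`. -/
theorem ric2_eq (hΓ : X.IsLC c d Γ) {u v : ι} (huv : X.pos u ≠ X.pos v) :
    X.ric2 d Γ u v = 2 * X.mric c d u v := by
  have key : ∀ {u v : ι}, X.pos u ≠ X.pos v → ∀ A, Γ u v A =
      if X.pos A = X.pos v then c u v A else 0 := fun {u v} huv A => by
    split_ifs with hA
    · exact hΓ.eq_of_ne huv hA
    · exact hΓ.mixed _ _ _ (Ne.symm hA)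
  have e1 : ctr X.ε (fun A => X.dv d A (Γ u v A + Γ v u A)) =
      ctr X.ε (fun A => if X.pos A = X.pos v then X.dv d A (c u v A) else 0)
      + ctr X.ε (fun A => if X.pos A = X.pos u then X.dv d A (c v u A) else 0) := by
    rw [← ctr_add]
    refine ctr_congr _ fun A => ?_
    rw [key huv, key huv.symm, dv_add, dv_ite, dv_ite]
  have e2 : ctr2 X.ε (fun A B => Γ A u B * Γ A v B) = 0 := by
    rw [← ctr2_zero X.ε]
    refine ctr2_congr _ fun A B => ?_
    by_cases hB : X.pos B = X.pos u
    · rw [hΓ.mixed A v B (by rw [hB]; exact huv.symm), mul_zero]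
    · rw [hΓ.mixed A u B (Ne.symm hB), zero_mul]
  have e3 : ctr2 X.ε (fun A B => Γ A u B * Γ B v A) =
      ctr2 X.ε fun A B => if X.pos A = X.pos v ∧ X.pos B = X.pos u then
        c A u B * c B v A else 0 := by
    refine ctr2_congr _ fun A B => ?_
    by_cases hB : X.pos B = X.pos u
    · by_cases hA : X.pos A = X.pos v
      · rw [if_pos ⟨hA, hB⟩, hΓ.eq_of_ne (by rw [hA]; exact huv.symm) hB,
          hΓ.eq_of_ne (by rw [hB]; exact huv) hA]
      · rw [if_neg (by tauto), hΓ.mixed B v A (Ne.symm hA), mul_zero]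
    · rw [if_neg (by tauto), hΓ.mixed A u B (Ne.symm hB), zero_mul]
  have e4 := h.mric_symm huv
  have e5 : ctr2 X.ε (fun A B => if X.pos A = X.pos v ∧ X.pos B = X.pos u then
      c A u B * c B v A else 0) = ctr2 X.ε fun A B =>
      if X.pos A = X.pos u ∧ X.pos B = X.pos v then c A v B * c B u A else 0 := by
    rw [ctr2_swap]
    refine ctr2_congr _ fun A B => ?_
    simp only [and_comm, mul_comm]
  rw [ric2, e1, e2, e3]
  simp only [mric] at e4 ⊢
  linear_combination -e4 - e5

/-- The two orders of the double divergence of a mixed symmetric tensor agree. -/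
theorem dv_sg_mdiv {t : ι → ι → K} (ts : ∀ A B, t A B = t B A)
    (tm : ∀ A B, X.pos A = X.pos B → t A B = 0) :
    ctr X.ε (fun B => X.dv d B (X.sg B * X.mdiv c d t B)) = 0 := by
  apply natCast_mul_cancel (n := 2) (by norm_num)
  have e1 : ctr X.ε (fun B => X.dv d B (X.sg B * X.mdiv c d t B)) =
      ctr2 X.ε (fun A B => X.sg B * X.dv d B (X.dv d A (t A B)))
      - ctr3 X.ε (fun A B C => X.sg C * X.dv d C (if X.pos A ≠ X.pos C ∧ X.pos B = X.pos C then
        c A C B * t A B else 0)) := by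
    rw [ctr3_rot X.ε, ctr2_swap]
    unfold ctr3
    rw [ctr2, ← ctr_sub]
    refine ctr_congr _ fun B => ?_
    simp only [mdiv]
    rw [dv_sg_mul, dv_sub, dv_ctr, dv_ctr2, ctr2_mul_left, ctr_mul_left, mul_sub]
  -- On a mixed tensor `s_A = -s_B`, so exchanging the indices reverses the sign. Twice the double
  -- divergence is therefore a commutator, evaluated by `dv_comm`.
  have e2 : ctr2 X.ε (fun A B => X.sg B * X.dv d B (X.dv d A (t A B))) =
      ctr2 X.ε (fun A B => -(X.sg B * X.dv d A (X.dv d B (t A B)))) := by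
    rw [ctr2_swap]
    refine ctr2_congr _ fun A B => ?_
    by_cases hh : X.pos A = X.pos B
    · rw [tm _ _ hh, tm _ _ hh.symm]; simp [dv_zero]
    · rw [ts, sg_eq_neg hh]; ring
  have e3 : ctr3 X.ε (fun A B C => X.sg B * X.dv d C (c B A C * t A B)) =
      ctr2 X.ε (fun A B => X.sg B * X.dv d B (X.dv d A (t A B)))
      - ctr2 X.ε (fun A B => X.sg B * X.dv d A (X.dv d B (t A B))) := by
    rw [← ctr2_sub]
    unfold ctr3 ctr2
    refine ctr_congr _ fun A => ctr_congr _ fun B => ?_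
    rw [ctr_mul_left, ← h.dv_comm]
    ring
  rw [ctr2_neg] at e2
  -- The commutator cancels the correction terms of `mdiv` after symmetrization over the three
  -- indices.
  have e4 : ctr3 X.ε (fun A B C => X.sg B * X.dv d C (c B A C * t A B)
      - 2 * (X.sg C * X.dv d C (if X.pos A ≠ X.pos C ∧ X.pos B = X.pos C then
        c A C B * t A B else 0))) = 0 := by
    refine ctr3_eq_zero_of_perm _ _ fun A B C => ?_
    simp only [h.anti12 B A C, h.anti23 A C B, h.anti13 C B A, ← h.rot A B C, h.rot C A B,
      ts B A, ts C B, ts A C]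
    have m1 := tm A B
    have m2 := tm B C
    have m3 := tm C A
    cases hA : X.pos A <;> cases hB : X.pos B <;> cases hC : X.pos C <;>
      simp only [hA, hB, hC, reduceCtorEq, forall_const, IsEmpty.forall_iff] at m1 m2 m3 <;>
      simp only [hA, hB, hC, m1, m2, m3, sg, ne_eq, not_true_eq_false, not_false_eq_true,
        reduceCtorEq, and_true, and_false, if_true, if_false, dv_zero, dv_neg, mul_zero,
        neg_mul, mul_neg] <;> ring
  rw [ctr3_sub, ctr3_mul_left] at e4
  push_cast
  rw [e1]
  linear_combination e2 - e3 + e4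

variable (X c d) in
omit h in
/-- The mixed part of the full Ricci tensor. -/
def _root_.GenGeom.FrameCalculus.fm (A B : ι) : K :=
  if X.pos A = X.pos B then 0 else X.mric c d A B

theorem fm_symm (A B : ι) : X.fm c d A B = X.fm c d B A := by
  unfold fm
  by_cases hh : X.pos A = X.pos B
  · rw [if_pos hh, if_pos hh.symm]
  · rw [if_neg hh, if_neg (Ne.symm hh), h.mric_symm hh]

/-- The contracted Bianchi identity. -/
theorem bianchi (hΓ : X.IsLC c d Γ) (k : ι) :
    8 * X.mdiv c d (X.fm c d) k =
      -(X.sg k * X.der k (ctr X.ε fun u => X.sg u * X.ric2 d Γ u u)) := by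
  -- The change of `G` under the symmetry generated by `e_k`, in components. The plan is to evaluate
  -- the right-hand side of `der_scalar` on it.
  set t : ι → ι → K := fun A B => (X.sg A - X.sg B) * c k A B with ht
  have ts : ∀ A B, t A B = t B A := fun A B => by
    simp only [ht]; rw [h.anti23 k B A]; ring
  have tm : ∀ A B, X.pos A = X.pos B → t A B = 0 := fun A B hh => by
    simp only [ht]; rw [sg_eq hh]; ring
  have e1 := h.dv_sg_mdiv ts tm
  -- The divergence of the Lie derivative of `G` reproduces the mixed Ricci tensor, but only in
  -- directions of type opposite to `k`.
  have e2 : ∀ B, X.pos B ≠ X.pos k → X.mdiv c d t B =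
      2 * X.sg k * (X.mric c d B k + X.der B (d k)) := fun B hB => by
    simp only [mdiv, mric]
    have q1 : ctr X.ε (fun A => X.dv d A (t A B)) =
        2 * X.sg k * ctr X.ε fun A => if X.pos A = X.pos k then X.dv d A (c B k A) else 0 := by
      rw [← ctr_mul_left]
      refine ctr_congr _ fun A => ?_
      split_ifs with hA
      · simp only [ht]
        rw [sg_eq hA, sg_eq_neg hB, h.rot B k A, show (X.sg k - -X.sg k) * c k A B =
          X.sg k * (c k A B + c k A B) by ring, dv_sg_mul, dv_add]
        ring
      · rw [tm A B (by cases hA' : X.pos A <;> cases hB' : X.pos B <;> simp_all), dv_zero,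
          mul_zero]
    have q2 : ctr2 X.ε (fun A E => if X.pos A ≠ X.pos B ∧ X.pos E = X.pos B then
        c A B E * t A E else 0) = 2 * X.sg k * ctr2 X.ε fun A E =>
        if X.pos A = X.pos k ∧ X.pos E = X.pos B then c A B E * c E k A else 0 := by
      rw [← ctr2_mul_left]
      refine ctr2_congr _ fun A E => ?_
      have : X.pos A ≠ X.pos B ↔ X.pos A = X.pos k := by
        cases hA' : X.pos A <;> cases hB' : X.pos B <;> simp_all
      simp only [this]
      split_ifs with hh
      · simp only [ht]
        rw [sg_eq hh.1, sg_eq hh.2, sg_eq_neg hB, h.rot E k A]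
        ring
      · ring
    rw [q1, q2]
    ring
  -- By `e1` the two eigenbundles contribute equally to the double divergence. It is enough to sum
  -- over the directions covered by `e2` and to double the result.
  have e3 : ctr X.ε (fun B => X.dv d B (X.mdiv c d t B)) =
      4 * X.sg k * ctr X.ε (fun B => if X.pos B ≠ X.pos k then X.dv d B (X.mric c d B k) else 0)
      + 4 * X.sg k * ctr X.ε (fun B => if X.pos B ≠ X.pos k then
        X.dv d B (X.der B (d k)) else 0) := by
    have := ctr_ite_ne (X := X) k fun B => X.dv d B (X.mdiv c d t B)
    simp only [← dv_sg_mul] at this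
    rw [e1, mul_zero, sub_zero] at this
    rw [← this, ← ctr_mul_left, ← ctr_mul_left, ← ctr_mul_left, ← ctr_add]
    refine ctr_congr _ fun B => ?_
    split_ifs with hB
    · rw [e2 B hB, show 2 * X.sg k * (X.mric c d B k + X.der B (d k)) =
        X.sg k * (X.mric c d B k + X.mric c d B k + X.der B (d k) + X.der B (d k)) by ring,
        dv_sg_mul]
      simp only [dv_add]
      ring
    · ring
  -- As `div ∘ 𝒟 = 0`, the partial trace of the second derivatives of `d k` is a multiple of the
  -- Laplacian, and so cancels the contribution of the density to `scalarVar`.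
  have e4 := ctr_ite_ne (X := X) k fun B => X.dv d B (X.der B (d k))
  rw [h.lap (d k)] at e4
  have e5 : ctr2 X.ε (fun u v => t u v * X.mric c d u v) = 4 * X.sg k * ctr2 X.ε (fun B A =>
      if X.pos B ≠ X.pos k ∧ X.pos A = X.pos k then c B k A * X.fm c d B A else 0) := by
    have q : ctr2 X.ε (fun A B => if X.pos A = X.pos k ∧ X.pos B ≠ X.pos k then
        t A B * X.mric c d A B else 0) = 2 * X.sg k * ctr2 X.ε (fun B A =>
        if X.pos B ≠ X.pos k ∧ X.pos A = X.pos k then c B k A * X.fm c d B A else 0) := by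
      rw [ctr2_swap, ← ctr2_mul_left]
      refine ctr2_congr _ fun B A => ?_
      simp only [and_comm]
      split_ifs with hh
      · simp only [ht]
        rw [sg_eq hh.2, sg_eq_neg hh.1, h.fm_symm, fm, if_neg (by rw [hh.2]; exact hh.1.symm),
          h.rot B k A]
        ring
      · ring
    have q' : ctr2 X.ε (fun A B => if X.pos B = X.pos k ∧ X.pos A ≠ X.pos k then
        t A B * X.mric c d A B else 0) = ctr2 X.ε (fun A B =>
        if X.pos A = X.pos k ∧ X.pos B ≠ X.pos k then t A B * X.mric c d A B else 0) := by
      rw [ctr2_swap]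
      refine ctr2_congr _ fun A B => ?_
      split_ifs with hh
      · rw [ts, h.mric_symm (by rw [hh.1]; exact hh.2)]
      · rfl
    have : ctr2 X.ε (fun u v => t u v * X.mric c d u v) =
        ctr2 X.ε (fun A B => if X.pos A = X.pos k ∧ X.pos B ≠ X.pos k then
          t A B * X.mric c d A B else 0)
        + ctr2 X.ε (fun A B => if X.pos B = X.pos k ∧ X.pos A ≠ X.pos k then
          t A B * X.mric c d A B else 0) := by
      rw [← ctr2_add]
      refine ctr2_congr _ fun A B => ?_
      have := tm A B
      cases hA : X.pos A <;> cases hB : X.pos B <;> cases hC : X.pos k <;>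
        simp_all
    rw [this, q', q]
    ring
  have e6 : X.mdiv c d (X.fm c d) k =
      ctr X.ε (fun B => if X.pos B ≠ X.pos k then X.dv d B (X.mric c d B k) else 0)
      - ctr2 X.ε (fun B A =>
        if X.pos B ≠ X.pos k ∧ X.pos A = X.pos k then c B k A * X.fm c d B A else 0) := by
    rw [mdiv]
    congr 1
    refine ctr_congr _ fun B => ?_
    rw [fm]
    split_ifs <;> simp_all [dv_zero]
  rw [h.der_scalar hΓ k, scalarVar, e5, e3, e6]
  linear_combination (-8 * ctr X.ε (fun B => if X.pos B ≠ X.pos k then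
      X.dv d B (X.mric c d B k) else 0) + 8 * ctr2 X.ε (fun B A =>
        if X.pos B ≠ X.pos k ∧ X.pos A = X.pos k then c B k A * X.fm c d B A else 0)
      - 8 * ctr X.ε (fun B => if X.pos B ≠ X.pos k then
        X.dv d B (X.der B (d k)) else 0)) * X.sg_mul_self k - 4 * e4

end IsCourant
end FrameCalculus
end GenGeom

/-! ### The mixed Hessian and the variation of the scalar curvature along the flow -/

namespace GenGeom
namespace FrameCalculus

variable {K ι : Type*} [CommRing K] [Algebra ℝ K] [Fintype ι] {X : FrameCalculus K ι}
  {c Γ : ι → ι → ι → K} {d : ι → K}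

variable (X) in
/-- The mixed part of the Hessian of `f`. -/
def hess (c : ι → ι → ι → K) (f : K) (A B : ι) : K :=
  if X.pos A = X.pos B then 0 else
    X.der A (X.der B f) - ctr X.ε fun C => if X.pos C = X.pos B then c A B C * X.der C f else 0

variable (X) in
/-- The Laplace operator `div (G 𝒟 f)`. -/
def lapl (d : ι → K) (f : K) : K := ctr X.ε fun A => X.sg A * X.dv d A (X.der A f)

namespace IsCourant

variable (h : X.IsCourant c d)
include h

/-- For mixed indices the two bracket corrections run over complementary sets of `C`; together they
form the commutator in `comm`. -/
theorem hess_symm (f : K) (A B : ι) : X.hess c f A B = X.hess c f B A := by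
  unfold hess
  by_cases hh : X.pos A = X.pos B
  · rw [if_pos hh, if_pos hh.symm]
  · rw [if_neg hh, if_neg (Ne.symm hh)]
    have e : ctr X.ε (fun C => if X.pos C = X.pos B then c A B C * X.der C f else 0)
        - ctr X.ε (fun C => if X.pos C = X.pos A then c B A C * X.der C f else 0) =
        ctr X.ε fun C => c A B C * X.der C f := by
      rw [← ctr_sub]
      refine ctr_congr _ fun C => ?_
      rw [h.anti12 B A C]
      cases hA : X.pos A <;> cases hB : X.pos B <;> cases hC : X.pos C <;> simp_all
    linear_combination h.comm A B f - e

/-- A Leibniz rule. The corrections by `c` in the divergence of `fm` and in the Hessian are the same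
sum up to sign after renaming, so they cancel. -/
theorem dv_fm_der (f : K) : ctr X.ε (fun B => X.dv d B (ctr X.ε fun A => X.fm c d A B * X.der A f)) =
    ctr X.ε (fun A => X.mdiv c d (X.fm c d) A * X.der A f)
      + ctr2 X.ε (fun A B => X.fm c d A B * X.hess c f A B) := by
  have e1 : ctr X.ε (fun B => X.dv d B (ctr X.ε fun A => X.fm c d A B * X.der A f)) =
      ctr2 X.ε (fun A B => X.dv d B (X.fm c d A B) * X.der A f)
      + ctr2 X.ε (fun A B => X.fm c d A B * X.der A (X.der B f)) := by
    rw [ctr2_swap X.ε (fun A B => X.fm c d A B * X.der A (X.der B f)), ← ctr2_add, ctr2_swap]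
    unfold ctr2
    refine ctr_congr _ fun B => ?_
    rw [dv_ctr]
    refine ctr_congr _ fun A => ?_
    beta_reduce
    rw [dv_mul, h.fm_symm A B]
  have e2 : ctr X.ε (fun A => X.mdiv c d (X.fm c d) A * X.der A f) =
      ctr2 X.ε (fun A B => X.dv d B (X.fm c d A B) * X.der A f)
      - ctr3 X.ε (fun C B E => if X.pos B ≠ X.pos C ∧ X.pos E = X.pos C then
        c B C E * X.fm c d B E * X.der C f else 0) := by
    unfold ctr3 ctr2
    rw [← ctr_sub]
    refine ctr_congr _ fun A => ?_
    rw [mdiv, sub_mul, ← ctr_mul_right]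
    congr 1
    · exact ctr_congr _ fun B => by rw [h.fm_symm]
    · simp only [ctr2]
      rw [← ctr_mul_right]
      refine ctr_congr _ fun B => ?_
      rw [← ctr_mul_right]
      refine ctr_congr _ fun C => ?_
      split_ifs <;> ring
  have e3 : ctr2 X.ε (fun A B => X.fm c d A B * X.hess c f A B) =
      ctr2 X.ε (fun A B => X.fm c d A B * X.der A (X.der B f))
      - ctr3 X.ε (fun A B C => if X.pos C = X.pos B then
        X.fm c d A B * c A B C * X.der C f else 0) := by
    rw [ctr3_eq, ← ctr2_sub]
    unfold ctr2
    refine ctr_congr _ fun A => ctr_congr _ fun B => ?_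
    unfold fm hess
    beta_reduce
    split_ifs with hh
    · simp [ctr_zero]
    · rw [mul_sub, ← ctr_mul_left]
      congr 1
      refine ctr_congr _ fun C => ?_
      split_ifs <;> ring
  have e4 : ctr3 X.ε (fun C B E => if X.pos B ≠ X.pos C ∧ X.pos E = X.pos C then
        c B C E * X.fm c d B E * X.der C f else 0) = -ctr3 X.ε (fun A B C =>
        if X.pos C = X.pos B then X.fm c d A B * c A B C * X.der C f else 0) := by
    rw [ctr3_rot', ← ctr3_neg]
    refine ctr3_congr _ fun A B C => ?_
    rw [h.anti23 A C B]
    unfold fm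
    cases hA : X.pos A <;> cases hB : X.pos B <;> cases hC : X.pos C <;> simp <;> ring
  rw [e1, e2, e3, e4]
  ring

/-- The commutation of the divergence of the mixed Hessian. -/
theorem mdiv_hess (f : K) (B : ι) : 2 * X.mdiv c d (X.hess c f) B =
    -(X.sg B * X.der B (X.lapl d f)) + 2 * ctr X.ε fun A => X.fm c d A B * X.der A f := by
  -- The derivative along `e_B` is pulled out of the trace. This costs a derivative of `d` and a
  -- bracket term; the former will become part of the Ricci tensor in `e5`.
  have e1 : ctr X.ε (fun A => X.dv d A (X.hess c f A B)) =
      X.der B (ctr X.ε fun A => if X.pos A ≠ X.pos B then X.dv d A (X.der A f) else 0)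
      - ctr X.ε (fun A => if X.pos A ≠ X.pos B then X.der B (d A) * X.der A f else 0)
      + ctr2 X.ε (fun A C => if X.pos A ≠ X.pos B then c A B C * X.der C (X.der A f) else 0)
      - ctr2 X.ε (fun A C => if X.pos A ≠ X.pos B ∧ X.pos C = X.pos A then
        X.dv d A (c B A C) * X.der C f + c B A C * X.der A (X.der C f) else 0) := by
    unfold ctr2
    rw [der_ctr, ← ctr_sub, ← ctr_add, ← ctr_sub]
    refine ctr_congr _ fun A => ?_
    rw [h.hess_symm, hess]
    by_cases hh : X.pos A = X.pos B
    · simp [hh, dv_zero, der_zero, ctr_zero]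
    · have q := h.comm A B (X.der A f)
      simp only [hh, Ne.symm hh, if_false, if_true, ne_eq, not_false_eq_true, true_and]
      rw [dv_sub, dv_ctr]
      simp only [dv_ite, dv_mul]
      simp only [dv, der_add, der_mul] at q ⊢
      linear_combination q
  have e2 : ctr2 X.ε (fun A E => if X.pos A ≠ X.pos B ∧ X.pos E = X.pos B then
      c A B E * X.hess c f A E else 0) =
      ctr2 X.ε (fun A E => if X.pos A ≠ X.pos B ∧ X.pos E = X.pos B then
        c A B E * X.der E (X.der A f) else 0)
      - ctr3 X.ε (fun A E C => if X.pos A ≠ X.pos B ∧ X.pos E = X.pos B ∧ X.pos C = X.pos A then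
        c A B E * c E A C * X.der C f else 0) := by
    rw [ctr3_eq, ← ctr2_sub]
    unfold ctr2
    refine ctr_congr _ fun A => ctr_congr _ fun E => ?_
    beta_reduce
    rw [h.hess_symm, hess]
    by_cases hA : X.pos A = X.pos B
    · simp [hA, ctr_zero]
    · by_cases hE : X.pos E = X.pos B
      · simp only [hA, hE, Ne.symm hA, if_false, if_true, ne_eq, not_false_eq_true, true_and]
        rw [mul_sub, ← ctr_mul_left]
        congr 1
        refine ctr_congr _ fun C => ?_
        split_ifs <;> ring
      · simp [hE, ctr_zero]
  -- The second derivatives that remain after subtracting the correction in `mdiv` have both indices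
  -- in the eigenbundle opposite to `B`; `e4` cancels them against those coming from the Hessian.
  have e3 : ctr2 X.ε (fun A C => if X.pos A ≠ X.pos B then c A B C * X.der C (X.der A f) else 0)
      - ctr2 X.ε (fun A E => if X.pos A ≠ X.pos B ∧ X.pos E = X.pos B then
        c A B E * X.der E (X.der A f) else 0) =
      ctr2 X.ε (fun A C => if X.pos A ≠ X.pos B ∧ X.pos C = X.pos A then
        c A B C * X.der C (X.der A f) else 0) := by
    rw [← ctr2_sub]
    refine ctr2_congr _ fun A C => ?_
    cases hA : X.pos A <;> cases hB : X.pos B <;> cases hC : X.pos C <;> simp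
  have e4 : ctr2 X.ε (fun A C => if X.pos A ≠ X.pos B ∧ X.pos C = X.pos A then
        X.dv d A (c B A C) * X.der C f + c B A C * X.der A (X.der C f) else 0) =
      ctr2 X.ε (fun A C => if X.pos A ≠ X.pos B ∧ X.pos C = X.pos A then
        X.dv d A (c B A C) * X.der C f else 0)
      + ctr2 X.ε (fun A C => if X.pos A ≠ X.pos B ∧ X.pos C = X.pos A then
        c A B C * X.der C (X.der A f) else 0) := by
    rw [ctr2_swap X.ε (fun A C => if X.pos A ≠ X.pos B ∧ X.pos C = X.pos A then
        c A B C * X.der C (X.der A f) else 0), ← ctr2_add]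
    refine ctr2_congr _ fun A C => ?_
    rw [← h.rot C B A, ← h.rot A C B]
    cases hA : X.pos A <;> cases hB : X.pos B <;> cases hC : X.pos C <;>
      simp [h.rot A C B]
  have e5 : ctr X.ε (fun A => X.fm c d A B * X.der A f) =
      ctr2 X.ε (fun A C => if X.pos A ≠ X.pos B ∧ X.pos C = X.pos A then
        X.dv d C (c B A C) * X.der A f else 0)
      - ctr X.ε (fun A => if X.pos A ≠ X.pos B then X.der B (d A) * X.der A f else 0)
      - ctr3 X.ε (fun A C E => if X.pos A ≠ X.pos B ∧ X.pos C = X.pos A ∧ X.pos E = X.pos B then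
        c C B E * c E A C * X.der A f else 0) := by
    unfold ctr3
    rw [ctr2, ← ctr_sub, ← ctr_sub]
    refine ctr_congr _ fun A => ?_
    rw [h.fm_symm, fm]
    by_cases hA : X.pos A = X.pos B
    · simp [hA, ctr_zero, ctr2_zero]
    · simp only [hA, Ne.symm hA, if_false, if_true, ne_eq, not_false_eq_true, true_and, mric]
      rw [sub_mul, sub_mul, ← ctr_mul_right]
      unfold ctr2
      simp only [← ctr_mul_right, ite_mul, zero_mul]
  have e6 : ctr2 X.ε (fun A C => if X.pos A ≠ X.pos B ∧ X.pos C = X.pos A then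
        X.dv d C (c B A C) * X.der A f else 0) = -ctr2 X.ε (fun A C =>
        if X.pos A ≠ X.pos B ∧ X.pos C = X.pos A then X.dv d A (c B A C) * X.der C f else 0) := by
    rw [ctr2_swap, ← ctr2_neg]
    refine ctr2_congr _ fun A C => ?_
    rw [h.anti23 B C A, dv_neg]
    cases hA : X.pos A <;> cases hB : X.pos B <;> cases hC : X.pos C <;> simp
  have e7 : ctr3 X.ε (fun A E C => if X.pos A ≠ X.pos B ∧ X.pos E = X.pos B ∧
        X.pos C = X.pos A then c A B E * c E A C * X.der C f else 0) = -ctr3 X.ε (fun A C E =>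
        if X.pos A ≠ X.pos B ∧ X.pos C = X.pos A ∧ X.pos E = X.pos B then
        c C B E * c E A C * X.der A f else 0) := by
    rw [ctr3_swap23, ctr3_swap12, ← ctr3_neg]
    refine ctr3_congr _ fun A C E => ?_
    rw [h.anti23 E C A]
    cases hA : X.pos A <;> cases hB : X.pos B <;> cases hC : X.pos C <;> cases hE : X.pos E <;>
      simp
  -- `lap` replaces the trace over one eigenbundle by `-s_B / 2` times the full Laplacian.
  have e8 := congrArg (X.der B) (ctr_ite_ne (X := X) B fun A => X.dv d A (X.der A f))
  rw [h.lap f, show (2 : K) * ctr X.ε (fun A => if X.pos A ≠ X.pos B then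
    X.dv d A (X.der A f) else 0) = ctr X.ε (fun A => if X.pos A ≠ X.pos B then
    X.dv d A (X.der A f) else 0) + ctr X.ε (fun A => if X.pos A ≠ X.pos B then
    X.dv d A (X.der A f) else 0) by ring, der_add, der_sub, der_zero, der_sg_mul] at e8
  rw [mdiv, e1, e2, lapl]
  linear_combination e8 + 2 * e3 - 2 * e4 - 2 * e5 - 2 * e6 + 2 * e7

/-- The evolution of the scalar curvature. -/
theorem scalarVar_eq (hΓ : X.IsLC c d Γ) (f : K) :
    2 * X.scalarVar c d (fun A B => -4 * X.fm c d A B + 4 * X.hess c f A B)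
        (fun A => X.der A (X.lapl d f)) =
      -8 * ctr2 X.ε (fun A B => X.fm c d A B * X.fm c d A B)
      - X.lapl d (ctr X.ε fun u => X.sg u * X.ric2 d Γ u u)
      + ctr X.ε fun A => X.sg A * (X.der A f *
          X.der A (ctr X.ε fun u => X.sg u * X.ric2 d Γ u u)) := by
  set R := ctr X.ε fun u => X.sg u * X.ric2 d Γ u u with hR
  have c4 : ∀ A x, X.dv d A (4 * x) = 4 * X.dv d A x := fun A x => by
    rw [show 4 * x = x + x + x + x by ring]; simp only [dv_add]; ring
  have c4n : ∀ A x, X.dv d A (-4 * x) = -4 * X.dv d A x := fun A x => by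
    rw [show -4 * x = -(4 * x) by ring, dv_neg, c4]; ring
  have e1 : ∀ B, X.mdiv c d (fun A B => -4 * X.fm c d A B + 4 * X.hess c f A B) B =
      -4 * X.mdiv c d (X.fm c d) B + 4 * X.mdiv c d (X.hess c f) B := fun B => by
    have q1 : ctr X.ε (fun A => X.dv d A (-4 * X.fm c d A B + 4 * X.hess c f A B)) =
        -4 * ctr X.ε (fun A => X.dv d A (X.fm c d A B))
        + 4 * ctr X.ε (fun A => X.dv d A (X.hess c f A B)) := by
      rw [← ctr_mul_left, ← ctr_mul_left, ← ctr_add]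
      exact ctr_congr _ fun A => by rw [dv_add, c4, c4n]
    have q2 : ctr2 X.ε (fun A E => if X.pos A ≠ X.pos B ∧ X.pos E = X.pos B then
          c A B E * (-4 * X.fm c d A E + 4 * X.hess c f A E) else 0) =
        -4 * ctr2 X.ε (fun A E => if X.pos A ≠ X.pos B ∧ X.pos E = X.pos B then
          c A B E * X.fm c d A E else 0)
        + 4 * ctr2 X.ε (fun A E => if X.pos A ≠ X.pos B ∧ X.pos E = X.pos B then
          c A B E * X.hess c f A E else 0) := by
      rw [← ctr2_mul_left, ← ctr2_mul_left, ← ctr2_add]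
      exact ctr2_congr _ fun A E => by split_ifs <;> ring
    simp only [mdiv]
    rw [q1, q2]
    ring
  -- The Bianchi identity evaluates the divergence of `fm` and `mdiv_hess` that of the Hessian.
  have e2 : ∀ B, 2 * X.mdiv c d (fun A B => -4 * X.fm c d A B + 4 * X.hess c f A B) B =
      X.sg B * X.der B R - 4 * (X.sg B * X.der B (X.lapl d f))
      + 8 * ctr X.ε (fun A => X.fm c d A B * X.der A f) := fun B => by
    have b1 := h.bianchi hΓ B
    have b2 := h.mdiv_hess f B
    rw [e1]
    linear_combination 4 * b2 - b1
  have e3 : 2 * ctr X.ε (fun B => X.dv d B (X.mdiv c d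
      (fun A B => -4 * X.fm c d A B + 4 * X.hess c f A B) B)) =
      X.lapl d R - 4 * X.lapl d (X.lapl d f)
      + 8 * ctr X.ε (fun B => X.dv d B (ctr X.ε fun A => X.fm c d A B * X.der A f)) := by
    simp only [lapl]
    rw [← ctr_mul_left, ← ctr_mul_left, ← ctr_mul_left, ← ctr_sub, ← ctr_add]
    refine ctr_congr _ fun B => ?_
    have := congrArg (X.dv d B) (e2 B)
    rw [show ∀ x : K, 2 * x = x + x from fun x => by ring, dv_add, dv_add, dv_sub, c4,
      show ∀ x : K, 8 * x = 4 * x + 4 * x from fun x => by ring, dv_add, c4, dv_sg_mul,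
      dv_sg_mul] at this
    simp only [lapl] at this
    linear_combination this
  have e4 : ctr2 X.ε (fun u v => (-4 * X.fm c d u v + 4 * X.hess c f u v) * X.mric c d u v) =
      -4 * ctr2 X.ε (fun A B => X.fm c d A B * X.fm c d A B)
      + 4 * ctr2 X.ε (fun A B => X.fm c d A B * X.hess c f A B) := by
    rw [← ctr2_mul_left, ← ctr2_mul_left, ← ctr2_add]
    refine ctr2_congr _ fun A B => ?_
    unfold fm hess
    split_ifs <;> ring
  have e5 := h.dv_fm_der f
  have e6 : 8 * ctr X.ε (fun A => X.mdiv c d (X.fm c d) A * X.der A f) =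
      -ctr X.ε fun A => X.sg A * (X.der A f * X.der A R) := by
    rw [← ctr_mul_left, ← ctr_neg]
    refine ctr_congr _ fun A => ?_
    have := h.bianchi hΓ A
    rw [← mul_assoc, this]
    ring
  have e7 : ctr X.ε (fun A => X.sg A * X.dv d A (X.der A (X.lapl d f))) =
    X.lapl d (X.lapl d f) := rfl
  -- The double divergence of the Hessian yields `Δ²f`, which the density term removes; the products
  -- of `fm` with the Hessian from `e4` and `e5` cancel as well. The gradient term is what the
  -- Bianchi identity leaves over in `e6`.
  rw [scalarVar, e4, e7]
  linear_combination -e3 - 8 * e5 - e6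

end IsCourant
end FrameCalculus
end GenGeom

/-! ### Comparison of the scalar curvature for two torsion-free connections -/

namespace GenGeom

section Slots

variable {K ι : Type*} [CommRing K] [Algebra ℝ K] [Fintype ι] (ε : ι → K) (H : ι → ι → K)

/-- Apply `H` to the first index. -/
def slot1 (a : ι → ι → ι → K) (A B C : ι) : K := ctr ε fun E => H A E * a E B C

/-- Apply `H` to the second index. -/
def slot2 (a : ι → ι → ι → K) (A B C : ι) : K := ctr ε fun E => H B E * a A E C

/-- Apply `H` to the third index. -/
def slot3 (a : ι → ι → ι → K) (A B C : ι) : K := ctr ε fun E => H C E * a A B E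

/-- The contraction of two tensors with three indices. -/
def ip3 (a b : ι → ι → ι → K) : K := ctr3 ε fun A B C => a A B C * b A B C

variable {H}

theorem ip3_slot1 (hs : ∀ A B, H A B = H B A) (a b : ι → ι → ι → K) :
    ip3 ε (slot1 ε H a) b = ip3 ε a (slot1 ε H b) := by
  have e : ∀ a b : ι → ι → ι → K, ip3 ε (slot1 ε H a) b =
      ctr4 ε fun A B C E => H A E * a E B C * b A B C := fun a b => by
    simp only [ip3, slot1, ← ctr_mul_right]; rfl
  have e' : ip3 ε a (slot1 ε H b) = ctr4 ε fun A B C E => a A B C * (H A E * b E B C) := by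
    simp only [ip3, slot1, ← ctr_mul_left]; rfl
  rw [e, e', ctr4_swap14]
  exact ctr4_congr _ fun A B C E => by rw [hs E A]; ring

theorem slot1_sub (a b : ι → ι → ι → K) :
    slot1 ε H (fun A B C => a A B C - b A B C) =
      fun A B C => slot1 ε H a A B C - slot1 ε H b A B C := by
  funext A B C; simp only [slot1, mul_sub, ctr_sub]

theorem slot2_sub (a b : ι → ι → ι → K) :
    slot2 ε H (fun A B C => a A B C - b A B C) =
      fun A B C => slot2 ε H a A B C - slot2 ε H b A B C := by
  funext A B C; simp only [slot2, mul_sub, ctr_sub]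

theorem ip3_sub_left (a a' b : ι → ι → ι → K) :
    ip3 ε (fun A B C => a A B C - a' A B C) b = ip3 ε a b - ip3 ε a' b := by
  simp only [ip3, sub_mul, ctr3_sub]

theorem ip3_sub_right (a b b' : ι → ι → ι → K) :
    ip3 ε a (fun A B C => b A B C - b' A B C) = ip3 ε a b - ip3 ε a b' := by
  simp only [ip3, mul_sub, ctr3_sub]

theorem ip3_neg_right (a b : ι → ι → ι → K) :
    ip3 ε a (fun A B C => -b A B C) = -ip3 ε a b := by
  simp only [ip3, mul_neg, ctr3_neg]

theorem ip3_neg_left (a b : ι → ι → ι → K) :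
    ip3 ε (fun A B C => -a A B C) b = -ip3 ε a b := by
  simp only [ip3, neg_mul, ctr3_neg]

theorem ip3_swap12 (a b : ι → ι → ι → K) :
    ip3 ε a b = ip3 ε (fun A B C => a B A C) fun A B C => b B A C := ctr3_swap12 ε _

theorem ip3_swap23 (a b : ι → ι → ι → K) :
    ip3 ε a b = ip3 ε (fun A B C => a A C B) fun A B C => b A C B := ctr3_swap23 ε _

theorem ip3_swap13 (a b : ι → ι → ι → K) :
    ip3 ε a b = ip3 ε (fun A B C => a C B A) fun A B C => b C B A := ctr3_swap13 ε _

theorem ip3_rot' (a b : ι → ι → ι → K) :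
    ip3 ε a b = ip3 ε (fun A B C => a C A B) fun A B C => b C A B := ctr3_rot' ε _

theorem ip3_slot2 (hs : ∀ A B, H A B = H B A) (a b : ι → ι → ι → K) :
    ip3 ε (slot2 ε H a) b = ip3 ε a (slot2 ε H b) := by
  rw [ip3_swap12, ip3_swap12 ε a]
  exact ip3_slot1 ε hs _ _

theorem ip3_slot3 (hs : ∀ A B, H A B = H B A) (a b : ι → ι → ι → K) :
    ip3 ε (slot3 ε H a) b = ip3 ε a (slot3 ε H b) := by
  rw [ip3_swap13, ip3_swap13 ε a]
  exact ip3_slot1 ε hs _ _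

theorem slot2_slot2 (hH : ∀ (x : ι → K) A, ctr ε (fun B => H A B * ctr ε fun C => H B C * x C) = x A)
    (a : ι → ι → ι → K) : slot2 ε H (slot2 ε H a) = a := by
  funext A B C; exact hH (fun E => a A E C) B

theorem slot3_slot3 (hH : ∀ (x : ι → K) A, ctr ε (fun B => H A B * ctr ε fun C => H B C * x C) = x A)
    (a : ι → ι → ι → K) : slot3 ε H (slot3 ε H a) = a := by
  funext A B C; exact hH (fun E => a A B E) C

theorem slot1_slot2 (a : ι → ι → ι → K) :
    slot1 ε H (slot2 ε H a) = slot2 ε H (slot1 ε H a) := by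
  funext A B C
  simp only [slot1, slot2, ← ctr_mul_left]
  rw [ctr_comm]
  exact ctr2_congr ε fun E E' => by ring

theorem slot1_slot3 (a : ι → ι → ι → K) :
    slot1 ε H (slot3 ε H a) = slot3 ε H (slot1 ε H a) := by
  funext A B C
  simp only [slot1, slot3, ← ctr_mul_left]
  rw [ctr_comm]
  exact ctr2_congr ε fun E E' => by ring

theorem slot2_slot3 (a : ι → ι → ι → K) :
    slot2 ε H (slot3 ε H a) = slot3 ε H (slot2 ε H a) := by
  funext A B C
  simp only [slot2, slot3, ← ctr_mul_left]
  rw [ctr_comm]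
  exact ctr2_congr ε fun E E' => by ring

/-- The commutator of `χ` and `H`. -/
def commH (ε : ι → K) (H : ι → ι → K) (χ : ι → ι → ι → K) (A C D : ι) : K :=
  slot3 ε H χ A C D - slot2 ε H χ A C D

/-- A quadratic expression in a tensor `χ` with vanishing cyclic sums depends only on the commutator
of `χ` with the involution `H`. -/
theorem quad_eq (hs : ∀ A B, H A B = H B A)
    (hH : ∀ (x : ι → K) A, ctr ε (fun B => H A B * ctr ε fun C => H B C * x C) = x A)
    {χ : ι → ι → ι → K} (χa : ∀ A B C, χ A B C = -χ A C B)
    (χc : ∀ A B C, χ A B C + χ B C A + χ C A B = 0) :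
    8 * ip3 ε χ (fun A u B => slot2 ε H χ B u A) - 4 * ip3 ε χ (slot2 ε H χ) =
      ip3 ε (commH ε H χ) (slot1 ε H (commH ε H χ))
        - 4 * ip3 ε (commH ε H χ) fun B C D => slot2 ε H (commH ε H χ) D B C := by
  -- `χ'` and `χ''` are the cyclic rotations of `χ`, and `χ + χ' + χ'' = 0`. Both sides of the claim
  -- expand into products of `χ` with words in the three commuting self-adjoint operators `slot1`,
  -- `slot2`, `slot3` applied to a rotation of `χ`; few of these are independent.
  set χ' : ι → ι → ι → K := fun B C D => χ D B C with hχ'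
  set χ'' : ι → ι → ι → K := fun B C D => χ C D B with hχ''
  have s23 : (fun A B C => χ A C B) = fun A B C => -χ A B C := by
    funext A B C; exact χa A C B
  have s23' : (fun A B C => χ' A C B) = fun A B C => -χ'' A B C := by
    funext A B C; exact χa B A C
  have cyc : χ = fun A B C => -χ' A B C - χ'' A B C := by
    funext A B C; simp only [hχ', hχ'']; linear_combination χc A B C
  have n1 : ∀ a : ι → ι → ι → K, slot1 ε H (fun A B C => -a A B C) = fun A B C => -slot1 ε H a A B C :=
    fun a => by funext A B C; simp only [slot1, mul_neg, ctr_neg]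
  have n2 : ∀ a : ι → ι → ι → K, slot2 ε H (fun A B C => -a A B C) = fun A B C => -slot2 ε H a A B C :=
    fun a => by funext A B C; simp only [slot2, mul_neg, ctr_neg]
  have n3 : ∀ a : ι → ι → ι → K, slot3 ε H (fun A B C => -a A B C) = fun A B C => -slot3 ε H a A B C :=
    fun a => by funext A B C; simp only [slot3, mul_neg, ctr_neg]
  have a3 : ∀ a b : ι → ι → ι → K, slot3 ε H (fun A B C => a A B C - b A B C) =
      fun A B C => slot3 ε H a A B C - slot3 ε H b A B C :=
    fun a b => by funext A B C; simp only [slot3, mul_sub, ctr_sub]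
  -- `(χ, Hᵢ χ')` in terms of `(χ, Hᵢ χ)`
  have sum1 : ip3 ε χ (slot1 ε H χ) = -ip3 ε χ (slot1 ε H χ') - ip3 ε χ (slot1 ε H χ'') := by
    conv_lhs => rw [show slot1 ε H χ = slot1 ε H (fun A B C => -χ' A B C - χ'' A B C) by rw [← cyc]]
    rw [slot1_sub, n1, ip3_sub_right, ip3_neg_right]
  have sum2 : ip3 ε χ (slot2 ε H χ) = -ip3 ε χ (slot2 ε H χ') - ip3 ε χ (slot2 ε H χ'') := by
    conv_lhs => rw [show slot2 ε H χ = slot2 ε H (fun A B C => -χ' A B C - χ'' A B C) by rw [← cyc]]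
    rw [slot2_sub, n2, ip3_sub_right, ip3_neg_right]
  -- Exchanging the last two indices reverses the sign of `χ` and takes `χ'` to `-χ''`.
  have w1 : ip3 ε χ (slot1 ε H χ') = ip3 ε χ (slot1 ε H χ'') := by
    rw [ip3_swap23, s23]
    change ip3 ε _ (slot1 ε H fun A B C => χ' A C B) = _
    rw [s23', n1, ip3_neg_left, ip3_neg_right, neg_neg]
  have w2 : ip3 ε χ (slot3 ε H χ') = ip3 ε χ (slot2 ε H χ'') := by
    rw [ip3_swap23, s23]
    change ip3 ε _ (slot2 ε H fun A B C => χ' A C B) = _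
    rw [s23', n2, ip3_neg_left, ip3_neg_right, neg_neg]
  -- The product of the three operators treats all slots alike and hence commutes with rotations of
  -- the indices, which gives `wk`.
  set k : (ι → ι → ι → K) → ι → ι → ι → K := fun a => slot1 ε H (slot2 ε H (slot3 ε H a)) with hk
  have sumk : ip3 ε χ (k χ) = -ip3 ε χ (k χ') - ip3 ε χ (k χ'') := by
    conv_lhs => rw [show k χ = k (fun A B C => -χ' A B C - χ'' A B C) by rw [← cyc]]
    simp only [hk]
    rw [a3, n3, slot2_sub, n2, slot1_sub, n1, ip3_sub_right, ip3_neg_right]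
  have wk : ip3 ε χ (k χ'') = ip3 ε χ (k χ') := by
    rw [ip3_rot']
    change ip3 ε χ' (slot3 ε H (slot1 ε H (slot2 ε H χ))) = _
    simp only [hk]
    rw [← ip3_slot3 ε hs, ← ip3_slot1 ε hs, ← ip3_slot2 ε hs, ← slot1_slot2]
    exact ctr3_congr _ fun _ _ _ => mul_comm _ _
  -- the left hand side
  have l1 : ip3 ε χ (fun A u B => slot2 ε H χ B u A) = -ip3 ε χ (slot2 ε H χ') := by
    change ip3 ε χ (slot2 ε H fun A u B => χ B u A) = _
    rw [show (fun A u B => χ B u A) = fun A u B => -χ' A u B by funext A u B; exact χa B u A,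
      n2, ip3_neg_right]
  -- the right hand side
  have r1 : ip3 ε (commH ε H χ) (slot1 ε H (commH ε H χ)) =
      2 * ip3 ε χ (slot1 ε H χ) - 2 * ip3 ε χ (k χ) := by
    change ip3 ε (fun A B C => slot3 ε H χ A B C - slot2 ε H χ A B C)
      (slot1 ε H fun A B C => slot3 ε H χ A B C - slot2 ε H χ A B C) = _
    rw [slot1_sub, ip3_sub_left, ip3_sub_right, ip3_sub_right, ip3_slot3 ε hs, ip3_slot3 ε hs,
      ip3_slot2 ε hs, ip3_slot2 ε hs, ← slot1_slot3, slot3_slot3 ε hH, ← slot1_slot3, ← slot1_slot2,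
      ← slot1_slot2, slot2_slot2 ε hH, ← slot2_slot3]
    simp only [hk]
    ring
  have r2 : ip3 ε (commH ε H χ) (fun B C D => slot2 ε H (commH ε H χ) D B C) =
      ip3 ε χ (k χ') - ip3 ε χ (slot3 ε H χ') - ip3 ε χ (slot1 ε H χ') + ip3 ε χ (slot2 ε H χ') := by
    have q : slot2 ε H (commH ε H χ) = fun A B C => slot2 ε H (slot3 ε H χ) A B C - χ A B C := by
      change slot2 ε H (fun A B C => slot3 ε H χ A B C - slot2 ε H χ A B C) = _
      rw [slot2_sub, slot2_slot2 ε hH]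
    rw [q]
    change ip3 ε (fun A B C => slot3 ε H χ A B C - slot2 ε H χ A B C)
      (fun B C D => slot1 ε H (slot2 ε H χ') B C D - χ' B C D) = _
    rw [ip3_sub_left, ip3_sub_right, ip3_sub_right, ip3_slot3 ε hs, ip3_slot3 ε hs,
      ip3_slot2 ε hs, ip3_slot2 ε hs, ← slot1_slot3, ← slot2_slot3, ← slot1_slot2,
      slot2_slot2 ε hH]
    simp only [hk]
    ring
  rw [l1, r1, r2]
  linear_combination -4 * sum2 - 2 * sum1 + 2 * sumk - 2 * wk - 2 * w1 - 4 * w2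

end Slots

namespace FrameCalculus

variable {K ι : Type*} [CommRing K] [Algebra ℝ K] [Fintype ι] {X : FrameCalculus K ι}

/-- The left side arises from `∂H`, expressed by a connection preserving `H` and contracted with
`χ`. The right side has the shape of the polarized quadratic part of the Ricci tensor, which is why
the two cancel in `ctr2_ric2_eq`. -/
theorem ctr4_conn {Γ χ : ι → ι → ι → K} {H : ι → ι → K} (hs : ∀ A B, H A B = H B A)
    (Γa : ∀ A B C, Γ A B C = -Γ A C B) (χc : ∀ A B C, χ A B C + χ B C A + χ C A B = 0)
    (χa : ∀ A B C, χ A B C = -χ A C B) :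
    ctr4 X.ε (fun u v A B => (Γ A u B * H B v + Γ A v B * H u B) * χ u v A) =
      ctr4 X.ε (fun u v A B => H u v * (Γ A u B * χ A v B))
      - 2 * ctr4 X.ε (fun u v A B => H u v * (Γ A u B * χ B v A)) := by
  have e1 : ctr4 X.ε (fun u v A B => Γ A u B * H B v * χ u v A) =
      ctr4 X.ε (fun u v A B => -1 * (H u v * (Γ A u B * χ B v A))) := by
    rw [ctr4_swap14]
    refine ctr4_congr _ fun u v A B => ?_
    rw [Γa A B u]; ring
  have e2 : ctr4 X.ε (fun u v A B => Γ A v B * H u B * χ u v A) =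
      ctr4 X.ε (fun u v A B => H u v * (Γ A u B * χ A v B))
      - ctr4 X.ε (fun u v A B => H u v * (Γ A u B * χ B v A)) := by
    rw [ctr4_swap12, ctr4_swap14, ← ctr4_sub]
    refine ctr4_congr _ fun u v A B => ?_
    rw [Γa A B u, hs v u]
    linear_combination (-H u v * Γ A u B) * (χc v B A - χa B A v)
  simp only [add_mul]
  rw [ctr4_add, e1, e2, ctr4_mul_left]
  ring

theorem ctr2_ric2 {d : ι → K} {Γ : ι → ι → ι → K} {H : ι → ι → K} (hs : ∀ A B, H A B = H B A) :
    ctr2 X.ε (fun u v => H u v * X.ric2 d Γ u v) =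
      2 * ctr3 X.ε (fun u v A => H u v * X.dv d A (Γ u v A))
      - 2 * ctr2 X.ε (fun u v => H u v * X.der u (d v))
      + ctr4 X.ε (fun u v A B => H u v * (Γ A u B * Γ A v B))
      - 2 * ctr4 X.ε (fun u v A B => H u v * (Γ A u B * Γ B v A)) := by
  have t4 : ∀ f : ι → ι → ι → ι → K, ctr4 X.ε f = ctr2 X.ε fun u v => ctr2 X.ε (f u v) :=
    fun _ => rfl
  have e1 : ctr2 X.ε (fun u v => H u v * X.ric2 d Γ u v) =
      ctr3 X.ε (fun u v A => H u v * X.dv d A (Γ u v A))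
      + ctr3 X.ε (fun u v A => H u v * X.dv d A (Γ v u A))
      - ctr2 X.ε (fun u v => H u v * X.der u (d v))
      - ctr2 X.ε (fun u v => H u v * X.der v (d u))
      + ctr4 X.ε (fun u v A B => H u v * (Γ A u B * Γ A v B))
      - 2 * ctr4 X.ε (fun u v A B => H u v * (Γ A u B * Γ B v A)) := by
    rw [t4, t4, ctr3_eq, ctr3_eq, ← ctr2_add, ← ctr2_sub, ← ctr2_sub, ← ctr2_add, ← ctr2_mul_left,
      ← ctr2_sub]
    refine ctr2_congr _ fun u v => ?_
    simp only [ric2, ctr2_mul_left, ctr_mul_left, dv_add, ctr_add]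
    ring
  have e2 : ctr3 X.ε (fun u v A => H u v * X.dv d A (Γ v u A)) =
      ctr3 X.ε (fun u v A => H u v * X.dv d A (Γ u v A)) := by
    rw [ctr3_swap12]
    exact ctr3_congr _ fun u v A => by rw [hs]
  have e3 : ctr2 X.ε (fun u v => H u v * X.der v (d u)) =
      ctr2 X.ε (fun u v => H u v * X.der u (d v)) := by
    rw [ctr2_swap]
    exact ctr2_congr _ fun u v => by rw [hs]
  rw [e1, e2, e3]
  ring

variable (X) in
/-- The divergence of a symmetric tensor with respect to a connection. -/
def cdiv (d : ι → K) (Γ : ι → ι → ι → K) (H : ι → ι → K) (B : ι) : K :=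
  ctr X.ε (fun A => X.dv d A (H A B)) - ctr2 X.ε fun A E => Γ A B E * H A E

/-- The scalar curvature of `H` computed from a compatible connection `Γ'`, in terms of another
torsion-free connection `Γ`. -/
theorem ctr2_ric2_eq {c Γ Γ' : ι → ι → ι → K} {d d' : ι → K} {H : ι → ι → K}
    (hs : ∀ A B, H A B = H B A)
    (Γa : ∀ A B C, Γ A B C = -Γ A C B) (Γc : ∀ A B C, Γ A B C + Γ B C A + Γ C A B = c A B C)
    (Γa' : ∀ A B C, Γ' A B C = -Γ' A C B)
    (Γc' : ∀ A B C, Γ' A B C + Γ' B C A + Γ' C A B = c A B C)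
    (Γd' : ∀ B, ctr X.ε (fun A => Γ' A B A) = d' B)
    (hH : ∀ A u v, X.der A (H u v) = ctr X.ε fun B => Γ' A u B * H B v + Γ' A v B * H u B) :
    ctr2 X.ε (fun u v => H u v * X.ric2 d' Γ' u v) =
      ctr2 X.ε (fun u v => H u v * X.ric2 d Γ u v)
      - 2 * ctr X.ε (fun B => X.dv d B (X.cdiv d Γ H B))
      - 4 * ctr X.ε (fun B => (d' B - d B) * X.cdiv d Γ H B)
      - 4 * ctr2 X.ε (fun A B => H A B * (X.der A (d' B - d B)
          - ctr X.ε fun C => Γ A B C * (d' C - d C)))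
      - 2 * ctr2 X.ε (fun A B => H A B * ((d' A - d A) * (d' B - d B)))
      + 2 * ctr4 X.ε (fun u v A B => H u v *
          ((Γ' A u B - Γ A u B) * (Γ' B v A - Γ B v A)))
      - ctr4 X.ε (fun u v A B => H u v * ((Γ' A u B - Γ A u B) * (Γ' A v B - Γ A v B))) := by
  have t4 : ∀ f : ι → ι → ι → ι → K, ctr4 X.ε f = ctr2 X.ε fun u v => ctr2 X.ε (f u v) :=
    fun _ => rfl
  set χ : ι → ι → ι → K := fun A B C => Γ' A B C - Γ A B C with hχ
  set ξ : ι → K := fun A => d' A - d A with hξ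
  have χa : ∀ A B C, χ A B C = -χ A C B := fun A B C => by
    simp only [hχ]; rw [Γa, Γa']; ring
  have χc : ∀ A B C, χ A B C + χ B C A + χ C A B = 0 := fun A B C => by
    simp only [hχ]; linear_combination Γc' A B C - Γc A B C
  -- the trace of the derivative of `H`
  have trH : ∀ A, ctr2 X.ε (fun u v => H u v * χ u v A) =
      -X.cdiv d Γ H A - ctr X.ε fun B => H A B * ξ B := fun A => by
    -- The compatibility `hH`, contracted with the index of differentiation: the trace of `Γ'`
    -- appears and is `d'`.
    have q1 : ctr X.ε (fun B => X.der B (H B A)) =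
        -ctr X.ε (fun B => H B A * d' B) + ctr2 X.ε fun B E => Γ' B A E * H B E := by
      have : ctr X.ε (fun B => H B A * d' B) = -ctr2 X.ε fun B E => Γ' B B E * H E A := by
        rw [ctr2_swap, ← ctr2_neg]
        refine ctr_congr _ fun E => ?_
        rw [← Γd', ← ctr_mul_left]
        exact ctr_congr _ fun B => by rw [Γa' B E B]; ring
      rw [this, neg_neg, ← ctr2_add]
      refine ctr_congr _ fun B => ?_
      rw [hH]
    have q2 : ctr2 X.ε (fun u v => H u v * χ u v A) =
        ctr2 X.ε (fun B E => Γ B A E * H B E) - ctr2 X.ε fun B E => Γ' B A E * H B E := by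
      rw [← ctr2_sub]
      refine ctr2_congr _ fun u v => ?_
      simp only [hχ]
      rw [Γa u v, Γa' u v]
      ring
    have q3 : ctr X.ε (fun B => X.dv d B (H B A)) =
        ctr X.ε (fun B => X.der B (H B A)) + ctr X.ε fun B => d B * H B A := by
      rw [← ctr_add]; rfl
    have q4 : ctr X.ε (fun B => H A B * ξ B) =
        ctr X.ε (fun B => H B A * d' B) - ctr X.ε fun B => d B * H B A := by
      rw [← ctr_sub]
      exact ctr_congr _ fun B => by rw [hs A B]; simp only [hξ]; ring
    rw [cdiv, q2, q3, q1, q4]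
    ring
  -- the terms with a derivative of `χ`
  have e1 : ctr3 X.ε (fun u v A => H u v * X.dv d A (χ u v A)) =
      ctr X.ε (fun A => X.dv d A (ctr2 X.ε fun u v => H u v * χ u v A))
      - (ctr4 X.ε (fun u v A B => H u v * (Γ' A u B * χ A v B))
      - 2 * ctr4 X.ε (fun u v A B => H u v * (Γ' A u B * χ B v A))) := by
    rw [← ctr4_conn hs Γa' χc χa]
    have q1 : ctr X.ε (fun A => X.dv d A (ctr2 X.ε fun u v => H u v * χ u v A)) =
        ctr3 X.ε fun u v A => X.dv d A (H u v * χ u v A) := by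
      rw [ctr3_rot X.ε]
      unfold ctr3
      refine ctr_congr _ fun A => ?_
      rw [dv_ctr2, ctr2_swap]
    have q2 : ctr4 X.ε (fun u v A B => (Γ' A u B * H B v + Γ' A v B * H u B) * χ u v A) =
        ctr3 X.ε fun u v A => X.der A (H u v) * χ u v A := by
      simp only [hH, ← ctr_mul_right]; rfl
    rw [q1, q2, ← ctr3_sub]
    exact ctr3_congr _ fun u v A => by rw [mul_comm (H u v) (χ u v A), dv_mul]; ring
  have e2 : ctr X.ε (fun A => X.dv d A (ctr2 X.ε fun u v => H u v * χ u v A)) =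
      -ctr X.ε (fun B => X.dv d B (X.cdiv d Γ H B))
      - ctr2 X.ε (fun A B => H A B * X.der A (ξ B))
      - ctr2 X.ε (fun A B => X.dv d A (H A B) * ξ B) := by
    rw [← ctr_neg, ctr2, ctr2, ← ctr_sub, ← ctr_sub]
    refine ctr_congr _ fun A => ?_
    rw [trH, dv_sub, dv_neg, dv_ctr, sub_sub, ← ctr_add]
    congr 1
    exact ctr_congr _ fun B => by rw [dv_mul]; ring
  have e3 : ctr2 X.ε (fun A B => X.dv d A (H A B) * ξ B) =
      ctr X.ε (fun B => ξ B * X.cdiv d Γ H B)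
      - ctr2 X.ε (fun A B => H A B * ctr X.ε fun C => Γ A B C * ξ C) := by
    have q : ctr2 X.ε (fun A B => H A B * ctr X.ε fun C => Γ A B C * ξ C) =
        -ctr X.ε (fun B => ξ B * ctr2 X.ε fun A E => Γ A B E * H A E) := by
      simp only [← ctr_mul_left, ← ctr2_mul_left]
      change ctr3 X.ε _ = -ctr3 X.ε _
      rw [ctr3_rot' X.ε (fun A B C => ξ A * (Γ B A C * H B C)), ← ctr3_neg]
      refine ctr3_congr _ fun A B C => ?_
      rw [Γa A C B]
      ring
    rw [q, ctr2_swap, ctr2, sub_neg_eq_add, ← ctr_add]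
    refine ctr_congr _ fun B => ?_
    rw [ctr_mul_right, cdiv]
    ring
  -- `d'` against `d`
  have e4 : ctr3 X.ε (fun u v A => H u v * X.dv d' A (Γ' u v A)) =
      ctr3 X.ε (fun u v A => H u v * X.dv d A (Γ u v A))
      + ctr3 X.ε (fun u v A => H u v * X.dv d A (χ u v A))
      + ctr2 X.ε (fun u v => H u v * ctr X.ε fun C => Γ u v C * ξ C)
      + ctr X.ε (fun A => ξ A * ctr2 X.ε fun u v => H u v * χ u v A) := by
    have q : ctr X.ε (fun A => ξ A * ctr2 X.ε fun u v => H u v * χ u v A) =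
        ctr3 X.ε fun u v A => ξ A * (H u v * χ u v A) := by
      rw [ctr3_rot X.ε]
      exact ctr_congr _ fun A => (ctr2_mul_left _ _ _).symm
    have q' : ctr2 X.ε (fun u v => H u v * ctr X.ε fun C => Γ u v C * ξ C) =
        ctr3 X.ε fun u v A => H u v * (Γ u v A * ξ A) := by
      simp only [← ctr_mul_left]; rfl
    rw [q, q', ← ctr3_add, ← ctr3_add, ← ctr3_add]
    refine ctr3_congr _ fun u v A => ?_
    have : Γ' u v A = Γ u v A + χ u v A := by simp only [hχ]; ring
    rw [this, dv, der_add, dv, dv]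
    simp only [hξ]
    ring
  have e5 : ctr X.ε (fun A => ξ A * ctr2 X.ε fun u v => H u v * χ u v A) =
      -ctr X.ε (fun B => ξ B * X.cdiv d Γ H B) - ctr2 X.ε (fun A B => H A B * (ξ A * ξ B)) := by
    rw [← ctr_neg, ctr2, ← ctr_sub]
    refine ctr_congr _ fun A => ?_
    rw [trH, mul_sub, ← ctr_mul_left]
    congr 1
    · ring
    · exact ctr_congr _ fun B => by ring
  have e6 : ctr2 X.ε (fun u v => H u v * X.der u (d' v)) =
      ctr2 X.ε (fun u v => H u v * X.der u (d v)) + ctr2 X.ε (fun A B => H A B * X.der A (ξ B)) := by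
    rw [← ctr2_add]
    refine ctr2_congr _ fun u v => ?_
    have : d' v = d v + ξ v := by simp only [hξ]; ring
    rw [this, der_add]
    ring
  -- quadratic terms
  have p1 : ctr4 X.ε (fun u v A B => H u v * (Γ' A u B * Γ' A v B)) =
      ctr4 X.ε (fun u v A B => H u v * (Γ A u B * Γ A v B))
      + 2 * ctr4 X.ε (fun u v A B => H u v * (Γ' A u B * χ A v B))
      - ctr4 X.ε (fun u v A B => H u v * (χ A u B * χ A v B)) := by
    have q : ctr4 X.ε (fun u v A B => H u v * (Γ' A u B * χ A v B)) =
        ctr4 X.ε (fun u v A B => H u v * (Γ' A v B * χ A u B)) := by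
      rw [ctr4_swap12]
      exact ctr4_congr _ fun u v A B => by rw [hs]
    rw [two_mul]
    nth_rewrite 2 [q]
    rw [← ctr4_add, ← ctr4_add, ← ctr4_sub]
    exact ctr4_congr _ fun u v A B => by simp only [hχ]; ring
  have p2 : ctr4 X.ε (fun u v A B => H u v * (Γ' A u B * Γ' B v A)) =
      ctr4 X.ε (fun u v A B => H u v * (Γ A u B * Γ B v A))
      + 2 * ctr4 X.ε (fun u v A B => H u v * (Γ' A u B * χ B v A))
      - ctr4 X.ε (fun u v A B => H u v * (χ A u B * χ B v A)) := by
    have q : ctr4 X.ε (fun u v A B => H u v * (Γ' A u B * χ B v A)) =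
        ctr4 X.ε (fun u v A B => H u v * (Γ' B v A * χ A u B)) := by
      rw [ctr4_swap12, ctr4_swap34]
      exact ctr4_congr _ fun u v A B => by rw [hs]
    rw [two_mul]
    nth_rewrite 2 [q]
    rw [← ctr4_add, ← ctr4_add, ← ctr4_sub]
    exact ctr4_congr _ fun u v A B => by simp only [hχ]; ring
  have e7 : ctr2 X.ε (fun A B => H A B * (X.der A (ξ B) - ctr X.ε fun C => Γ A B C * ξ C)) =
      ctr2 X.ε (fun A B => H A B * X.der A (ξ B))
      - ctr2 X.ε (fun A B => H A B * ctr X.ε fun C => Γ A B C * ξ C) := by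
    rw [← ctr2_sub]
    exact ctr2_congr _ fun A B => by ring
  -- The products of `Γ'` with `χ` from `e1` cancel those from `p1` and `p2`. Apart from terms in
  -- `Γ` and `ξ`, only quadratic expressions in `χ` are left.
  rw [ctr2_ric2 hs, ctr2_ric2 hs, e4, e1, e2, e3, e5, e6, p1, p2, e7]
  ring

end FrameCalculus
end GenGeom

/-! ### The first variation of the scalar curvature -/

namespace GenGeom

namespace FrameCalculus

section Weight

variable {K ι : Type*} [CommRing K] [Algebra ℝ K] [Fintype ι] {X : FrameCalculus K ι}

/-- Change of the full Ricci tensor under a change of the half-density. -/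
theorem fm_sub_der (X : FrameCalculus K ι) (c : ι → ι → ι → K) (d : ι → K) (f : K) (A B : ι) :
    X.fm c (fun A => d A - X.der A f) A B = X.fm c d A B + X.hess c f A B := by
  unfold fm hess
  split_ifs
  · rw [add_zero]
  · unfold mric
    have h1 : ctr X.ε (fun E => if X.pos E = X.pos B then X.dv (fun A => d A - X.der A f) E (c A B E) else 0) =
        ctr X.ε (fun E => if X.pos E = X.pos B then X.dv d E (c A B E) else 0) -
        ctr X.ε fun E => if X.pos E = X.pos B then c A B E * X.der E f else 0 := by
      rw [← ctr_sub]
      refine ctr_congr _ fun E => ?_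
      split_ifs
      · unfold dv; ring
      · rw [sub_zero]
    rw [h1, der_sub]
    ring

end Weight

section Variation

variable {K ι : Type*} [CommRing K] [Algebra ℝ K] [Fintype ι]

/-- A notion of differentiability at `t₀` of families in a ring with derivations. -/
structure IsVariation (X : FrameCalculus K ι) (J : Set ℝ) (t₀ : ℝ) (V : (ℝ → K) → K → Prop) : Prop where
  const : ∀ a, V (fun _ => a) 0
  add : ∀ {x y x' y'}, V x x' → V y y' → V (fun t => x t + y t) (x' + y')
  mul : ∀ {x y x' y'}, V x x' → V y y' → V (fun t => x t * y t) (x' * y t₀ + x t₀ * y')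
  der : ∀ {x x'} A, V x x' → V (fun t => X.der A (x t)) (X.der A x')
  congr : ∀ {x y x'}, V x x' → (∀ t ∈ J, x t = y t) → V y x'

variable {X : FrameCalculus K ι} {J : Set ℝ} {t₀ : ℝ} {V : (ℝ → K) → K → Prop} (hV : X.IsVariation J t₀ V)

namespace IsVariation

include hV

theorem const_mul (a : K) {x : ℝ → K} {x' : K} (h : V x x') : V (fun t => a * x t) (a * x') := by
  have := hV.mul (hV.const a) h
  rwa [zero_mul, zero_add] at this

theorem neg {x : ℝ → K} {x' : K} (h : V x x') : V (fun t => -x t) (-x') := by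
  have := hV.const_mul (-1) h
  simpa using this

theorem sub {x y : ℝ → K} {x' y' : K} (h : V x x') (h' : V y y') : V (fun t => x t - y t) (x' - y') := by
  simpa only [sub_eq_add_neg] using hV.add h (hV.neg h')

theorem sum {κ : Type*} (s : Finset κ) {x : κ → ℝ → K} {x' : κ → K} (h : ∀ i, V (x i) (x' i)) :
    V (fun t => ∑ i ∈ s, x i t) (∑ i ∈ s, x' i) := by
  classical
  induction s using Finset.induction_on with
  | empty => simpa using hV.const 0
  | insert i s hi ih =>
    simp only [Finset.sum_insert hi]
    exact hV.add (h i) ih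

theorem ctr {x : ι → ℝ → K} {x' : ι → K} (h : ∀ A, V (x A) (x' A)) :
    V (fun t => GenGeom.ctr X.ε fun A => x A t) (GenGeom.ctr X.ε x') :=
  hV.sum Finset.univ fun A => hV.const_mul (X.ε A) (h A)

theorem ctr2 {x : ι → ι → ℝ → K} {x' : ι → ι → K} (h : ∀ A B, V (x A B) (x' A B)) :
    V (fun t => GenGeom.ctr2 X.ε fun A B => x A B t) (GenGeom.ctr2 X.ε x') :=
  hV.ctr fun A => hV.ctr (h A)

theorem dv (d : ι → K) (A : ι) {x : ℝ → K} {x' : K} (h : V x x') :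
    V (fun t => X.dv d A (x t)) (X.dv d A x') :=
  hV.add (hV.der A h) (hV.const_mul (d A) h)

theorem mul_of_zero {x y : ℝ → K} {x' y' : K} (h : V x x') (h' : V y y') (hx : x t₀ = 0) (hy : y t₀ = 0) :
    V (fun t => x t * y t) 0 := by
  have := hV.mul h h'
  rwa [hx, hy, mul_zero, zero_mul, add_zero] at this

theorem cdiv (d : ι → K) (Γ : ι → ι → ι → K) {H : ℝ → ι → ι → K} {h : ι → ι → K}
    (hH : ∀ A B, V (fun t => H t A B) (h A B)) (B : ι) :
    V (fun t => X.cdiv d Γ (H t) B) (X.cdiv d Γ h B) :=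
  hV.sub (hV.ctr fun A => hV.dv d A (hH A B)) (hV.ctr2 fun A E => hV.const_mul (Γ A B E) (hH A E))

theorem ip3_of_zero {a b : ℝ → ι → ι → ι → K} {a' b' : ι → ι → ι → K}
    (ha : ∀ A B D, V (fun t => a t A B D) (a' A B D)) (hb : ∀ A B D, V (fun t => b t A B D) (b' A B D))
    (ha0 : ∀ A B D, a t₀ A B D = 0) (hb0 : ∀ A B D, b t₀ A B D = 0) :
    V (fun t => ip3 X.ε (a t) (b t)) 0 := by
  have := hV.ctr fun A => hV.ctr2 fun B D => hV.mul_of_zero (ha A B D) (hb A B D) (ha0 A B D) (hb0 A B D)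
  simp only [ctr2_zero, ctr_zero] at this
  exact this

end IsVariation

/-- The components of the involution at time `t₀`. -/
def diag [DecidableEq ι] (X : FrameCalculus K ι) (A B : ι) : K := if A = B then X.ε A * X.sg A else 0

section Diag

variable [DecidableEq ι] {c Γ : ι → ι → ι → K} {d : ι → K} (hε : ∀ A, X.ε A * X.ε A = 1)
include hε

theorem ctr_diag (A : ι) (f : ι → K) : GenGeom.ctr X.ε (fun B => X.diag A B * f B) = X.sg A * f A := by
  simp only [GenGeom.ctr, diag, ite_mul, zero_mul, mul_ite, mul_zero, Finset.sum_ite_eq, Finset.mem_univ, if_true]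
  linear_combination X.sg A * f A * hε A

theorem ctr2_diag (f : ι → ι → K) : GenGeom.ctr2 X.ε (fun A B => X.diag A B * f A B) =
    GenGeom.ctr X.ε fun A => X.sg A * f A A :=
  ctr_congr _ fun A => ctr_diag hε A (f A)

omit hε in
theorem diag_symm (A B : ι) : X.diag A B = X.diag B A := by
  unfold diag
  by_cases h : A = B
  · subst h; rfl
  · rw [if_neg h, if_neg (Ne.symm h)]

/-- A trace of `D G = 0`. The connection preserves the eigenbundles, so both terms equal `s_B d_B`.
-/
theorem cdiv_diag (hΓ : X.IsLC c d Γ) (B : ι) : X.cdiv d Γ X.diag B = 0 := by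
  have h1 : GenGeom.ctr X.ε (fun A => X.dv d A (X.diag A B)) = X.sg B * d B := by
    have : ∀ A, X.dv d A (X.diag A B) = X.diag B A * d A := fun A => by
      unfold FrameCalculus.dv
      rw [diag_symm B A]
      have : X.der A (X.diag A B) = 0 := by
        unfold diag
        split_ifs
        · rw [mul_comm, der_sg_mul, X.der_ε, mul_zero]
        · exact X.der_zero A
      rw [this]; ring
    simp only [this, ctr_diag hε]
  have h2 : GenGeom.ctr2 X.ε (fun A E => Γ A B E * X.diag A E) = X.sg B * d B := by
    have h3 : ∀ A E, Γ A B E * X.diag A E = X.diag A E * Γ A B E := fun A E => mul_comm _ _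
    simp only [h3, ctr2_diag hε]
    rw [← hΓ.tr B, ← ctr_mul_left]
    refine ctr_congr _ fun A => ?_
    by_cases hAB : X.pos A = X.pos B
    · rw [sg_eq hAB]
    · rw [hΓ.mixed A B A (Ne.symm hAB), mul_zero, mul_zero]
  unfold FrameCalculus.cdiv
  rw [h1, h2, sub_self]

/-- The `G`-trace of the covariant derivative of `b` is the divergence of `G b`, since `G` is
parallel and the trace of the connection is `d`. -/
theorem ctr2_diag_hess (hΓ : X.IsLC c d Γ) (b : ι → K) :
    GenGeom.ctr2 X.ε (fun A B => X.diag A B * (X.der A (b B) - GenGeom.ctr X.ε fun C => Γ A B C * b C)) =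
      GenGeom.ctr X.ε fun A => X.sg A * X.dv d A (b A) := by
  rw [ctr2_diag hε]
  have h1 : GenGeom.ctr X.ε (fun A => X.sg A * GenGeom.ctr X.ε fun C => Γ A A C * b C) =
      -GenGeom.ctr X.ε fun A => X.sg A * (d A * b A) := by
    have h2 : GenGeom.ctr X.ε (fun A => X.sg A * GenGeom.ctr X.ε fun C => Γ A A C * b C) =
        GenGeom.ctr X.ε fun C => GenGeom.ctr X.ε fun A => X.sg A * (Γ A A C * b C) := by
      rw [ctr_comm]
      exact ctr_congr _ fun A => (ctr_mul_left _ _ _).symm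
    rw [h2, ← ctr_neg]
    refine ctr_congr _ fun C => ?_
    rw [← hΓ.tr C, ← ctr_mul_right, ← ctr_mul_left, ← ctr_neg]
    refine ctr_congr _ fun A => ?_
    by_cases hAC : X.pos A = X.pos C
    · rw [sg_eq hAC, hΓ.anti A A C]; ring
    · rw [hΓ.mixed A A C hAC, hΓ.mixed A C A (Ne.symm hAC)]; ring
  simp only [mul_sub, ctr_sub, h1, FrameCalculus.dv, mul_add, ctr_add]
  ring

end Diag

/-- On a mixed tensor only the coefficients of `Γ` determined by `c` contribute. -/
theorem cdiv_eq_mdiv {c Γ : ι → ι → ι → K} {d : ι → K} {h : ι → ι → K} (hΓ : X.IsLC c d Γ)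
    (h0 : ∀ A B, X.pos A = X.pos B → h A B = 0) (B : ι) : X.cdiv d Γ h B = X.mdiv c d h B := by
  unfold FrameCalculus.cdiv mdiv
  congr 1
  refine ctr2_congr _ fun A E => ?_
  by_cases h1 : X.pos A = X.pos B <;> by_cases h2 : X.pos E = X.pos B
  · rw [h0 A E (h1.trans h2.symm)]; simp [h1]
  · rw [hΓ.mixed A B E (Ne.symm h2)]; simp [h2]
  · rw [if_pos ⟨h1, h2⟩, hΓ.eq_of_ne h1 h2]
  · rw [hΓ.mixed A B E (Ne.symm h2)]; simp [h2]

include hV in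
/-- The first variation of the scalar curvature. -/
theorem IsVariation.scalar [DecidableEq ι] {c Γ : ι → ι → ι → K} {d : ι → K} (hε : ∀ A, X.ε A * X.ε A = 1)
    (hc : X.IsCourant c d) (hΓ : X.IsLC c d Γ)
    {H : ℝ → ι → ι → K} {h : ι → ι → K} (hH : ∀ A B, V (fun t => H t A B) (h A B))
    (h0 : ∀ A B, X.pos A = X.pos B → h A B = 0) (hH0 : H t₀ = X.diag)
    {d' : ℝ → ι → K} {b : ι → K} (hd : ∀ A, V (fun t => d' t A) (b A)) (hd0 : d' t₀ = d)
    {R : ℝ → K} (hR : ∀ t ∈ J, ∃ Γ' : ι → ι → ι → K, (∀ A B, H t A B = H t B A) ∧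
      (∀ (x : ι → K) A, GenGeom.ctr X.ε (fun B => H t A B * GenGeom.ctr X.ε fun C => H t B C * x C) = x A) ∧
      (∀ A B C, Γ' A B C = -Γ' A C B) ∧ (∀ A B C, Γ' A B C + Γ' B C A + Γ' C A B = c A B C) ∧
      (∀ B, GenGeom.ctr X.ε (fun A => Γ' A B A) = d' t B) ∧
      (∀ A u v, X.der A (H t u v) = GenGeom.ctr X.ε fun B => Γ' A u B * H t B v + Γ' A v B * H t u B) ∧
      R t = GenGeom.ctr2 X.ε fun u v => H t u v * X.ric2 (d' t) Γ' u v) :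
    V R (2 * X.scalarVar c d h b) := by
  -- The covariant derivative of `H t` for the connection `Γ`, which does not depend on `t`. Unlike
  -- `Γ'`, about whose dependence on `t` nothing is known, it can be differentiated.
  set N : ℝ → ι → ι → ι → K := fun t A u v => X.der A (H t u v) -
    GenGeom.ctr X.ε fun B => Γ A u B * H t B v + Γ A v B * H t u B with hN
  -- The part of `ctr2_ric2_eq` that is built from `H t`, `d' t` and fixed data.
  set T : ℝ → K := fun t => GenGeom.ctr2 X.ε (fun u v => H t u v * X.ric2 d Γ u v)
      - 2 * GenGeom.ctr X.ε (fun B => X.dv d B (X.cdiv d Γ (H t) B))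
      - 4 * GenGeom.ctr X.ε (fun B => (d' t B - d B) * X.cdiv d Γ (H t) B)
      - 4 * GenGeom.ctr2 X.ε (fun A B => H t A B * (X.der A (d' t B - d B)
          - GenGeom.ctr X.ε fun C => Γ A B C * (d' t C - d C)))
      - 2 * GenGeom.ctr2 X.ε (fun A B => H t A B * ((d' t A - d A) * (d' t B - d B))) with hT
  -- The rest is quadratic in `χ = Γ' - Γ`. As `Γ'` preserves `H t`, the tensor `N t` is the
  -- commutator of `χ` with `H t`, so `quad_eq` eliminates `χ`.
  have hRT : ∀ t ∈ J, T t + algebraMap ℝ K (1 / 4) * (ip3 X.ε (N t) (slot1 X.ε (H t) (N t))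
      - 4 * ip3 X.ε (N t) fun B C D => slot2 X.ε (H t) (N t) D B C) = R t := fun t htJ => by
    obtain ⟨Γ', hs, hsq, Γa', Γc', Γd', hder, hRt⟩ := hR t htJ
    set χ : ι → ι → ι → K := fun A B C => Γ' A B C - Γ A B C with hχ
    have χa : ∀ A B C, χ A B C = -χ A C B := fun A B C => by
      simp only [hχ]; rw [hΓ.anti, Γa']; ring
    have χc : ∀ A B C, χ A B C + χ B C A + χ C A B = 0 := fun A B C => by
      simp only [hχ]; linear_combination Γc' A B C - hΓ.cyc A B C
    have hNc : N t = commH X.ε (H t) χ := by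
      funext A u v
      simp only [hN, commH, slot2, slot3]
      rw [hder, ← ctr_sub, ← ctr_sub]
      refine ctr_congr _ fun B => ?_
      rw [hs v B, χa A B v]
      simp only [hχ]; ring
    have hq := quad_eq X.ε hs hsq χa χc
    rw [← hNc] at hq
    have e1 : ctr4 X.ε (fun u v A B => H t u v * (χ A u B * χ B v A)) =
        ip3 X.ε χ (fun A u B => slot2 X.ε (H t) χ B u A) := by
      rw [ctr4_swap23, ctr4_swap12, ctr4_swap34]
      refine ctr3_congr _ fun A u B => ?_
      simp only [slot2, ← ctr_mul_left]
      exact ctr_congr _ fun v => by ring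
    have e2 : ctr4 X.ε (fun u v A B => H t u v * (χ A u B * χ A v B)) =
        ip3 X.ε χ (slot2 X.ε (H t) χ) := by
      rw [ctr4_swap23, ctr4_swap12, ctr4_swap34]
      refine ctr3_congr _ fun A u B => ?_
      simp only [slot2, ← ctr_mul_left]
      exact ctr_congr _ fun v => by ring
    have hmain := ctr2_ric2_eq hs hΓ.anti hΓ.cyc Γa' Γc' Γd' hder (d := d)
    rw [e1, e2, ← hRt] at hmain
    have h4 : (4 : K) * algebraMap ℝ K (1 / 4) = 1 := by
      rw [← map_ofNat (algebraMap ℝ K) 4, ← map_mul]; norm_num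
    refine natCast_mul_cancel (n := 4) (by norm_num) ?_
    push_cast
    simp only [hT]
    linear_combination -4 * hmain + (ip3 X.ε (N t) (slot1 X.ε (H t) (N t))
      - 4 * ip3 X.ε (N t) fun B C D => slot2 X.ε (H t) (N t) D B C) * h4 - hq
  have hN0 : ∀ A u v, N t₀ A u v = 0 := fun A u v => by
    have h1 : X.der A (X.diag u v) = 0 := by
      unfold diag
      split_ifs
      · rw [mul_comm, der_sg_mul, X.der_ε, mul_zero]
      · exact X.der_zero A
    simp only [hN, hH0, h1]
    rw [ctr_add]
    have h2 : GenGeom.ctr X.ε (fun B => Γ A u B * X.diag B v) = X.sg v * Γ A u v := by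
      rw [← ctr_diag hε]
      exact ctr_congr _ fun B => by rw [diag_symm, mul_comm]
    have h3 : GenGeom.ctr X.ε (fun B => Γ A v B * X.diag u B) = X.sg u * Γ A v u := by
      rw [← ctr_diag hε]
      exact ctr_congr _ fun B => by rw [mul_comm]
    rw [h2, h3, hΓ.anti A v u]
    by_cases huv : X.pos u = X.pos v
    · rw [sg_eq huv]; ring
    · rw [hΓ.mixed A u v huv]; ring
  have VN : ∀ A u v, ∃ n, V (fun t => N t A u v) n := fun A u v =>
    ⟨_, hV.sub (hV.der A (hH u v)) (hV.ctr fun B => hV.add (hV.const_mul (Γ A u B) (hH B v))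
      (hV.const_mul (Γ A v B) (hH u B)))⟩
  choose n hn using VN
  -- Both factors vanish at `t₀`, so the derivative is zero whatever the derivative of `N` may be.
  have VQ := hV.sub (hV.ip3_of_zero hn (b := fun t => slot1 X.ε (H t) (N t))
      (fun A B D => hV.ctr fun E => hV.mul (hH A E) (hn E B D)) hN0
      (fun A B D => by simp only [slot1, hN0, mul_zero, ctr_zero]))
    (hV.const_mul 4 (hV.ip3_of_zero hn (b := fun t B C D => slot2 X.ε (H t) (N t) D B C)
      (fun A B D => hV.ctr fun E => hV.mul (hH A E) (hn D E B)) hN0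
      (fun A B D => by simp only [slot2, hN0, mul_zero, ctr_zero])))
  have hξ : ∀ A, V (fun t => d' t A - d A) (b A) := fun A => by
    have := hV.sub (hd A) (hV.const (d A))
    rwa [sub_zero] at this
  -- The same principle disposes of `V3` and `V5`: the difference of divergences and the divergence
  -- of `H` are both zero at `t₀`.
  have hξ0 : ∀ A, d' t₀ A - d A = 0 := fun A => by rw [hd0, sub_self]
  have hcd0 : ∀ B, X.cdiv d Γ (H t₀) B = 0 := fun B => by rw [hH0, cdiv_diag hε hΓ]
  have V1 : V (fun t => GenGeom.ctr2 X.ε fun u v => H t u v * X.ric2 d Γ u v)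
      (GenGeom.ctr2 X.ε fun u v => h u v * X.ric2 d Γ u v) := hV.ctr2 fun u v => by
    have := hV.mul (hH u v) (hV.const (X.ric2 d Γ u v))
    rwa [mul_zero, add_zero] at this
  have V2 : V (fun t => GenGeom.ctr X.ε fun B => X.dv d B (X.cdiv d Γ (H t) B))
      (GenGeom.ctr X.ε fun B => X.dv d B (X.cdiv d Γ h B)) :=
    hV.ctr fun B => hV.dv d B (hV.cdiv d Γ hH B)
  have V3 : V (fun t => GenGeom.ctr X.ε fun B => (d' t B - d B) * X.cdiv d Γ (H t) B) 0 := by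
    have := hV.ctr fun B => hV.mul_of_zero (hξ B) (hV.cdiv d Γ hH B) (hξ0 B) (hcd0 B)
    rwa [ctr_zero] at this
  have V4 : V (fun t => GenGeom.ctr2 X.ε (fun A B => H t A B * (X.der A (d' t B - d B)
          - GenGeom.ctr X.ε fun C => Γ A B C * (d' t C - d C))))
      (GenGeom.ctr X.ε fun A => X.sg A * X.dv d A (b A)) := by
    rw [← ctr2_diag_hess hε hΓ, ← hH0]
    refine hV.ctr2 fun A B => ?_
    have := hV.mul (hH A B) (hV.sub (hV.der A (hξ B)) (hV.ctr fun C => hV.const_mul (Γ A B C) (hξ C)))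
    simp only [hξ0, der_zero, mul_zero, ctr_zero, sub_zero, zero_add] at this
    exact this
  have V5 : V (fun t => GenGeom.ctr2 X.ε (fun A B => H t A B * ((d' t A - d A) * (d' t B - d B)))) 0 := by
    have := hV.ctr2 fun A B => hV.mul (hH A B) (hV.mul_of_zero (hξ A) (hξ B) (hξ0 A) (hξ0 B))
    simp only [hξ0, mul_zero, add_zero, ctr2_zero] at this
    exact this
  have VT := hV.congr (hV.add (hV.sub (hV.sub (hV.sub (hV.sub V1 (hV.const_mul 2 V2)) (hV.const_mul 4 V3))
    (hV.const_mul 4 V4)) (hV.const_mul 2 V5)) (hV.const_mul (algebraMap ℝ K (1 / 4)) VQ)) hRT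
  convert VT using 1
  have e1 : GenGeom.ctr2 X.ε (fun u v => h u v * X.ric2 d Γ u v) =
      2 * GenGeom.ctr2 X.ε fun u v => h u v * X.mric c d u v := by
    rw [← ctr2_mul_left]
    refine ctr2_congr _ fun u v => ?_
    by_cases huv : X.pos u = X.pos v
    · rw [h0 u v huv]; ring
    · rw [hc.ric2_eq hΓ huv]; ring
  simp only [e1, cdiv_eq_mdiv hΓ h0, FrameCalculus.scalarVar]
  ring

end Variation

end FrameCalculus
end GenGeom

/-! ### Locality of derivatives and calculus with sections -/

open scoped Topology
noncomputable section
namespace GenGeom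

section Locality

variable {EB : Type*} [NormedAddCommGroup EB] [NormedSpace ℝ EB]
  {M : Type*} [TopologicalSpace M] [ChartedSpace EB M]

section dirDeriv

variable {f g : M → ℝ} {x : M}

theorem dirDeriv_congr (h : f =ᶠ[𝓝 x] g) : dirDeriv (EB := EB) f x = dirDeriv g x := by
  unfold dirDeriv
  rw [h.mfderiv_eq]

theorem dirDeriv_add (hf : MDifferentiableAt 𝓘(ℝ, EB) 𝓘(ℝ, ℝ) f x)
    (hg : MDifferentiableAt 𝓘(ℝ, EB) 𝓘(ℝ, ℝ) g x) (X : TangentSpace 𝓘(ℝ, EB) x) :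
    dirDeriv (fun y => f y + g y) x X = dirDeriv f x X + dirDeriv g x X := by
  have h := (hf.hasMFDerivAt.add hg.hasMFDerivAt).mfderiv
  exact congrArg (fun L => L X) h

theorem dirDeriv_mul (hf : MDifferentiableAt 𝓘(ℝ, EB) 𝓘(ℝ, ℝ) f x)
    (hg : MDifferentiableAt 𝓘(ℝ, EB) 𝓘(ℝ, ℝ) g x) (X : TangentSpace 𝓘(ℝ, EB) x) :
    dirDeriv (fun y => f y * g y) x X = f x * dirDeriv g x X + g x * dirDeriv f x X := by
  have h := (hf.hasMFDerivAt.mul hg.hasMFDerivAt).mfderiv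
  exact congrArg (fun L => L X) h

theorem dirDeriv_const (a : ℝ) (X : TangentSpace 𝓘(ℝ, EB) x) :
    dirDeriv (fun _ : M => a) x X = 0 := by
  have h := (hasMFDerivAt_const (I := 𝓘(ℝ, EB)) (I' := 𝓘(ℝ, ℝ)) a x).mfderiv
  exact congrArg (fun L => L X) h

theorem dirDeriv_comp {φ : ℝ → ℝ} {φ' : ℝ} (hφ : HasDerivAt φ φ' (f x))
    (hf : MDifferentiableAt 𝓘(ℝ, EB) 𝓘(ℝ, ℝ) f x) (X : TangentSpace 𝓘(ℝ, EB) x) :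
    dirDeriv (fun y => φ (f y)) x X = φ' * dirDeriv f x X := by
  have h := (hφ.hasFDerivAt.hasMFDerivAt.comp x hf.hasMFDerivAt).mfderiv
  have h2 := congrArg (fun L => L X) h
  rw [mul_comm]
  exact h2

end dirDeriv

theorem mdiffAt (f : C^∞⟮𝓘(ℝ, EB), M; ℝ⟯) (x : M) : MDifferentiableAt 𝓘(ℝ, EB) 𝓘(ℝ, ℝ) f x :=
  f.contMDiff.mdifferentiable (by simp) x

variable [FiniteDimensional ℝ EB] [IsManifold 𝓘(ℝ, EB) ∞ M] [T2Space M]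

theorem exists_bump {p : M} {U : Set M} (hU : U ∈ 𝓝 p) :
    ∃ χ : C^∞⟮𝓘(ℝ, EB), M; ℝ⟯, (∀ᶠ x in 𝓝 p, χ x = 1) ∧ tsupport χ ⊆ U := by
  obtain ⟨χ, -, h⟩ := (SmoothBumpFunction.nhds_basis_tsupport (I := 𝓘(ℝ, EB)) p).mem_iff.1 hU
  exact ⟨⟨χ, χ.contMDiff⟩, χ.eventuallyEq_one, h⟩

/-- Multiplication by a bump function extends a locally smooth function by zero, so local
constructions can be carried out with global functions. -/
theorem exists_contMDiffMap_eventuallyEq {p : M} {g : M → ℝ}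
    (hg : ∀ᶠ x in 𝓝 p, ContMDiffAt 𝓘(ℝ, EB) 𝓘(ℝ, ℝ) ∞ g x) :
    ∃ h : C^∞⟮𝓘(ℝ, EB), M; ℝ⟯, h =ᶠ[𝓝 p] g := by
  obtain ⟨χ, h1, h2⟩ := exists_bump (EB := EB) hg
  refine ⟨⟨fun x => χ x * g x, fun x => ?_⟩, ?_⟩
  · by_cases hx : x ∈ tsupport χ
    · exact χ.contMDiff.contMDiffAt.mul (h2 hx)
    · have : (fun x => χ x * g x) =ᶠ[𝓝 x] fun _ => 0 := by
        filter_upwards [(isClosed_tsupport χ).isOpen_compl.mem_nhds hx] with y hy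
        rw [image_eq_zero_of_notMem_tsupport hy, zero_mul]
      exact contMDiffAt_const.congr_of_eventuallyEq this
  · filter_upwards [h1] with x hx
    show χ x * g x = g x
    rw [hx, one_mul]

end Locality

section Courant

variable {EB : Type*} [NormedAddCommGroup EB] [NormedSpace ℝ EB]
  {M : Type*} [TopologicalSpace M] [ChartedSpace EB M] [IsManifold 𝓘(ℝ, EB) ∞ M]
  {F : Type*} [NormedAddCommGroup F] [NormedSpace ℝ F]
  {E : M → Type*} [TopologicalSpace (Bundle.TotalSpace F E)]
  [∀ x, AddCommGroup (E x)] [∀ x, Module ℝ (E x)]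
  [∀ x, TopologicalSpace (E x)] [FiberBundle F E] [VectorBundle ℝ F E]
  (C : CourantAlgebroid EB F E)

/-- The derivative of a function along the anchor of a section. -/
def lie (u : Sec EB F E) (f : C^∞⟮𝓘(ℝ, EB), M; ℝ⟯) : C^∞⟮𝓘(ℝ, EB), M; ℝ⟯ :=
  ⟨fun x => dirDeriv f x (C.anchor x (u x)), by
    have h := (contMDiff_snd_tangentBundle_modelSpace ℝ 𝓘(ℝ, ℝ) (n := ∞)).comp
      ((f.contMDiff.contMDiff_tangentMap (m := ∞) (by simp)).comp (C.anchor_smooth u))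
    exact h⟩

/-- The pairing of two sections. -/
def pair (u v : Sec EB F E) : C^∞⟮𝓘(ℝ, EB), M; ℝ⟯ :=
  ⟨fun x => C.pairing x (u x) (v x), C.pairing_smooth u v⟩

variable {C}

theorem lie_apply (u : Sec EB F E) (f : C^∞⟮𝓘(ℝ, EB), M; ℝ⟯) (x : M) :
    lie C u f x = dirDeriv f x (C.anchor x (u x)) := rfl

theorem pair_apply (u v : Sec EB F E) (x : M) : pair C u v x = C.pairing x (u x) (v x) := rfl

theorem pair_comm (u v : Sec EB F E) : pair C u v = pair C v u := by
  ext x; exact C.pairing_symm x _ _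

theorem lie_congr {u : Sec EB F E} {f g : C^∞⟮𝓘(ℝ, EB), M; ℝ⟯} {x : M} (h : f =ᶠ[𝓝 x] g) :
    lie C u f x = lie C u g x := by
  rw [lie_apply, lie_apply, dirDeriv_congr h]

theorem lie_eventuallyEq {u : Sec EB F E} {f g : C^∞⟮𝓘(ℝ, EB), M; ℝ⟯} {x : M} (h : f =ᶠ[𝓝 x] g) :
    lie C u f =ᶠ[𝓝 x] lie C u g := by
  filter_upwards [h.eventuallyEq_nhds] with y hy using lie_congr hy

theorem lie_add (u : Sec EB F E) (f g : C^∞⟮𝓘(ℝ, EB), M; ℝ⟯) :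
    lie C u (f + g) = lie C u f + lie C u g := by
  ext x; exact dirDeriv_add (mdiffAt f x) (mdiffAt g x) _

theorem lie_mul (u : Sec EB F E) (f g : C^∞⟮𝓘(ℝ, EB), M; ℝ⟯) :
    lie C u (f * g) = f * lie C u g + g * lie C u f := by
  ext x; exact dirDeriv_mul (mdiffAt f x) (mdiffAt g x) _

theorem lie_neg (u : Sec EB F E) (f : C^∞⟮𝓘(ℝ, EB), M; ℝ⟯) : lie C u (-f) = -lie C u f := by
  have h := lie_add (C := C) u f (-f)
  have h0 : lie C u (f + -f) = 0 := by
    ext x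
    have : f + -f = 0 := add_neg_cancel f
    rw [this]
    exact dirDeriv_const 0 _
  rw [h0] at h
  exact eq_neg_of_add_eq_zero_right h.symm

theorem lie_eq_zero_of_eventuallyEq_const {u : Sec EB F E} {f : C^∞⟮𝓘(ℝ, EB), M; ℝ⟯} {x : M} {a : ℝ}
    (h : f =ᶠ[𝓝 x] fun _ => a) : lie C u f x = 0 := by
  rw [lie_apply, dirDeriv_congr h, dirDeriv_const]

theorem lie_fsmul (f g : C^∞⟮𝓘(ℝ, EB), M; ℝ⟯) (u : Sec EB F E) :
    lie C (fsmul f u) g = f * lie C u g := by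
  ext x
  have : C.anchor x (fsmul f u x) = f x • C.anchor x (u x) := map_smul _ _ _
  simp only [lie_apply, this, map_smul]
  rfl

theorem lie_add_left (u v : Sec EB F E) (f : C^∞⟮𝓘(ℝ, EB), M; ℝ⟯) :
    lie C (u + v) f = lie C u f + lie C v f := by
  ext x
  have : C.anchor x ((u + v) x) = C.anchor x (u x) + C.anchor x (v x) := map_add _ _ _
  simp only [lie_apply, this, map_add]
  rfl

theorem pair_fsmul (f : C^∞⟮𝓘(ℝ, EB), M; ℝ⟯) (u v : Sec EB F E) :
    pair C (fsmul f u) v = f * pair C u v := by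
  ext x
  have : fsmul f u x = f x • u x := rfl
  simp [pair_apply, this]

theorem pair_fsmul_right (f : C^∞⟮𝓘(ℝ, EB), M; ℝ⟯) (u v : Sec EB F E) :
    pair C u (fsmul f v) = f * pair C u v := by
  rw [pair_comm, pair_fsmul, pair_comm]

theorem pair_add (u v w : Sec EB F E) : pair C (u + v) w = pair C u w + pair C v w := by
  ext x
  have : (u + v) x = u x + v x := rfl
  simp [pair_apply, this]

theorem pair_add_right (u v w : Sec EB F E) : pair C u (v + w) = pair C u v + pair C u w := by
  rw [pair_comm, pair_add, pair_comm v, pair_comm w]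

theorem lie_pair (u v w : Sec EB F E) :
    lie C u (pair C v w) = pair C (C.bracket u v) w + pair C v (C.bracket u w) := by
  ext x; exact C.invariant u v w x

theorem pair_bracket_symm (u v w : Sec EB F E) :
    pair C (C.bracket u v) w + pair C (C.bracket v u) w = lie C w (pair C u v) := by
  rw [← pair_add]
  ext x; exact C.symmetric_part u v w x

theorem bracket_fsmul (u v : Sec EB F E) (f : C^∞⟮𝓘(ℝ, EB), M; ℝ⟯) :
    C.bracket u (fsmul f v) = fsmul f (C.bracket u v) + fsmul (lie C u f) v := by
  ext x; exact C.leibniz u v f x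

/-- The pairing is nondegenerate. -/
theorem eq_of_pairing {x : M} {a b : E x} (h : ∀ c, C.pairing x a c = C.pairing x b c) : a = b := by
  have := (C.pairing_nondegenerate x).1 (a - b) fun c => by rw [map_sub, LinearMap.sub_apply, h, sub_self]
  exact sub_eq_zero.1 this

/-- The anchor is a morphism of brackets. -/
theorem lie_bracket (u v : Sec EB F E) (f : C^∞⟮𝓘(ℝ, EB), M; ℝ⟯) (hE : ∀ x (e : E x), ∃ s : Sec EB F E, s x = e) :
    lie C (C.bracket u v) f = lie C u (lie C v f) - lie C v (lie C u f) := by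
  ext x
  show lie C (C.bracket u v) f x = lie C u (lie C v f) x - lie C v (lie C u f) x
  -- The Jacobi identity for `u`, `v` and `f w`: the part proportional to `f` is the Jacobi identity
  -- for `w`, the mixed first-order terms cancel, and the claim multiplied by `w` is left.
  have key : ∀ w : Sec EB F E, (lie C (C.bracket u v) f x -
      (lie C u (lie C v f) x - lie C v (lie C u f) x)) • w x = 0 := fun w => by
    have h := C.jacobi u v (fsmul f w)
    simp only [bracket_fsmul, map_add] at h
    rw [C.jacobi u v w] at h
    have h2 := congrArg (fun s : Sec EB F E => s x) h
    have e1 : ∀ s t : Sec EB F E, (s + t) x = s x + t x := fun _ _ => rfl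
    have e2 : ∀ (g : C^∞⟮𝓘(ℝ, EB), M; ℝ⟯) (s : Sec EB F E), fsmul g s x = g x • s x := fun _ _ => rfl
    simp only [e1, e2] at h2
    rw [← sub_eq_zero] at h2
    rw [← neg_zero, ← h2]
    module
  -- In a zero fibre no `w` can be tested, but there the anchor vanishes and so do all derivatives.
  by_cases h0 : ∀ e : E x, e = 0
  · have h1 : ∀ (s : Sec EB F E) (g : C^∞⟮𝓘(ℝ, EB), M; ℝ⟯), lie C s g x = 0 := fun s g => by
      rw [lie_apply, h0 (s x), map_zero, map_zero]
    rw [h1, h1, h1, sub_zero]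
  · push Not at h0
    obtain ⟨e, he⟩ := h0
    obtain ⟨w, hw⟩ := hE x e
    have := (smul_eq_zero.1 (key w)).resolve_right (by rwa [hw])
    exact sub_eq_zero.1 this

end Courant

end GenGeom

end

/-! ### Germs, local frames and the structure equations -/

noncomputable section
namespace GenGeom

variable {EB : Type*} [NormedAddCommGroup EB] [NormedSpace ℝ EB] [FiniteDimensional ℝ EB]
  {M : Type*} [TopologicalSpace M] [ChartedSpace EB M] [IsManifold 𝓘(ℝ, EB) ∞ M]
  [T2Space M] [SigmaCompactSpace M]
  {F : Type*} [NormedAddCommGroup F] [NormedSpace ℝ F] [FiniteDimensional ℝ F]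
  {E : M → Type*} [TopologicalSpace (Bundle.TotalSpace F E)]
  [∀ x, AddCommGroup (E x)] [∀ x, Module ℝ (E x)]
  [∀ x, TopologicalSpace (E x)] [FiberBundle F E] [VectorBundle ℝ F E]
  [ContMDiffVectorBundle ∞ F E 𝓘(ℝ, EB)]
  {C : CourantAlgebroid EB F E}

theorem map_ctr {K L ι : Type*} [CommRing K] [CommRing L] [Fintype ι] (φ : K →+* L) (ε f : ι → K) :
    φ (ctr ε f) = ctr (fun A => φ (ε A)) fun A => φ (f A) := by
  simp [ctr, map_sum]

variable (EB M) in
/-- The constant function. -/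
def cst (r : ℝ) : C^∞⟮𝓘(ℝ, EB), M; ℝ⟯ := algebraMap ℝ _ r

@[simp] theorem cst_apply (r : ℝ) (x : M) : cst EB M r x = r := by
  rfl

/-- Evaluation of smooth functions at a point. -/
def evalAt (p : M) : C^∞⟮𝓘(ℝ, EB), M; ℝ⟯ →+* ℝ where
  toFun f := f p
  map_one' := rfl
  map_mul' _ _ := rfl
  map_zero' := rfl
  map_add' _ _ := rfl

theorem evalAt_apply (p : M) (f : C^∞⟮𝓘(ℝ, EB), M; ℝ⟯) : evalAt p f = f p := rfl

theorem ctr_apply {ι : Type*} [Fintype ι] (ε : ι → ℝ) (f : ι → C^∞⟮𝓘(ℝ, EB), M; ℝ⟯) (x : M) :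
    ctr (fun A => cst EB M (ε A)) f x = ctr ε fun A => f A x := by
  have := map_ctr (evalAt x) (fun A => cst EB M (ε A)) f
  simpa [evalAt_apply] using this

variable (EB) in
/-- The ideal of smooth functions vanishing near `p`. -/
def germIdeal (p : M) : Ideal C^∞⟮𝓘(ℝ, EB), M; ℝ⟯ where
  carrier := {f | f =ᶠ[𝓝 p] fun _ => 0}
  add_mem' {f g} hf hg := by
    filter_upwards [hf, hg] with x h1 h2
    show f x + g x = 0
    rw [h1, h2, add_zero]
  zero_mem' := Filter.Eventually.of_forall fun _ => rfl
  smul_mem' f g hg := by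
    filter_upwards [hg] with x h2
    show f x * g x = 0
    rw [h2, mul_zero]

variable (EB) in
/-- Germs of smooth functions at `p`. -/
abbrev SmoothGerm (p : M) : Type _ := C^∞⟮𝓘(ℝ, EB), M; ℝ⟯ ⧸ germIdeal EB p

/-- The germ of a smooth function. -/
def germ (p : M) : C^∞⟮𝓘(ℝ, EB), M; ℝ⟯ →+* SmoothGerm EB p := Ideal.Quotient.mk _

theorem germ_surjective (p : M) : Function.Surjective (germ (EB := EB) p) :=
  Ideal.Quotient.mk_surjective

theorem germ_eq {p : M} {f g : C^∞⟮𝓘(ℝ, EB), M; ℝ⟯} : germ p f = germ p g ↔ f =ᶠ[𝓝 p] g := by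
  unfold germ
  rw [Ideal.Quotient.eq]
  constructor
  · intro h
    have h' : ∀ᶠ x in 𝓝 p, (f - g) x = 0 := h
    filter_upwards [h'] with x hx
    exact sub_eq_zero.1 hx
  · intro h
    show ∀ᶠ x in 𝓝 p, (f - g) x = 0
    filter_upwards [h] with x hx
    exact sub_eq_zero.2 hx

/-- The value of a germ. -/
def germEv (p : M) : SmoothGerm EB p →+* ℝ :=
  Ideal.Quotient.lift _ (evalAt p) fun f hf => by
    have hf' : ∀ᶠ x in 𝓝 p, f x = 0 := hf
    exact hf'.self_of_nhds

@[simp] theorem germEv_germ (p : M) (f : C^∞⟮𝓘(ℝ, EB), M; ℝ⟯) : germEv p (germ p f) = f p :=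
  Ideal.Quotient.lift_mk _ _ _

variable (C) in
/-- The derivative of a germ along a section. -/
def germDer (p : M) (u : Sec EB F E) : SmoothGerm EB p → SmoothGerm EB p :=
  Quotient.lift (fun f => germ p (lie C u f)) fun f g h => by
    have h' : germ p f = germ p g := Quotient.sound h
    exact germ_eq.2 (lie_eventuallyEq (germ_eq.1 h'))

@[simp] theorem germDer_germ (p : M) (u : Sec EB F E) (f : C^∞⟮𝓘(ℝ, EB), M; ℝ⟯) :
    germDer C p u (germ p f) = germ p (lie C u f) := rfl

variable (C) in
/-- A local orthonormal frame on an open set, given by global sections. -/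
structure IsFrameOn {ι : Type*} [Fintype ι] [DecidableEq ι] (U : Set M) (e : ι → Sec EB F E)
    (ε : ι → ℝ) : Prop where
  isOpen : IsOpen U
  sq : ∀ A, ε A * ε A = 1
  orth : ∀ x ∈ U, ∀ A B, C.pairing x (e A x) (e B x) = if A = B then ε A else 0
  span : ∀ x ∈ U, ∀ v : E x, v = ∑ A, (ε A * C.pairing x v (e A x)) • e A x

/-- Every vector is the value of a section. -/
theorem exists_sec (x : M) (e : E x) : ∃ s : Sec EB F E, s x = e := exists_section_through e

theorem lie_bracket' (u v : Sec EB F E) (f : C^∞⟮𝓘(ℝ, EB), M; ℝ⟯) :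
    lie C (C.bracket u v) f = lie C u (lie C v f) - lie C v (lie C u f) :=
  lie_bracket u v f exists_sec

/-- A functional on sections that is insensitive to cutoff functions is local. -/
theorem eq_of_eventuallyEq {p : M} (Φ : Sec EB F E → ℝ)
    (hcut : ∀ (χ : C^∞⟮𝓘(ℝ, EB), M; ℝ⟯) u, (∀ᶠ x in 𝓝 p, χ x = 1) → Φ (fsmul χ u) = Φ u)
    {u v : Sec EB F E} (h : ∀ᶠ x in 𝓝 p, u x = v x) : Φ u = Φ v := by
  obtain ⟨χ, h1, h2⟩ := exists_bump (EB := EB) h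
  rw [← hcut χ u h1, ← hcut χ v h1]
  congr 1
  ext x
  show χ x • u x = χ x • v x
  by_cases hx : x ∈ tsupport χ
  · rw [h2 hx]
  · rw [image_eq_zero_of_notMem_tsupport hx, zero_smul, zero_smul]

theorem sec_sum_apply {κ : Type*} (s : Finset κ) (f : κ → Sec EB F E) (x : M) :
    (∑ i ∈ s, f i) x = ∑ i ∈ s, f i x := by
  classical
  induction s using Finset.induction_on with
  | empty => rfl
  | insert i s hi ih =>
    rw [Finset.sum_insert hi, Finset.sum_insert hi, ← ih]; rfl

theorem map_sec_sum {κ G : Type*} [AddCommGroup G] (Φ : Sec EB F E → G)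
    (hadd : ∀ u v, Φ (u + v) = Φ u + Φ v) (s : Finset κ) (f : κ → Sec EB F E) :
    Φ (∑ i ∈ s, f i) = ∑ i ∈ s, Φ (f i) := by
  classical
  have h0 : Φ 0 = 0 := by have := hadd 0 0; simpa using this
  induction s using Finset.induction_on with
  | empty => simpa using h0
  | insert i s hi ih => rw [Finset.sum_insert hi, Finset.sum_insert hi, hadd, ih]

variable (C) in
/-- Divergence operators compatible with the bracket. -/
structure IsDivergence (δ : Sec EB F E → C^∞⟮𝓘(ℝ, EB), M; ℝ⟯) : Prop where
  add : ∀ u v, δ (u + v) = δ u + δ v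
  fsmul : ∀ f u, δ (fsmul f u) = f * δ u + lie C u f
  bracket : ∀ u v, δ (C.bracket u v) = lie C u (δ v) - lie C v (δ u)

theorem IsDivergence.congr {δ : Sec EB F E → C^∞⟮𝓘(ℝ, EB), M; ℝ⟯} (hδ : IsDivergence C δ) {p : M}
    {u v : Sec EB F E} (h : ∀ᶠ x in 𝓝 p, u x = v x) : δ u p = δ v p := by
  refine eq_of_eventuallyEq (fun u => δ u p) (fun χ u hχ => ?_) h
  · show δ (GenGeom.fsmul χ u) p = δ u p
    rw [hδ.fsmul]
    show χ p * δ u p + lie C u χ p = δ u p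
    rw [hχ.self_of_nhds, lie_eq_zero_of_eventuallyEq_const hχ, one_mul, add_zero]

namespace IsFrameOn

variable {ι : Type*} [Fintype ι] [DecidableEq ι] {U : Set M} {e : ι → Sec EB F E} {ε : ι → ℝ}
  (hF : IsFrameOn C U e ε)
include hF

/-- A function-linear functional is determined by its values on the frame. -/
theorem tensorial {p : M} (hp : p ∈ U) (Φ : Sec EB F E → ℝ) (hadd : ∀ u v, Φ (u + v) = Φ u + Φ v)
    (hmul : ∀ f u, Φ (fsmul f u) = f p * Φ u) (u : Sec EB F E) :
    Φ u = ctr ε fun A => C.pairing p (u p) (e A p) * Φ (e A) := by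
  have h := eq_of_eventuallyEq (p := p) Φ (fun χ u hχ => by
    rw [hmul, hχ.self_of_nhds, one_mul]) (u := u)
    (v := ∑ A, fsmul (cst EB M (ε A) * pair C u (e A)) (e A)) (by
      filter_upwards [hF.isOpen.mem_nhds hp] with x hx
      rw [sec_sum_apply]
      conv_lhs => rw [hF.span x hx (u x)]
      refine Finset.sum_congr rfl fun A _ => ?_
      show _ = (cst EB M (ε A) x * pair C u (e A) x) • e A x
      rw [cst_apply]; rfl)
  rw [h, map_sec_sum Φ hadd]
  refine Finset.sum_congr rfl fun A _ => ?_
  rw [hmul]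
  show cst EB M (ε A) p * pair C u (e A) p * _ = _
  rw [cst_apply, pair_apply, mul_assoc]

theorem pair_eq {x : M} (hx : x ∈ U) (a b : E x) : C.pairing x a b =
    ctr ε fun A => C.pairing x a (e A x) * C.pairing x b (e A x) := by
  conv_lhs => rw [hF.span x hx a]
  simp only [map_sum, map_smul, LinearMap.sum_apply, LinearMap.smul_apply, smul_eq_mul, ctr]
  exact Finset.sum_congr rfl fun A _ => by rw [C.pairing_symm x (e A x) b]; ring

theorem lie_eq {x : M} (hx : x ∈ U) (w : Sec EB F E) (f : C^∞⟮𝓘(ℝ, EB), M; ℝ⟯) : lie C w f x =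
    ctr ε fun A => C.pairing x (w x) (e A x) * lie C (e A) f x := by
  simp only [lie_apply]
  conv_lhs => rw [hF.span x hx (w x)]
  simp only [map_sum, map_smul, smul_eq_mul, ctr, mul_assoc]

/-- A divergence operator is local, so `w` may be replaced by its expansion in the frame, to which
the Leibniz rule applies. -/
theorem div_eq {δ : Sec EB F E → C^∞⟮𝓘(ℝ, EB), M; ℝ⟯} (hδ : IsDivergence C δ) {x : M} (hx : x ∈ U)
    (w : Sec EB F E) : δ w x = ctr ε fun A => C.pairing x (w x) (e A x) * δ (e A) x +
      lie C (e A) (pair C w (e A)) x := by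
  have h := hδ.congr (p := x) (u := w)
    (v := ∑ A, GenGeom.fsmul (cst EB M (ε A) * pair C w (e A)) (e A)) (by
      filter_upwards [hF.isOpen.mem_nhds hx] with y hy
      rw [sec_sum_apply]
      conv_lhs => rw [hF.span y hy (w y)]
      refine Finset.sum_congr rfl fun A _ => ?_
      show _ = (cst EB M (ε A) y * pair C w (e A) y) • e A y
      rw [cst_apply]; rfl)
  rw [h, map_sec_sum δ hδ.add]
  have hs : ∀ g : ι → C^∞⟮𝓘(ℝ, EB), M; ℝ⟯, (∑ A, g A) x = ∑ A, g A x := fun g =>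
    map_sum (evalAt (EB := EB) x) g _
  rw [hs]
  refine Finset.sum_congr rfl fun A _ => ?_
  rw [hδ.fsmul, lie_mul]
  show cst EB M (ε A) x * pair C w (e A) x * _ + (cst EB M (ε A) x * _ + pair C w (e A) x *
    lie C (e A) (cst EB M (ε A)) x) = _
  rw [lie_eq_zero_of_eventuallyEq_const (a := ε A) (Filter.Eventually.of_forall fun y =>
    cst_apply _ _), cst_apply, pair_apply]
  ring

theorem ε_ne (A : ι) : ε A ≠ 0 := fun h => by
  have := hF.sq A
  rw [h] at this; simp at this

end IsFrameOn

/-- The germs of the frame derivations. -/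
def frameCalc {ι : Type*} (C : CourantAlgebroid EB F E) (e : ι → Sec EB F E) (ε : ι → ℝ) (pos : ι → Bool)
    (p : M) : FrameCalculus (SmoothGerm EB p) ι where
  ε A := germ p (cst EB M (ε A))
  pos := pos
  der A := germDer C p (e A)
  der_add A x y := by
    obtain ⟨f, rfl⟩ := germ_surjective p x
    obtain ⟨g, rfl⟩ := germ_surjective p y
    rw [← map_add, germDer_germ, lie_add, map_add]; rfl
  der_mul A x y := by
    obtain ⟨f, rfl⟩ := germ_surjective p x
    obtain ⟨g, rfl⟩ := germ_surjective p y
    rw [← map_mul, germDer_germ, lie_mul, map_add, map_mul, map_mul]; rfl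
  der_ε A B := by
    rw [germDer_germ, ← map_zero (germ p), germ_eq]
    exact Filter.Eventually.of_forall fun x => lie_eq_zero_of_eventuallyEq_const (a := ε B)
      (Filter.Eventually.of_forall fun y => cst_apply _ _)

/-- The structure functions of a frame. -/
def strFun {ι : Type*} (C : CourantAlgebroid EB F E) (e : ι → Sec EB F E) (p : M) (A B D : ι) :
    SmoothGerm EB p := germ p (pair C (C.bracket (e A) (e B)) (e D))

namespace IsFrameOn

variable {ι : Type*} [Fintype ι] [DecidableEq ι] {U : Set M} {e : ι → Sec EB F E} {ε : ι → ℝ}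
  (hF : IsFrameOn C U e ε)
include hF

theorem pair_eventuallyEq {x : M} (hx : x ∈ U) (A B : ι) :
    pair C (e A) (e B) =ᶠ[𝓝 x] fun _ => if A = B then ε A else 0 := by
  filter_upwards [hF.isOpen.mem_nhds hx] with y hy using hF.orth y hy A B

theorem lie_pair_frame {x : M} (hx : x ∈ U) (w : Sec EB F E) (A B : ι) :
    lie C w (pair C (e A) (e B)) x = 0 :=
  lie_eq_zero_of_eventuallyEq_const (hF.pair_eventuallyEq hx A B)

theorem germ_pair {p : M} (hp : p ∈ U) (u v : Sec EB F E) : germ p (pair C u v) =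
    ctr (fun A => germ p (cst EB M (ε A)))
      fun A => germ p (pair C u (e A)) * germ p (pair C v (e A)) := by
  simp only [← map_mul, ← map_ctr]
  rw [germ_eq]
  filter_upwards [hF.isOpen.mem_nhds hp] with x hx
  rw [ctr_apply]
  exact hF.pair_eq hx _ _

/-- The section `[f e_A, e_A] + [e_A, f e_A]` represents `ε_A 𝒟 f`. -/
theorem pair_grad {x : M} (hx : x ∈ U) (A : ι) (f : C^∞⟮𝓘(ℝ, EB), M; ℝ⟯) (w : Sec EB F E) :
    pair C (C.bracket (fsmul f (e A)) (e A) + C.bracket (e A) (fsmul f (e A))) w x =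
      ε A * lie C w f x := by
  rw [pair_add, pair_bracket_symm, pair_fsmul, lie_mul]
  show f x * lie C w _ x + pair C (e A) (e A) x * lie C w f x = _
  rw [hF.lie_pair_frame hx, (hF.pair_eventuallyEq hx A A).self_of_nhds]
  simp

/-- The frame has constant pairings near `p`, so the invariance of the pairing and the symmetric
part of the bracket make `c` totally antisymmetric. The commutators come from the anchor being a
morphism and from the divergence of a bracket, and the last equation is the Jacobi identity in
components. -/
theorem isCourant {δ : Sec EB F E → C^∞⟮𝓘(ℝ, EB), M; ℝ⟯} (hδ : IsDivergence C δ) {p : M} (hp : p ∈ U)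
    (pos : ι → Bool) :
    (frameCalc C e ε pos p).IsCourant (strFun C e p) fun A => germ p (δ (e A)) := by
  have a12 : ∀ A B D, strFun C e p A B D = -strFun C e p B A D := fun A B D => by
    unfold strFun
    rw [← map_neg, germ_eq]
    filter_upwards [hF.isOpen.mem_nhds hp] with x hx
    have h1 : pair C (C.bracket (e A) (e B)) (e D) x + pair C (C.bracket (e B) (e A)) (e D) x = _ :=
      DFunLike.congr_fun (pair_bracket_symm (C := C) (e A) (e B) (e D)) x
    rw [hF.lie_pair_frame hx] at h1
    exact eq_neg_of_add_eq_zero_left h1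
  have a23 : ∀ A B D, strFun C e p A B D = -strFun C e p A D B := fun A B D => by
    unfold strFun
    rw [← map_neg, germ_eq]
    filter_upwards [hF.isOpen.mem_nhds hp] with x hx
    have h1 : _ = pair C (C.bracket (e A) (e B)) (e D) x + pair C (e B) (C.bracket (e A) (e D)) x :=
      DFunLike.congr_fun (lie_pair (C := C) (e A) (e B) (e D)) x
    rw [hF.lie_pair_frame hx, pair_comm (e B)] at h1
    exact eq_neg_of_add_eq_zero_left h1.symm
  refine ⟨a12, a23, fun A B f => ?_, fun A B => ?_, fun f => ?_, fun k A B D => ?_⟩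
  · obtain ⟨f, rfl⟩ := germ_surjective p f
    show germ p (lie C (e A) (lie C (e B) f)) - germ p (lie C (e B) (lie C (e A) f)) =
      ctr (fun A => germ p (cst EB M (ε A))) fun D =>
        germ p (pair C (C.bracket (e A) (e B)) (e D)) * germ p (lie C (e D) f)
    simp only [← map_mul, ← map_ctr, ← map_sub]
    rw [germ_eq, ← lie_bracket']
    filter_upwards [hF.isOpen.mem_nhds hp] with x hx
    rw [ctr_apply]
    exact hF.lie_eq hx _ _
  · show germ p (lie C (e A) (δ (e B))) - germ p (lie C (e B) (δ (e A))) =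
      ctr (fun A => germ p (cst EB M (ε A))) fun D =>
        germ p (lie C (e D) (pair C (C.bracket (e A) (e B)) (e D))) +
          germ p (δ (e D)) * germ p (pair C (C.bracket (e A) (e B)) (e D))
    simp only [← map_mul, ← map_add, ← map_ctr, ← map_sub]
    rw [germ_eq, ← hδ.bracket]
    filter_upwards [hF.isOpen.mem_nhds hp] with x hx
    rw [ctr_apply, hF.div_eq hδ hx]
    refine ctr_congr _ fun D => ?_
    rw [add_comm, mul_comm]; rfl
  · obtain ⟨f, rfl⟩ := germ_surjective p f
    show ctr (fun A => germ p (cst EB M (ε A))) (fun D =>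
        germ p (lie C (e D) (lie C (e D) f)) + germ p (δ (e D)) * germ p (lie C (e D) f)) = 0
    simp only [← map_mul, ← map_add, ← map_ctr]
    rw [← map_zero (germ p), germ_eq]
    filter_upwards [hF.isOpen.mem_nhds hp] with x hx
    rw [ctr_apply]
    show _ = (0 : ℝ)
    by_cases hι : Nonempty ι
    · obtain ⟨A⟩ := hι
      -- This section is `ε_A 𝒟f` near `x`. Since the divergence of `[u,v]` is antisymmetric in `u`
      -- and `v`, it has divergence zero; this is the reason for `div ∘ 𝒟 = 0`.
      set s := C.bracket (fsmul f (e A)) (e A) + C.bracket (e A) (fsmul f (e A)) with hs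
      have h0 : δ s x = 0 := by
        rw [hs, hδ.add, hδ.bracket, hδ.bracket]
        show _ - _ + (_ - _) = (0 : ℝ)
        ring
      have hg : ∀ B, pair C s (e B) =ᶠ[𝓝 x] (cst EB M (ε A) * lie C (e B) f :
          C^∞⟮𝓘(ℝ, EB), M; ℝ⟯) := fun B => by
        filter_upwards [hF.isOpen.mem_nhds hx] with y hy
        rw [hF.pair_grad hy]
        show _ = cst EB M (ε A) y * _
        rw [cst_apply]
      rw [hF.div_eq hδ hx] at h0
      have h1 : ctr ε (fun B => C.pairing x (s x) (e B x) * δ (e B) x + lie C (e B) (pair C s (e B)) x) =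
          ε A * ctr ε fun B => lie C (e B) (lie C (e B) f) x + δ (e B) x * lie C (e B) f x := by
        rw [← ctr_mul_left]
        refine ctr_congr _ fun B => ?_
        rw [lie_congr (hg B), lie_mul]
        have h2 := hF.pair_grad hx A f (e B)
        rw [pair_apply] at h2
        rw [h2]
        show _ + (cst EB M (ε A) x * _ + _ * lie C (e B) (cst EB M (ε A)) x) = _
        rw [lie_eq_zero_of_eventuallyEq_const (a := ε A) (Filter.Eventually.of_forall fun y =>
          cst_apply _ _), cst_apply]
        ring
      rw [h1] at h0
      exact (mul_eq_zero.1 h0).resolve_left (hF.ε_ne A)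
    · have := not_nonempty_iff.1 hι
      simp [ctr]
  · have hj : pair C (C.bracket (e k) (C.bracket (e A) (e B))) (e D) =
        pair C (C.bracket (C.bracket (e k) (e A)) (e B)) (e D) +
          pair C (C.bracket (e A) (C.bracket (e k) (e B))) (e D) := by
      rw [C.jacobi, pair_add]
    have h1 := lie_pair (C := C) (e k) (C.bracket (e A) (e B)) (e D)
    have h2 := lie_pair (C := C) (e A) (C.bracket (e k) (e B)) (e D)
    have h3 := lie_pair (C := C) (e B) (C.bracket (e k) (e A)) (e D)
    have h4 := pair_bracket_symm (C := C) (C.bracket (e k) (e A)) (e B) (e D)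
    have h := congrArg (germ p) (show lie C (e k) (pair C (C.bracket (e A) (e B)) (e D)) =
      lie C (e A) (pair C (C.bracket (e k) (e B)) (e D)) - lie C (e B) (pair C (C.bracket (e k) (e A)) (e D))
        + lie C (e D) (pair C (C.bracket (e k) (e A)) (e B))
        + pair C (C.bracket (e A) (e B)) (C.bracket (e k) (e D))
        + pair C (C.bracket (e k) (e A)) (C.bracket (e B) (e D))
        - pair C (C.bracket (e k) (e B)) (C.bracket (e A) (e D)) by
      linear_combination h1 + hj - h2 + h3 + h4)
    have hc : germ p (lie C (e B) (pair C (C.bracket (e k) (e A)) (e D))) =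
        -(frameCalc C e ε pos p).der B (strFun C e p k D A) := by
      rw [← FrameCalculus.der_neg, ← a23]; rfl
    simp only [map_add, map_sub, hF.germ_pair hp (C.bracket _ _) (C.bracket _ _), hc] at h
    refine h.trans ?_
    have hmn : ∀ x y : SmoothGerm EB p, x * -y = -(x * y) := fun x y => by ring
    simp only [ctr_add]
    rw [ctr_congr (f := fun E => strFun C e p k A E * strFun C e p E B D)
      (g := fun E => germ p (pair C (C.bracket (e k) (e A)) (e E)) * germ p (pair C (C.bracket (e B) (e D)) (e E)))
      _ fun E => by rw [a12 E B, a23 B E, neg_neg]; rfl,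
      ctr_congr (f := fun E => strFun C e p k B E * strFun C e p A E D)
      (g := fun E => -(germ p (pair C (C.bracket (e k) (e B)) (e E)) * germ p (pair C (C.bracket (e A) (e D)) (e E))))
      _ fun E => by rw [a23 A E]; exact hmn _ _,
      ctr_congr (f := fun E => strFun C e p k D E * strFun C e p A B E)
      (g := fun E => germ p (pair C (C.bracket (e A) (e B)) (e E)) * germ p (pair C (C.bracket (e k) (e D)) (e E)))
      _ fun E => by rw [mul_comm]; rfl, ctr_neg]
    have e1 : germ p (lie C (e A) (pair C (C.bracket (e k) (e B)) (e D))) =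
      (frameCalc C e ε pos p).der A (strFun C e p k B D) := rfl
    have e2 : germ p (lie C (e D) (pair C (C.bracket (e k) (e A)) (e B))) =
      (frameCalc C e ε pos p).der D (strFun C e p k A B) := rfl
    have e3 : (frameCalc C e ε pos p).ε = fun A => germ p (cst EB M (ε A)) := rfl
    rw [e1, e2, e3]
    ring

end IsFrameOn

theorem fsmul_apply (f : C^∞⟮𝓘(ℝ, EB), M; ℝ⟯) (v : Sec EB F E) (x : M) : fsmul f v x = f x • v x := rfl

theorem sec_add_apply (u v : Sec EB F E) (x : M) : (u + v) x = u x + v x := rfl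

theorem sec_sub_apply (u v : Sec EB F E) (x : M) : (u - v) x = u x - v x := rfl

theorem lie_sub_left (u v : Sec EB F E) (f : C^∞⟮𝓘(ℝ, EB), M; ℝ⟯) :
    lie C (u - v) f = lie C u f - lie C v f := by
  have h := lie_add_left (C := C) (u - v) v f
  rw [sub_add_cancel] at h
  rw [h, add_sub_cancel_right]

/-! ### Tensoriality of the Riemann tensor -/

namespace Connection

variable (D : Connection C)

theorem app_apply (u v : Sec EB F E) (x : M) : D.app u v x = D.toFun v x (u x) := rfl

theorem app_add_left (u u' v : Sec EB F E) : D.app (u + u') v = D.app u v + D.app u' v := by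
  ext x; exact map_add (D.toFun v x) (u x) (u' x)

theorem app_add_right (u v v' : Sec EB F E) : D.app u (v + v') = D.app u v + D.app u v' := by
  ext x; exact congrArg (fun T => T (u x)) (D.add v v' x)

theorem app_fsmul_left (f : C^∞⟮𝓘(ℝ, EB), M; ℝ⟯) (u v : Sec EB F E) :
    D.app (fsmul f u) v = fsmul f (D.app u v) := by
  ext x; exact map_smul (D.toFun v x) (f x) (u x)

theorem app_fsmul_right (f : C^∞⟮𝓘(ℝ, EB), M; ℝ⟯) (u v : Sec EB F E) :
    D.app u (fsmul f v) = fsmul f (D.app u v) + fsmul (lie C u f) v := by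
  ext x; exact D.leibniz f v x (u x)

theorem lie_pair_app (u v w : Sec EB F E) :
    lie C u (pair C v w) = pair C (D.app u v) w + pair C v (D.app u w) := by
  ext x; exact D.metric v w x (u x)

/-- The operator `[D_x, D_y] z` without bracket term. -/
def curv (x y z : Sec EB F E) : Sec EB F E :=
  D.app x (D.app y z) - D.app (D.app x y) z - (D.app y (D.app x z) - D.app (D.app y x) z)

theorem curv_add_left (x x' y z : Sec EB F E) : D.curv (x + x') y z = D.curv x y z + D.curv x' y z := by
  simp only [curv, app_add_left, app_add_right]; abel

theorem curv_add_right (x y z z' : Sec EB F E) : D.curv x y (z + z') = D.curv x y z + D.curv x y z' := by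
  simp only [curv, app_add_right]; abel

theorem curv_swap (x y z : Sec EB F E) : D.curv y x z = -D.curv x y z := by
  simp only [curv]; abel

theorem curv_fsmul_left (f : C^∞⟮𝓘(ℝ, EB), M; ℝ⟯) (x y z : Sec EB F E) :
    D.curv (fsmul f x) y z = fsmul f (D.curv x y z) := by
  simp only [curv, app_fsmul_left, app_fsmul_right, app_add_left]
  ext q
  simp only [sec_sub_apply, sec_add_apply, fsmul_apply]
  module

/-- The second-order operator acting on functions that belongs to `curv`. -/
def curvFun (x y : Sec EB F E) (f : C^∞⟮𝓘(ℝ, EB), M; ℝ⟯) : C^∞⟮𝓘(ℝ, EB), M; ℝ⟯ :=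
  lie C x (lie C y f) - lie C (D.app x y) f - (lie C y (lie C x f) - lie C (D.app y x) f)

/-- `curv` has no bracket term and is not tensorial in the last argument. The defect is `curvFun`,
which the third term of the Riemann tensor will compensate. -/
theorem curv_fsmul_right (f : C^∞⟮𝓘(ℝ, EB), M; ℝ⟯) (x y z : Sec EB F E) :
    D.curv x y (fsmul f z) = fsmul f (D.curv x y z) + fsmul (D.curvFun x y f) z := by
  simp only [curv, app_fsmul_right, app_add_right]
  ext q
  have e : D.curvFun x y f q = lie C x (lie C y f) q - lie C (D.app x y) f q -
    (lie C y (lie C x f) q - lie C (D.app y x) f q) := rfl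
  simp only [sec_sub_apply, sec_add_apply, fsmul_apply, e]
  module

end Connection

theorem sum_coframe (x : M) (a : E x) :
    ∑ α, C.pairing x (coframe C x α) a • frame F x α = a := by
  have : FiniteDimensional ℝ (E x) := VectorBundle.finiteDimensional ℝ F E x
  conv_rhs => rw [← (frame F x).sum_repr a]
  refine Finset.sum_congr rfl fun α _ => ?_
  congr 1
  have : C.pairing x (coframe C x α) = (frame F x).coord α := by
    refine (frame F x).ext fun β => ?_
    rw [coframe, LinearMap.BilinForm.apply_dualBasis_left]
    simp [Finsupp.single_apply]
  rw [this]; rfl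

theorem sum_ctr2 {K ι κ : Type*} [CommRing K] [Fintype ι] (s : Finset κ) (ε : ι → K)
    (f : κ → ι → ι → K) : ∑ α ∈ s, ctr2 ε (f α) = ctr2 ε fun A B => ∑ α ∈ s, f α A B := by
  simp only [ctr2, ctr, Finset.mul_sum]
  rw [Finset.sum_comm]
  exact Finset.sum_congr rfl fun A _ => Finset.sum_comm

namespace IsFrameOn

variable {ι : Type*} [Fintype ι] [DecidableEq ι] {U : Set M} {e : ι → Sec EB F E} {ε : ι → ℝ}
  (hF : IsFrameOn C U e ε) {p : M} (hp : p ∈ U)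
include hF hp

/-- A contraction over dual bases does not depend on the basis; this passes from the arbitrary bases
in the definitions to an orthonormal frame. -/
theorem sum_frame_coframe (Ψ : E p →ₗ[ℝ] E p →ₗ[ℝ] ℝ) :
    ∑ α, Ψ (frame F p α) (coframe C p α) = ctr ε fun A => Ψ (e A p) (e A p) := by
  have h1 : ∀ α, Ψ (frame F p α) (coframe C p α) =
      ∑ A, ε A * Ψ (C.pairing p (coframe C p α) (e A p) • frame F p α) (e A p) := fun α => by
    conv_lhs => rw [hF.span p hp (coframe C p α)]
    simp [mul_assoc]
  simp only [h1, ctr]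
  rw [Finset.sum_comm]
  refine Finset.sum_congr rfl fun A _ => ?_
  rw [← Finset.mul_sum]
  congr 1
  calc _ = Ψ (∑ α, C.pairing p (coframe C p α) (e A p) • frame F p α) (e A p) := by
        simp [map_sum, LinearMap.sum_apply]
    _ = _ := by rw [sum_coframe]

theorem trace_eq (T : Module.End ℝ (E p)) :
    LinearMap.trace ℝ (E p) T = ctr ε fun A => C.pairing p (T (e A p)) (e A p) := by
  have : FiniteDimensional ℝ (E p) := VectorBundle.finiteDimensional ℝ F E p
  have : T = ∑ A, ε A • ((C.pairing p).flip (e A p)).smulRight (T (e A p)) := by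
    ext v
    conv_lhs => rw [hF.span p hp v]
    simp [map_sum, LinearMap.sum_apply, mul_smul]
  conv_lhs => rw [this]
  simp [map_sum, LinearMap.trace_smulRight, ctr]

variable {D : Connection C}

theorem riem_eq (w z x y : Sec EB F E) : D.riem w z x y p = 1 / 2 * (C.pairing p (w p) (D.curv x y z p) +
    C.pairing p (y p) (D.curv z w x p) - ctr ε fun A =>
      C.pairing p (D.toFun x p (e A p)) (y p) * C.pairing p (D.toFun z p (e A p)) (w p)) := by
  have h := hF.sum_frame_coframe hp (LinearMap.mk₂ ℝ (fun a b =>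
    C.pairing p (D.toFun x p a) (y p) * C.pairing p (D.toFun z p b) (w p))
    (by intros; simp; ring) (by intros; simp; ring) (by intros; simp; ring) (by intros; simp; ring))
  simp only [LinearMap.mk₂_apply] at h
  rw [← h]; rfl

/-- The commutator of the derivatives is the derivative along `[u,v]`, so `curvFun` is the
derivative along `[u,v] - D_u v + D_v u`. For a torsion-free Courant connection this section is not
zero but dual to `⟨D u, v⟩`. -/
theorem curvFun_eq (hT : D.IsTorsionFree) (u v : Sec EB F E) (f : C^∞⟮𝓘(ℝ, EB), M; ℝ⟯) :
    D.curvFun u v f p = ctr ε fun A => C.pairing p (D.toFun u p (e A p)) (v p) * lie C (e A) f p := by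
  have h : D.curvFun u v f = lie C (C.bracket u v - D.app u v + D.app v u) f := by
    rw [lie_add_left, lie_sub_left, lie_bracket', Connection.curvFun]; ring
  rw [h, hF.lie_eq hp]
  refine ctr_congr _ fun A => ?_
  congr 1
  have := hT u v (e A) p
  have e1 : (C.bracket u v - D.app u v + D.app v u) p =
    -(D.app u v p - D.app v u p - C.bracket u v p) := by
    rw [sec_add_apply, sec_sub_apply]; abel
  rw [e1, map_neg, LinearMap.neg_apply]
  rw [Connection.app_apply D (e A) u] at this
  linarith

theorem riem_symm (w z x y : Sec EB F E) : D.riem w z x y p = D.riem y x z w p := by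
  rw [hF.riem_eq hp, hF.riem_eq hp]
  simp only [mul_comm (C.pairing p (D.toFun x p _) (y p))]
  ring

theorem riem_add_three (w z x x' y : Sec EB F E) :
    D.riem w z (x + x') y p = D.riem w z x y p + D.riem w z x' y p := by
  simp only [hF.riem_eq hp, D.curv_add_left, D.curv_add_right, sec_add_apply, D.add, map_add,
    LinearMap.add_apply, add_mul, ctr_add]
  ring

theorem riem_add_four (w z x y y' : Sec EB F E) :
    D.riem w z x (y + y') p = D.riem w z x y p + D.riem w z x y' p := by
  have h : D.curv x (y + y') z p = D.curv x y z p + D.curv x y' z p := by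
    rw [D.curv_swap (y + y'), D.curv_add_left, D.curv_swap x y, D.curv_swap x y', neg_add, neg_neg,
      neg_neg]; rfl
  simp only [hF.riem_eq hp, h, sec_add_apply, map_add,
    LinearMap.add_apply, add_mul, ctr_add]
  ring

theorem riem_fsmul_four (f : C^∞⟮𝓘(ℝ, EB), M; ℝ⟯) (w z x y : Sec EB F E) :
    D.riem w z x (fsmul f y) p = f p * D.riem w z x y p := by
  have h : D.curv x (fsmul f y) z p = f p • D.curv x y z p := by
    have e1 : D.curv x y z = -D.curv y x z := D.curv_swap y x z
    have e2 : D.curv x (fsmul f y) z = -D.curv (fsmul f y) x z := D.curv_swap _ _ _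
    rw [e1, e2, D.curv_fsmul_left]
    exact (smul_neg _ _).symm
  simp only [hF.riem_eq hp, h, fsmul_apply, map_smul, smul_eq_mul, LinearMap.smul_apply]
  simp only [mul_assoc, ctr_mul_left]
  ring

/-- Two terms fail to be linear over functions: `curv z w (f x)`, by `curvFun`, and the product of
covariant derivatives, by the differential of `f`. `curvFun_eq` identifies the two defects. -/
theorem riem_fsmul_three (hT : D.IsTorsionFree) (f : C^∞⟮𝓘(ℝ, EB), M; ℝ⟯) (w z x y : Sec EB F E) :
    D.riem w z (fsmul f x) y p = f p * D.riem w z x y p := by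
  have h : ∀ A, D.toFun (fsmul f x) p (e A p) = f p • D.toFun x p (e A p) + lie C (e A) f p • x p :=
    fun A => D.leibniz f x p (e A p)
  simp only [hF.riem_eq hp, D.curv_fsmul_left, D.curv_fsmul_right, fsmul_apply, sec_add_apply, h, map_add,
    map_smul, smul_eq_mul, LinearMap.smul_apply, LinearMap.add_apply, hF.curvFun_eq hp hT, add_mul,
    ctr_add]
  have e1 : ctr ε (fun A => lie C (e A) f p * C.pairing p (x p) (y p) *
      C.pairing p (D.toFun z p (e A p)) (w p)) =
      ctr ε (fun A => C.pairing p (D.toFun z p (e A p)) (w p) * lie C (e A) f p) *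
        C.pairing p (y p) (x p) := by
    rw [← ctr_mul_right]
    exact ctr_congr _ fun A => by rw [C.pairing_symm p (x p)]; ring
  rw [e1]
  simp only [mul_assoc, ctr_mul_left]
  ring

theorem riem_three (hT : D.IsTorsionFree) (w z x y : Sec EB F E) : D.riem w z x y p =
    ctr ε fun A => C.pairing p (x p) (e A p) * D.riem w z (e A) y p :=
  hF.tensorial hp (fun x => D.riem w z x y p) (fun _ _ => hF.riem_add_three hp _ _ _ _ _)
    (fun _ _ => hF.riem_fsmul_three hp hT _ _ _ _ _) x

theorem riem_four (w z x y : Sec EB F E) : D.riem w z x y p =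
    ctr ε fun A => C.pairing p (y p) (e A p) * D.riem w z x (e A) p :=
  hF.tensorial hp (fun y => D.riem w z x y p) (fun _ _ => hF.riem_add_four hp _ _ _ _ _)
    (fun _ _ => hF.riem_fsmul_four hp _ _ _ _ _) y

/-- The pair symmetry `riem_symm` transports tensoriality from the last two arguments to the first
two. -/
theorem riem_two (hT : D.IsTorsionFree) (w z x y : Sec EB F E) : D.riem w z x y p =
    ctr ε fun A => C.pairing p (z p) (e A p) * D.riem w (e A) x y p := by
  rw [hF.riem_symm hp, hF.riem_three hp hT]
  exact ctr_congr _ fun A => by rw [hF.riem_symm hp]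

theorem riem_one (w z x y : Sec EB F E) : D.riem w z x y p =
    ctr ε fun A => C.pairing p (w p) (e A p) * D.riem (e A) z x y p := by
  rw [hF.riem_symm hp, hF.riem_four hp]
  exact ctr_congr _ fun A => by rw [hF.riem_symm hp]

/-- The components of the full Ricci tensor. -/
theorem fullRicci_eq_riem (hT : D.IsTorsionFree) (v u : E p) : D.fullRicci p v u =
    ctr2 ε fun A B => C.pairing p v (e A p) * C.pairing p u (e B p) *
      ctr ε fun K => D.riem (e K) (e A) (e K) (e B) p := by
  -- By tensoriality the arbitrary extensions used in `riemAt` enter only through their values at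
  -- `p`.
  have h0 : ∀ a v b u : E p, D.riemAt p a v b u = ctr2 ε fun A B =>
      C.pairing p v (e A p) * C.pairing p u (e B p) * ctr2 ε fun K L =>
        C.pairing p a (e K p) * C.pairing p b (e L p) * D.riem (e K) (e A) (e L) (e B) p := by
    intro a v b u
    rw [Connection.riemAt, hF.riem_two hp hT, extSec_apply]
    unfold ctr2
    refine ctr_congr _ fun A => ?_
    rw [hF.riem_four hp, extSec_apply, ← ctr_mul_left]
    refine ctr_congr _ fun B => ?_
    rw [hF.riem_one hp, extSec_apply, ← mul_assoc]
    congr 1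
    refine ctr_congr _ fun K => ?_
    rw [hF.riem_three hp hT, extSec_apply, ← ctr_mul_left]
    exact ctr_congr _ fun L => by ring
  have h1 : ∀ K L, ∑ α, C.pairing p (coframe C p α) (e K p) * C.pairing p (frame F p α) (e L p) =
      if K = L then ε K else 0 := fun K L => by
    rw [← hF.orth p hp K L]
    conv_rhs => rw [← sum_coframe (C := C) p (e K p)]
    simp [map_sum, LinearMap.sum_apply]
  have h2 : ∀ r : ι → ι → ℝ, ∑ α, ctr2 ε (fun K L => C.pairing p (coframe C p α) (e K p) *
      C.pairing p (frame F p α) (e L p) * r K L) = ctr ε fun K => r K K := fun r => by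
    simp only [ctr2, ctr, Finset.mul_sum]
    rw [Finset.sum_comm]
    refine Finset.sum_congr rfl fun K _ => ?_
    rw [Finset.sum_comm]
    have : ∀ L, ∑ α, ε K * (ε L * (C.pairing p (coframe C p α) (e K p) *
      C.pairing p (frame F p α) (e L p) * r K L)) = ε K * ε L * r K L * if K = L then ε K else 0 := by
      intro L
      rw [← h1, Finset.mul_sum]
      exact Finset.sum_congr rfl fun α _ => by ring
    simp only [this, mul_ite, mul_zero, Finset.sum_ite_eq, Finset.mem_univ, if_true]
    linear_combination ε K * r K K * hF.sq K
  unfold Connection.fullRicci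
  simp only [h0, sum_ctr2, ← Finset.mul_sum]
  unfold ctr2
  refine ctr_congr _ fun A => ctr_congr _ fun B => ?_
  have h3 := h2 fun K L => D.riem (e K) (e A) (e L) (e B) p
  rw [sum_ctr2] at h3
  exact congrArg (HMul.hMul (C.pairing p v (e A p) * C.pairing p u (e B p))) h3

end IsFrameOn

/-- The algebraic identity behind the frame formula for the full Ricci tensor. -/
theorem ric2_algebra {ι : Type*} [Fintype ι] (ε : ι → ℝ) (g : ι → ι → ι → ℝ) (dg : ι → ι → ι → ι → ℝ)
    (d : ι → ℝ) (d' : ι → ι → ℝ) (ha : ∀ A B K, g A B K = -g A K B)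
    (hda : ∀ L A B K, dg L A B K = -dg L A K B) (htr : ∀ B, ctr ε (fun A => g A B A) = d B)
    (hdtr : ∀ B A, ctr ε (fun K => dg B K A K) = d' B A) (A B : ι) :
    ctr ε (fun K => (dg K B A K - dg B K A K - ctr ε (fun L => g B A L * g K K L)
        + ctr ε (fun L => g K A L * g B K L) - ctr ε (fun L => g K B L * g L A K)
        + ctr ε (fun L => g B K L * g L A K))
      + (dg A K K B - dg K A K B - ctr ε (fun L => g K K L * g A B L)
        + ctr ε (fun L => g A K L * g K B L) - ctr ε (fun L => g A K L * g L K B)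
        + ctr ε (fun L => g K A L * g L K B))
      - ctr ε fun L => g L K B * g L A K) =
    ctr ε (fun K => dg K A B K + dg K B A K + d K * (g A B K + g B A K)) - d' A B - d' B A
      + ctr2 ε (fun K L => g K A L * g K B L) - 2 * ctr2 ε fun K L => g K A L * g L B K := by
  have hK : ∀ L, ctr ε (fun K => g K K L) = -d L := fun L => by
    rw [← htr, ← ctr_neg]; exact ctr_congr _ fun K => ha _ _ _
  have e1 : ctr2 ε (fun K L => g B A L * g K K L) = -ctr ε fun L => d L * g B A L := by
    rw [ctr2_swap, ← ctr_neg]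
    refine ctr_congr _ fun L => ?_
    rw [ctr_mul_left, hK]; ring
  have e2 : ctr2 ε (fun K L => g B K L * g L A K) = -ctr2 ε fun K L => g K A L * g B K L := by
    rw [ctr2_swap, ← ctr2_neg]
    exact ctr2_congr _ fun L K => by rw [ha B]; ring
  have e3 : ctr2 ε (fun K L => g K B L * g L A K) = ctr2 ε fun K L => g K A L * g L B K := by
    rw [ctr2_swap]
    exact ctr2_congr _ fun L K => by ring
  have e4 : ctr2 ε (fun K L => g K K L * g A B L) = -ctr ε fun L => d L * g A B L := by
    rw [ctr2_swap, ← ctr_neg]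
    refine ctr_congr _ fun L => ?_
    rw [ctr_mul_right, hK]; ring
  have e5 : ctr2 ε (fun K L => g A K L * g L K B) = ctr2 ε fun K L => g A K L * g K B L := by
    rw [ctr2_swap]
    exact ctr2_congr _ fun L K => by rw [ha A, ha L]; ring
  have e6 : ctr2 ε (fun K L => g K A L * g L K B) = -ctr2 ε fun K L => g K A L * g L B K := by
    rw [← ctr2_neg]
    exact ctr2_congr _ fun L K => by rw [ha K L B]; ring
  have e7 : ctr2 ε (fun K L => g L K B * g L A K) = -ctr2 ε fun K L => g K A L * g K B L := by
    rw [ctr2_swap, ← ctr2_neg]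
    exact ctr2_congr _ fun L K => by rw [ha L K B]; ring
  have e8 : ctr ε (fun K => dg A K K B) = -d' A B := by
    rw [← hdtr, ← ctr_neg]; exact ctr_congr _ fun K => hda _ _ _ _
  have e9 : ctr ε (fun K => dg K A K B) = -ctr ε fun K => dg K A B K := by
    rw [← ctr_neg]; exact ctr_congr _ fun K => hda _ _ _ _
  unfold ctr2 at *
  simp only [ctr_add, ctr_sub, mul_add, e1, e2, e3, e4, e5, e6, e7, e8, e9, hdtr]
  ring

/-- The connection coefficients of a frame. -/
def conFun {ι : Type*} (D : Connection C) (e : ι → Sec EB F E) (p : M) (A B K : ι) :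
    SmoothGerm EB p := germ p (pair C (D.app (e A) (e B)) (e K))

theorem germEv_der {ι : Type*} (e : ι → Sec EB F E) (ε : ι → ℝ) (pos : ι → Bool) (p : M)
    (f : C^∞⟮𝓘(ℝ, EB), M; ℝ⟯) (A : ι) :
    germEv p ((frameCalc C e ε pos p).der A (germ p f)) = lie C (e A) f p := by
  show germEv p (germ p _) = _
  rw [germEv_germ]

theorem germEv_ctr {ι : Type*} [Fintype ι] (e : ι → Sec EB F E) (ε : ι → ℝ) (pos : ι → Bool) (p : M)
    (f : ι → SmoothGerm EB p) :
    germEv p (ctr (frameCalc C e ε pos p).ε f) = ctr ε fun A => germEv p (f A) := by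
  rw [map_ctr]
  congr 1

theorem germEv_ctr2 {ι : Type*} [Fintype ι] (e : ι → Sec EB F E) (ε : ι → ℝ) (pos : ι → Bool) (p : M)
    (f : ι → ι → SmoothGerm EB p) :
    germEv p (ctr2 (frameCalc C e ε pos p).ε f) = ctr2 ε fun A B => germEv p (f A B) := by
  simp only [ctr2, germEv_ctr]

/-! ### The full Ricci tensor in terms of connection coefficients -/

namespace IsFrameOn

variable {ι : Type*} [Fintype ι] [DecidableEq ι] {U : Set M} {e : ι → Sec EB F E} {ε : ι → ℝ}
  (hF : IsFrameOn C U e ε) {p : M} (hp : p ∈ U) {D : Connection C}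
include hF hp

theorem pairing_curv (w x y z : ι) : C.pairing p (e w p) (D.curv (e x) (e y) (e z) p) =
    lie C (e x) (pair C (D.app (e y) (e z)) (e w)) p - lie C (e y) (pair C (D.app (e x) (e z)) (e w)) p
    - ctr ε (fun L => pair C (D.app (e y) (e z)) (e L) p * pair C (D.app (e x) (e w)) (e L) p)
    + ctr ε (fun L => pair C (D.app (e x) (e z)) (e L) p * pair C (D.app (e y) (e w)) (e L) p)
    - ctr ε (fun L => pair C (D.app (e x) (e y)) (e L) p * pair C (D.app (e L) (e z)) (e w) p)
    + ctr ε (fun L => pair C (D.app (e y) (e x)) (e L) p * pair C (D.app (e L) (e z)) (e w) p) := by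
  have h1 : ∀ x y z, pair C (D.app (e x) (D.app (e y) (e z))) (e w) p =
      lie C (e x) (pair C (D.app (e y) (e z)) (e w)) p -
      ctr ε (fun L => pair C (D.app (e y) (e z)) (e L) p * pair C (D.app (e x) (e w)) (e L) p) := by
    intro x y z
    have h : _ = pair C (D.app (e x) (D.app (e y) (e z))) (e w) p +
      pair C (D.app (e y) (e z)) (D.app (e x) (e w)) p :=
      DFunLike.congr_fun (D.lie_pair_app (e x) (D.app (e y) (e z)) (e w)) p
    rw [h, pair_apply (D.app (e y) (e z)) (D.app (e x) (e w)), hF.pair_eq hp]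
    simp only [pair_apply]
    ring
  have h2 : ∀ x y z, pair C (D.app (D.app (e x) (e y)) (e z)) (e w) p =
      ctr ε (fun L => pair C (D.app (e x) (e y)) (e L) p * pair C (D.app (e L) (e z)) (e w) p) := by
    intro x y z
    rw [pair_apply, D.app_apply, hF.span p hp (D.app (e x) (e y) p)]
    simp only [map_sum, map_smul, LinearMap.sum_apply, LinearMap.smul_apply, smul_eq_mul, ctr, mul_assoc]
    rfl
  have h3 : C.pairing p (e w p) (D.curv (e x) (e y) (e z) p) =
      pair C (D.app (e x) (D.app (e y) (e z))) (e w) p - pair C (D.app (D.app (e x) (e y)) (e z)) (e w) p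
      - (pair C (D.app (e y) (D.app (e x) (e z))) (e w) p
        - pair C (D.app (D.app (e y) (e x)) (e z)) (e w) p) := by
    rw [C.pairing_symm]
    simp only [Connection.curv, sec_sub_apply, map_sub, LinearMap.sub_apply, pair_apply]
  rw [h3, h1, h1, h2, h2]
  ring

theorem conFun_anti (A B K : ι) : conFun D e p A B K = -conFun D e p A K B := by
  unfold conFun
  rw [← map_neg, germ_eq]
  filter_upwards [hF.isOpen.mem_nhds hp] with x hx
  have h : _ = pair C (D.app (e A) (e B)) (e K) x + pair C (e B) (D.app (e A) (e K)) x :=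
    DFunLike.congr_fun (D.lie_pair_app (e A) (e B) (e K)) x
  rw [hF.lie_pair_frame hx, pair_comm (e B)] at h
  exact eq_neg_of_add_eq_zero_left h.symm

theorem conFun_cyc (hT : D.IsTorsionFree) (A B K : ι) :
    conFun D e p A B K + conFun D e p B K A + conFun D e p K A B = strFun C e p A B K := by
  rw [hF.conFun_anti hp B K A]
  unfold conFun strFun
  rw [← map_neg, ← map_add, ← map_add, germ_eq]
  refine Filter.Eventually.of_forall fun x => ?_
  have h := hT (e A) (e B) (e K) x
  show C.pairing x (D.app (e A) (e B) x) (e K x) + -(C.pairing x (D.app (e B) (e A) x) (e K x)) +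
    C.pairing x (D.app (e K) (e A) x) (e B x) = C.pairing x (C.bracket (e A) (e B) x) (e K x)
  simp only [map_sub, LinearMap.sub_apply] at h
  linarith

theorem conFun_tr {δ : Sec EB F E → C^∞⟮𝓘(ℝ, EB), M; ℝ⟯}
    (hd : ∀ u x, LinearMap.trace ℝ (E x) (D.toFun u x) = δ u x) (pos : ι → Bool) (B : ι) :
    ctr (frameCalc C e ε pos p).ε (fun A => conFun D e p A B A) = germ p (δ (e B)) := by
  show ctr (fun A => germ p (cst EB M (ε A))) (fun A => germ p _) = _
  rw [← map_ctr, germ_eq]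
  filter_upwards [hF.isOpen.mem_nhds hp] with x hx
  rw [ctr_apply, ← hd, hF.trace_eq hx]
  rfl

/-- The components of the full Ricci tensor in terms of the connection coefficients. -/
theorem two_mul_ctr_riem {δ : Sec EB F E → C^∞⟮𝓘(ℝ, EB), M; ℝ⟯}
    (hd : ∀ u x, LinearMap.trace ℝ (E x) (D.toFun u x) = δ u x) (pos : ι → Bool) (A B : ι) :
    2 * ctr ε (fun K => D.riem (e K) (e A) (e K) (e B) p) = germEv p ((frameCalc C e ε pos p).ric2
      (fun A => germ p (δ (e A))) (conFun D e p) A B) := by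
  -- The traces of the coefficients hold as identities of germs; they may thus be differentiated
  -- before being evaluated at `p`, as the hypothesis on the traces of derivatives demands.
  have key := ric2_algebra ε (fun A B K => germEv p (conFun D e p A B K))
    (fun L A B K => germEv p ((frameCalc C e ε pos p).der L (conFun D e p A B K)))
    (fun A => δ (e A) p) (fun A B => lie C (e A) (δ (e B)) p)
    (fun A B K => by rw [hF.conFun_anti hp A B K, map_neg])
    (fun L A B K => by rw [hF.conFun_anti hp A B K, FrameCalculus.der_neg, map_neg])
    (fun B => by rw [← germEv_ctr e ε pos, hF.conFun_tr hp hd, germEv_germ])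
    (fun B A => by
      rw [← germEv_ctr e ε pos, ← FrameCalculus.der_ctr, hF.conFun_tr hp hd, germEv_der]) A B
  unfold FrameCalculus.ric2 FrameCalculus.dv
  simp only [map_sub, map_add, map_mul, germEv_ctr, germEv_ctr2, germEv_der, germEv_germ,
    FrameCalculus.der_add]
  rw [map_ofNat]
  refine Eq.trans ?_ (key.trans ?_)
  · rw [← ctr_mul_left]
    refine ctr_congr _ fun K => ?_
    rw [hF.riem_eq hp, hF.pairing_curv hp, hF.pairing_curv hp]
    simp only [conFun, germEv_germ, germEv_der]
    simp only [pair_apply, D.app_apply]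
    ring
  · rfl

end IsFrameOn

/-- A family of sections which is orthonormal near `p` and consists of eigenvectors of `P`. -/
structure IsOrthoNear (C : CourantAlgebroid EB F E) (P : ∀ x, Module.End ℝ (E x)) (p : M) {ι : Type}
    [DecidableEq ι] (e : ι → Sec EB F E) (ε s : ι → ℝ) : Prop where
  sign : ∀ A, ε A = 1 ∨ ε A = -1
  eig : ∀ A, s A = 1 ∨ s A = -1
  orth : ∀ᶠ x in 𝓝 p, ∀ A B, C.pairing x (e A x) (e B x) = if A = B then ε A else 0
  map : ∀ᶠ x in 𝓝 p, ∀ A, P x (e A x) = s A • e A x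

/-! ### Existence of orthonormal frames of eigenvectors -/

section Extension

variable {P : ∀ x, Module.End ℝ (E x)} (hP : ∀ x a b, C.pairing x (P x a) b = C.pairing x a (P x b))
  (hP2 : ∀ x a, P x (P x a) = a) {p : M} {ι : Type} [Fintype ι] [DecidableEq ι]
  {e : ι → Sec EB F E} {ε s : ι → ℝ}
include hP hP2

/-- The orthogonal complement of the given vectors is invariant under `P`, nonzero and
nondegenerate, so it contains a non-null vector. Its two eigencomponents are orthogonal, hence one
of them is non-null. -/
theorem IsOrthoNear.exists_eigenvector (h : IsOrthoNear C P p e ε s)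
    (hc : Fintype.card ι < Module.finrank ℝ (E p)) :
    ∃ (b : E p) (t : ℝ), (t = 1 ∨ t = -1) ∧ P p b = t • b ∧ C.pairing p b b ≠ 0 ∧
      ∀ A, C.pairing p b (e A p) = 0 := by
  have : FiniteDimensional ℝ (E p) := VectorBundle.finiteDimensional ℝ F E p
  have ho := h.orth.self_of_nhds
  have hm := h.map.self_of_nhds
  have hsq : ∀ A, ε A * ε A = 1 := fun A => by rcases h.sign A with h | h <;> rw [h] <;> norm_num
  have proj : ∀ v : E p, ∃ w : E p, (∀ A, C.pairing p w (e A p) = 0) ∧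
      v - w ∈ Submodule.span ℝ (range fun A => e A p) := fun v => by
    refine ⟨v - ∑ A, (ε A * C.pairing p v (e A p)) • e A p, fun B => ?_, ?_⟩
    · simp only [map_sub, LinearMap.sub_apply, map_sum, map_smul, LinearMap.sum_apply,
        LinearMap.smul_apply, ho, smul_eq_mul, mul_ite, mul_zero, Finset.sum_ite_eq', Finset.mem_univ,
        if_true]
      linear_combination -C.pairing p v (e B p) * hsq B
    · rw [sub_sub_cancel]
      exact Submodule.sum_mem _ fun A _ => Submodule.smul_mem _ _ (Submodule.subset_span ⟨A, rfl⟩)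
  have horth : ∀ w : E p, (∀ A, C.pairing p w (e A p) = 0) →
      ∀ z ∈ Submodule.span ℝ (range fun A => e A p), C.pairing p w z = 0 := fun w hw z hz => by
    induction hz using Submodule.span_induction with
    | mem z hz => obtain ⟨A, rfl⟩ := hz; exact hw A
    | zero => simp
    | add a b _ _ ha hb => rw [map_add, ha, hb, add_zero]
    | smul r a _ ha => rw [map_smul, ha, smul_zero]
  have hne : Submodule.span ℝ (range fun A => e A p) ≠ ⊤ := fun htop => by
    have := finrank_range_le_card (R := ℝ) (fun A => e A p)
    rw [Set.finrank, htop, finrank_top] at this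
    omega
  obtain ⟨v, hv⟩ : ∃ v, v ∉ Submodule.span ℝ (range fun A => e A p) := by
    by_contra! hcon
    exact hne (Submodule.eq_top_iff'.2 hcon)
  obtain ⟨w, hw, hvw⟩ := proj v
  have hw0 : w ≠ 0 := fun h0 => hv (by rwa [h0, sub_zero] at hvw)
  obtain ⟨z, hz⟩ : ∃ z, C.pairing p w z ≠ 0 := by
    by_contra! hcon
    exact hw0 ((C.pairing_nondegenerate p).1 w hcon)
  obtain ⟨z', hz', hzz⟩ := proj z
  have hwz : C.pairing p w z' ≠ 0 := by
    have := horth w hw _ hzz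
    rw [map_sub, sub_eq_zero] at this
    rwa [← this]
  -- Polarization: if `w` and `z'` are null with nonzero product, then their sum is not null.
  obtain ⟨a, ha, haa⟩ : ∃ a : E p, (∀ A, C.pairing p a (e A p) = 0) ∧ C.pairing p a a ≠ 0 := by
    by_cases h1 : C.pairing p w w = 0
    · by_cases h2 : C.pairing p z' z' = 0
      · refine ⟨w + z', fun A => by simp [hw, hz'], ?_⟩
        have : C.pairing p (w + z') (w + z') = 2 * C.pairing p w z' := by
          simp only [map_add, LinearMap.add_apply, h1, h2, C.pairing_symm p z' w]; ring
        rw [this]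
        exact mul_ne_zero two_ne_zero hwz
      · exact ⟨z', hz', h2⟩
    · exact ⟨w, hw, h1⟩
  have hPa : ∀ A, C.pairing p (P p a) (e A p) = 0 := fun A => by
    rw [hP, hm, map_smul, ha, smul_zero]
  have hsum : C.pairing p a a = C.pairing p ((1 / 2 : ℝ) • (a + P p a)) ((1 / 2 : ℝ) • (a + P p a)) +
      C.pairing p ((1 / 2 : ℝ) • (a - P p a)) ((1 / 2 : ℝ) • (a - P p a)) := by
    simp only [map_smul, map_add, map_sub, LinearMap.smul_apply, LinearMap.add_apply, LinearMap.sub_apply,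
      smul_eq_mul, hP, hP2]
    ring
  by_cases h1 : C.pairing p ((1 / 2 : ℝ) • (a + P p a)) ((1 / 2 : ℝ) • (a + P p a)) = 0
  · refine ⟨(1 / 2 : ℝ) • (a - P p a), -1, Or.inr rfl, ?_, ?_, fun A => ?_⟩
    · rw [map_smul, map_sub, hP2]; module
    · intro h2; exact haa (by rw [hsum, h1, h2, add_zero])
    · simp [ha, hPa]
  · refine ⟨(1 / 2 : ℝ) • (a + P p a), 1, Or.inl rfl, ?_, h1, fun A => ?_⟩
    · rw [map_smul, map_add, hP2]; module
    · simp [ha, hPa]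

/-- Near a point where `N` is nonzero, `|N|^{-1/2}` is smooth and the sign of `N` is constant; this
normalizes a non-null section. -/
theorem exists_invSqrt {p : M} (N : C^∞⟮𝓘(ℝ, EB), M; ℝ⟯) (hN : N p ≠ 0) :
    ∃ h : C^∞⟮𝓘(ℝ, EB), M; ℝ⟯, ∀ᶠ x in 𝓝 p, h x * (h x * N x) = SignType.sign (N p) := by
  have hc : ContinuousAt N p := N.contMDiff.continuous.continuousAt
  have hne : ∀ᶠ x in 𝓝 p, N x ≠ 0 := hc.eventually_ne hN
  obtain ⟨h, hh⟩ := exists_contMDiffMap_eventuallyEq (EB := EB) (p := p)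
    (g := fun x => (Real.sqrt |N x|)⁻¹) (by
      filter_upwards [hne] with x hx
      have h1 : ContDiffAt ℝ ∞ (fun r : ℝ => (Real.sqrt |r|)⁻¹) (N x) :=
        ((contDiffAt_abs hx).sqrt (abs_pos.2 hx).ne').inv (Real.sqrt_pos.2 (abs_pos.2 hx)).ne'
      exact h1.contMDiffAt.comp x N.contMDiff.contMDiffAt)
  have hsgn : ∀ᶠ x in 𝓝 p, SignType.sign (N x) = SignType.sign (N p) := by
    rcases lt_or_gt_of_ne hN with h0 | h0
    · filter_upwards [hc.eventually_lt_const h0] with x hx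
      rw [sign_neg hx, sign_neg h0]
    · filter_upwards [hc.eventually_const_lt h0] with x hx
      rw [sign_pos hx, sign_pos h0]
  refine ⟨h, ?_⟩
  filter_upwards [hh, hne, hsgn] with x h1 h2 h3
  rw [h1, ← h3]
  have h4 := abs_pos.2 h2
  have h5 := Real.mul_self_sqrt h4.le
  have h6 := (Real.sqrt_pos.2 h4).ne'
  have h7 : (SignType.sign (N x) : ℝ) * |N x| = N x := by
    rw [mul_comm]; exact abs_mul_sign _
  field_simp
  rw [sq, h5, mul_comm, h7]

/-- A Gram–Schmidt step. The projection to the eigenbundle and the projection off the given sections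
leave the value `b` at `p` unchanged, so the result is non-null near `p` and can be normalized. The
second projection respects the eigenbundle because the given sections are themselves eigenvectors.
-/
theorem IsOrthoNear.extend (hPs : ∀ v : Sec EB F E, ∃ w : Sec EB F E, ∀ x, w x = P x (v x))
    (h : IsOrthoNear C P p e ε s) (hc : Fintype.card ι < Module.finrank ℝ (E p)) :
    ∃ (e' : Option ι → Sec EB F E) (ε' s' : Option ι → ℝ), IsOrthoNear C P p e' ε' s' := by
  obtain ⟨b, t, ht, hb, hbb, hbe⟩ := h.exists_eigenvector hP hP2 hc
  obtain ⟨v, hv⟩ := exists_sec (EB := EB) (F := F) p b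
  obtain ⟨w, hw⟩ := hPs v
  have htt : t * t = 1 := by rcases ht with h | h <;> rw [h] <;> norm_num
  set v1 : Sec EB F E := fsmul (cst EB M (1 / 2)) (v + fsmul (cst EB M t) w) with hv1
  have hv1x : ∀ x, v1 x = (1 / 2 : ℝ) • (v x + t • P x (v x)) := fun x => by
    rw [hv1, fsmul_apply, sec_add_apply, fsmul_apply, cst_apply, cst_apply, hw]
  have hPv1 : ∀ x, P x (v1 x) = t • v1 x := fun x => by
    rw [hv1x, map_smul, map_add, map_smul, hP2]
    rcases ht with h | h <;> rw [h] <;> module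
  have hv1p : v1 p = b := by
    rw [hv1x, hv, hb, smul_smul, htt, one_smul]; module
  set v2 : Sec EB F E := v1 - ∑ A, fsmul (cst EB M (ε A) * pair C v1 (e A)) (e A) with hv2
  have hv2x : ∀ x, v2 x = v1 x - ∑ A, (ε A * C.pairing x (v1 x) (e A x)) • e A x := fun x => by
    rw [hv2, sec_sub_apply, sec_sum_apply]
    rfl
  have hv2p : v2 p = b := by rw [hv2x, hv1p]; simp [hbe]
  have hsq : ∀ A, ε A * ε A = 1 := fun A => by rcases h.sign A with h | h <;> rw [h] <;> norm_num
  have ho2 : ∀ᶠ x in 𝓝 p, ∀ B, C.pairing x (v2 x) (e B x) = 0 := by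
    filter_upwards [h.orth] with x ho B
    rw [hv2x]
    simp only [map_sub, LinearMap.sub_apply, map_sum, map_smul, LinearMap.sum_apply,
        LinearMap.smul_apply, ho, smul_eq_mul, mul_ite, mul_zero, Finset.sum_ite_eq', Finset.mem_univ,
        if_true]
    linear_combination -C.pairing x (v1 x) (e B x) * hsq B
  have hP2v : ∀ᶠ x in 𝓝 p, P x (v2 x) = t • v2 x := by
    filter_upwards [h.map] with x hm
    rw [hv2x, map_sub, hPv1, smul_sub, map_sum, Finset.smul_sum]
    congr 1
    refine Finset.sum_congr rfl fun A _ => ?_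
    rw [map_smul, hm, smul_smul, smul_smul]
    have h1 := hP x (v1 x) (e A x)
    rw [hPv1, hm, map_smul, map_smul, LinearMap.smul_apply, smul_eq_mul, smul_eq_mul] at h1
    congr 1
    linear_combination -ε A * h1
  obtain ⟨g, hg⟩ := exists_invSqrt (P := P) hP hP2 (p := p) (pair C v2 v2) (by rwa [pair_apply, hv2p])
  have hsgn : ((SignType.sign (pair C v2 v2 p) : SignType) : ℝ) = 1 ∨
      ((SignType.sign (pair C v2 v2 p) : SignType) : ℝ) = -1 := by
    have h0 : pair C v2 v2 p ≠ 0 := by rwa [pair_apply, hv2p]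
    rcases lt_or_gt_of_ne h0 with h0 | h0
    · right; simp [sign_neg h0]
    · left; simp [sign_pos h0]
  refine ⟨fun A => A.elim (fsmul g v2) e, fun A => A.elim (SignType.sign (pair C v2 v2 p) : ℝ) ε,
    fun A => A.elim t s, ?_, ?_, ?_, ?_⟩
  · rintro (_ | A)
    · exact hsgn
    · exact h.sign A
  · rintro (_ | A)
    · exact ht
    · exact h.eig A
  · filter_upwards [h.orth, ho2, hg] with x h1 h2 h3
    rintro (_ | A) (_ | B)
    · simp only [Option.elim, fsmul_apply, map_smul, LinearMap.smul_apply, smul_eq_mul, if_true]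
      exact h3
    · simp [fsmul_apply, h2]
    · simp [fsmul_apply, C.pairing_symm x (e A x), h2]
    · simpa using h1 A B
  · filter_upwards [h.map, hP2v] with x h1 h2
    rintro (_ | A)
    · show P x (g x • v2 x) = t • (g x • v2 x)
      rw [map_smul, h2, smul_comm]
    · exact h1 A

theorem exists_isOrthoNear (hPs : ∀ v : Sec EB F E, ∃ w : Sec EB F E, ∀ x, w x = P x (v x)) (p : M)
    (n : ℕ) (hn : n ≤ Module.finrank ℝ (E p)) :
    ∃ (ι : Type) (_ : Fintype ι) (_ : DecidableEq ι) (e : ι → Sec EB F E) (ε s : ι → ℝ),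
      Fintype.card ι = n ∧ IsOrthoNear C P p e ε s := by
  induction n with
  | zero =>
    exact ⟨Empty, inferInstance, inferInstance, Empty.elim, Empty.elim, Empty.elim, rfl,
      fun A => A.elim, fun A => A.elim, Filter.Eventually.of_forall fun x A => A.elim,
      Filter.Eventually.of_forall fun x A => A.elim⟩
  | succ n ih =>
    obtain ⟨ι, _, _, e, ε, s, hc, h⟩ := ih (by omega)
    obtain ⟨e', ε', s', hext⟩ := h.extend hP hP2 hPs (by omega)
    exact ⟨Option ι, inferInstance, inferInstance, e', ε', s', by simp [hc], hext⟩

/-- Existence of local orthonormal frames of eigenvectors. -/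
theorem exists_isFrameOn (hPs : ∀ v : Sec EB F E, ∃ w : Sec EB F E, ∀ x, w x = P x (v x)) (p : M) :
    ∃ (ι : Type) (_ : Fintype ι) (_ : DecidableEq ι) (U : Set M) (e : ι → Sec EB F E) (ε : ι → ℝ)
      (pos : ι → Bool), p ∈ U ∧ IsFrameOn C U e ε ∧
        ∀ x ∈ U, ∀ A, P x (e A x) = (if pos A then (1 : ℝ) else -1) • e A x := by
  classical
  obtain ⟨ι, _, _, e, ε, s, hc, h⟩ := exists_isOrthoNear hP hP2 hPs p _ le_rfl
  obtain ⟨U, hU, hUo, hpU⟩ := eventually_nhds_iff.1 (h.orth.and h.map)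
  refine ⟨ι, inferInstance, inferInstance, U, e, ε, fun A => decide (s A = 1), hpU, ⟨hUo, fun A => ?_,
    fun x hx => (hU x hx).1, fun x hx v => ?_⟩, fun x hx A => ?_⟩
  · rcases h.sign A with h | h <;> rw [h] <;> norm_num
  · have : FiniteDimensional ℝ (E x) := VectorBundle.finiteDimensional ℝ F E x
    have hsq : ∀ A, ε A * ε A = 1 := fun A => by rcases h.sign A with h | h <;> rw [h] <;> norm_num
    have ho := (hU x hx).1
    have hli : LinearIndependent ℝ fun A => e A x := by
      rw [Fintype.linearIndependent_iff]
      intro g hg B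
      have h1 := congrArg (fun v => C.pairing x v (e B x)) hg
      simp only [map_sum, map_smul, LinearMap.sum_apply, LinearMap.smul_apply, ho, smul_eq_mul, mul_ite,
        mul_zero, Finset.sum_ite_eq', Finset.mem_univ, if_true, map_zero, LinearMap.zero_apply] at h1
      linear_combination ε B * h1 - g B * hsq B
    have hfr : Module.finrank ℝ (E x) = Module.finrank ℝ (E p) := by
      rw [VectorBundle.finrank_eq ℝ F E, VectorBundle.finrank_eq ℝ F E]
    have hspan := hli.span_eq_top_of_card_eq_finrank' (by rw [hc, hfr])
    rw [← sub_eq_zero]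
    refine (C.pairing_nondegenerate x).1 _ fun z => ?_
    have hz : z ∈ Submodule.span ℝ (range fun A => e A x) := hspan ▸ Submodule.mem_top
    induction hz using Submodule.span_induction with
    | mem z hz =>
      obtain ⟨B, rfl⟩ := hz
      simp only [map_sub, LinearMap.sub_apply, map_sum, map_smul, LinearMap.sum_apply,
        LinearMap.smul_apply, ho, smul_eq_mul, mul_ite, mul_zero, Finset.sum_ite_eq', Finset.mem_univ,
        if_true]
      linear_combination -C.pairing x v (e B x) * hsq B
    | zero => simp
    | add a b _ _ ha hb => rw [map_add, ha, hb, add_zero]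
    | smul r a _ ha => rw [map_smul, ha, smul_zero]
  · rw [(hU x hx).2]
    congr 1
    rcases h.eig A with h | h <;> simp [h]

end Extension

/-- A section with smooth pairings is smooth. -/
theorem exists_sec_of_pairing (C : CourantAlgebroid EB F E) (s : ∀ x, E x) (h : ∀ v : Sec EB F E,
    ContMDiff 𝓘(ℝ, EB) 𝓘(ℝ, ℝ) ∞ fun x => C.pairing x (s x) (v x)) :
    ∃ S : Sec EB F E, ∀ x, S x = s x := by
  refine ⟨⟨s, fun p => ?_⟩, fun x => rfl⟩
  -- With the identity in place of `G` one gets an orthonormal frame without any eigenvalue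
  -- condition. The coefficients of `s` in it are pairings, which are smooth.
  obtain ⟨ι, _, _, U, e, ε, -, hp, hF, -⟩ := exists_isFrameOn (C := C) (P := fun x => LinearMap.id)
    (fun _ _ _ => rfl) (fun _ _ => rfl) (fun v => ⟨v, fun _ => rfl⟩) p
  set S : Sec EB F E := ∑ A, fsmul (cst EB M (ε A) * ⟨_, h (e A)⟩) (e A) with hS
  refine S.contMDiff.contMDiffAt.congr_of_eventuallyEq ?_
  filter_upwards [hF.isOpen.mem_nhds hp] with x hx
  have : s x = S x := by
    rw [hS, sec_sum_apply]
    conv_lhs => rw [hF.span x hx (s x)]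
    refine Finset.sum_congr rfl fun A _ => ?_
    show _ = (cst EB M (ε A) x * C.pairing x (s x) (e A x)) • e A x
    rw [cst_apply]
  show Bundle.TotalSpace.mk' F x (s x) = Bundle.TotalSpace.mk' F x (S x)
  rw [this]

/-! ### The components of `G` and of its connections in a frame -/

variable (G : GenPseudometric C)

/-- The section `G v`. -/
def GenPseudometric.sec (v : Sec EB F E) : Sec EB F E :=
  (exists_sec_of_pairing C (fun x => G.toFun x (v x)) fun w => G.smooth v w).choose

theorem GenPseudometric.sec_apply (v : Sec EB F E) (x : M) : G.sec v x = G.toFun x (v x) :=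
  (exists_sec_of_pairing C (fun x => G.toFun x (v x)) fun w => G.smooth v w).choose_spec x

variable (C) in
/-- The section `𝒟 f`. -/
theorem exists_grad (f : C^∞⟮𝓘(ℝ, EB), M; ℝ⟯) : ∃ S : Sec EB F E, ∀ x, S x = calD C f x := by
  refine exists_sec_of_pairing C _ fun v => ?_
  have : (fun x => C.pairing x (calD C f x) (v x)) = lie C v f := by
    funext x
    have : FiniteDimensional ℝ (E x) := VectorBundle.finiteDimensional ℝ F E x
    exact LinearMap.BilinForm.apply_toDual_symm_apply (hB := C.pairing_nondegenerate x) _ _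
  rw [this]
  exact (lie C v f).contMDiff

/-- A frame on which `G` is diagonal. -/
def IsAdapted {ι : Type*} (G : GenPseudometric C) (U : Set M) (e : ι → Sec EB F E) (pos : ι → Bool) : Prop :=
  ∀ x ∈ U, ∀ A, G.toFun x (e A x) = (if pos A then (1 : ℝ) else -1) • e A x

theorem exists_adapted (p : M) :
    ∃ (ι : Type) (_ : Fintype ι) (_ : DecidableEq ι) (U : Set M) (e : ι → Sec EB F E) (ε : ι → ℝ)
      (pos : ι → Bool), p ∈ U ∧ IsFrameOn C U e ε ∧ IsAdapted G U e pos :=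
  exists_isFrameOn (C := C) (P := G.toFun) G.symm G.sq (fun v => ⟨G.sec v, G.sec_apply v⟩) p

/-- The components of `G`. -/
def metFun {ι : Type*} (e : ι → Sec EB F E) (p : M) (A B : ι) : SmoothGerm EB p :=
  germ p (pair C (G.sec (e A)) (e B))

theorem pair_sec_comm (u v : Sec EB F E) : pair C (G.sec u) v = pair C (G.sec v) u := by
  ext x
  show C.pairing x (G.sec u x) (v x) = C.pairing x (G.sec v x) (u x)
  rw [G.sec_apply, G.sec_apply, G.symm, C.pairing_symm]

theorem metFun_symm {ι : Type*} (e : ι → Sec EB F E) (p : M) (A B : ι) :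
    metFun G e p A B = metFun G e p B A := by
  rw [metFun, pair_sec_comm]; rfl

/-- A divergence operator representing `div_σ`. -/
structure Represents (σ : PosHalfDensity EB M) (δ : Sec EB F E → C^∞⟮𝓘(ℝ, EB), M; ℝ⟯) : Prop where
  isDivergence : IsDivergence C δ
  eq : ∀ u x, δ u x = divHD C σ u x

/-- The calculus of smooth functions in a frame. -/
def funCalc {ι : Type*} (C : CourantAlgebroid EB F E) (e : ι → Sec EB F E) (ε : ι → ℝ) (pos : ι → Bool) :
    FrameCalculus C^∞⟮𝓘(ℝ, EB), M; ℝ⟯ ι where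
  ε A := cst EB M (ε A)
  pos := pos
  der A := lie C (e A)
  der_add A x y := lie_add _ _ _
  der_mul A x y := lie_mul _ _ _
  der_ε A B := by
    ext x
    exact lie_eq_zero_of_eventuallyEq_const (a := ε B) (Filter.Eventually.of_forall fun y => cst_apply _ _)

theorem germ_ric2 {ι : Type*} [Fintype ι] (e : ι → Sec EB F E) (ε : ι → ℝ) (pos : ι → Bool) (p : M)
    (d : ι → C^∞⟮𝓘(ℝ, EB), M; ℝ⟯) (Γ : ι → ι → ι → C^∞⟮𝓘(ℝ, EB), M; ℝ⟯) (A B : ι) :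
    germ p ((funCalc C e ε pos).ric2 d Γ A B) =
      (frameCalc C e ε pos p).ric2 (fun A => germ p (d A)) (fun A B K => germ p (Γ A B K)) A B := by
  have h1 : ∀ A f, germ p ((funCalc C e ε pos).der A f) = (frameCalc C e ε pos p).der A (germ p f) :=
    fun A f => rfl
  have h2 : ∀ A, germ p ((funCalc C e ε pos).ε A) = (frameCalc C e ε pos p).ε A := fun _ => rfl
  unfold FrameCalculus.ric2 FrameCalculus.dv ctr2
  simp only [map_sub, map_add, map_mul, map_ctr, h1, h2]
  rw [map_ofNat]

namespace IsFrameOn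

variable {G} {ι : Type*} [Fintype ι] [DecidableEq ι] {U : Set M} {e : ι → Sec EB F E} {ε : ι → ℝ}
  (hF : IsFrameOn C U e ε) {p : M} (hp : p ∈ U) {D : Connection C}
include hF hp

theorem der_metFun (hc : D.IsCompatible G) (pos : ι → Bool) (A u v : ι) :
    (frameCalc C e ε pos p).der A (metFun G e p u v) = ctr (frameCalc C e ε pos p).ε fun B =>
      conFun D e p A u B * metFun G e p B v + conFun D e p A v B * metFun G e p u B := by
  have h1 : lie C (e A) (pair C (G.sec (e u)) (e v)) =
      pair C (D.app (e A) (e u)) (G.sec (e v)) + pair C (D.app (e A) (e v)) (G.sec (e u)) := by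
    rw [D.lie_pair_app, pair_comm (G.sec (e u))]
    congr 1
    ext x
    show C.pairing x (D.toFun (G.sec (e u)) x (e A x)) _ = C.pairing x (D.toFun (e u) x (e A x)) (G.sec (e v) x)
    rw [hc (e u) (G.sec (e u)) (G.sec_apply _), G.sec_apply, G.symm]
  show germ p (lie C (e A) (pair C (G.sec (e u)) (e v))) = _
  rw [h1, map_add, hF.germ_pair hp, hF.germ_pair hp, ← ctr_add]
  refine ctr_congr _ fun B => ?_
  rw [metFun_symm G e p B v]
  rfl

/-- Since `G` is symmetric with `G² = 1`, it preserves the pairing, and the sections `G e_A` have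
the same Gram matrix as the `e_A`. -/
theorem metFun_sq (pos : ι → Bool) (x : ι → SmoothGerm EB p) (A : ι) :
    ctr (frameCalc C e ε pos p).ε (fun B => metFun G e p A B *
      ctr (frameCalc C e ε pos p).ε fun K => metFun G e p B K * x K) = x A := by
  have h1 : ∀ K, ctr (frameCalc C e ε pos p).ε (fun B => metFun G e p A B * metFun G e p K B) =
      if A = K then (frameCalc C e ε pos p).ε A else 0 := fun K => by
    refine (hF.germ_pair hp (G.sec (e A)) (G.sec (e K))).symm.trans ?_
    have : pair C (G.sec (e A)) (G.sec (e K)) = pair C (e A) (e K) := by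
      ext y
      show C.pairing y (G.sec (e A) y) (G.sec (e K) y) = C.pairing y (e A y) (e K y)
      rw [G.sec_apply, G.sec_apply, G.symm, G.sq]
    rw [this]
    have h2 : (if A = K then (frameCalc C e ε pos p).ε A else 0) =
        germ p (if A = K then cst EB M (ε A) else 0) := by split_ifs <;> simp [frameCalc]
    rw [h2, germ_eq]
    filter_upwards [hF.pair_eventuallyEq hp A K] with y hy
    rw [hy]
    split_ifs
    · rw [cst_apply]
    · rfl
  have h3 : ctr (frameCalc C e ε pos p).ε (fun B => metFun G e p A B *
      ctr (frameCalc C e ε pos p).ε fun K => metFun G e p B K * x K) =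
      ctr (frameCalc C e ε pos p).ε fun K => (if A = K then (frameCalc C e ε pos p).ε A else 0) * x K := by
    simp only [← h1, ← ctr_mul_left, ← ctr_mul_right]
    rw [ctr_comm]
    refine ctr_congr _ fun K => ctr_congr _ fun B => ?_
    rw [metFun_symm G e p K B]; ring
  rw [h3]
  simp only [ctr, ite_mul, zero_mul, mul_ite, mul_zero, Finset.sum_ite_eq, Finset.mem_univ, if_true]
  have : (frameCalc C e ε pos p).ε A * (frameCalc C e ε pos p).ε A = 1 := by
    show germ p _ * germ p _ = 1
    rw [← map_mul, ← map_one (germ p)]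
    congr 1
    ext y
    show cst EB M (ε A) y * cst EB M (ε A) y = 1
    rw [cst_apply, hF.sq]
  rw [← mul_assoc, this, one_mul]

theorem ε_sq (pos : ι → Bool) (A : ι) :
    (frameCalc C e ε pos p).ε A * (frameCalc C e ε pos p).ε A = 1 := by
  show germ p _ * germ p _ = 1
  rw [← map_mul, ← map_one (germ p)]
  congr 1
  ext y
  show cst EB M (ε A) y * cst EB M (ε A) y = 1
  rw [cst_apply, hF.sq]

theorem metFun_adapted {pos : ι → Bool} (ha : IsAdapted G U e pos) (A B : ι) : metFun G e p A B =
    if A = B then (frameCalc C e ε pos p).ε A * (frameCalc C e ε pos p).sg A else 0 := by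
  have h2 : (if A = B then (frameCalc C e ε pos p).ε A * (frameCalc C e ε pos p).sg A else 0) =
      germ p (if A = B then cst EB M (ε A) * (if pos A then 1 else -1) else 0) := by
    have hsg : (frameCalc C e ε pos p).sg A = germ p (if pos A then 1 else -1) := by
      show (if pos A then 1 else -1 : SmoothGerm EB p) = _
      split_ifs
      · rw [map_one]
      · rw [map_neg, map_one]
    rw [hsg]
    by_cases h : A = B
    · rw [if_pos h, if_pos h, map_mul]; rfl
    · rw [if_neg h, if_neg h, map_zero]
  rw [h2, metFun, germ_eq]
  filter_upwards [hF.isOpen.mem_nhds hp] with x hx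
  rw [pair_apply, G.sec_apply, ha x hx, map_smul, LinearMap.smul_apply, hF.orth x hx]
  have h0 : (0 : C^∞⟮𝓘(ℝ, EB), M; ℝ⟯) x = 0 := rfl
  split_ifs <;> simp [h0]

/-- The first three conditions hold in any orthonormal frame. For the mixed coefficients, an
off-diagonal component of `G` is zero in an adapted frame, so its derivative vanishes; by `D G = 0`
and antisymmetry that derivative is `(s_K - s_B) Γ A B K`, and the eigenvalues differ. -/
theorem isLC {σ : PosHalfDensity EB M} {δ : Sec EB F E → C^∞⟮𝓘(ℝ, EB), M; ℝ⟯} (hD : D.IsLC G σ)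
    (hδ : Represents (C := C) σ δ) {pos : ι → Bool} (ha : IsAdapted G U e pos) :
    (frameCalc C e ε pos p).IsLC (strFun C e p) (fun A => germ p (δ (e A))) (conFun D e p) where
  anti := hF.conFun_anti hp
  cyc := hF.conFun_cyc hp hD.torsionFree
  tr := hF.conFun_tr hp (fun u x => by rw [hδ.eq, hD.divergence]) pos
  mixed A B K hBK := by
    have hder := hF.der_metFun hp hD.compatible pos A B K
    have hBK' : B ≠ K := fun h => hBK (by rw [h])
    have hs := FrameCalculus.sg_eq_neg (X := frameCalc C e ε pos p) hBK
    simp only [hF.metFun_adapted hp ha, if_neg hBK', FrameCalculus.der_zero] at hder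
    simp only [ctr, mul_add, mul_ite, mul_zero, Finset.sum_add_distrib, Finset.sum_ite_eq, Finset.sum_ite_eq',
      Finset.mem_univ, if_true] at hder
    rw [hF.conFun_anti hp A K B, hs] at hder
    have e1 := hF.ε_sq hp pos B
    have e2 := hF.ε_sq hp pos K
    have e3 := (frameCalc C e ε pos p).sg_mul_self K
    refine natCast_mul_cancel (n := 2) two_ne_zero ?_
    push_cast
    set X := frameCalc C e ε pos p
    linear_combination -X.sg K * hder +
      conFun D e p A B K * (-(X.ε K * X.ε K) * e3 - X.ε B * X.ε B * e3 - e1 - e2)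

end IsFrameOn

theorem sum_coframe_pairing (x : M) (a b : E x) :
    ∑ α, C.pairing x (coframe C x α) a * C.pairing x (frame F x α) b = C.pairing x a b := by
  conv_rhs => rw [← sum_coframe (C := C) x a]
  simp [map_sum, LinearMap.sum_apply]

theorem exists_isLC_fullRicci {G : GenPseudometric C} {σ : PosHalfDensity EB M}
    (hex : ∃ D : Connection C, D.IsLC G σ) :
    ∃ D : Connection C, D.IsLC G σ ∧ ∀ p v u, fullRicci G σ p v u = D.fullRicci p v u :=
  ⟨hex.choose, hex.choose_spec, fun p v u => by rw [GenGeom.fullRicci, dif_pos hex]⟩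

namespace IsFrameOn

variable {G : GenPseudometric C} {σ : PosHalfDensity EB M}
  {δ : Sec EB F E → C^∞⟮𝓘(ℝ, EB), M; ℝ⟯} (hδ : Represents (C := C) σ δ)
  {D : Connection C} (hD : D.IsLC G σ) (hDR : ∀ p v u, fullRicci G σ p v u = D.fullRicci p v u)
  {ι : Type*} [Fintype ι] [DecidableEq ι] {U : Set M} {e : ι → Sec EB F E} {ε : ι → ℝ}
  (hF : IsFrameOn C U e ε) {p : M} (hp : p ∈ U)
include hδ hD hDR hF hp

theorem fullRicci_eq (pos : ι → Bool) (v u : E p) : fullRicci G σ p v u =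
    ctr2 ε fun A B => C.pairing p v (e A p) * C.pairing p u (e B p) *
      (1 / 2 * germEv p ((frameCalc C e ε pos p).ric2 (fun A => germ p (δ (e A))) (conFun D e p) A B)) := by
  rw [hDR, hF.fullRicci_eq_riem hp hD.torsionFree]
  refine ctr2_congr _ fun A B => ?_
  rw [← hF.two_mul_ctr_riem hp (fun u x => by rw [hδ.eq, hD.divergence]) pos]
  ring

theorem scalar_eq (pos : ι → Bool) : scalar G σ p = 1 / 2 * ctr2 ε fun A B =>
    C.pairing p (G.toFun p (e A p)) (e B p) *
      germEv p ((frameCalc C e ε pos p).ric2 (fun A => germ p (δ (e A))) (conFun D e p) A B) := by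
  unfold GenGeom.scalar
  simp only [fullRicci_eq hδ hD hDR hF hp pos, sum_ctr2]
  unfold ctr2
  simp only [← ctr_mul_left]
  refine ctr_congr _ fun A => ctr_congr _ fun B => ?_
  rw [← Finset.sum_mul, ← sum_coframe_pairing p (G.toFun p (e A p))]
  simp only [G.symm]
  ring

/-- The right side is a global smooth function independent of the point of `U`; this is what yields
smoothness of the curvature and the corresponding identity of germs. -/
theorem two_mul_scalar (pos : ι → Bool) : 2 * scalar G σ p =
    ctr2 (fun A => cst EB M (ε A)) (fun A B => pair C (G.sec (e A)) (e B) * (funCalc C e ε pos).ric2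
      (fun A => δ (e A)) (fun A B K => pair C (D.app (e A) (e B)) (e K)) A B) p := by
  rw [scalar_eq hδ hD hDR hF hp pos]
  have h1 : ∀ f : C^∞⟮𝓘(ℝ, EB), M; ℝ⟯, f p = evalAt p f := fun _ => rfl
  have h2 : ∀ f : C^∞⟮𝓘(ℝ, EB), M; ℝ⟯, evalAt p f = germEv p (germ p f) := fun f => by
    rw [germEv_germ]; rfl
  rw [h1, h2]
  have h3 := germ_ric2 (C := C) e ε pos p (fun A => δ (e A))
    (fun A B K => pair C (D.app (e A) (e B)) (e K))
  unfold ctr2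
  simp only [map_ctr, map_mul, germEv_germ, h3, cst_apply, ← mul_assoc, one_div]
  rw [mul_inv_cancel₀ two_ne_zero, one_mul]
  simp only [pair_apply, G.sec_apply]
  rfl

end IsFrameOn

/-! ### Scalar and Ricci curvature in frames -/

section Scalar

variable {G : GenPseudometric C} {σ : PosHalfDensity EB M}
  {δ : Sec EB F E → C^∞⟮𝓘(ℝ, EB), M; ℝ⟯} (hδ : Represents (C := C) σ δ)
  {D : Connection C} (hD : D.IsLC G σ) (hDR : ∀ p v u, fullRicci G σ p v u = D.fullRicci p v u)
include hδ hD hDR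

theorem contMDiff_scalar : ContMDiff 𝓘(ℝ, EB) 𝓘(ℝ, ℝ) ∞ (scalar G σ) := fun p => by
  obtain ⟨ι, _, _, U, e, ε, pos, hp, hF, -⟩ := exists_adapted G p
  set R := ctr2 (fun A => cst EB M (ε A)) (fun A B => pair C (G.sec (e A)) (e B) * (funCalc C e ε pos).ric2
      (fun A => δ (e A)) (fun A B K => pair C (D.app (e A) (e B)) (e K)) A B) with hR
  refine (cst EB M (1 / 2) * R).contMDiff.contMDiffAt.congr_of_eventuallyEq ?_
  filter_upwards [hF.isOpen.mem_nhds hp] with x hx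
  show _ = cst EB M (1 / 2) x * R x
  rw [cst_apply, hR, ← IsFrameOn.two_mul_scalar hδ hD hDR hF hx pos]
  ring

/-- The scalar curvature as a smooth function. -/
def scalarMap : C^∞⟮𝓘(ℝ, EB), M; ℝ⟯ := ⟨scalar G σ, contMDiff_scalar hδ hD hDR⟩

variable {ι : Type*} [Fintype ι] [DecidableEq ι] {U : Set M} {e : ι → Sec EB F E} {ε : ι → ℝ}
  (hF : IsFrameOn C U e ε) {p : M} (hp : p ∈ U)
include hF hp

theorem two_mul_germ_scalarMap (pos : ι → Bool) : 2 * germ p (scalarMap hδ hD hDR) =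
    ctr2 (frameCalc C e ε pos p).ε fun A B => metFun G e p A B *
      (frameCalc C e ε pos p).ric2 (fun A => germ p (δ (e A))) (conFun D e p) A B := by
  have h1 : germ p (cst EB M 2 * scalarMap hδ hD hDR) = germ p (ctr2 (fun A => cst EB M (ε A))
      (fun A B => pair C (G.sec (e A)) (e B) * (funCalc C e ε pos).ric2
      (fun A => δ (e A)) (fun A B K => pair C (D.app (e A) (e B)) (e K)) A B)) := by
    rw [germ_eq]
    filter_upwards [hF.isOpen.mem_nhds hp] with x hx
    rw [← IsFrameOn.two_mul_scalar hδ hD hDR hF hx pos]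
    show cst EB M 2 x * _ = _
    rw [cst_apply]; rfl
  have h2 : germ p (cst EB M 2) = 2 := by
    rw [← map_ofNat (germ p) 2]
    congr 1
    show algebraMap ℝ _ 2 = _
    rw [map_ofNat]
  rw [map_mul, h2] at h1
  rw [h1]
  have h3 := germ_ric2 (C := C) e ε pos p (fun A => δ (e A))
    (fun A B K => pair C (D.app (e A) (e B)) (e K))
  unfold ctr2
  simp only [map_ctr, map_mul, h3]
  rfl

variable {pos : ι → Bool} (ha : IsAdapted G U e pos)
include ha

theorem two_mul_germ_scalarMap_adapted : 2 * germ p (scalarMap hδ hD hDR) =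
    ctr (frameCalc C e ε pos p).ε fun A => (frameCalc C e ε pos p).sg A *
      (frameCalc C e ε pos p).ric2 (fun A => germ p (δ (e A))) (conFun D e p) A A := by
  rw [two_mul_germ_scalarMap hδ hD hDR hF hp pos]
  simp only [hF.metFun_adapted hp ha, ctr2, ctr, ite_mul, zero_mul, mul_ite, mul_zero, Finset.sum_ite_eq,
    Finset.mem_univ, if_true]
  refine Finset.sum_congr rfl fun A _ => ?_
  set X := frameCalc C e ε pos p
  have h := hF.ε_sq hp pos A
  linear_combination X.ε A * X.sg A * X.ric2 (fun A => germ p (δ (e A))) (conFun D e p) A A * h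

omit hp in
theorem pairing_adapted {x : M} (hx : x ∈ U) (v : E x) (A : ι) : C.pairing x (G.toFun x v) (e A x) =
    (if pos A then (1 : ℝ) else -1) * C.pairing x v (e A x) := by
  rw [G.symm, ha x hx, map_smul, smul_eq_mul]

/-- Subtracting `G F G` from the full Ricci tensor `F` multiplies the component `A B` by `1 - s_A
s_B`, which is `0` inside an eigenbundle and `2` across. -/
theorem ricci_eq (v u : E p) : ricci G σ p v u = ctr2 ε fun A B =>
    C.pairing p v (e A p) * C.pairing p u (e B p) * (2 * germEv p ((frameCalc C e ε pos p).fm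
      (strFun C e p) (fun A => germ p (δ (e A))) A B)) := by
  have hC := hF.isCourant hδ.isDivergence hp pos
  have hL := hF.isLC hp hD hδ ha
  unfold ricci
  rw [IsFrameOn.fullRicci_eq hδ hD hDR hF hp pos, IsFrameOn.fullRicci_eq hδ hD hDR hF hp pos]
  unfold ctr2
  simp only [← ctr_sub, pairing_adapted hδ hD hDR hF ha hp]
  refine ctr_congr _ fun A => ctr_congr _ fun B => ?_
  unfold FrameCalculus.fm
  by_cases hAB : (frameCalc C e ε pos p).pos A = (frameCalc C e ε pos p).pos B
  · have hAB' : pos A = pos B := hAB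
    rw [if_pos hAB, map_zero, hAB']
    split_ifs <;> ring
  · rw [if_neg hAB, hC.ric2_eq hL hAB, map_mul, map_ofNat]
    have hAB' : pos A ≠ pos B := hAB
    cases hA : pos A <;> cases hB : pos B <;> simp_all <;> ring

theorem ricci_frame (A B : ι) : ricci G σ p (e A p) (e B p) = 2 * germEv p
    ((frameCalc C e ε pos p).fm (strFun C e p) (fun A => germ p (δ (e A))) A B) := by
  rw [ricci_eq hδ hD hDR hF hp ha]
  simp only [hF.orth p hp, ctr2, ctr, ite_mul, zero_mul, mul_ite, mul_zero, Finset.sum_ite_eq,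
    Finset.mem_univ, if_true]
  have h1 := hF.sq A
  have h2 := hF.sq B
  set r := germEv p ((frameCalc C e ε pos p).fm (strFun C e p) (fun A => germ p (δ (e A))) A B)
  linear_combination 2 * r * ε B * ε B * h1 + 2 * r * h2

/-- The Ricci tensor is mixed, so `s_A s_B = -1` on its support; together with `Rc = 2 fm` this is
the source of the factor `-4`. -/
theorem ricciNormSq_eq : ricciNormSq G σ p = -4 * ctr2 ε fun A B =>
    germEv p ((frameCalc C e ε pos p).fm (strFun C e p) (fun A => germ p (δ (e A))) A B) ^ 2 := by
  set r : ι → ι → ℝ := fun A B =>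
    germEv p ((frameCalc C e ε pos p).fm (strFun C e p) (fun A => germ p (δ (e A))) A B) with hr
  set s : ι → ℝ := fun A => if pos A then 1 else -1 with hs
  have hric : ∀ v u, ricci G σ p v u = ctr2 ε fun A B =>
    C.pairing p v (e A p) * C.pairing p u (e B p) * (2 * r A B) := ricci_eq hδ hD hDR hF hp ha
  have h1 : ∀ a u, ∑ γ, C.pairing p (coframe C p γ) a * ricci G σ p (frame F p γ) u = ricci G σ p a u := by
    intro a u
    simp only [hric, ← ctr2_mul_left, sum_ctr2]
    refine ctr2_congr _ fun A B => ?_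
    rw [← sum_coframe_pairing p a, Finset.sum_mul, Finset.sum_mul]
    exact Finset.sum_congr rfl fun γ _ => by ring
  have h2 : ∀ a u, ∑ γ, C.pairing p (coframe C p γ) a * ricci G σ p u (frame F p γ) = ricci G σ p u a := by
    intro a u
    simp only [hric, ← ctr2_mul_left, sum_ctr2]
    refine ctr2_congr _ fun A B => ?_
    rw [← sum_coframe_pairing p a, Finset.mul_sum, Finset.sum_mul]
    exact Finset.sum_congr rfl fun γ _ => by ring
  have h3 : ricciNormSq G σ p = ∑ α, ∑ β, ricci G σ p (frame F p α) (frame F p β) *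
      ricci G σ p (G.toFun p (coframe C p α)) (G.toFun p (coframe C p β)) := by
    unfold ricciNormSq
    refine Finset.sum_congr rfl fun α _ => Finset.sum_congr rfl fun β _ => ?_
    rw [← h1 (G.toFun p (coframe C p α)), Finset.mul_sum]
    refine Finset.sum_congr rfl fun γ _ => ?_
    rw [← h2 (G.toFun p (coframe C p β)), Finset.mul_sum, Finset.mul_sum]
    refine Finset.sum_congr rfl fun κ _ => ?_
    rw [C.pairing_symm p (coframe C p γ), C.pairing_symm p (coframe C p κ)]
    ring
  have h4 : ∀ α β, ricci G σ p (G.toFun p (coframe C p α)) (G.toFun p (coframe C p β)) =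
      ctr2 ε fun A B => s A * s B * (2 * r A B) *
        (C.pairing p (coframe C p α) (e A p) * C.pairing p (coframe C p β) (e B p)) := fun α β => by
    rw [hric]
    refine ctr2_congr _ fun A B => ?_
    rw [pairing_adapted hδ hD hDR hF ha hp, pairing_adapted hδ hD hDR hF ha hp]
    ring
  rw [h3]
  simp only [h4, ← ctr2_mul_left, sum_ctr2]
  refine ctr2_congr _ fun A B => ?_
  have h5 : ∑ α, ∑ β, ricci G σ p (frame F p α) (frame F p β) * (s A * s B * (2 * r A B) *
        (C.pairing p (coframe C p α) (e A p) * C.pairing p (coframe C p β) (e B p))) =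
      s A * s B * (2 * r A B) * ricci G σ p (e A p) (e B p) := by
    rw [← h1 (e A p), Finset.mul_sum]
    refine Finset.sum_congr rfl fun α _ => ?_
    rw [← h2 (e B p), Finset.mul_sum, Finset.mul_sum]
    exact Finset.sum_congr rfl fun β _ => by ring
  rw [h5, ricci_frame hδ hD hDR hF hp ha]
  show s A * s B * (2 * r A B) * (2 * r A B) = -4 * r A B ^ 2
  by_cases hAB : pos A = pos B
  · have : r A B = 0 := by
      simp only [hr, FrameCalculus.fm]
      rw [if_pos (show (frameCalc C e ε pos p).pos A = (frameCalc C e ε pos p).pos B from hAB), map_zero]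
    rw [this]; ring
  · have : s A * s B = -1 := by
      simp only [hs]
      cases hA : pos A <;> cases hB : pos B <;> simp_all
    rw [this]; ring

end Scalar

theorem two_le_infty : (2 : WithTop ℕ∞) ≤ ∞ := by
  have h : (((2 : ℕ∞)) : WithTop ℕ∞) ≤ ∞ := WithTop.coe_le_coe.2 le_top
  exact h

/-! ### Divergences on a vector space -/

section Flat

variable {V : Type*} [NormedAddCommGroup V] [NormedSpace ℝ V] [FiniteDimensional ℝ V]

/-- The trace of continuous endomorphisms as a continuous functional. -/
def trL : (V →L[ℝ] V) →L[ℝ] ℝ :=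
  LinearMap.toContinuousLinearMap ((LinearMap.trace ℝ V) ∘ₗ ContinuousLinearMap.coeLM ℝ)

theorem trL_apply (A : V →L[ℝ] V) : trL A = LinearMap.trace ℝ V A.toLinearMap := rfl

theorem trL_comp_comm (A B : V →L[ℝ] V) : trL (A.comp B) = trL (B.comp A) :=
  LinearMap.trace_mul_comm ℝ A.toLinearMap B.toLinearMap

theorem hasDerivAt_det_one_add (A : V →L[ℝ] V) :
    HasDerivAt (fun t : ℝ => (1 + t • A).det) (trL A) 0 := by
  set b := Module.finBasis ℝ V
  set m := LinearMap.toMatrix b b A.toLinearMap with hm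
  have h1 : ∀ t : ℝ, (1 + t • A).det = 1 + m.trace * t + _ * t ^ 2 := fun t => by
    rw [← Matrix.det_one_add_smul t m, ContinuousLinearMap.det, ← LinearMap.det_toMatrix b]
    congr 1
    rw [hm, ← LinearMap.toMatrix_one b, ← map_smul, ← map_add]; rfl
  have h2 : trL A = m.trace := by rw [trL_apply, LinearMap.trace_eq_matrix_trace ℝ b]
  rw [h2]
  simp only [h1]
  set q := Polynomial.divX (Polynomial.divX (1 + (Polynomial.X : Polynomial ℝ) • m.map Polynomial.C).det)
  have h3 : HasDerivAt (fun t : ℝ => 1 + m.trace * t + q.eval t * t ^ 2)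
      (m.trace * 1 + (q.derivative.eval 0 * 0 ^ 2 + q.eval 0 * (2 * 0 ^ (2 - 1)))) 0 :=
    (((hasDerivAt_id (0 : ℝ)).const_mul _).const_add 1).add
      ((q.hasDerivAt 0).mul (by simpa using hasDerivAt_pow 2 (0 : ℝ)))
  simpa using h3

theorem differentiable_det : Differentiable ℝ fun A : V →L[ℝ] V => A.det := by
  set b := Module.finBasis ℝ V
  have h : (fun A : V →L[ℝ] V => A.det) = fun A =>
      ∑ τ : Equiv.Perm _, ((Equiv.Perm.sign τ : ℤ) : ℝ) *
        ∏ i, (LinearMap.toContinuousLinearMap ((b.coord (τ i)) ∘ₗ (LinearMap.applyₗ (b i)) ∘ₗ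
          ContinuousLinearMap.coeLM ℝ) : (V →L[ℝ] V) →L[ℝ] ℝ) A := by
    funext A
    rw [ContinuousLinearMap.det, ← LinearMap.det_toMatrix b, Matrix.det_apply']
    refine Finset.sum_congr rfl fun τ _ => ?_
    congr 1
    refine Finset.prod_congr rfl fun i _ => ?_
    rw [LinearMap.toMatrix_apply]; rfl
  rw [h]
  fun_prop

/-- Jacobi's formula: factoring `A + t B = A (1 + t A' B)` reduces it to the derivative at the
identity. -/
theorem fderiv_det {A A' : V →L[ℝ] V} (h : A.comp A' = 1) (B : V →L[ℝ] V) :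
    fderiv ℝ (fun A : V →L[ℝ] V => A.det) A B = A.det * trL (A'.comp B) := by
  have h1 : HasDerivAt (fun t : ℝ => (A + t • B).det)
      (fderiv ℝ (fun A : V →L[ℝ] V => A.det) A B) 0 := by
    have h2 : HasDerivAt (fun t : ℝ => A + t • B) B 0 := by
      simpa using ((hasDerivAt_id (0 : ℝ)).smul_const B).const_add A
    have h3 := (differentiable_det (A + (0 : ℝ) • B)).hasFDerivAt.comp_hasDerivAt (0 : ℝ) h2
    rw [zero_smul, add_zero] at h3
    exact h3
  have h2 : (fun t : ℝ => (A + t • B).det) = fun t => A.det * (1 + t • A'.comp B).det := by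
    funext t
    have : A + t • B = A * (1 + t • A'.comp B) := by
      rw [mul_add, mul_one, mul_smul_comm]
      congr 2
      show B = (A.comp A').comp B
      rw [h]; rfl
    rw [this]
    simp only [ContinuousLinearMap.det]
    exact map_mul LinearMap.det _ _
  rw [h2] at h1
  exact h1.unique ((hasDerivAt_det_one_add (A'.comp B)).const_mul _)

/-- The divergence of a vector field with respect to the density `exp (2 ℓ)` on a vector space. -/
def flatDiv (l : V → ℝ) (X : V → V) (y : V) : ℝ := 2 * fderiv ℝ l y (X y) + trL (fderiv ℝ X y)

theorem flatDiv_congr {l l' : V → ℝ} {X X' : V → V} {y : V} (hl : l =ᶠ[𝓝 y] l') (hX : X =ᶠ[𝓝 y] X') :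
    flatDiv l X y = flatDiv l' X' y := by
  rw [flatDiv, flatDiv, hl.fderiv_eq, hX.fderiv_eq, hX.eq_of_nhds]

theorem flatDiv_add (l : V → ℝ) {X Y : V → V} {y : V} (hX : DifferentiableAt ℝ X y)
    (hY : DifferentiableAt ℝ Y y) :
    flatDiv l (fun z => X z + Y z) y = flatDiv l X y + flatDiv l Y y := by
  unfold flatDiv
  rw [fderiv_fun_add hX hY, map_add, map_add]; ring

theorem flatDiv_smul (l : V → ℝ) {f : V → ℝ} {X : V → V} {y : V} (hf : DifferentiableAt ℝ f y)
    (hX : DifferentiableAt ℝ X y) :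
    flatDiv l (fun z => f z • X z) y = f y * flatDiv l X y + fderiv ℝ f y (X y) := by
  unfold flatDiv
  rw [fderiv_fun_smul hf hX, map_add, map_smul, map_smul, smul_eq_mul, smul_eq_mul]
  have : trL ((fderiv ℝ f y).smulRight (X y)) = fderiv ℝ f y (X y) :=
    LinearMap.trace_smulRight (fderiv ℝ f y).toLinearMap (X y)
  rw [this]; ring

theorem flatDiv_contDiffAt {l : V → ℝ} {X : V → V} {y : V} (hl : ContDiffAt ℝ ∞ l y)
    (hX : ContDiffAt ℝ ∞ X y) : ContDiffAt ℝ ∞ (flatDiv l X) y := by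
  unfold flatDiv
  have h1 : ContDiffAt ℝ ∞ (fderiv ℝ l) y := hl.fderiv_right (by simp)
  have h2 : ContDiffAt ℝ ∞ (fderiv ℝ X) y := hX.fderiv_right (by simp)
  exact (contDiffAt_const.mul (h1.clm_apply hX)).add ((trL (V := V)).contDiff.contDiffAt.comp y h2)

theorem fderiv_flatDiv {l : V → ℝ} {X : V → V} {y : V} (hl : ContDiffAt ℝ ∞ l y)
    (hX : ContDiffAt ℝ ∞ X y) (v : V) : fderiv ℝ (flatDiv l X) y v =
      2 * (fderiv ℝ (fderiv ℝ l) y v (X y) + fderiv ℝ l y (fderiv ℝ X y v)) +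
        trL (fderiv ℝ (fderiv ℝ X) y v) := by
  have h1 : ContDiffAt ℝ ∞ (fderiv ℝ l) y := hl.fderiv_right (by simp)
  have h2 : ContDiffAt ℝ ∞ (fderiv ℝ X) y := hX.fderiv_right (by simp)
  have d1 := (h1.differentiableAt (by simp)).hasFDerivAt
  have d2 := (h2.differentiableAt (by simp)).hasFDerivAt
  have d3 := (hX.differentiableAt (by simp)).hasFDerivAt
  have h := ((d1.clm_apply d3).const_mul 2).add (trL.hasFDerivAt.comp y d2)
  have h' : fderiv ℝ (flatDiv l X) y = _ := h.fderiv
  rw [h']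
  simp
  ring

/-- Second derivatives of `l`, `X` and `Y` are symmetric, and the products of first derivatives of
`X` and `Y` form a commutator, whose trace is zero. -/
theorem flatDiv_bracket {l : V → ℝ} {X Y : V → V} {y : V} (hl : ContDiffAt ℝ ∞ l y)
    (hX : ContDiffAt ℝ ∞ X y) (hY : ContDiffAt ℝ ∞ Y y) :
    flatDiv l (fun z => fderiv ℝ Y z (X z) - fderiv ℝ X z (Y z)) y =
      fderiv ℝ (flatDiv l Y) y (X y) - fderiv ℝ (flatDiv l X) y (Y y) := by
  rw [fderiv_flatDiv hl hX, fderiv_flatDiv hl hY]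
  have h1 : ContDiffAt ℝ ∞ (fderiv ℝ X) y := hX.fderiv_right (by simp)
  have h2 : ContDiffAt ℝ ∞ (fderiv ℝ Y) y := hY.fderiv_right (by simp)
  have d1 := (h1.differentiableAt (by simp)).hasFDerivAt
  have d2 := (h2.differentiableAt (by simp)).hasFDerivAt
  have dX := (hX.differentiableAt (by simp)).hasFDerivAt
  have dY := (hY.differentiableAt (by simp)).hasFDerivAt
  have h := (d2.clm_apply dX).sub (d1.clm_apply dY)
  have sX : ∀ v w, fderiv ℝ (fderiv ℝ X) y v w = fderiv ℝ (fderiv ℝ X) y w v :=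
    hX.isSymmSndFDerivAt (by simpa using two_le_infty)
  have sY : ∀ v w, fderiv ℝ (fderiv ℝ Y) y v w = fderiv ℝ (fderiv ℝ Y) y w v :=
    hY.isSymmSndFDerivAt (by simpa using two_le_infty)
  have sl : ∀ v w, fderiv ℝ (fderiv ℝ l) y v w = fderiv ℝ (fderiv ℝ l) y w v :=
    hl.isSymmSndFDerivAt (by simpa using two_le_infty)
  have e1 : (fderiv ℝ (fderiv ℝ Y) y).flip (X y) = fderiv ℝ (fderiv ℝ Y) y (X y) := by
    ext v; exact sY _ _
  have e2 : (fderiv ℝ (fderiv ℝ X) y).flip (Y y) = fderiv ℝ (fderiv ℝ X) y (Y y) := by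
    ext v; exact sX _ _
  have h' := h.fderiv
  rw [e1, e2] at h'
  unfold flatDiv
  have h'' : fderiv ℝ (fun z => fderiv ℝ Y z (X z) - fderiv ℝ X z (Y z)) y = _ := h'
  rw [h'', sl (X y) (Y y)]
  simp only [map_sub, map_add, trL_comp_comm (fderiv ℝ Y y)]
  ring

/-- The trace of the transformed field acquires a term with the second derivative of `ψ`. By
Jacobi's formula it is the derivative of `log det` of the Jacobian, with which the logarithm of the
density transforms. -/
theorem flatDiv_comp {l l' : V → ℝ} {X X' : V → V} {ψ : V → V} {y : V} (hψ : ContDiffAt ℝ ∞ ψ y)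
    {A : V →L[ℝ] V} (hA : (fderiv ℝ ψ y).comp A = 1) (hA' : A.comp (fderiv ℝ ψ y) = 1)
    (hdet : (fderiv ℝ ψ y).det ≠ 0) (hX : DifferentiableAt ℝ X y) (hX' : DifferentiableAt ℝ X' (ψ y))
    (hl' : DifferentiableAt ℝ l' (ψ y)) (hXX : ∀ᶠ z in 𝓝 y, X' (ψ z) = fderiv ℝ ψ z (X z))
    (hll : ∀ᶠ z in 𝓝 y, l z = 1 / 2 * Real.log (fderiv ℝ ψ z).det + l' (ψ z)) :
    flatDiv l X y = flatDiv l' X' (ψ y) := by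
  have h1 : ContDiffAt ℝ ∞ (fderiv ℝ ψ) y := hψ.fderiv_right (by simp)
  have d1 := (h1.differentiableAt (by simp)).hasFDerivAt
  have dψ := (hψ.differentiableAt (by simp)).hasFDerivAt
  have s : ∀ v w, fderiv ℝ (fderiv ℝ ψ) y v w = fderiv ℝ (fderiv ℝ ψ) y w v :=
    hψ.isSymmSndFDerivAt (by simpa using two_le_infty)
  have e1 : (fderiv ℝ X' (ψ y)).comp (fderiv ℝ ψ y) =
      (fderiv ℝ ψ y).comp (fderiv ℝ X y) + fderiv ℝ (fderiv ℝ ψ) y (X y) := by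
    have h2 := (hX'.hasFDerivAt.comp y dψ).fderiv
    have h3 := (d1.clm_apply hX.hasFDerivAt).fderiv
    have h4 : (X' ∘ ψ) =ᶠ[𝓝 y] fun z => fderiv ℝ ψ z (X z) := hXX
    rw [h4.fderiv_eq, h3] at h2
    rw [← h2]
    congr 1
    ext v; exact s _ _
  have e2 : trL (fderiv ℝ X' (ψ y)) = trL (fderiv ℝ X y) + trL (A.comp (fderiv ℝ (fderiv ℝ ψ) y (X y))) := by
    have h2 : fderiv ℝ X' (ψ y) = ((fderiv ℝ X' (ψ y)).comp (fderiv ℝ ψ y)).comp A := by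
      rw [ContinuousLinearMap.comp_assoc, hA]; rfl
    rw [h2, trL_comp_comm, e1, ContinuousLinearMap.comp_add, map_add, ← ContinuousLinearMap.comp_assoc, hA']
    rfl
  have e3 : fderiv ℝ l y (X y) = 1 / 2 * trL (A.comp (fderiv ℝ (fderiv ℝ ψ) y (X y))) +
      fderiv ℝ l' (ψ y) (X' (ψ y)) := by
    have h2 := (((((differentiable_det (fderiv ℝ ψ y)).hasFDerivAt.comp y d1).log hdet).const_mul
      (1 / 2)).add (hl'.hasFDerivAt.comp y dψ)).fderiv
    have h3 : l =ᶠ[𝓝 y] _ := hll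
    rw [h3.fderiv_eq]
    refine (congrArg (fun L => L (X y)) h2).trans ?_
    have h4 := fderiv_det hA (fderiv ℝ (fderiv ℝ ψ) y (X y))
    simp only [add_apply, smul_apply,
      ContinuousLinearMap.comp_apply, smul_eq_mul, h4, Function.comp]
    rw [hXX.self_of_nhds]
    field_simp
  unfold flatDiv
  rw [e2, e3]; ring

end Flat

/-! ### The divergence of a half-density in charts -/

section Charts

variable (EB) in
/-- The linear coordinates on `T_x M` of the preferred chart around `p`. -/
def tanCoord (p x : M) : TangentSpace 𝓘(ℝ, EB) x →L[ℝ] EB :=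
  (trivializationAt EB (TangentSpace 𝓘(ℝ, EB) : M → Type _) p).continuousLinearMapAt ℝ x

variable (EB) in
/-- The domain of the preferred chart. -/
def dom (p : M) : Set M := (chartAt EB p).source

theorem mem_baseSet {p x : M} (hx : x ∈ dom EB p) :
    x ∈ (trivializationAt EB (TangentSpace 𝓘(ℝ, EB) : M → Type _) p).baseSet := hx

theorem isOpen_dom (p : M) : IsOpen (dom EB p) := (chartAt EB p).open_source

theorem mem_dom (p : M) : p ∈ dom EB p := mem_chart_source EB p

theorem mfderiv_chart {W : Type*} [NormedAddCommGroup W] [NormedSpace ℝ W] {f : M → W} {p x : M}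
    (hx : x ∈ dom EB p) (hf : MDifferentiableAt 𝓘(ℝ, EB) 𝓘(ℝ, W) f x) (v : TangentSpace 𝓘(ℝ, EB) x) :
    (mfderiv 𝓘(ℝ, EB) 𝓘(ℝ, W) f x v : W) =
      fderiv ℝ (f ∘ (chartAt EB p).symm) (chartAt EB p x) (tanCoord EB p x v) := by
  have hφ : MDifferentiableAt 𝓘(ℝ, EB) 𝓘(ℝ, EB) (chartAt EB p) x :=
    mdifferentiableAt_atlas (chart_mem_atlas EB p) hx
  have hs : MDifferentiableAt 𝓘(ℝ, EB) 𝓘(ℝ, EB) (chartAt EB p).symm (chartAt EB p x) :=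
    mdifferentiableAt_atlas_symm (chart_mem_atlas EB p) ((chartAt EB p).map_source hx)
  have hl : (chartAt EB p).symm (chartAt EB p x) = x := (chartAt EB p).left_inv hx
  have hf' : MDifferentiableAt 𝓘(ℝ, EB) 𝓘(ℝ, W) (f ∘ (chartAt EB p).symm) (chartAt EB p x) :=
    MDifferentiableAt.comp _ (by rwa [hl]) hs
  have he : f =ᶠ[𝓝 x] (f ∘ (chartAt EB p).symm) ∘ chartAt EB p := by
    filter_upwards [(isOpen_dom (EB := EB) p).mem_nhds hx] with y hy
    simp only [Function.comp, (chartAt EB p).left_inv hy]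
  rw [he.mfderiv_eq, mfderiv_comp x hf' hφ, mfderiv_eq_fderiv]
  unfold tanCoord
  rw [TangentBundle.continuousLinearMapAt_trivializationAt hx]
  rfl

theorem tanCoord_coordFrame {p x : M} (hx : x ∈ dom EB p) (v : EB) :
    tanCoord EB p x (coordFrame p x v) = v :=
  Bundle.Trivialization.continuousLinearMapAt_symmL _ (mem_baseSet hx) v

theorem coordFrame_tanCoord {p x : M} (hx : x ∈ dom EB p) (v : TangentSpace 𝓘(ℝ, EB) x) :
    coordFrame p x (tanCoord EB p x v) = v :=
  Bundle.Trivialization.symmL_continuousLinearMapAt _ (mem_baseSet hx) v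

/-- The coordinate representation of a vector field. -/
def fieldRep (p : M) (X : ∀ x : M, TangentSpace 𝓘(ℝ, EB) x) (y : EB) : EB :=
  tanCoord EB p ((chartAt EB p).symm y) (X ((chartAt EB p).symm y))

/-- The logarithm of the coordinate representation of a density. -/
def logRep (σ : PosHalfDensity EB M) (p : M) (y : EB) : ℝ := Real.log (σ.rep p ((chartAt EB p).symm y))

theorem rep_pos (σ : PosHalfDensity EB M) {p x : M} (hx : x ∈ dom EB p) : 0 < σ.rep p x :=
  σ.pos x (ContinuousLinearEquiv.equivOfInverse (coordFrame p x) (tanCoord EB p x)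
    (tanCoord_coordFrame hx) (coordFrame_tanCoord hx))

theorem contMDiffAt_rep (σ : PosHalfDensity EB M) {p x : M} (hx : x ∈ dom EB p) :
    ContMDiffAt 𝓘(ℝ, EB) 𝓘(ℝ, ℝ) ∞ (σ.rep p) x :=
  (σ.smooth p x (mem_baseSet hx)).contMDiffAt
    ((trivializationAt EB (TangentSpace 𝓘(ℝ, EB) : M → Type _) p).open_baseSet.mem_nhds (mem_baseSet hx))

theorem contDiffAt_comp_chart {W : Type*} [NormedAddCommGroup W] [NormedSpace ℝ W] {f : M → W} {p x : M}
    (hx : x ∈ dom EB p) (hf : ContMDiffAt 𝓘(ℝ, EB) 𝓘(ℝ, W) ∞ f x) :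
    ContDiffAt ℝ ∞ (f ∘ (chartAt EB p).symm) (chartAt EB p x) := by
  have hs : ContMDiffAt 𝓘(ℝ, EB) 𝓘(ℝ, EB) ∞ (chartAt EB p).symm (chartAt EB p x) :=
    contMDiffOn_chart_symm.contMDiffAt
      ((chartAt EB p).open_target.mem_nhds ((chartAt EB p).map_source hx))
  have hl : (chartAt EB p).symm (chartAt EB p x) = x := (chartAt EB p).left_inv hx
  exact contMDiffAt_iff_contDiffAt.1 (ContMDiffAt.comp (chartAt EB p x) (by rwa [hl]) hs)

theorem contDiffAt_logRep (σ : PosHalfDensity EB M) {p x : M} (hx : x ∈ dom EB p) :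
    ContDiffAt ℝ ∞ (logRep σ p) (chartAt EB p x) := by
  refine (contDiffAt_comp_chart hx (contMDiffAt_rep σ hx)).log ?_
  simp only [Function.comp, (chartAt EB p).left_inv hx]
  exact (rep_pos σ hx).ne'

/-- The anchor of a section as a vector field. -/
def field (C : CourantAlgebroid EB F E) (u : Sec EB F E) (x : M) : TangentSpace 𝓘(ℝ, EB) x :=
  C.anchor x (u x)

theorem contMDiffAt_tanCoord (u : Sec EB F E) {p x : M} (hx : x ∈ dom EB p) :
    ContMDiffAt 𝓘(ℝ, EB) 𝓘(ℝ, EB) ∞ (fun y => tanCoord EB p y (field C u y)) x := by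
  have h := ((trivializationAt EB (TangentSpace 𝓘(ℝ, EB) : M → Type _) p).contMDiffAt_section_iff
    (IB := 𝓘(ℝ, EB)) (n := ∞) (s := field C u) (mem_baseSet hx)).1 (C.anchor_smooth u x)
  refine h.congr_of_eventuallyEq ?_
  filter_upwards [(isOpen_dom (EB := EB) p).mem_nhds hx] with y hy
  exact Bundle.Trivialization.continuousLinearMapAt_apply_of_mem ℝ _ (mem_baseSet hy) _

theorem contDiffAt_fieldRep (u : Sec EB F E) {p x : M} (hx : x ∈ dom EB p) :
    ContDiffAt ℝ ∞ (fieldRep p (field C u)) (chartAt EB p x) :=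
  contDiffAt_comp_chart hx (contMDiffAt_tanCoord u hx)

theorem lie_chart (u : Sec EB F E) {p x : M} (hx : x ∈ dom EB p) (f : C^∞⟮𝓘(ℝ, EB), M; ℝ⟯) :
    lie C u f x = fderiv ℝ (f ∘ (chartAt EB p).symm) (chartAt EB p x)
      (fieldRep p (field C u) (chartAt EB p x)) := by
  rw [lie_apply, fieldRep, (chartAt EB p).left_inv hx]
  exact mfderiv_chart hx (mdiffAt f x) _

/-- The divergence in the chart around `x`. -/
theorem divHD_eq_self (σ : PosHalfDensity EB M) (u : Sec EB F E) (x : M) :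
    divHD C σ u x = flatDiv (logRep σ x) (fieldRep x (field C u)) (chartAt EB x x) := by
  have hx := mem_dom (EB := EB) x
  have h1 := (rep_pos σ hx).ne'
  have e1 : dirDeriv (σ.rep x) x (field C u x) = fderiv ℝ (σ.rep x ∘ (chartAt EB x).symm)
      (chartAt EB x x) (fieldRep x (field C u) (chartAt EB x x)) := by
    rw [fieldRep, (chartAt EB x).left_inv hx]
    exact mfderiv_chart hx ((contMDiffAt_rep σ hx).mdifferentiableAt (by simp)) _
  have e2 : fderiv ℝ (logRep σ x) (chartAt EB x x) = (σ.rep x x)⁻¹ •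
      fderiv ℝ (σ.rep x ∘ (chartAt EB x).symm) (chartAt EB x x) := by
    have h2 := ((contDiffAt_comp_chart hx (contMDiffAt_rep σ hx)).differentiableAt (by simp)).hasFDerivAt
    have h3 : (σ.rep x ∘ (chartAt EB x).symm) (chartAt EB x x) = σ.rep x x := by
      simp only [Function.comp, (chartAt EB x).left_inv hx]
    have h4 := (h2.log (by rwa [h3])).fderiv
    rw [h3] at h4
    exact h4
  have e3 : coordDiv (field C u) x = trL (fderiv ℝ (fieldRep x (field C u)) (chartAt EB x x)) := by
    rw [trL_apply]
    unfold coordDiv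
    refine congrArg (LinearMap.trace ℝ EB) (LinearMap.ext fun v => ?_)
    have h5 : (fun y => (trivializationAt EB (TangentSpace 𝓘(ℝ, EB) : M → Type _) x
        ⟨y, field C u y⟩).2) =ᶠ[𝓝 x] fun y => tanCoord EB x y (field C u y) := by
      filter_upwards [(isOpen_dom (EB := EB) x).mem_nhds hx] with y hy
      exact (Bundle.Trivialization.continuousLinearMapAt_apply_of_mem ℝ _ (mem_baseSet hy) _).symm
    rw [h5.mfderiv_eq]
    refine (mfderiv_chart hx ((contMDiffAt_tanCoord u hx).mdifferentiableAt (by simp)) _).trans ?_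
    exact congrArg (fderiv ℝ (fieldRep x (field C u)) (chartAt EB x x)) (tanCoord_coordFrame hx v)
  unfold divHD PosHalfDensity.lieDeriv flatDiv
  change 2 * (dirDeriv (σ.rep x) x (field C u x) + 1 / 2 * coordDiv (field C u) x * σ.rep x x) / _ = _
  rw [e1, e3, e2]
  simp only [smul_apply, smul_eq_mul]
  field_simp

/-- The divergence in any chart. -/
theorem divHD_eq (σ : PosHalfDensity EB M) (u : Sec EB F E) {p x : M} (hx : x ∈ dom EB p) :
    divHD C σ u x = flatDiv (logRep σ p) (fieldRep p (field C u)) (chartAt EB p x) := by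
  rw [divHD_eq_self]
  -- `divHD` at `x` is defined in the chart preferred at `x`, which changes with `x`. Invariance
  -- under the transition map `ψ` makes one chart serve for all nearby points; even smoothness rests
  -- on this.
  set ψ : EB → EB := chartAt EB x ∘ (chartAt EB p).symm with hψ
  have hxx := mem_dom (EB := EB) x
  have hcl : ∀ q ∈ dom EB p, q ∈ dom EB x → ∀ v : TangentSpace 𝓘(ℝ, EB) q,
      tanCoord EB x q v = fderiv ℝ ψ (chartAt EB p q) (tanCoord EB p q v) := fun q hp hq v => by
    rw [← mfderiv_chart hp (mdifferentiableAt_atlas (chart_mem_atlas EB x) hq)]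
    unfold tanCoord
    rw [TangentBundle.continuousLinearMapAt_trivializationAt hq]
    rfl
  have hψy : ψ (chartAt EB p x) = chartAt EB x x := by
    simp only [hψ, Function.comp, (chartAt EB p).left_inv hx]
  have hnear : ∀ᶠ z in 𝓝 (chartAt EB p x), z ∈ (chartAt EB p).target ∧
      (chartAt EB p).symm z ∈ dom EB x := by
    refine ((chartAt EB p).open_target.eventually_mem ((chartAt EB p).map_source hx)).and ?_
    have hc := (chartAt EB p).continuousAt_symm ((chartAt EB p).map_source hx)
    refine hc.eventually_mem ((isOpen_dom x).mem_nhds ?_)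
    rwa [(chartAt EB p).left_inv hx]
  have hframe : ∀ q ∈ dom EB p, q ∈ dom EB x →
      coordFrame p q = (coordFrame x q).comp (fderiv ℝ ψ (chartAt EB p q)) := fun q hp hq => by
    ext v
    have h1 := hcl q hp hq (coordFrame p q v)
    rw [tanCoord_coordFrame hp] at h1
    rw [ContinuousLinearMap.comp_apply, ← h1, coordFrame_tanCoord hq]
  rw [← hψy]
  symm
  refine flatDiv_comp (A := (tanCoord EB p x).comp (coordFrame x x)) ?_ ?_ ?_ ?_ ?_ ?_ ?_ ?_ ?_
  · exact contDiffAt_comp_chart hx (contMDiffAt_of_mem_maximalAtlas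
      (IsManifold.chart_mem_maximalAtlas x) hxx)
  · ext v
    show fderiv ℝ ψ (chartAt EB p x) (tanCoord EB p x (coordFrame x x v)) = v
    rw [← hcl x hx hxx, tanCoord_coordFrame hxx]
  · ext v
    show tanCoord EB p x (coordFrame x x (fderiv ℝ ψ (chartAt EB p x) v)) = v
    have := congrArg (fun L => L v) (hframe x hx hxx)
    rw [ContinuousLinearMap.comp_apply] at this
    rw [← this, tanCoord_coordFrame hx]
  -- If the Jacobian were singular, equivariance would make the positive density vanish on a
  -- coordinate frame.
  · intro h0
    have h1 := rep_pos σ hx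
    unfold PosHalfDensity.rep at h1
    rw [hframe x hx hxx, σ.equivariant, h0] at h1
    simp at h1
  · exact (contDiffAt_fieldRep u hx).differentiableAt (by simp)
  · rw [hψy]; exact (contDiffAt_fieldRep u hxx).differentiableAt (by simp)
  · rw [hψy]; exact (contDiffAt_logRep σ hxx).differentiableAt (by simp)
  · filter_upwards [hnear] with z hz
    have h1 := hcl _ ((chartAt EB p).map_target hz.1) hz.2 (field C u ((chartAt EB p).symm z))
    rw [(chartAt EB p).right_inv hz.1] at h1
    unfold fieldRep
    have h2 : (chartAt EB x).symm (ψ z) = (chartAt EB p).symm z := (chartAt EB x).left_inv hz.2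
    rw [h2, h1]
  · filter_upwards [hnear] with z hz
    have h2 : (chartAt EB x).symm (ψ z) = (chartAt EB p).symm z := (chartAt EB x).left_inv hz.2
    have h3 := hframe _ ((chartAt EB p).map_target hz.1) hz.2
    rw [(chartAt EB p).right_inv hz.1] at h3
    have h4 : σ.rep p ((chartAt EB p).symm z) =
        Real.sqrt |(fderiv ℝ ψ z).det| * σ.rep x ((chartAt EB p).symm z) := by
      rw [PosHalfDensity.rep, h3, σ.equivariant]; rfl
    have h5 := rep_pos σ ((chartAt EB p).map_target hz.1)
    have h6 := rep_pos σ hz.2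
    have h7 : Real.sqrt |(fderiv ℝ ψ z).det| ≠ 0 := fun h0 => by
      rw [h4, h0, zero_mul] at h5
      exact lt_irrefl _ h5
    unfold logRep
    rw [h2, h4, Real.log_mul h7 h6.ne', Real.log_sqrt (abs_nonneg _), Real.log_abs]
    ring

theorem contMDiff_divHD (σ : PosHalfDensity EB M) (u : Sec EB F E) :
    ContMDiff 𝓘(ℝ, EB) 𝓘(ℝ, ℝ) ∞ (divHD C σ u) := fun p => by
  have hp := mem_dom (EB := EB) p
  have h1 : ContMDiffAt 𝓘(ℝ, EB) 𝓘(ℝ, ℝ) ∞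
      (flatDiv (logRep σ p) (fieldRep p (field C u)) ∘ chartAt EB p) p :=
    (flatDiv_contDiffAt (contDiffAt_logRep σ hp) (contDiffAt_fieldRep u hp)).contMDiffAt.comp p
      (contMDiffAt_of_mem_maximalAtlas (IsManifold.chart_mem_maximalAtlas p) hp)
  refine h1.congr_of_eventuallyEq ?_
  filter_upwards [(isOpen_dom (EB := EB) p).mem_nhds hp] with x hx
  exact divHD_eq σ u hx

variable (C) in
/-- The divergence of a section as a smooth function. -/
def divMap (σ : PosHalfDensity EB M) (u : Sec EB F E) : C^∞⟮𝓘(ℝ, EB), M; ℝ⟯ :=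
  ⟨divHD C σ u, contMDiff_divHD σ u⟩

/-- Vectors are separated by linear functionals. A functional composed with the chart agrees near
`x` with a global function, and on functions the anchor of a bracket acts as a commutator. -/
theorem fieldRep_bracket (u v : Sec EB F E) {p x : M} (hx : x ∈ dom EB p) :
    fieldRep p (field C (C.bracket u v)) (chartAt EB p x) =
      fderiv ℝ (fieldRep p (field C v)) (chartAt EB p x) (fieldRep p (field C u) (chartAt EB p x)) -
      fderiv ℝ (fieldRep p (field C u)) (chartAt EB p x) (fieldRep p (field C v) (chartAt EB p x)) := by
  refine (SeparatingDual.eq_iff_forall_dual_eq (R := ℝ)).2 fun a => ?_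
  obtain ⟨f, hf⟩ := exists_contMDiffMap_eventuallyEq (EB := EB) (p := x)
    (g := fun y => a (chartAt EB p y)) (by
      filter_upwards [(isOpen_dom (EB := EB) p).mem_nhds hx] with y hy
      exact a.contDiff.contDiffAt.contMDiffAt.comp y
        (contMDiffAt_of_mem_maximalAtlas (IsManifold.chart_mem_maximalAtlas p) hy))
  have htgt := (chartAt EB p).map_source hx
  have hsymm : Filter.Tendsto (chartAt EB p).symm (𝓝 (chartAt EB p x)) (𝓝 x) := by
    have := (chartAt EB p).continuousAt_symm htgt
    rwa [ContinuousAt, (chartAt EB p).left_inv hx] at this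
  have hfa : f ∘ (chartAt EB p).symm =ᶠ[𝓝 (chartAt EB p x)] a := by
    filter_upwards [hsymm.eventually hf, (chartAt EB p).open_target.mem_nhds htgt] with z hz hz2
    rw [Function.comp, hz, (chartAt EB p).right_inv hz2]
  have h1 : ∀ w : Sec EB F E, lie C w f ∘ (chartAt EB p).symm =ᶠ[𝓝 (chartAt EB p x)]
      fun z => a (fieldRep p (field C w) z) := fun w => by
    filter_upwards [hfa.eventuallyEq_nhds, (chartAt EB p).open_target.mem_nhds htgt] with z hz hz2
    rw [Function.comp, lie_chart w ((chartAt EB p).map_target hz2), (chartAt EB p).right_inv hz2,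
      hz.fderiv_eq, a.fderiv]
  have h2 : ∀ w w' : Sec EB F E, lie C w (lie C w' f) x = a (fderiv ℝ (fieldRep p (field C w'))
      (chartAt EB p x) (fieldRep p (field C w) (chartAt EB p x))) := fun w w' => by
    rw [lie_chart w hx, (h1 w').fderiv_eq]
    have h3 := (a.hasFDerivAt.comp (chartAt EB p x)
      ((contDiffAt_fieldRep (C := C) w' hx).differentiableAt (by simp)).hasFDerivAt).fderiv
    have h4 : fderiv ℝ (fun z => a (fieldRep p (field C w') z)) (chartAt EB p x) = _ := h3
    rw [h4]; rfl
  have h5 : lie C (C.bracket u v) f x = lie C u (lie C v f) x - lie C v (lie C u f) x := by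
    rw [lie_bracket']; rfl
  rw [lie_chart _ hx, hfa.fderiv_eq, a.fderiv, h2, h2] at h5
  rw [h5, map_sub]

theorem represents_divMap (σ : PosHalfDensity EB M) : Represents (C := C) σ (divMap C σ) where
  eq u x := rfl
  isDivergence := by
    have dX : ∀ (u : Sec EB F E) (x : M), DifferentiableAt ℝ (fieldRep x (field C u)) (chartAt EB x x) :=
      fun u x => (contDiffAt_fieldRep u (mem_dom x)).differentiableAt (by simp)
    refine ⟨fun u v => ?_, fun f u => ?_, fun u v => ?_⟩
    · ext x
      show divHD C σ _ x = divHD C σ u x + divHD C σ v x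
      rw [divHD_eq_self σ u, divHD_eq_self σ v, ← flatDiv_add _ (dX u x) (dX v x), divHD_eq_self]
      refine flatDiv_congr (Filter.EventuallyEq.rfl) (Filter.Eventually.of_forall fun y => ?_)
      simp only [fieldRep, field]
      rw [← map_add, ← map_add]; rfl
    · ext x
      show divHD C σ _ x = f x * divHD C σ u x + lie C u f x
      have hf : DifferentiableAt ℝ (f ∘ (chartAt EB x).symm) (chartAt EB x x) :=
        (contDiffAt_comp_chart (mem_dom x) f.contMDiff.contMDiffAt).differentiableAt (by simp)
      have h := flatDiv_smul (logRep σ x) hf (dX u x)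
      have hfx : (f ∘ (chartAt EB x).symm) (chartAt EB x x) = f x := by
        simp only [Function.comp, (chartAt EB x).left_inv (mem_dom x)]
      rw [hfx] at h
      rw [divHD_eq_self σ u, lie_chart u (mem_dom x), ← h, divHD_eq_self]
      refine flatDiv_congr (Filter.EventuallyEq.rfl) (Filter.Eventually.of_forall fun y => ?_)
      simp only [fieldRep, field]
      have : fsmul f u ((chartAt EB x).symm y) = f ((chartAt EB x).symm y) • u ((chartAt EB x).symm y) := rfl
      rw [this, map_smul, map_smul]; rfl
    · ext x
      show divHD C σ _ x = lie C u (divMap C σ v) x - lie C v (divMap C σ u) x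
      have hx := mem_dom (EB := EB) x
      have htgt := (chartAt EB x).map_source hx
      have h1 : ∀ w : Sec EB F E, divMap C σ w ∘ (chartAt EB x).symm =ᶠ[𝓝 (chartAt EB x x)]
          flatDiv (logRep σ x) (fieldRep x (field C w)) := fun w => by
        filter_upwards [(chartAt EB x).open_target.mem_nhds htgt] with z hz
        have h2 := divHD_eq (C := C) σ w ((chartAt EB x).map_target hz)
        rw [(chartAt EB x).right_inv hz] at h2
        exact h2
      rw [lie_chart u hx, lie_chart v hx, (h1 u).fderiv_eq, (h1 v).fderiv_eq,
        ← flatDiv_bracket (contDiffAt_logRep σ hx) (contDiffAt_fieldRep u hx) (contDiffAt_fieldRep v hx),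
        divHD_eq_self]
      refine flatDiv_congr (Filter.EventuallyEq.rfl) ?_
      filter_upwards [(chartAt EB x).open_target.mem_nhds htgt] with z hz
      have h2 := fieldRep_bracket (C := C) u v ((chartAt EB x).map_target hz)
      rwa [(chartAt EB x).right_inv hz] at h2

end Charts

/-- The conditions on an operator `Γ(E) → Γ(E^* ⊗ E)` at a point to be a connection in `LC(G, div_σ)`. -/
structure IsLCAt (G : GenPseudometric C) (σ : PosHalfDensity EB M) (Φ : Sec EB F E → ∀ x : M, Module.End ℝ (E x))
    (x : M) : Prop where
  add : ∀ v w : Sec EB F E, Φ (v + w) x = Φ v x + Φ w x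
  leibniz : ∀ (f : C^∞⟮𝓘(ℝ, EB), M; ℝ⟯) (v : Sec EB F E) (e : E x),
    Φ (fsmul f v) x e = f x • Φ v x e + dirDeriv f x (C.anchor x e) • v x
  metric : ∀ (v w : Sec EB F E) (e : E x),
    dirDeriv (fun y => C.pairing y (v y) (w y)) x (C.anchor x e) =
      C.pairing x (Φ v x e) (w x) + C.pairing x (v x) (Φ w x e)
  compatible : ∀ v Gv : Sec EB F E, (∀ x, Gv x = G.toFun x (v x)) →
    ∀ e : E x, Φ Gv x e = G.toFun x (Φ v x e)
  torsionFree : ∀ u v w : Sec EB F E,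
    C.pairing x (Φ v x (u x) - Φ u x (v x) - C.bracket u v x) (w x) +
      C.pairing x (Φ u x (w x)) (v x) = 0
  divergence : ∀ u : Sec EB F E, LinearMap.trace ℝ (E x) (Φ u x) = divHD C σ u x

/-! ### Existence of connections in `LC(G, div_σ)` -/

variable {G : GenPseudometric C} {σ : PosHalfDensity EB M}

/-- Connections can be glued with a partition of unity. -/
theorem exists_isLC_of_local (h : ∀ p : M, ∃ (U : Set M) (Φ : Sec EB F E → ∀ x : M, Module.End ℝ (E x)),
    IsOpen U ∧ p ∈ U ∧ (∀ u v w : Sec EB F E, ContMDiff 𝓘(ℝ, EB) 𝓘(ℝ, ℝ) ∞ fun x =>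
      C.pairing x (Φ v x (u x)) (w x)) ∧ ∀ x ∈ U, IsLCAt G σ Φ x) :
    ∃ D : Connection C, D.IsLC G σ := by
  choose U Φ hUo hpU hsm hLC using h
  obtain ⟨ψ, hψ⟩ := SmoothPartitionOfUnity.exists_isSubordinate 𝓘(ℝ, EB) isClosed_univ U hUo
    (fun x _ => mem_iUnion.2 ⟨x, hpU x⟩)
  have hLC' : ∀ x, ∀ i ∈ ψ.finsupport x, IsLCAt G σ (Φ i) x := fun x i hi => by
    refine hLC i x (hψ i (subset_tsupport _ ?_))
    exact (ψ.mem_finsupport x).1 hi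
  have hone : ∀ x, ∑ i ∈ ψ.finsupport x, ψ i x = 1 := fun x => ψ.sum_finsupport x (mem_univ x)
  -- All conditions in `IsLCAt` are affine in the operator, hence are preserved by averages with
  -- weights of sum one.
  set D : Sec EB F E → ∀ x : M, Module.End ℝ (E x) := fun v x => ∑ i ∈ ψ.finsupport x, ψ i x • Φ i v x with hD
  have happ : ∀ v x e, D v x e = ∑ i ∈ ψ.finsupport x, ψ i x • Φ i v x e := fun v x e => by
    simp [hD, LinearMap.sum_apply]
  have hpair : ∀ v x e a, C.pairing x (D v x e) a =
      ∑ i ∈ ψ.finsupport x, ψ i x * C.pairing x (Φ i v x e) a := fun v x e a => by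
    simp [happ, map_sum, LinearMap.sum_apply]
  have hDx : ∀ x, IsLCAt G σ D x := fun x => by
    refine ⟨fun v w => ?_, fun f v e => ?_, fun v w e => ?_, fun v Gv hv e => ?_, fun u v w => ?_, fun u => ?_⟩
    · simp only [hD, ← Finset.sum_add_distrib, ← smul_add]
      exact Finset.sum_congr rfl fun i hi => by rw [(hLC' x i hi).add]
    · rw [happ, happ, ← one_smul ℝ (dirDeriv f x (C.anchor x e) • v x), ← hone x, Finset.smul_sum,
        Finset.sum_smul, ← Finset.sum_add_distrib]
      refine Finset.sum_congr rfl fun i hi => ?_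
      rw [(hLC' x i hi).leibniz, smul_add, smul_comm (f x)]
    · rw [C.pairing_symm x (v x), hpair, hpair, ← one_mul (dirDeriv _ x _), ← hone x, Finset.sum_mul,
        ← Finset.sum_add_distrib]
      refine Finset.sum_congr rfl fun i hi => ?_
      rw [(hLC' x i hi).metric, C.pairing_symm x (v x), mul_add]
    · rw [happ, happ, map_sum]
      refine Finset.sum_congr rfl fun i hi => ?_
      rw [(hLC' x i hi).compatible v Gv hv, map_smul]
    · rw [map_sub, map_sub, LinearMap.sub_apply, LinearMap.sub_apply, hpair, hpair, hpair,
        ← one_mul (C.pairing x (C.bracket u v x) _), ← hone x, Finset.sum_mul, ← Finset.sum_sub_distrib,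
        ← Finset.sum_sub_distrib, ← Finset.sum_add_distrib]
      refine Finset.sum_eq_zero fun i hi => ?_
      have := (hLC' x i hi).torsionFree u v w
      rw [map_sub, map_sub, LinearMap.sub_apply, LinearMap.sub_apply] at this
      linear_combination ψ i x * this
    · simp only [hD, map_sum, map_smul, smul_eq_mul]
      rw [← one_mul (divHD C σ u x), ← hone x, Finset.sum_mul]
      exact Finset.sum_congr rfl fun i hi => by rw [(hLC' x i hi).divergence]
  refine ⟨⟨D, fun u v => ?_, fun v w x => (hDx x).add v w, fun f v x => (hDx x).leibniz f v,
    fun v w x => (hDx x).metric v w⟩, ⟨fun v Gv hv x => (hDx x).compatible v Gv hv, fun u v w x =>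
    (hDx x).torsionFree u v w, fun u x => (hDx x).divergence u⟩⟩
  obtain ⟨S, hS⟩ := exists_sec_of_pairing C (fun x => D v x (u x)) fun w => by
    simp only [hpair]
    have h1 : ∀ x, ∑ i ∈ ψ.finsupport x, ψ i x * C.pairing x (Φ i v x (u x)) (w x) =
        ∑ᶠ i, ψ i x • C.pairing x (Φ i v x (u x)) (w x) := fun x =>
      ψ.sum_finsupport_smul_eq_finsum x fun i x => C.pairing x (Φ i v x (u x)) (w x)
    simp only [h1]
    exact ψ.contMDiff_finsum_smul fun i x _ => (hsm i u v w).contMDiffAt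
  have h2 : (fun x => Bundle.TotalSpace.mk' F x (D v x (u x))) = fun x => Bundle.TotalSpace.mk' F x (S x) :=
    funext fun x => by rw [hS]
  rw [h2]
  exact S.contMDiff

namespace IsFrameOn

variable {ι : Type*} [Fintype ι] [DecidableEq ι] {U : Set M} {e : ι → Sec EB F E} {ε : ι → ℝ}

/-- The connection with given coefficients in a frame. -/
def locConn (C : CourantAlgebroid EB F E) (e : ι → Sec EB F E) (ε : ι → ℝ)
    (Γ : ι → ι → ι → C^∞⟮𝓘(ℝ, EB), M; ℝ⟯) (v : Sec EB F E) (x : M) :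
    Module.End ℝ (E x) :=
  ∑ K, ((ε K • ((dirDeriv (pair C v (e K)) x).comp (C.anchor x) +
    ∑ A, (ε A * ctr ε fun B => pair C v (e B) x * Γ A B K x) • (C.pairing x).flip (e A x))).smulRight (e K x))

/-- Its components. -/
def locFun (C : CourantAlgebroid EB F E) (e : ι → Sec EB F E) (ε : ι → ℝ)
    (Γ : ι → ι → ι → C^∞⟮𝓘(ℝ, EB), M; ℝ⟯) (u v : Sec EB F E) (K : ι) : C^∞⟮𝓘(ℝ, EB), M; ℝ⟯ :=
  lie C u (pair C v (e K)) + ∑ A, cst EB M (ε A) * (pair C u (e A) *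
    ∑ B, cst EB M (ε B) * (pair C v (e B) * Γ A B K))

theorem locFun_apply (Γ : ι → ι → ι → C^∞⟮𝓘(ℝ, EB), M; ℝ⟯) (u v : Sec EB F E) (K : ι) (x : M) :
    locFun C e ε Γ u v K x = lie C u (pair C v (e K)) x + ctr ε fun A => pair C u (e A) x *
      ctr ε fun B => pair C v (e B) x * Γ A B K x := by
  have hs : ∀ g : ι → C^∞⟮𝓘(ℝ, EB), M; ℝ⟯, (∑ A, g A) x = ∑ A, g A x := fun g =>
    map_sum (evalAt (EB := EB) x) g _
  unfold locFun ctr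
  show _ + (∑ A, _ : C^∞⟮𝓘(ℝ, EB), M; ℝ⟯) x = _
  rw [hs]
  congr 1
  refine Finset.sum_congr rfl fun A _ => ?_
  show cst EB M (ε A) x * (_ * (∑ B, _ : C^∞⟮𝓘(ℝ, EB), M; ℝ⟯) x) = _
  rw [hs, cst_apply]
  congr 2

theorem locConn_apply (Γ : ι → ι → ι → C^∞⟮𝓘(ℝ, EB), M; ℝ⟯) (u v : Sec EB F E) (x : M) :
    locConn C e ε Γ v x (u x) = ∑ K, (ε K * locFun C e ε Γ u v K x) • e K x := by
  simp only [locFun_apply]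
  unfold locConn
  simp only [LinearMap.sum_apply, LinearMap.smulRight_apply]
  refine Finset.sum_congr rfl fun K _ => ?_
  congr 1
  simp only [LinearMap.smul_apply, LinearMap.add_apply, LinearMap.comp_apply, LinearMap.sum_apply, smul_eq_mul]
  rw [lie_apply]
  congr 2
  unfold ctr
  refine Finset.sum_congr rfl fun A _ => ?_
  show (ε A * _) * C.pairing x (u x) (e A x) = ε A * (C.pairing x (u x) (e A x) * _)
  ring

theorem contMDiff_pair_locConn (Γ : ι → ι → ι → C^∞⟮𝓘(ℝ, EB), M; ℝ⟯) (u v w : Sec EB F E) :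
    ContMDiff 𝓘(ℝ, EB) 𝓘(ℝ, ℝ) ∞ fun x => C.pairing x (locConn C e ε Γ v x (u x)) (w x) := by
  have h : (fun x => C.pairing x (locConn C e ε Γ v x (u x)) (w x)) =
      pair C (∑ K, fsmul (cst EB M (ε K) * locFun C e ε Γ u v K) (e K)) w := by
    funext x
    rw [pair_apply, sec_sum_apply, locConn_apply]
    congr 2
  rw [h]
  exact (pair C _ w).contMDiff

variable (hF : IsFrameOn C U e ε)
include hF

theorem pairing_locConn_frame (Γ : ι → ι → ι → C^∞⟮𝓘(ℝ, EB), M; ℝ⟯) (u v : Sec EB F E) {x : M} (hx : x ∈ U)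
    (K : ι) : C.pairing x (locConn C e ε Γ v x (u x)) (e K x) = locFun C e ε Γ u v K x := by
  rw [locConn_apply]
  simp only [map_sum, map_smul, LinearMap.sum_apply, LinearMap.smul_apply, smul_eq_mul, hF.orth x hx, mul_ite,
    mul_zero, Finset.sum_ite_eq', Finset.mem_univ, if_true]
  linear_combination locFun C e ε Γ u v K x * hF.sq K

theorem eq_of_pairing_frame {x : M} (hx : x ∈ U) {a b : E x}
    (h : ∀ K, C.pairing x a (e K x) = C.pairing x b (e K x)) : a = b := by
  rw [hF.span x hx a, hF.span x hx b]
  simp only [h]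

theorem locFun_frame (Γ : ι → ι → ι → C^∞⟮𝓘(ℝ, EB), M; ℝ⟯) {x : M} (hx : x ∈ U) (A B K : ι) :
    locFun C e ε Γ (e A) (e B) K x = Γ A B K x := by
  rw [locFun_apply, hF.lie_pair_frame hx]
  simp only [(hF.pair_eventuallyEq hx _ _).self_of_nhds, ctr, ite_mul, zero_mul, mul_ite, mul_zero,
    Finset.sum_ite_eq, Finset.mem_univ, if_true]
  linear_combination Γ A B K x * (ε B * ε B * hF.sq A + hF.sq B)

/-- A trilinear functional vanishing on the frame vanishes. -/
theorem eq_zero_of_frame {p : M} (hp : p ∈ U) (Φ : Sec EB F E → Sec EB F E → Sec EB F E → ℝ)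
    (a1 : ∀ u u' v w, Φ (u + u') v w = Φ u v w + Φ u' v w) (m1 : ∀ f u v w, Φ (fsmul f u) v w = f p * Φ u v w)
    (a2 : ∀ u v v' w, Φ u (v + v') w = Φ u v w + Φ u v' w) (m2 : ∀ f u v w, Φ u (fsmul f v) w = f p * Φ u v w)
    (a3 : ∀ u v w w', Φ u v (w + w') = Φ u v w + Φ u v w') (m3 : ∀ f u v w, Φ u v (fsmul f w) = f p * Φ u v w)
    (h : ∀ A B K, Φ (e A) (e B) (e K) = 0) (u v w : Sec EB F E) : Φ u v w = 0 := by
  rw [hF.tensorial hp (fun u => Φ u v w) (fun u u' => a1 u u' v w) (fun f u => m1 f u v w)]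
  rw [ctr_congr (g := fun _ => 0) _ fun A => ?_, ctr_zero]
  rw [hF.tensorial hp (fun v => Φ (e A) v w) (fun v v' => a2 _ v v' w) (fun f v => m2 f _ v w)]
  rw [ctr_congr (g := fun _ => 0) _ fun B => ?_, ctr_zero, mul_zero]
  rw [hF.tensorial hp (fun w => Φ (e A) (e B) w) (fun w w' => a3 _ _ w w') (fun f w => m3 f _ _ w)]
  rw [ctr_congr (g := fun _ => 0) _ fun K => ?_, ctr_zero, mul_zero]
  rw [h, mul_zero]

/-- Additivity and the Leibniz rule are built into `locConn`. They make the defects of the metric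
and torsion conditions trilinear over functions, so that these need only be checked on the frame;
the defect of the divergence is linear and treated likewise. Compatibility holds since mixed
coefficients vanish. -/
theorem isLCAt {δ : Sec EB F E → C^∞⟮𝓘(ℝ, EB), M; ℝ⟯} (hδ : Represents (C := C) σ δ) {pos : ι → Bool}
    (ha : IsAdapted G U e pos) {Γ : ι → ι → ι → C^∞⟮𝓘(ℝ, EB), M; ℝ⟯} {x : M} (hx : x ∈ U)
    (Γa : ∀ A B K, Γ A B K x = -Γ A K B x)
    (Γc : ∀ A B K, Γ A B K x + Γ B K A x + Γ K A B x = C.pairing x (C.bracket (e A) (e B) x) (e K x))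
    (Γt : ∀ B, ctr ε (fun A => Γ A B A x) = δ (e B) x) (Γm : ∀ A B K, pos B ≠ pos K → Γ A B K x = 0) :
    IsLCAt G σ (locConn C e ε Γ) x := by
  have hadd : ∀ v w : Sec EB F E, locConn C e ε Γ (v + w) x = locConn C e ε Γ v x + locConn C e ε Γ w x :=
    fun v w => by
    refine LinearMap.ext fun a => ?_
    obtain ⟨u, rfl⟩ := exists_sec (EB := EB) (F := F) x a
    refine hF.eq_of_pairing_frame hx fun K => ?_
    rw [LinearMap.add_apply, map_add, LinearMap.add_apply, hF.pairing_locConn_frame Γ _ _ hx,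
      hF.pairing_locConn_frame Γ _ _ hx, hF.pairing_locConn_frame Γ _ _ hx, locFun_apply, locFun_apply,
      locFun_apply, pair_add, lie_add]
    simp only [pair_add, ContMDiffMap.coe_add, Pi.add_apply, add_mul, mul_add, ctr_add]
    ring
  have hleib : ∀ (f : C^∞⟮𝓘(ℝ, EB), M; ℝ⟯) (u v : Sec EB F E), locConn C e ε Γ (fsmul f v) x (u x) =
      f x • locConn C e ε Γ v x (u x) + lie C u f x • v x := fun f u v => by
    refine hF.eq_of_pairing_frame hx fun K => ?_
    rw [map_add, map_smul, map_smul, LinearMap.add_apply, LinearMap.smul_apply, LinearMap.smul_apply,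
      hF.pairing_locConn_frame Γ _ _ hx, hF.pairing_locConn_frame Γ _ _ hx, locFun_apply, locFun_apply,
      pair_fsmul, lie_mul]
    simp only [pair_fsmul, ContMDiffMap.coe_mul, ContMDiffMap.coe_add, Pi.add_apply, Pi.mul_apply,
      mul_assoc, smul_eq_mul, ctr_mul_left, mul_left_comm _ (f x)]
    rw [pair_apply]; ring
  have hfr : ∀ A B K, C.pairing x (locConn C e ε Γ (e B) x (e A x)) (e K x) = Γ A B K x := fun A B K => by
    rw [hF.pairing_locConn_frame Γ _ _ hx, hF.locFun_frame Γ hx]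
  have fs : ∀ (f : C^∞⟮𝓘(ℝ, EB), M; ℝ⟯) (u : Sec EB F E), fsmul f u x = f x • u x := fun _ _ => rfl
  have ad : ∀ u v : Sec EB F E, (u + v) x = u x + v x := fun _ _ => rfl
  refine ⟨hadd, fun f v a => ?_, fun v w a => ?_, fun v Gv hv a => ?_, fun u v w => ?_, fun u => ?_⟩
  · obtain ⟨u, rfl⟩ := exists_sec (EB := EB) (F := F) x a
    exact hleib f u v
  · obtain ⟨u, rfl⟩ := exists_sec (EB := EB) (F := F) x a
    have h := hF.eq_zero_of_frame hx (fun u v w => lie C u (pair C v w) x -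
      (C.pairing x (locConn C e ε Γ v x (u x)) (w x) + C.pairing x (v x) (locConn C e ε Γ w x (u x))))
      ?_ ?_ ?_ ?_ ?_ ?_ (fun A B K => ?_) u v w
    · exact sub_eq_zero.1 h
    · intro u u' v w
      rw [lie_add_left]
      simp only [ad, map_add, LinearMap.add_apply, ContMDiffMap.coe_add, Pi.add_apply]; ring
    · intro f u v w
      rw [lie_fsmul]
      simp only [fs, map_smul, LinearMap.smul_apply, ContMDiffMap.coe_mul, Pi.mul_apply, smul_eq_mul]; ring
    · intro u v v' w
      rw [pair_add, lie_add, hadd]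
      simp only [ad, map_add, LinearMap.add_apply, ContMDiffMap.coe_add, Pi.add_apply]; ring
    · intro f u v w
      rw [pair_fsmul, lie_mul, hleib]
      simp only [fs, map_smul, map_add, LinearMap.add_apply, LinearMap.smul_apply, ContMDiffMap.coe_mul,
        ContMDiffMap.coe_add, Pi.add_apply, Pi.mul_apply, smul_eq_mul, pair_apply]; ring
    · intro u v w w'
      rw [pair_add_right, lie_add, hadd]
      simp only [ad, map_add, LinearMap.add_apply, ContMDiffMap.coe_add, Pi.add_apply]; ring
    · intro f u v w
      rw [pair_fsmul_right, lie_mul, hleib]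
      simp only [fs, map_smul, map_add, ContMDiffMap.coe_mul,
        ContMDiffMap.coe_add, Pi.add_apply, Pi.mul_apply, smul_eq_mul, pair_apply]; ring
    · rw [hF.lie_pair_frame hx, C.pairing_symm x (e B x), hfr, hfr, Γa A B K]; ring
  · obtain ⟨u, rfl⟩ := exists_sec (EB := EB) (F := F) x a
    refine hF.eq_of_pairing_frame hx fun K => ?_
    have hpg : ∀ K, ∀ y ∈ U, pair C Gv (e K) y = (if pos K then (1 : ℝ) else -1) * pair C v (e K) y :=
      fun K y hy => by
      rw [pair_apply, hv, G.symm, ha y hy, map_smul, smul_eq_mul]; rfl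
    have hl : lie C u (pair C Gv (e K)) x = (if pos K then (1 : ℝ) else -1) * lie C u (pair C v (e K)) x := by
      have h1 : lie C u (pair C Gv (e K)) x =
          lie C u (cst EB M (if pos K then (1 : ℝ) else -1) * pair C v (e K)) x := lie_congr (by
        filter_upwards [hF.isOpen.mem_nhds hx] with y hy
        rw [hpg K y hy]
        show _ = cst EB M _ y * _
        rw [cst_apply])
      rw [h1, lie_mul]
      show cst EB M _ x * _ + _ * lie C u (cst EB M _) x = _
      rw [cst_apply, lie_eq_zero_of_eventuallyEq_const (Filter.Eventually.of_forall fun y => cst_apply _ _)]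
      ring
    rw [hF.pairing_locConn_frame Γ _ _ hx, G.symm, ha x hx, map_smul, smul_eq_mul,
      hF.pairing_locConn_frame Γ _ _ hx, locFun_apply, locFun_apply, hl, mul_add, ← ctr_mul_left]
    congr 1
    refine ctr_congr _ fun A => ?_
    rw [← ctr_mul_left, ← ctr_mul_left, ← ctr_mul_left]
    refine ctr_congr _ fun B => ?_
    rw [hpg B x hx]
    by_cases hBK : pos B = pos K
    · rw [hBK]; ring
    · rw [Γm A B K hBK]; ring
  · have h := hF.eq_zero_of_frame hx (fun u v w => C.pairing x (locConn C e ε Γ v x (u x)) (w x) -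
      C.pairing x (locConn C e ε Γ u x (v x)) (w x) - pair C (C.bracket u v) w x +
      C.pairing x (locConn C e ε Γ u x (w x)) (v x)) ?_ ?_ ?_ ?_ ?_ ?_ (fun A B K => ?_) u v w
    · rw [map_sub, map_sub, LinearMap.sub_apply, LinearMap.sub_apply]
      exact h
    · intro u u' v w
      rw [hadd]
      simp only [ad, pair_add, map_add, LinearMap.add_apply, ContMDiffMap.coe_add, Pi.add_apply]; ring
    · intro f u v w
      -- The bracket obeys a Leibniz rule only in its second argument; the symmetric part exchanges
      -- the arguments.
      have h1 : ∀ z : Sec EB F E, pair C (C.bracket z v) w = lie C w (pair C z v) - pair C (C.bracket v z) w :=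
        fun z => by rw [← pair_bracket_symm]; ring
      rw [hleib, hleib, h1, h1, bracket_fsmul, pair_add, pair_fsmul, pair_fsmul, pair_fsmul, lie_mul]
      simp only [fs, map_smul, map_add, LinearMap.add_apply, LinearMap.smul_apply, ContMDiffMap.coe_mul,
        ContMDiffMap.coe_add, ContMDiffMap.coe_sub, Pi.sub_apply, Pi.add_apply, Pi.mul_apply, smul_eq_mul,
        pair_apply]; ring
    · intro u v v' w
      rw [hadd, map_add, pair_add]
      simp only [ad, map_add, LinearMap.add_apply, ContMDiffMap.coe_add, Pi.add_apply]; ring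
    · intro f u v w
      rw [hleib, bracket_fsmul, pair_add, pair_fsmul, pair_fsmul]
      simp only [fs, map_smul, map_add, LinearMap.add_apply, LinearMap.smul_apply, ContMDiffMap.coe_mul,
        ContMDiffMap.coe_add, Pi.add_apply, Pi.mul_apply, smul_eq_mul, pair_apply]; ring
    · intro u v w w'
      rw [pair_add_right]
      simp only [ad, map_add, LinearMap.add_apply, ContMDiffMap.coe_add, Pi.add_apply]; ring
    · intro f u v w
      rw [pair_fsmul_right]
      simp only [fs, map_smul, LinearMap.smul_apply, ContMDiffMap.coe_mul,
        Pi.mul_apply, smul_eq_mul, pair_apply]; ring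
    · rw [hfr, hfr, hfr, pair_apply, ← Γc A B K, Γa B A K]; ring
  · rw [← hδ.eq, hF.trace_eq hx]
    have htr : ∀ u : Sec EB F E, ctr ε (fun A => C.pairing x (locConn C e ε Γ u x (e A x)) (e A x)) - δ u x =
        ctr ε fun B => C.pairing x (u x) (e B x) *
        (ctr ε (fun A => C.pairing x (locConn C e ε Γ (e B) x (e A x)) (e A x)) - δ (e B) x) := fun u => by
      refine hF.tensorial hx (fun u => ctr ε (fun A => C.pairing x (locConn C e ε Γ u x (e A x)) (e A x)) -
        δ u x) (fun u v => ?_) (fun f u => ?_) u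
      · rw [hadd, hδ.isDivergence.add]
        simp only [map_add, LinearMap.add_apply, ContMDiffMap.coe_add, Pi.add_apply, ctr_add]; ring
      · rw [hδ.isDivergence.fsmul, ctr_congr (g := fun A => f x * C.pairing x (locConn C e ε Γ u x (e A x)) (e A x)
          + C.pairing x (u x) (e A x) * lie C (e A) f x) _ fun A => by
            rw [hleib, map_add, map_smul, map_smul, LinearMap.add_apply, LinearMap.smul_apply,
              LinearMap.smul_apply, smul_eq_mul, smul_eq_mul]; ring,
          ctr_add, ctr_mul_left, ← hF.lie_eq hx]
        simp only [ContMDiffMap.coe_mul, ContMDiffMap.coe_add, Pi.add_apply, Pi.mul_apply]; ring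
    refine sub_eq_zero.1 ((htr u).trans ?_)
    simp only [hfr, Γt, sub_self, mul_zero, ctr_zero]

/-- The multiplicity of an eigenvalue in a diagonalizing frame is not one. -/
theorem card_ne_one {pos : ι → Bool} (ha : IsAdapted G U e pos) {x : M} (hx : x ∈ U) (s : Bool) :
    (Finset.univ.filter fun A => pos A = s).card ≠ 1 := by
  intro h
  obtain ⟨A, hA⟩ := Finset.card_eq_one.1 h
  have hA' : ∀ B, pos B = s ↔ B = A := fun B => by
    have := Finset.ext_iff.1 hA B
    simpa using this
  have key : Module.finrank ℝ (Module.End.eigenspace (G.toFun x) (if s then 1 else -1)) = 1 := by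
    have hAe : e A x ∈ Module.End.eigenspace (G.toFun x) (if s then 1 else -1) := by
      rw [Module.End.mem_eigenspace_iff, ha x hx, (hA' A).2 rfl]
    have hne : e A x ≠ 0 := fun h0 => by
      have := hF.orth x hx A A
      rw [h0, map_zero, if_pos rfl] at this
      exact hF.ε_ne A this.symm
    refine finrank_eq_one_iff'.2 ⟨⟨e A x, hAe⟩, fun h0 => hne (congrArg Subtype.val h0), fun w => ?_⟩
    refine ⟨ε A * C.pairing x (w : E x) (e A x), Subtype.ext ?_⟩
    show (ε A * C.pairing x (w : E x) (e A x)) • e A x = (w : E x)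
    conv_rhs => rw [hF.span x hx (w : E x)]
    rw [Finset.sum_eq_single A (fun B _ hB => ?_) (by simp)]
    have hw := Module.End.mem_eigenspace_iff.1 w.2
    have h1 : C.pairing x (G.toFun x (w : E x)) (e B x) = _ := congrArg (fun a => C.pairing x a (e B x)) hw
    simp only [G.symm, ha x hx, map_smul, LinearMap.smul_apply, smul_eq_mul] at h1
    have hB' : pos B ≠ s := fun h => hB ((hA' B).1 h)
    have h2 : C.pairing x (w : E x) (e B x) = 0 := by
      have aux : ∀ (r : ℝ) (a b : Bool), a ≠ b → (if a then (1 : ℝ) else -1) * r = (if b then 1 else -1) * r →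
          r = 0 := fun r a b hab hr => by
        cases a <;> cases b <;> simp at hab hr <;> linarith
      exact aux _ _ _ hB' h1
    rw [h2, mul_zero, zero_smul]
  cases s
  · exact G.rank_neg_ne_one x (by simpa using key)
  · exact G.rank_pos_ne_one x (by simpa using key)

end IsFrameOn

/-- Torsion and compatibility force the coefficients whose first index differs in type from the
other two. Within an eigenbundle of rank `n` the cyclic part `c / 3` is completed by a pure trace
term, which adjusts the divergence and requires division by `n - 1`. The local solutions are then
glued. -/
theorem exists_isLC (G : GenPseudometric C) (σ : PosHalfDensity EB M) : ∃ D : Connection C, D.IsLC G σ := by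
  refine exists_isLC_of_local fun p => ?_
  obtain ⟨ι, _, _, U, e, ε, pos, hp, hF, ha⟩ := exists_adapted G p
  have hδ := represents_divMap (C := C) σ
  set d := fun A => divMap C σ (e A) with hd
  set c := fun A B K => pair C (C.bracket (e A) (e B)) (e K) with hc
  set n : Bool → ℝ := fun s => ((Finset.univ.filter fun A => pos A = s).card : ℝ) with hn
  have hn1 : ∀ s, n s - 1 ≠ 0 := fun s h => hF.card_ne_one ha hp s (by
    have : ((Finset.univ.filter fun A => pos A = s).card : ℝ) = 1 := sub_eq_zero.1 h
    exact_mod_cast this)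
  -- The cyclic sum of the last bracket is zero, and its trace is `(n - 1) d_B`, while the trace of
  -- `c / 3` vanishes by antisymmetry.
  set Γ : ι → ι → ι → C^∞⟮𝓘(ℝ, EB), M; ℝ⟯ := fun A B K => if pos B ≠ pos K then 0 else
    if pos A ≠ pos B then c A B K else cst EB M (1 / 3) * c A B K + cst EB M ((n (pos A) - 1)⁻¹) *
      ((if A = K then cst EB M (ε A) * d B else 0) - if A = B then cst EB M (ε A) * d K else 0) with hΓ
  have hΓx : ∀ A B K x, Γ A B K x = if pos B ≠ pos K then 0 else
    if pos A ≠ pos B then c A B K x else 1 / 3 * c A B K x + (n (pos A) - 1)⁻¹ *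
      ((if A = K then ε A * d B x else 0) - if A = B then ε A * d K x else 0) := fun A B K x => by
    simp only [hΓ]
    split_ifs <;> simp [cst_apply]
  refine ⟨U, IsFrameOn.locConn C e ε Γ, hF.isOpen, hp, IsFrameOn.contMDiff_pair_locConn Γ, fun x hx => ?_⟩
  have c12 : ∀ A B D, c A B D x = -c B A D x := fun A B D => by
    have h1 : pair C (C.bracket (e A) (e B)) (e D) x + pair C (C.bracket (e B) (e A)) (e D) x = _ :=
      DFunLike.congr_fun (pair_bracket_symm (C := C) (e A) (e B) (e D)) x
    rw [hF.lie_pair_frame hx] at h1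
    exact eq_neg_of_add_eq_zero_left h1
  have c23 : ∀ A B D, c A B D x = -c A D B x := fun A B D => by
    have h1 : _ = pair C (C.bracket (e A) (e B)) (e D) x + pair C (e B) (C.bracket (e A) (e D)) x :=
      DFunLike.congr_fun (lie_pair (C := C) (e A) (e B) (e D)) x
    rw [hF.lie_pair_frame hx, pair_comm (e B)] at h1
    exact eq_neg_of_add_eq_zero_left h1.symm
  have crot : ∀ A B D, c B D A x = c A B D x := fun A B D => by rw [c23, c12 B A, neg_neg]
  refine hF.isLCAt hδ ha hx (fun A B K => ?_) (fun A B K => ?_) (fun B => ?_) (fun A B K h => ?_)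
  · rw [hΓx, hΓx, c23 A B K]
    by_cases h1 : pos B = pos K
    · simp only [h1, ne_eq, not_true_eq_false, if_false]
      split_ifs <;> ring
    · simp [h1, Ne.symm h1]
  · show _ = c A B K x
    rw [hΓx, hΓx, hΓx, crot A B K, ← crot K A B]
    by_cases h1 : pos A = pos B <;> by_cases h2 : pos B = pos K
    · have h3 := h1.trans h2
      simp only [h1, h2, ne_eq, not_true_eq_false, if_false, eq_comm (a := B) (b := A),
        eq_comm (a := K) (b := A), eq_comm (a := K) (b := B)]
      split_ifs <;> subst_vars <;> ring
    · have h3 : pos A ≠ pos K := fun h => h2 (h1.symm.trans h)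
      simp [h1, h2, Ne.symm h2]
    · have h3 : pos A ≠ pos K := fun h => h1 (h.trans h2.symm)
      simp [← h2, h1, Ne.symm h1]
    · by_cases h3 : pos A = pos K
      · simp [← h3, h1, Ne.symm h1]
      -- Three indices cannot have pairwise different eigenvalues when only two eigenvalues exist.
      · exfalso
        revert h1 h2 h3
        generalize pos A = a; generalize pos B = b; generalize pos K = k
        decide +revert
  · have h1 : ∀ A, Γ A B A x = if pos A = pos B then (n (pos B) - 1)⁻¹ *
        (ε A * d B x - if A = B then ε A * d A x else 0) else 0 := fun A => by
      have h0 : c A B A x = 0 := by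
        have := c12 A B A; have h' := crot A B A; have := c12 B A A; have := c23 B A A
        linarith
      rw [hΓx, h0]
      by_cases h : pos A = pos B
      · simp [h]
      · simp [h, Ne.symm h]
    simp only [h1, ctr, mul_ite, mul_zero]
    rw [← Finset.sum_filter]
    have h2 : ∀ A, ε A * ((n (pos B) - 1)⁻¹ * (ε A * d B x - if A = B then ε A * d A x else 0)) =
        (n (pos B) - 1)⁻¹ * (d B x - if A = B then d B x else 0) := fun A => by
      have := hF.sq A
      split_ifs with h
      · subst h; ring
      · linear_combination (n (pos B) - 1)⁻¹ * d B x * this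
    simp only [h2, ← Finset.mul_sum, Finset.sum_sub_distrib, Finset.sum_const, nsmul_eq_mul]
    rw [Finset.sum_ite_eq' , if_pos (by simp)]
    show (n (pos B) - 1)⁻¹ * (n (pos B) * d B x - d B x) = d B x
    have := hn1 (pos B)
    field_simp
  · rw [hΓx, if_pos h]

/-! ### Change of the half-density -/

section Weights

variable {σ σ' : PosHalfDensity EB M} {φ : C^∞⟮𝓘(ℝ, EB), M; ℝ⟯}

/-- `σ' = e^{-φ/2} σ`. -/
def IsWeighted (σ σ' : PosHalfDensity EB M) (φ : C^∞⟮𝓘(ℝ, EB), M; ℝ⟯) : Prop :=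
  ∀ x B, σ'.toFun x B = Real.exp (-(φ x) / 2) * σ.toFun x B

theorem isWeighted_weight (σ : PosHalfDensity EB M) (φ : C^∞⟮𝓘(ℝ, EB), M; ℝ⟯) : IsWeighted σ (σ.weight φ) φ :=
  fun _ _ => rfl

theorem IsWeighted.eq_log (h : IsWeighted σ σ' φ) {p x : M} (hx : x ∈ dom EB p) :
    φ x = -2 * (Real.log (σ'.rep p x) - Real.log (σ.rep p x)) := by
  have h1 : σ'.rep p x = Real.exp (-(φ x) / 2) * σ.rep p x := h x _
  rw [h1, Real.log_mul (Real.exp_pos _).ne' (rep_pos σ hx).ne', Real.log_exp]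
  ring

theorem toFun_eq_rep (σ : PosHalfDensity EB M) {p x : M} (hx : x ∈ dom EB p)
    (B : EB →L[ℝ] TangentSpace 𝓘(ℝ, EB) x) :
    σ.toFun x B = Real.sqrt |((tanCoord EB p x).comp B).det| * σ.rep p x := by
  rw [PosHalfDensity.rep, ← σ.equivariant]
  congr 1
  ext v
  exact (coordFrame_tanCoord hx (B v)).symm

/-- The quotient of two positive half-densities is a positive function, since both scale by the same
factor under a change of frame. -/
theorem exists_isWeighted (σ σ' : PosHalfDensity EB M) :
    ∃ φ : C^∞⟮𝓘(ℝ, EB), M; ℝ⟯, IsWeighted σ σ' φ := by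
  -- Independence of the chart lets the quotient be computed in the fixed chart at `p`, which gives
  -- its smoothness there.
  have key : ∀ p x : M, x ∈ dom EB p → Real.log (σ'.rep p x) - Real.log (σ.rep p x) =
      Real.log (σ'.rep x x) - Real.log (σ.rep x x) := fun p x hx => by
    have h1 := toFun_eq_rep σ (mem_dom (EB := EB) x) (coordFrame p x)
    have h2 := toFun_eq_rep σ' (mem_dom (EB := EB) x) (coordFrame p x)
    have e1 : σ.rep p x = _ := h1
    have e2 : σ'.rep p x = _ := h2
    have hp := rep_pos σ hx
    rw [e1] at hp
    have h3 := (pos_of_mul_pos_left hp (rep_pos σ (mem_dom (EB := EB) x)).le).ne'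
    rw [e1, e2, Real.log_mul h3 (rep_pos σ' (mem_dom x)).ne', Real.log_mul h3 (rep_pos σ (mem_dom x)).ne']
    ring
  refine ⟨⟨fun x => -2 * (Real.log (σ'.rep x x) - Real.log (σ.rep x x)), fun p => ?_⟩, fun x B => ?_⟩
  · have h1 : ContMDiffAt 𝓘(ℝ, EB) 𝓘(ℝ, ℝ) ∞
        (fun x => -2 * (Real.log (σ'.rep p x) - Real.log (σ.rep p x))) p := by
      have hl : ∀ τ : PosHalfDensity EB M, ContMDiffAt 𝓘(ℝ, EB) 𝓘(ℝ, ℝ) ∞ (fun x => Real.log (τ.rep p x)) p :=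
        fun τ => ContDiffAt.comp_contMDiffAt (Real.contDiffAt_log.2 (rep_pos τ (mem_dom p)).ne')
          (contMDiffAt_rep τ (mem_dom p))
      have hm : ContDiff ℝ ∞ fun r : ℝ × ℝ => -2 * (r.1 - r.2) := by fun_prop
      exact hm.contDiffAt.comp_contMDiffAt ((hl σ').prodMk_space (hl σ))
    refine h1.congr_of_eventuallyEq ?_
    filter_upwards [(isOpen_dom (EB := EB) p).mem_nhds (mem_dom p)] with x hx
    rw [key p x hx]
  · show _ = Real.exp (-(-2 * (Real.log (σ'.rep x x) - Real.log (σ.rep x x))) / 2) * _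
    have h1 := rep_pos σ (mem_dom (EB := EB) x)
    have h2 := rep_pos σ' (mem_dom (EB := EB) x)
    rw [toFun_eq_rep σ (mem_dom (EB := EB) x) B, toFun_eq_rep σ' (mem_dom (EB := EB) x) B,
      show -(-2 * (Real.log (σ'.rep x x) - Real.log (σ.rep x x))) / 2 =
        Real.log (σ'.rep x x) - Real.log (σ.rep x x) by ring, Real.exp_sub, Real.exp_log h1, Real.exp_log h2]
    field_simp

/-- The change of the divergence. -/
theorem IsWeighted.divMap_eq (h : IsWeighted σ σ' φ) (u : Sec EB F E) :
    divMap C σ' u = divMap C σ u - lie C u φ := by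
  ext x
  show divHD C σ' u x = divHD C σ u x - lie C u φ x
  have hx := mem_dom (EB := EB) x
  have hd := (contDiffAt_logRep σ hx).differentiableAt (by simp)
  have hφ : DifferentiableAt ℝ (φ ∘ (chartAt EB x).symm) (chartAt EB x x) :=
    (contDiffAt_comp_chart hx φ.contMDiff.contMDiffAt).differentiableAt (by simp)
  have hl : logRep σ' x =ᶠ[𝓝 (chartAt EB x x)]
      fun y => logRep σ x y - (1 / 2) * (φ ∘ (chartAt EB x).symm) y := by
    filter_upwards [(chartAt EB x).open_target.mem_nhds ((chartAt EB x).map_source hx)] with y hy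
    have := h.eq_log ((chartAt EB x).map_target hy)
    show Real.log _ = Real.log _ - 1 / 2 * φ _
    rw [this]; ring
  rw [divHD_eq_self, divHD_eq_self, lie_chart u hx]
  unfold flatDiv
  have hf : HasFDerivAt (fun y => logRep σ x y - (1 / 2) * (φ ∘ (chartAt EB x).symm) y) _ (chartAt EB x x) :=
    hd.hasFDerivAt.sub (hφ.hasFDerivAt.const_mul (1 / 2))
  rw [hl.fderiv_eq, hf.fderiv]
  simp only [sub_apply, smul_apply, smul_eq_mul]
  ring

end Weights

/-! ### Interchange of time and space derivatives -/

section Flat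

variable {V Z : Type*} [NormedAddCommGroup V] [NormedSpace ℝ V] [NormedAddCommGroup Z] [NormedSpace ℝ Z]
  {J : Set ℝ} {T : Set V} {g : ℝ × V → Z} {t : ℝ} {y : V}

theorem hasFDerivAt_slice (hT : IsOpen T) (hg : DifferentiableWithinAt ℝ g (J ×ˢ T) (t, y)) (ht : t ∈ J)
    (hy : y ∈ T) : HasFDerivAt (fun z => g (t, z))
      ((fderivWithin ℝ g (J ×ˢ T) (t, y)).comp (ContinuousLinearMap.inr ℝ ℝ V)) y := by
  have h := hg.hasFDerivWithinAt.comp (s := T) y (f := fun z => (t, z)) (hasFDerivAt_prodMk_right t y).hasFDerivWithinAt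
    (fun z hz => ⟨ht, hz⟩)
  exact h.hasFDerivAt (hT.mem_nhds hy)

theorem hasDerivWithinAt_slice (hg : DifferentiableWithinAt ℝ g (J ×ˢ T) (t, y)) (hy : y ∈ T) :
    HasDerivWithinAt (fun s => g (s, y)) (fderivWithin ℝ g (J ×ˢ T) (t, y) (1, 0)) J t := by
  have h := hg.hasFDerivWithinAt.comp (s := J) t (f := fun s => (s, y))
    (hasFDerivAt_prodMk_left t y).hasFDerivWithinAt (fun s hs => ⟨hs, hy⟩)
  have h2 := h.hasDerivWithinAt
  exact h2

/-- The time derivative commutes with space derivatives. -/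
theorem hasDerivWithinAt_fderiv_slice (hJ : UniqueDiffOn ℝ J) (hJc : J ⊆ closure (interior J)) (hT : IsOpen T)
    {g : ℝ × V → ℝ} (hg : ContDiffOn ℝ ∞ g (J ×ˢ T)) (ht : t ∈ J) (hy : y ∈ T) {g' : V → ℝ}
    (hg' : ∀ᶠ z in 𝓝 y, HasDerivWithinAt (fun s => g (s, z)) (g' z) J t) (v : V) :
    HasDerivWithinAt (fun s => fderiv ℝ (fun z => g (s, z)) y v) (fderiv ℝ g' y v) J t := by
  have hS : UniqueDiffOn ℝ (J ×ˢ T) := hJ.prod hT.uniqueDiffOn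
  set D := fderivWithin ℝ g (J ×ˢ T) with hD
  have hdg : ∀ q ∈ J ×ˢ T, DifferentiableWithinAt ℝ g (J ×ˢ T) q := fun q hq => hg.differentiableOn (by simp) q hq
  have hDs : ContDiffOn ℝ ∞ D (J ×ˢ T) := hg.fderivWithin hS (m := ∞) (by simp)
  have hDd : DifferentiableWithinAt ℝ D (J ×ˢ T) (t, y) := hDs.differentiableOn (by simp) _ ⟨ht, hy⟩
  have h1 := hasDerivWithinAt_slice hDd hy
  have h2 : HasDerivWithinAt (fun s => D (s, y) (0, v)) (fderivWithin ℝ D (J ×ˢ T) (t, y) (1, 0) (0, v)) J t := by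
    have := (ContinuousLinearMap.apply ℝ ℝ ((0 : ℝ), v)).hasFDerivAt.comp_hasDerivWithinAt t h1
    exact this
  have h3 : fderiv ℝ g' y v = fderivWithin ℝ D (J ×ˢ T) (t, y) (0, v) (1, 0) := by
    have he : g' =ᶠ[𝓝 y] fun z => D (t, z) (1, 0) := by
      filter_upwards [hg', hT.mem_nhds hy] with z hz hzT
      exact (hJ t ht).eq_deriv _ hz (hasDerivWithinAt_slice (hdg _ ⟨ht, hzT⟩) hzT)
    rw [he.fderiv_eq]
    have h4 := (ContinuousLinearMap.apply ℝ ℝ ((1 : ℝ), (0 : V))).hasFDerivAt.comp y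
      (hasFDerivAt_slice hT hDd ht hy)
    have h5 : fderiv ℝ (fun z => D (t, z) (1, 0)) y = _ := h4.fderiv
    rw [h5]
    rfl
  -- At an endpoint of `J` the point lies on the boundary of the domain; symmetry of the second
  -- derivative extends there because the point is in the closure of the interior.
  have hsymm : IsSymmSndFDerivWithinAt ℝ g (J ×ˢ T) (t, y) := by
    refine (hg (t, y) ⟨ht, hy⟩).isSymmSndFDerivWithinAt (n := ∞) (by
      rw [minSmoothness_of_isRCLikeNormedField]; exact two_le_infty) hS ?_ ⟨ht, hy⟩
    rw [interior_prod_eq, closure_prod_eq, hT.interior_eq]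
    exact ⟨hJc ht, subset_closure hy⟩
  rw [h3, hsymm]
  refine h2.congr (fun s hs => ?_) ?_
  · rw [(hasFDerivAt_slice hT (hdg (s, y) ⟨hs, hy⟩) hs hy).fderiv]; rfl
  · rw [(hasFDerivAt_slice hT (hdg (t, y) ⟨ht, hy⟩) ht hy).fderiv]; rfl

theorem contDiffOn_fderiv_slice (hJ : UniqueDiffOn ℝ J) (hT : IsOpen T)
    {g : ℝ × V → ℝ} (hg : ContDiffOn ℝ ∞ g (J ×ˢ T)) {X : V → V} (hX : ContDiffOn ℝ ∞ X T) :
    ContDiffOn ℝ ∞ (fun q : ℝ × V => fderiv ℝ (fun z => g (q.1, z)) q.2 (X q.2)) (J ×ˢ T) := by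
  have hS : UniqueDiffOn ℝ (J ×ˢ T) := hJ.prod hT.uniqueDiffOn
  have hDs : ContDiffOn ℝ ∞ (fderivWithin ℝ g (J ×ˢ T)) (J ×ˢ T) := hg.fderivWithin hS (m := ∞) (by simp)
  have hX' : ContDiffOn ℝ ∞ (fun q : ℝ × V => ((0 : ℝ), X q.2)) (J ×ˢ T) :=
    contDiffOn_const.prodMk (hX.comp contDiffOn_snd fun q hq => hq.2)
  refine (hDs.clm_apply hX').congr fun q hq => ?_
  rw [(hasFDerivAt_slice hT (hg.differentiableOn (by simp) q hq) hq.1 hq.2).fderiv]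
  rfl

end Flat

/-! ### Time derivatives of families of germs -/

section Families

variable {J : Set ℝ} {t₀ : ℝ} {p : M}

/-- A family of functions which is smooth in time and space near `p`, with time derivative `g'`. -/
structure HasTimeDeriv (J : Set ℝ) (t₀ : ℝ) (p : M) (g : ℝ → C^∞⟮𝓘(ℝ, EB), M; ℝ⟯)
    (g' : C^∞⟮𝓘(ℝ, EB), M; ℝ⟯) : Prop where
  smooth : ContDiffOn ℝ ∞ (fun q : ℝ × EB => g q.1 ((chartAt EB p).symm q.2)) (J ×ˢ (chartAt EB p).target)
  deriv : ∀ᶠ x in 𝓝 p, HasDerivWithinAt (fun s => g s x) (g' x) J t₀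

namespace HasTimeDeriv

theorem const (a : C^∞⟮𝓘(ℝ, EB), M; ℝ⟯) : HasTimeDeriv J t₀ p (fun _ => a) 0 where
  smooth := by
    have h : ContDiffOn ℝ ∞ (a ∘ (chartAt EB p).symm) (chartAt EB p).target := fun y hy => by
      have := contDiffAt_comp_chart ((chartAt EB p).map_target hy) a.contMDiff.contMDiffAt
      rw [(chartAt EB p).right_inv hy] at this
      exact this.contDiffWithinAt
    exact h.comp contDiffOn_snd fun q hq => hq.2
  deriv := Filter.Eventually.of_forall fun x => hasDerivWithinAt_const _ _ _

variable {g h : ℝ → C^∞⟮𝓘(ℝ, EB), M; ℝ⟯} {g' h' : C^∞⟮𝓘(ℝ, EB), M; ℝ⟯}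

theorem add (hg : HasTimeDeriv J t₀ p g g') (hh : HasTimeDeriv J t₀ p h h') :
    HasTimeDeriv J t₀ p (fun t => g t + h t) (g' + h') where
  smooth := hg.smooth.add hh.smooth
  deriv := by
    filter_upwards [hg.deriv, hh.deriv] with x h1 h2 using h1.add h2

theorem mul (hg : HasTimeDeriv J t₀ p g g') (hh : HasTimeDeriv J t₀ p h h') :
    HasTimeDeriv J t₀ p (fun t => g t * h t) (g' * h t₀ + g t₀ * h') where
  smooth := hg.smooth.mul hh.smooth
  deriv := by
    filter_upwards [hg.deriv, hh.deriv] with x h1 h2 using h1.mul h2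

theorem lie (hJ : UniqueDiffOn ℝ J) (hJc : J ⊆ closure (interior J)) (ht : t₀ ∈ J)
    (hg : HasTimeDeriv J t₀ p g g') (u : Sec EB F E) :
    HasTimeDeriv J t₀ p (fun t => GenGeom.lie C u (g t)) (GenGeom.lie C u g') where
  smooth := by
    have hX : ContDiffOn ℝ ∞ (fieldRep p (field C u)) (chartAt EB p).target := fun y hy => by
      have := contDiffAt_fieldRep (C := C) u ((chartAt EB p).map_target hy)
      rw [(chartAt EB p).right_inv hy] at this
      exact this.contDiffWithinAt
    refine (contDiffOn_fderiv_slice hJ (chartAt EB p).open_target hg.smooth hX).congr fun q hq => ?_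
    have := lie_chart (C := C) u ((chartAt EB p).map_target hq.2) (g q.1)
    rw [(chartAt EB p).right_inv hq.2] at this
    exact this
  deriv := by
    filter_upwards [hg.deriv.eventually_nhds, (isOpen_dom (EB := EB) p).mem_nhds (mem_dom p)] with x hx hxp
    have htgt := (chartAt EB p).map_source hxp
    have hsymm : Filter.Tendsto (chartAt EB p).symm (𝓝 (chartAt EB p x)) (𝓝 x) := by
      have := (chartAt EB p).continuousAt_symm htgt
      rwa [ContinuousAt, (chartAt EB p).left_inv hxp] at this
    have := hasDerivWithinAt_fderiv_slice hJ hJc (chartAt EB p).open_target hg.smooth ht htgt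
      (g' := g' ∘ (chartAt EB p).symm) (hsymm.eventually hx) (fieldRep p (field C u) (chartAt EB p x))
    rw [lie_chart u hxp]
    refine this.congr (fun s _ => lie_chart u hxp (g s)) (lie_chart u hxp (g t₀))

end HasTimeDeriv

/-- Families of germs with a time derivative. -/
def HasGermDeriv (J : Set ℝ) (t₀ : ℝ) (p : M) (y : ℝ → SmoothGerm EB p) (y' : SmoothGerm EB p) : Prop :=
  ∃ g g', HasTimeDeriv J t₀ p g g' ∧ (∀ t ∈ J, germ p (g t) = y t) ∧ germ p g' = y'

theorem HasGermDeriv.hasDerivWithinAt {y : ℝ → SmoothGerm EB p} {y' : SmoothGerm EB p}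
    (h : HasGermDeriv J t₀ p y y') (ht : t₀ ∈ J) :
    HasDerivWithinAt (fun s => germEv p (y s)) (germEv p y') J t₀ := by
  obtain ⟨g, g', hg, h1, rfl⟩ := h
  rw [germEv_germ]
  refine hg.deriv.self_of_nhds.congr (fun s hs => ?_) ?_
  · rw [← h1 s hs, germEv_germ]
  · rw [← h1 t₀ ht, germEv_germ]

/-- Smooth dependence on time and space together is part of `HasTimeDeriv`, so differentiating along
the frame remains possible; the condition `der` is the interchange of derivatives. -/
theorem isVariation {ι : Type*} [Fintype ι] (e : ι → Sec EB F E) (ε : ι → ℝ) (pos : ι → Bool)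
    (hJ : UniqueDiffOn ℝ J) (hJc : J ⊆ closure (interior J)) (ht : t₀ ∈ J) :
    (frameCalc C e ε pos p).IsVariation J t₀ (HasGermDeriv J t₀ p) where
  const a := by
    obtain ⟨a, rfl⟩ := germ_surjective p a
    exact ⟨_, _, HasTimeDeriv.const a, fun _ _ => rfl, map_zero _⟩
  add := by
    rintro _ _ _ _ ⟨g, g', hg, h1, rfl⟩ ⟨h, h', hh, h2, rfl⟩
    exact ⟨_, _, hg.add hh, fun t htJ => by rw [map_add, h1 t htJ, h2 t htJ], map_add _ _ _⟩
  mul := by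
    rintro _ _ _ _ ⟨g, g', hg, h1, rfl⟩ ⟨h, h', hh, h2, rfl⟩
    refine ⟨_, _, hg.mul hh, fun t htJ => by rw [map_mul, h1 t htJ, h2 t htJ], ?_⟩
    rw [map_add, map_mul, map_mul, h1 t₀ ht, h2 t₀ ht]
  der := by
    rintro _ _ A ⟨g, g', hg, h1, rfl⟩
    exact ⟨_, _, hg.lie hJ hJc ht (C := C) (e A), fun t htJ =>
      congrArg (germDer C p (e A)) (h1 t htJ), rfl⟩
  congr := by
    rintro _ _ _ ⟨g, g', hg, h1, rfl⟩ h
    exact ⟨g, g', hg, fun t htJ => (h1 t htJ).trans (h t htJ), rfl⟩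

theorem contDiffOn_of_contMDiffOn {h : ℝ → M → ℝ} {W : Set M} (hW : (chartAt EB p).source ⊆ W)
    (hs : ContMDiffOn (𝓘(ℝ, ℝ).prod 𝓘(ℝ, EB)) 𝓘(ℝ, ℝ) ∞ (fun q : ℝ × M => h q.1 q.2) (J ×ˢ W)) :
    ContDiffOn ℝ ∞ (fun q : ℝ × EB => h q.1 ((chartAt EB p).symm q.2)) (J ×ˢ (chartAt EB p).target) := by
  have h1 : ContMDiffOn (𝓘(ℝ, ℝ).prod 𝓘(ℝ, EB)) (𝓘(ℝ, ℝ).prod 𝓘(ℝ, EB)) ∞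
      (fun q : ℝ × EB => (q.1, (chartAt EB p).symm q.2)) (J ×ˢ (chartAt EB p).target) :=
    contMDiffOn_fst.prodMk (contMDiffOn_chart_symm.comp contMDiffOn_snd fun q hq => hq.2)
  have h2 := hs.comp h1 fun q hq => ⟨hq.1, hW ((chartAt EB p).map_target hq.2)⟩
  rw [← contMDiffOn_iff_contDiffOn, modelWithCornersSelf_prod, ← chartedSpaceSelf_prod]
  exact h2

end Families

/-! ### The Laplacian and its change of weight -/

section Laplace

variable (G : GenPseudometric C) (σ : PosHalfDensity EB M)

omit G σ in
theorem pairing_calD (f : C^∞⟮𝓘(ℝ, EB), M; ℝ⟯) (x : M) (a : E x) :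
    C.pairing x (calD C f x) a = dirDeriv f x (C.anchor x a) := by
  have : FiniteDimensional ℝ (E x) := VectorBundle.finiteDimensional ℝ F E x
  exact LinearMap.BilinForm.apply_toDual_symm_apply (hB := C.pairing_nondegenerate x) _ _

/-- The section `G 𝒟 f`. -/
def gradG (f : C^∞⟮𝓘(ℝ, EB), M; ℝ⟯) : Sec EB F E := G.sec (exists_grad C f).choose

theorem gradG_apply (f : C^∞⟮𝓘(ℝ, EB), M; ℝ⟯) (x : M) : gradG G f x = G.toFun x (calD C f x) := by
  rw [gradG, G.sec_apply, (exists_grad C f).choose_spec]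

theorem pair_gradG (f : C^∞⟮𝓘(ℝ, EB), M; ℝ⟯) (w : Sec EB F E) : pair C (gradG G f) w = lie C (G.sec w) f := by
  ext x
  rw [pair_apply, gradG_apply, G.symm, lie_apply, G.sec_apply, pairing_calD]

theorem sec_eq_of_pair {u v : Sec EB F E} (h : ∀ w : Sec EB F E, pair C u w = pair C v w) : u = v := by
  ext x
  refine eq_of_pairing (C := C) fun a => ?_
  obtain ⟨w, rfl⟩ := exists_sec (EB := EB) (F := F) x a
  exact DFunLike.congr_fun (h w) x

theorem gradG_mul (f g : C^∞⟮𝓘(ℝ, EB), M; ℝ⟯) :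
    gradG G (f * g) = fsmul f (gradG G g) + fsmul g (gradG G f) :=
  sec_eq_of_pair (C := C) fun w => by
    rw [pair_add, pair_fsmul, pair_fsmul, pair_gradG, pair_gradG, pair_gradG, lie_mul]

/-- Both sides are `⟨G 𝒟f, 𝒟g⟩`, which is symmetric because `G` is. -/
theorem lie_gradG_comm (f g : C^∞⟮𝓘(ℝ, EB), M; ℝ⟯) : lie C (gradG G f) g = lie C (gradG G g) f := by
  have h : ∀ f g : C^∞⟮𝓘(ℝ, EB), M; ℝ⟯, lie C (gradG G f) g = pair C (gradG G f) (exists_grad C g).choose :=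
    fun f g => by
    ext x
    rw [pair_apply, (exists_grad C g).choose_spec, C.pairing_symm, lie_apply, pairing_calD]
  rw [h f g, pair_gradG, gradG]

/-- The Laplacian as a smooth function. -/
def lapMap (f : C^∞⟮𝓘(ℝ, EB), M; ℝ⟯) : C^∞⟮𝓘(ℝ, EB), M; ℝ⟯ := divMap C σ (gradG G f)

theorem laplacian_eq (f : C^∞⟮𝓘(ℝ, EB), M; ℝ⟯) (x : M) : laplacian G σ f x = lapMap G σ f x := by
  have h : (fun y => G.toFun y (calD C f y)) = gradG G f := funext fun y => (gradG_apply G f y).symm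
  unfold laplacian
  rw [h]
  rfl

theorem lapMap_mul (f g : C^∞⟮𝓘(ℝ, EB), M; ℝ⟯) : lapMap G σ (f * g) =
    f * lapMap G σ g + g * lapMap G σ f + 2 * lie C (gradG G f) g := by
  have hδ := (represents_divMap (C := C) σ).isDivergence
  unfold lapMap
  rw [gradG_mul, hδ.add, hδ.fsmul, hδ.fsmul, lie_gradG_comm G g f]
  ring

/-- The function `e^{-f}`. -/
def expNeg (f : C^∞⟮𝓘(ℝ, EB), M; ℝ⟯) : C^∞⟮𝓘(ℝ, EB), M; ℝ⟯ :=
  ⟨fun x => Real.exp (-(f x)), (Real.contDiff_exp.comp contDiff_neg).contMDiff.comp f.contMDiff⟩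

theorem lie_expNeg (u : Sec EB F E) (f : C^∞⟮𝓘(ℝ, EB), M; ℝ⟯) : lie C u (expNeg f) = -(expNeg f * lie C u f) := by
  ext x
  have h : HasDerivAt (fun r : ℝ => Real.exp (-r)) (-(Real.exp (-(f x)))) (f x) := by
    simpa using (hasDerivAt_neg (f x)).exp
  refine (dirDeriv_comp (EB := EB) h (mdiffAt f x) (C.anchor x (u x))).trans ?_
  exact neg_mul _ _

theorem gradG_expNeg (f : C^∞⟮𝓘(ℝ, EB), M; ℝ⟯) : gradG G (expNeg f) = fsmul (-expNeg f) (gradG G f) :=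
  sec_eq_of_pair (C := C) fun w => by
    rw [pair_fsmul, pair_gradG, pair_gradG, lie_expNeg]; ring

variable {G σ} {τ : PosHalfDensity EB M}

theorem lapMap_weight {f : C^∞⟮𝓘(ℝ, EB), M; ℝ⟯} (h : IsWeighted σ τ f) (g : C^∞⟮𝓘(ℝ, EB), M; ℝ⟯) :
    lapMap G τ g = lapMap G σ g - lie C (gradG G f) g := by
  unfold lapMap
  rw [h.divMap_eq, lie_gradG_comm]

/-- The quadratic gradient term in `Δ_σ e^{-f}` is exactly the drift that turns `Δ_σ` into the
Laplacian of `e^{-f/2} σ`. -/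
theorem lapMap_expNeg {f : C^∞⟮𝓘(ℝ, EB), M; ℝ⟯} (h : IsWeighted σ τ f) :
    lapMap G σ (expNeg f) = -(expNeg f * lapMap G τ f) := by
  have hδ := (represents_divMap (C := C) σ).isDivergence
  rw [lapMap_weight h]
  unfold lapMap
  rw [gradG_expNeg, hδ.fsmul, lie_neg, lie_expNeg]
  ring

end Laplace

theorem contMDiff_scalar' (G : GenPseudometric C) (σ : PosHalfDensity EB M) :
    ContMDiff 𝓘(ℝ, EB) 𝓘(ℝ, ℝ) ∞ (scalar G σ) := by
  obtain ⟨D, hD, hDR⟩ := exists_isLC_fullRicci (exists_isLC G σ)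
  exact contMDiff_scalar (represents_divMap σ) hD hDR

/-- The scalar curvature as a smooth function. -/
def scalMap (G : GenPseudometric C) (σ : PosHalfDensity EB M) : C^∞⟮𝓘(ℝ, EB), M; ℝ⟯ :=
  ⟨scalar G σ, contMDiff_scalar' G σ⟩

/-- The conjugate heat operator on `R e^{-f}`. -/
theorem conj_product {G : GenPseudometric C} {σ τ : PosHalfDensity EB M} {f : C^∞⟮𝓘(ℝ, EB), M; ℝ⟯}
    (h : IsWeighted σ τ f) (R : C^∞⟮𝓘(ℝ, EB), M; ℝ⟯) : lapMap G σ (R * expNeg f) =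
      R * lapMap G σ (expNeg f) + expNeg f * lapMap G τ R - expNeg f * lie C (gradG G f) R := by
  rw [lapMap_mul, lapMap_weight h, lie_gradG_comm G R, gradG_expNeg, lie_fsmul]
  ring

/-! ### Laplacian, gradient and Ricci components in an adapted frame -/

namespace IsFrameOn

variable {ι : Type*} [Fintype ι] [DecidableEq ι] {U : Set M} {e : ι → Sec EB F E} {ε : ι → ℝ}
  {pos : ι → Bool} {G : GenPseudometric C}

theorem germ_fm (e : ι → Sec EB F E) (ε : ι → ℝ) (pos : ι → Bool) (p : M)
    (d : ι → C^∞⟮𝓘(ℝ, EB), M; ℝ⟯) (A B : ι) :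
    germ p ((funCalc C e ε pos).fm (fun A B K => pair C (C.bracket (e A) (e B)) (e K)) d A B) =
      (frameCalc C e ε pos p).fm (strFun C e p) (fun A => germ p (d A)) A B := by
  have h1 : ∀ A f, germ p ((funCalc C e ε pos).der A f) = (frameCalc C e ε pos p).der A (germ p f) :=
    fun A f => rfl
  have h2 : ∀ A, germ p ((funCalc C e ε pos).ε A) = (frameCalc C e ε pos p).ε A := fun _ => rfl
  have h3 : ∀ A, (funCalc C e ε pos).pos A = (frameCalc C e ε pos p).pos A := fun _ => rfl
  unfold FrameCalculus.fm FrameCalculus.mric FrameCalculus.dv ctr2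
  simp only [apply_ite (germ p), map_sub, map_add, map_mul, map_ctr, h1, h2, h3, map_zero]
  rfl

variable (hF : IsFrameOn C U e ε) {p : M} (hp : p ∈ U) (ha : IsAdapted G U e pos)
include hF hp ha

theorem pair_gradG_frame (f : C^∞⟮𝓘(ℝ, EB), M; ℝ⟯) {x : M} (hx : x ∈ U) (A : ι) :
    pair C (gradG G f) (e A) x = (if pos A then (1 : ℝ) else -1) * lie C (e A) f x := by
  rw [pair_gradG, lie_apply, G.sec_apply, ha x hx, map_smul, map_smul, smul_eq_mul]
  rfl

theorem germ_lapMap (σ : PosHalfDensity EB M) (g : C^∞⟮𝓘(ℝ, EB), M; ℝ⟯) : germ p (lapMap G σ g) =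
    (frameCalc C e ε pos p).lapl (fun A => germ p (divMap C σ (e A))) (germ p g) := by
  have hs : ∀ A, (frameCalc C e ε pos p).sg A = germ p (cst EB M (if pos A then 1 else -1)) := fun A => by
    show (if pos A then 1 else -1 : SmoothGerm EB p) = _
    split_ifs
    · have h : cst EB M 1 = 1 := by ext y; rw [cst_apply]; rfl
      rw [h, map_one]
    · have h : cst EB M (-1) = -1 := by ext y; rw [cst_apply]; rfl
      rw [h, map_neg, map_one]
  unfold FrameCalculus.lapl FrameCalculus.dv
  simp only [hs]
  show _ = ctr (fun A => germ p (cst EB M (ε A))) fun A => germ p _ * (germ p (lie C (e A) (lie C (e A) g)) +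
    germ p _ * germ p (lie C (e A) g))
  simp only [← map_mul, ← map_add, ← map_ctr]
  rw [germ_eq]
  filter_upwards [hF.isOpen.mem_nhds hp] with x hx
  rw [ctr_apply, lapMap, hF.div_eq (represents_divMap (C := C) σ).isDivergence hx]
  refine ctr_congr _ fun A => ?_
  have h1 : lie C (e A) (pair C (gradG G g) (e A)) x =
      lie C (e A) (cst EB M (if pos A then 1 else -1) * lie C (e A) g) x := lie_congr (by
    filter_upwards [hF.isOpen.mem_nhds hx] with y hy
    rw [hF.pair_gradG_frame hp ha g hy]
    show _ = cst EB M _ y * _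
    rw [cst_apply])
  rw [h1, lie_mul]
  show pair C (gradG G g) (e A) x * _ + (cst EB M _ x * _ + _ * lie C (e A) (cst EB M _) x) = cst EB M _ x * (_ + _ * _)
  rw [cst_apply, lie_eq_zero_of_eventuallyEq_const (Filter.Eventually.of_forall fun y => cst_apply _ _),
    hF.pair_gradG_frame hp ha g hx]
  ring

theorem lie_gradG_eq (f g : C^∞⟮𝓘(ℝ, EB), M; ℝ⟯) : lie C (gradG G f) g p =
    germEv p (ctr (frameCalc C e ε pos p).ε fun A => (frameCalc C e ε pos p).sg A *
      ((frameCalc C e ε pos p).der A (germ p f) * (frameCalc C e ε pos p).der A (germ p g))) := by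
  rw [germEv_ctr, hF.lie_eq hp]
  refine ctr_congr _ fun A => ?_
  rw [← pair_apply, hF.pair_gradG_frame hp ha f hp, map_mul, map_mul]
  have h1 : germEv p ((frameCalc C e ε pos p).sg A) = if pos A then 1 else -1 := by
    show germEv p (if pos A then 1 else -1 : SmoothGerm EB p) = _
    split_ifs
    · exact map_one _
    · rw [map_neg, map_one]
  rw [h1, mul_assoc]
  rfl

end IsFrameOn

/-! ### Variation along generalized Ricci flow -/

section Flow

variable {J : Set ℝ} {G : ℝ → GenPseudometric C} {σ : ℝ → PosHalfDensity EB M}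
  {f : ℝ → C^∞⟮𝓘(ℝ, EB), M; ℝ⟯} {t₀ : ℝ}

/-- The time derivative of `f` for which `e^{-f}` solves the conjugate heat equation. -/
theorem hasDerivWithinAt_of_conjHeat (hJ : UniqueDiffOn ℝ J) (ht : t₀ ∈ J) {x : M}
    (hd : DifferentiableWithinAt ℝ (fun s => f s x) J t₀)
    (hconj : conjHeat J G σ (fun t y => Real.exp (-(f t y))) t₀ x = 0) :
    HasDerivWithinAt (fun s => f s x)
      (-lapMap (G t₀) ((σ t₀).weight (f t₀)) (f t₀) x - scalar (G t₀) (σ t₀) x) J t₀ := by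
  have h1 := hd.hasDerivWithinAt
  have h2 : HasDerivWithinAt (fun s => Real.exp (-(f s x))) (Real.exp (-(f t₀ x)) * -derivWithin (fun s => f s x) J t₀)
      J t₀ := h1.fun_neg.exp
  have h3 : laplacian (G t₀) (σ t₀) (fun y => Real.exp (-(f t₀ y))) x =
      -(Real.exp (-(f t₀ x)) * lapMap (G t₀) ((σ t₀).weight (f t₀)) (f t₀) x) := by
    have := DFunLike.congr_fun (lapMap_expNeg (G := G t₀) (isWeighted_weight (σ t₀) (f t₀))) x
    rw [← laplacian_eq] at this
    exact this
  unfold conjHeat at hconj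
  rw [h2.derivWithin (hJ t₀ ht), h3] at hconj
  have h4 : Real.exp (-(f t₀ x)) * (derivWithin (fun s => f s x) J t₀ -
      (-lapMap (G t₀) ((σ t₀).weight (f t₀)) (f t₀) x - scalar (G t₀) (σ t₀) x)) = 0 := by
    linear_combination hconj
  have h5 := sub_eq_zero.1 ((mul_eq_zero.1 h4).resolve_left (Real.exp_pos _).ne')
  rwa [h5] at h1

variable (hJ : UniqueDiffOn ℝ J) (hJc : J ⊆ closure (interior J)) (ht : t₀ ∈ J)
  (hflow : IsGenRicciFlow J G σ)
include hJ ht hflow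

/-- The variation of the half-density `e^{-f/2} σ`. -/
theorem hasTimeDeriv_weight (hf : ContMDiffOn (𝓘(ℝ, ℝ).prod 𝓘(ℝ, EB)) 𝓘(ℝ, ℝ) ∞
      (fun q : ℝ × M => f q.1 q.2) (J ×ˢ univ))
    (hconj : ∀ x, conjHeat J G σ (fun t y => Real.exp (-(f t y))) t₀ x = 0) {φ : ℝ → C^∞⟮𝓘(ℝ, EB), M; ℝ⟯}
    (hφ : ∀ t, IsWeighted ((σ t₀).weight (f t₀)) ((σ t).weight (f t)) (φ t)) (p : M) :
    HasTimeDeriv J t₀ p φ (-lapMap (G t₀) ((σ t₀).weight (f t₀)) (f t₀)) := by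
  set τ := (σ t₀).weight (f t₀) with hτ
  -- In the chart at `p`, `φ t` is `f t` minus twice the logarithm of `σ t`, up to a term
  -- independent of time; the space-time smoothness of `f` and `σ` carries over.
  have hrep : ∀ t, ∀ x ∈ dom EB p, φ t x = f t x - 2 * Real.log ((σ t).rep p x) + 2 * Real.log (τ.rep p x) :=
    fun t x hx => by
    rw [(hφ t).eq_log hx]
    have h1 : ((σ t).weight (f t)).rep p x = Real.exp (-(f t x) / 2) * (σ t).rep p x := rfl
    rw [h1, Real.log_mul (Real.exp_pos _).ne' (rep_pos (σ t) hx).ne', Real.log_exp]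
    ring
  have hfc := contDiffOn_of_contMDiffOn (p := p) (h := fun t x => f t x) (subset_univ _) hf
  have hσc := contDiffOn_of_contMDiffOn (p := p) (h := fun t x => (σ t).rep p x)
    (W := (trivializationAt EB (TangentSpace 𝓘(ℝ, EB) : M → Type _) p).baseSet)
    (fun x hx => mem_baseSet hx) (hflow.smooth_density p)
  have hτc : ContDiffOn ℝ ∞ (fun q : ℝ × EB => logRep τ p q.2) (J ×ˢ (chartAt EB p).target) := by
    have h : ContDiffOn ℝ ∞ (logRep τ p) (chartAt EB p).target := fun y hy => by
      have := contDiffAt_logRep τ ((chartAt EB p).map_target hy)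
      rw [(chartAt EB p).right_inv hy] at this
      exact this.contDiffWithinAt
    exact h.comp contDiffOn_snd fun q hq => hq.2
  refine ⟨?_, ?_⟩
  · refine ((hfc.sub (contDiffOn_const (c := (2 : ℝ)).mul (hσc.log fun q hq =>
      (rep_pos (σ q.1) ((chartAt EB p).map_target hq.2)).ne'))).add (contDiffOn_const (c := (2 : ℝ)).mul hτc)).congr
      fun q hq => ?_
    exact hrep q.1 _ ((chartAt EB p).map_target hq.2)
  · filter_upwards [(isOpen_dom (EB := EB) p).mem_nhds (mem_dom p)] with x hx
    have h1 : DifferentiableWithinAt ℝ (fun s => f s x) J t₀ := by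
      have h := hasDerivWithinAt_slice (hfc.differentiableOn (by simp) (t₀, chartAt EB p x)
        ⟨ht, (chartAt EB p).map_source hx⟩) ((chartAt EB p).map_source hx)
      simp only [(chartAt EB p).left_inv hx] at h
      exact h.differentiableWithinAt
    have h2 := hasDerivWithinAt_of_conjHeat hJ ht h1 (hconj x)
    have h3 := hflow.density_eq t₀ ht x (coordFrame p x)
    have hpos := (rep_pos (σ t₀) hx).ne'
    have h4 : HasDerivWithinAt (fun s => Real.log ((σ s).rep p x))
        (-(1 / 2) * scalar (G t₀) (σ t₀) x * (σ t₀).rep p x / (σ t₀).rep p x) J t₀ := h3.log hpos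
    -- The conjugate heat equation contributes `-R(G,σ)` and the flow of `σ` contributes `+R(G,σ)`,
    -- so only the Laplacian remains.
    have h5 := (h2.sub (h4.const_mul 2)).add_const (2 * Real.log (τ.rep p x))
    refine (h5.congr_deriv ?_).congr (fun s _ => hrep s x hx) (hrep t₀ x hx)
    show _ = -lapMap (G t₀) τ (f t₀) x
    field_simp
    ring

/-- The variation of the metric in a frame. -/
theorem hasTimeDeriv_metric {ι : Type*} [Fintype ι] [DecidableEq ι] {U : Set M} {e : ι → Sec EB F E} {ε : ι → ℝ}
    {pos : ι → Bool} (hF : IsFrameOn C U e ε) (ha : IsAdapted (G t₀) U e pos) {p : M} (hp : p ∈ U) (A B : ι) :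
    HasTimeDeriv J t₀ p (fun t => pair C ((G t).sec (e A)) (e B)) (cst EB M (-4) * (funCalc C e ε pos).fm
      (fun A B K => pair C (C.bracket (e A) (e B)) (e K)) (fun A => divMap C (σ t₀) (e A)) A B) := by
  have hs : ∀ t x, pair C ((G t).sec (e A)) (e B) x = C.pairing x (e A x) ((G t).toFun x (e B x)) := fun t x => by
    rw [pair_apply, (G t).sec_apply, (G t).symm]
  refine ⟨?_, ?_⟩
  · refine (contDiffOn_of_contMDiffOn (h := fun t x => C.pairing x (e A x) ((G t).toFun x (e B x))) (subset_univ _)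
      (hflow.smooth_metric (e A) (e B))).congr fun q hq => hs _ _
  · obtain ⟨D, hD, hDR⟩ := exists_isLC_fullRicci (exists_isLC (G t₀) (σ t₀))
    filter_upwards [hF.isOpen.mem_nhds hp] with x hx
    refine ((hflow.metric_eq t₀ ht x (e A x) (e B x)).congr_deriv ?_).congr (fun s _ => hs s x) (hs t₀ x)
    rw [ricci_frame (represents_divMap (σ t₀)) hD hDR hF hx ha, ← IsFrameOn.germ_fm, germEv_germ]
    show _ = cst EB M (-4) x * _
    rw [cst_apply]
    ring

include hJc in
/-- The evolution of the scalar curvature. -/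
theorem hasDerivWithinAt_scalar (hf : ContMDiffOn (𝓘(ℝ, ℝ).prod 𝓘(ℝ, EB)) 𝓘(ℝ, ℝ) ∞
      (fun q : ℝ × M => f q.1 q.2) (J ×ˢ univ))
    (hconj : ∀ x, conjHeat J G σ (fun t y => Real.exp (-(f t y))) t₀ x = 0) (p : M) :
    HasDerivWithinAt (fun s => scalar (G s) ((σ s).weight (f s)) p)
      (ricciNormSq (G t₀) ((σ t₀).weight (f t₀)) p
        - lapMap (G t₀) ((σ t₀).weight (f t₀)) (scalMap (G t₀) ((σ t₀).weight (f t₀))) p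
        + lie C (gradG (G t₀) (f t₀)) (scalMap (G t₀) ((σ t₀).weight (f t₀))) p) J t₀ := by
  set τ : ℝ → PosHalfDensity EB M := fun t => (σ t).weight (f t) with hτ
  choose φ hφ using fun t => exists_isWeighted (τ t₀) (τ t)
  have hφt := hasTimeDeriv_weight hJ ht hflow hf hconj hφ p
  -- One connection for every time, chosen without any regularity in `t`; `IsVariation.scalar` asks
  -- for none.
  choose D hD hDR using fun t => exists_isLC_fullRicci (exists_isLC (G t) (τ t))
  have hδ := fun t => represents_divMap (C := C) (τ t)
  obtain ⟨ι, _, _, U, e, ε, pos, hp, hF, ha⟩ := exists_adapted (G t₀) p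
  set X := frameCalc C e ε pos p with hX
  set c := strFun C e p with hc
  set d' : ℝ → ι → SmoothGerm EB p := fun t A => germ p (divMap C (τ t) (e A)) with hd'
  have hV := isVariation (C := C) (p := p) e ε pos hJ hJc ht
  have hcour : X.IsCourant c (d' t₀) := hF.isCourant (hδ t₀).isDivergence hp pos
  have hΓ : X.IsLC c (d' t₀) (conFun (D t₀) e p) := hF.isLC hp (hD t₀) (hδ t₀) ha
  set h : ι → ι → SmoothGerm EB p := fun A B => -4 * X.fm c (d' t₀) A B + 4 * X.hess c (germ p (f t₀)) A B with hh
  set b : ι → SmoothGerm EB p := fun A => X.der A (X.lapl (d' t₀) (germ p (f t₀))) with hb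
  have Vd : ∀ A, HasGermDeriv J t₀ p (fun t => d' t A) (b A) := fun A => by
    have h1 : HasGermDeriv J t₀ p (fun t => germ p (φ t)) (germ p (-lapMap (G t₀) (τ t₀) (f t₀))) :=
      ⟨φ, _, hφt, fun _ _ => rfl, rfl⟩
    have h2 := hV.congr (y := fun t => d' t A) (hV.sub (hV.const (d' t₀ A)) (hV.der A h1)) fun t _ => by
      simp only [hd']
      rw [(hφ t).divMap_eq, map_sub]
      rfl
    -- The divergences move by `-𝒟φ`, and the derivative of `φ` is `-Δ_τ f`; hence `b_A = ∂_A Δ_τ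
    -- f`.
    rwa [map_neg, hF.germ_lapMap hp ha, FrameCalculus.der_neg, zero_sub, neg_neg] at h2
  have VH : ∀ A B, HasGermDeriv J t₀ p (fun t => metFun (G t) e p A B) (h A B) := fun A B => by
    refine ⟨_, _, hasTimeDeriv_metric hJ ht hflow hF ha hp A B, fun _ _ => rfl, ?_⟩
    rw [map_mul, IsFrameOn.germ_fm]
    -- The flow moves `G` by the Ricci tensor of `σ`, whereas the curvature studied is that of `τ`.
    -- `fm_sub_der` converts one into the other and accounts for the Hessian in `h`.
    have h1 : d' t₀ = fun A => germ p (divMap C (σ t₀) (e A)) - X.der A (germ p (f t₀)) := by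
      funext A
      simp only [hd']
      rw [(isWeighted_weight (σ t₀) (f t₀)).divMap_eq, map_sub]
      rfl
    have h2 : germ p (cst EB M (-4)) = -4 := by
      have : cst EB M (-4) = -4 := by
        show algebraMap ℝ C^∞⟮𝓘(ℝ, EB), M; ℝ⟯ (-4) = -4
        rw [map_neg, map_ofNat]
      rw [this, map_neg, map_ofNat]
    simp only [hh]
    rw [h1, FrameCalculus.fm_sub_der, h2]
    ring
  -- The frame stays fixed in time and is adapted only to `G t₀`. For other times only what holds in
  -- every orthonormal frame is supplied: `G² = 1`, symmetry, and the properties of some compatible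
  -- connection.
  have VR := hV.scalar (R := fun t => 2 * germ p (scalMap (G t) (τ t))) (hF.ε_sq hp pos) hcour hΓ VH
    (fun A B hAB => by
      have hAB' : X.pos A = X.pos B := hAB
      simp only [hh, FrameCalculus.fm, FrameCalculus.hess, if_pos hAB', mul_zero, add_zero])
    (by funext A B; exact hF.metFun_adapted hp ha A B) Vd rfl fun t htJ =>
    ⟨conFun (D t) e p, fun A B => metFun_symm (G t) e p A B, fun x A => hF.metFun_sq hp pos x A,
      hF.conFun_anti hp, hF.conFun_cyc hp (hD t).torsionFree,
      hF.conFun_tr hp (fun u x => by rw [(hδ t).eq, (hD t).divergence]) pos,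
      hF.der_metFun hp (hD t).compatible pos, two_mul_germ_scalarMap (hδ t) (hD t) (hDR t) hF hp pos⟩
  have hR2 : ctr X.ε (fun u => X.sg u * X.ric2 (d' t₀) (conFun (D t₀) e p) u u) =
      2 * germ p (scalMap (G t₀) (τ t₀)) :=
    (two_mul_germ_scalarMap_adapted (hδ t₀) (hD t₀) (hDR t₀) hF hp ha).symm
  have e1 : X.lapl (d' t₀) (2 * germ p (scalMap (G t₀) (τ t₀))) =
      2 * germ p (lapMap (G t₀) (τ t₀) (scalMap (G t₀) (τ t₀))) := by
    rw [hF.germ_lapMap hp ha, two_mul, two_mul]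
    unfold FrameCalculus.lapl
    simp only [X.der_add, X.dv_add, mul_add, ctr_add]
    rfl
  have e2 : ctr X.ε (fun A => X.sg A * (X.der A (germ p (f t₀)) * X.der A (2 * germ p (scalMap (G t₀) (τ t₀))))) =
      2 * ctr X.ε fun A => X.sg A * (X.der A (germ p (f t₀)) * X.der A (germ p (scalMap (G t₀) (τ t₀)))) := by
    rw [two_mul, two_mul]
    simp only [X.der_add, mul_add, ctr_add]
  -- The frame expressions describe twice the scalar curvature; the factor is removed at the end.
  rw [hcour.scalarVar_eq hΓ, hR2, e1, e2] at VR
  have h1 := VR.hasDerivWithinAt ht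
  have e3 : germEv p (ctr2 X.ε fun A B => X.fm c (d' t₀) A B * X.fm c (d' t₀) A B) =
      ctr2 ε fun A B => germEv p (X.fm c (d' t₀) A B) ^ 2 := by
    rw [germEv_ctr2]
    exact ctr2_congr _ fun A B => by rw [map_mul, sq]
  simp only [map_add, map_sub, map_neg, map_mul, map_ofNat, germEv_germ] at h1
  rw [e3, ← hF.lie_gradG_eq hp ha] at h1
  refine ((h1.const_mul (1 / 2)).congr_deriv ?_).congr (fun s _ => ?_) ?_
  · rw [ricciNormSq_eq (hδ t₀) (hD t₀) (hDR t₀) hF hp ha]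
    ring
  · show scalar _ _ p = 1 / 2 * (2 * scalMap (G s) (τ s) p)
    rw [← mul_assoc, one_div, inv_mul_cancel₀ two_ne_zero, one_mul]; rfl
  · show scalar _ _ p = 1 / 2 * (2 * scalMap (G t₀) (τ t₀) p)
    rw [← mul_assoc, one_div, inv_mul_cancel₀ two_ne_zero, one_mul]; rfl

end Flow

end GenGeom

end

/-! ### The evolution of the weighted scalar curvature times `u` -/

open GenGeom in
theorem mainTheorem5
    {EB : Type*} [NormedAddCommGroup EB] [NormedSpace ℝ EB] [FiniteDimensional ℝ EB]
    {M : Type*} [TopologicalSpace M] [ChartedSpace EB M] [IsManifold 𝓘(ℝ, EB) ∞ M]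
    [T2Space M] [SigmaCompactSpace M]
    {F : Type*} [NormedAddCommGroup F] [NormedSpace ℝ F] [FiniteDimensional ℝ F]
    {E : M → Type*} [TopologicalSpace (Bundle.TotalSpace F E)]
    [∀ x, AddCommGroup (E x)] [∀ x, Module ℝ (E x)]
    [∀ x, TopologicalSpace (E x)] [FiberBundle F E] [VectorBundle ℝ F E]
    [ContMDiffVectorBundle ∞ F E 𝓘(ℝ, EB)]
    (C : CourantAlgebroid EB F E)
    (J : Set ℝ) (hJ : J.OrdConnected) (hJ' : (interior J).Nonempty)
    (G : ℝ → GenPseudometric C) (σ : ℝ → PosHalfDensity EB M)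
    (hflow : IsGenRicciFlow J G σ)
    (f : ℝ → C^∞⟮𝓘(ℝ, EB), M; ℝ⟯)
    (hf : ContMDiffOn (𝓘(ℝ, ℝ).prod 𝓘(ℝ, EB)) 𝓘(ℝ, ℝ) ∞
      (fun q : ℝ × M => f q.1 q.2) (J ×ˢ univ))
    (u : ℝ → M → ℝ) (hu : ∀ t x, u t x = Real.exp (-(f t x)))
    (hconj : ∀ t ∈ J, ∀ x, conjHeat J G σ u t x = 0) :
    (∀ t ∈ J, ContMDiff 𝓘(ℝ, EB) 𝓘(ℝ, ℝ) ∞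
      (fun x => scalar (G t) ((σ t).weight (f t)) x * u t x)) ∧
    (∀ t ∈ J, ∀ x, DifferentiableWithinAt ℝ
      (fun s => scalar (G s) ((σ s).weight (f s)) x * u s x) J t) ∧
    ∀ t ∈ J, ∀ x,
      conjHeat J G σ (fun s y => scalar (G s) ((σ s).weight (f s)) y * u s y) t x =
        -ricciNormSq (G t) ((σ t).weight (f t)) x * u t x := by
  obtain rfl : u = fun t y => Real.exp (-(f t y)) := funext fun t => funext fun y => hu t y
  have hJu : UniqueDiffOn ℝ J := uniqueDiffOn_convex (hJ.convex (𝕜 := ℝ)) hJ'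
  -- An interval with non-empty interior lies in the closure of that interior; this makes mixed
  -- derivatives symmetric at the endpoints of `J`.
  have hJc : J ⊆ closure (interior J) := by
    rw [(hJ.convex (𝕜 := ℝ)).closure_interior_eq_closure_of_nonempty_interior hJ']
    exact subset_closure
  have hR := fun t (ht : t ∈ J) x => hasDerivWithinAt_scalar hJu hJc ht hflow hf (hconj t ht) x
  have hd : ∀ t ∈ J, ∀ x, DifferentiableWithinAt ℝ (fun s => f s x) J t := fun t ht x => by
    have h := hasDerivWithinAt_slice ((contDiffOn_of_contMDiffOn (p := x) (h := fun t x => f t x)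
      (subset_univ _) hf).differentiableOn (by simp) (t, chartAt EB x x) ⟨ht, mem_chart_target EB x⟩)
      (mem_chart_target EB x)
    simp only [(chartAt EB x).left_inv (mem_chart_source EB x)] at h
    exact h.differentiableWithinAt
  have hU := fun t (ht : t ∈ J) x =>
    (hasDerivWithinAt_of_conjHeat hJu ht (hd t ht x) (hconj t ht x)).fun_neg.exp
  refine ⟨fun t ht => ?_, fun t ht x => ((hR t ht x).mul (hU t ht x)).differentiableWithinAt,
    fun t ht x => ?_⟩
  · exact (scalMap (G t) ((σ t).weight (f t)) * expNeg (f t)).contMDiff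
  · have hw := isWeighted_weight (σ t) (f t)
    have h1 : laplacian (G t) (σ t) (fun y => scalar (G t) ((σ t).weight (f t)) y * Real.exp (-(f t y))) x =
        _ := laplacian_eq (G t) (σ t) (scalMap (G t) ((σ t).weight (f t)) * expNeg (f t)) x
    have h2 := DFunLike.congr_fun (conj_product (G := G t) hw (scalMap (G t) ((σ t).weight (f t)))) x
    have h3 := DFunLike.congr_fun (lapMap_expNeg (G := G t) hw) x
    have h4 : derivWithin (fun s => scalar (G s) ((σ s).weight (f s)) x * Real.exp (-(f s x))) J t = _ :=
      ((hR t ht x).mul (hU t ht x)).derivWithin (hJu t ht)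
    show -derivWithin (fun s => scalar (G s) ((σ s).weight (f s)) x * Real.exp (-(f s x))) J t
      - laplacian (G t) (σ t) (fun y => scalar (G t) ((σ t).weight (f t)) y * Real.exp (-(f t y))) x
      + scalar (G t) (σ t) x * (scalar (G t) ((σ t).weight (f t)) x * Real.exp (-(f t x))) =
      -ricciNormSq (G t) ((σ t).weight (f t)) x * Real.exp (-(f t x))
    rw [h4, h1, h2]
    simp only [ContMDiffMap.coe_add, ContMDiffMap.coe_sub, ContMDiffMap.coe_mul, Pi.add_apply, Pi.sub_apply,
      Pi.mul_apply]
    rw [h3]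
    have e1 : expNeg (f t) x = Real.exp (-(f t x)) := rfl
    have e2 : scalMap (G t) ((σ t).weight (f t)) x = scalar (G t) ((σ t).weight (f t)) x := rfl
    have e3 : (-(expNeg (f t) * lapMap (G t) ((σ t).weight (f t)) (f t)) : C^∞⟮𝓘(ℝ, EB), M; ℝ⟯) x =
      -(Real.exp (-(f t x)) * lapMap (G t) ((σ t).weight (f t)) (f t) x) := rfl
    rw [e1, e2, e3]
    -- With `∂_t u = u (Δ_τ f + R(G,σ))` and `Δ_σ u = -u Δ_τ f`, the terms proportional to `R(G,τ)
    -- u` cancel. The terms `Δ_τ R` and `⟨G 𝒟f, 𝒟R⟩` from the evolution of `R` cancel those of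
    -- `conj_product`, and `-|Rc|² u` remains.
    ring
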